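/- **Setting.** Let $k$ be a field. A *local operator-system* is a finite-dimensional local commutative $k$-algebra $\mathcal D$ with maximal ideal $\mathfrak m$ and residue field $k$ (residue map $\pi:\mathcal D\to k$), with a *ranked* basis $(\epsilon_0=1,\epsilon_1,\dots,\epsilon_m)$, i.e. consecutive blocks of it give bases of $\mathfrak m^i/\mathfrak m^{i+1}$, $i=0,1,2,\dots$. Write $\alpha_i^{pq}\in k$ for the coefficient of $\epsilon_i$ in $\epsilon_p\epsilon_q$, $\operatorname{Null}(\mathcal D)=\{q\ge 1:\epsilon_q\mathfrak m=0\}$ and $\mathcal D(R)=\mathcal D\otimes_kR$ for a $k$-algebra $R$. A $\mathcal D$-operator from $R\subseteq S$ is a $k$-algebra homomorphism $e:R\to\mathcal D(S)$ with $\pi^S\circ e$ the inclusion; so $e(x)=1\otimes x+\sum_{i=1}^m\epsilon_i\otimes\partial_i(x)$. A $\mathcal D$-field is a field $R$ with a $\mathcal D$-operator $R\to\mathcal D(R)$. Fix two local operator-systems $\underline{\mathcal D}=(\mathcal D_1,\mathcal D_2)$, with bases $(\epsilon_{u,i})_{0\le i\le m_u}$; a $\underline{\mathcal D}$-operator is a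 pair $\underline e=(e_1,e_2)$ of $\mathcal D_u$-operators, with components $\partial_{u,i}$. Fix a $\underline{\mathcal D}$-field $(F,\underline e)$. All rings are $F$-algebras, and $\underline{\mathcal D}$-fields are extensions of $(F,\underline e)$. An *LHS-commutation system* $\Gamma=\{r_1,r_2\}$ consists of $k$-algebra homomorphisms $r_u:\mathcal D_u\to\mathcal D_u\otimes_k\mathcal D_u(F)$ such that, for some $c_{u,\ell}^{ij}\in F$, $$r_1(\epsilon_{1,\ell})=1\otimes\epsilon_{1,\ell}+\sum_{i,j}\epsilon_{1,i}\otimes\epsilon_{1,j}\otimes c_{1,\ell}^{ji},\qquad r_2(\epsilon_{2,\ell})=\epsilon_{2,\ell}\otimes1+1\otimes\epsilon_{2,\ell}+\sum_{i,j}\epsilon_{2,i}\otimes\epsilon_{2,j}\otimes c_{2,\ell}^{ji},$$ with $c_{1,\ell}^{ji}=0$ unless $i,j\in\operatorname{Null}(\mathcal D_1)$. For rings $A\subseteq R\subseteq S$ and a $\underline{\mathcal D}$-operator $\underline e:R\to\underline{\mathcal D}(S)$ with $e_u(A)\subseteq\mathcal D_u(R)$, we say that $\underline e$ *commutes on $(A,R,S)$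 with respect to $\Gamma$* if, on $A$, $$\mathcal D_1(e_1)\circ e_1=r_1^{e_1}\circ e_1,\qquad \mathcal D_2(e_2)\circ e_2=r_2^{\iota}\circ e_2,\qquad \mathcal D_1(e_2)\circ e_1=r_{12}^{e_1}\circ e_2,$$ where $r_{12}(x)=1\otimes x$, and a homomorphism $r:\mathcal D_v\to\mathcal D_u\otimes\mathcal D_v(F)$ has the lifts $r^\iota(d\otimes x)=r(d)(1\otimes1\otimes x)$ and $r^{e_u}(d\otimes x)=r(d)\,\mathcal D_u(\iota)(e_u(x))$, $\iota:S\to \mathcal D_v(S)$ being $s\mapsto 1\otimes s$. (On a ring this says $[\partial_{1,i},\partial_{1,j}]=\sum_\ell c_{1,\ell}^{ij}\partial_{1,\ell}$, $\partial_{2,i}\partial_{2,j}=\sum_\ell c_{2,\ell}^{ij}\partial_{2,\ell}$ and $[\partial_{1,i},\partial_{2,j}]=0$.) A $\underline{\mathcal D}^\Gamma$-field is a $\underline{\mathcal D}$-field $K$ whose operator commutes on $(K,K,K)$. $\Gamma$ is *Jacobi-associative* if: 1. with the index $u=1$ suppressed, for all $i,j,s,r$ one has $c_r^{ij}=-c_r^{ji}$,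 $$\sum_\ell\bigl(c_\ell^{ij}c_r^{\ell s}+c_\ell^{si}c_r^{\ell j}+c_\ell^{js}c_r^{\ell i}\bigr)=\partial_i(c_r^{js})+\partial_s(c_r^{ij})+\partial_j(c_r^{si}),$$ and, putting $A_{qr}=\sum_p\bigl(\alpha_i^{pq}\partial_p(c_r^{js})+\alpha_s^{pq}\partial_p(c_r^{ij})+\alpha_j^{pq}\partial_p(c_r^{si})\bigr)$, $A_{rr}=0$ and $A_{qr}+A_{rq}=0$ for $q<r$; 2. with the index $u=2$ suppressed, for all $i,j,s,r$ $$\sum_\ell\Bigl(c_\ell^{ij}c_r^{\ell s}-c_\ell^{js}c_r^{i\ell}-\sum_{p,q}\alpha_i^{pq}\partial_p(c_\ell^{js})c_r^{q\ell}\Bigr)=\partial_i(c_r^{js});$$ 3. $\partial_{u,s}(c_{v,r}^{ij})=0$ whenever $u\ne v$. **Kernels.** Let $\mathfrak d=\{(u,i):u\in\{1,2\},1\le i\le m_u\}$, ordered by $(2,1)<\dots<(2,m_2)<(1,1)<\dots<(1,m_1)$, let $n \geq 0$ and $\mathfrak n=\{1,\dots,n\}$. Let $(K,\underline e)$ be a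 $\underline{\mathcal D}^\Gamma$-field. A *$\underline{\mathcal D}$-kernel of length $s$ over $K$* is a field $L_s=K(a_t^\xi:\xi\in\mathfrak d^{\le s},t\in\mathfrak n)$ with a $\underline{\mathcal D}$-operator $\underline e:L_{s-1}\to\underline{\mathcal D}(L_s)$ extending that of $K$ with $\partial_i(a_t^\xi)=a_t^{(i,\xi)}$ for $|\xi|\le s-1$, $i \in \mathfrak d$; here $L_j=K(a_t^\xi:|\xi|\le j)$ and $L_{-1}=K$. For $s\ge2$ it is a *$\underline{\mathcal D}^\Gamma$-kernel* if $\underline e$ commutes on $(L_{s-2},L_{s-1},L_s)$ with respect to $\Gamma$. Let $N$ be the set of weakly decreasing finite tuples in $\mathfrak d$ with at most one entry of the form $(2,i)$. Let $\psi(\xi)$ be the vector of numbers of occurrences in $\xi$ of the elements of $\mathfrak d$, listed from the largest to the smallest. On $N\times\mathfrak n$ put $(\xi,t)\le(\eta,t')$ if $t=t'$ and $\psi(\xi)\le\psi(\eta)$ coordinatewise, and $(\xi,t)\triangleleft(\eta,t')$ if $(|\xi|,t,\psi(\xi))$ is lexicographically smaller than $(|\eta|,t',\psi(\eta))$. A pair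 $(\xi,t)\in N\times\mathfrak n$ with $|\xi|\le s$ is a *separable* (resp. *inseparable*) *leader* of $L_s$ if $a_t^\xi$ is algebraic and separable (resp. algebraic and not separable) over $K(a_{t'}^\eta:(\eta,t')\in N\times\mathfrak n,\ (\eta,t')\triangleleft(\xi,t))$. A *minimal-separable leader* is a separable leader $(\xi,t)$ such that no separable leader $(\eta,t)$ satisfies $(\eta,t)<(\xi,t)$. The leaders of $L_j$ for $j\le s$ are defined in the same way from the $a^\xi_t$ with $|\xi|\le j$. $L_s$ is *separable* if it has no inseparable leader $(\xi,t)$ with $|\xi|=s$. A *regular realisation* of a $\underline{\mathcal D}^\Gamma$-kernel $L_s$ is a $\underline{\mathcal D}^\Gamma$-field $L\supseteq L_s$ extending $(K,\underline e)$, whose $\underline{\mathcal D}$-structure extends that of $L_s$ and which is generated over $K$, as a $\underline{\mathcal D}$-field, by $(a_t^\emptyset)_{t\in\mathfrak n}$. Its leaders are defined as above, without bound on the length, from $a_t^\xi=\partial_{i_1}\cdots\partial_{i_l}a_t^\emptyset$ for $\xi=(i_1,\dots,i_l)$. It is *principal* if its minimal-separable leaders and its inseparable leaders are the same as those of $L_s$.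 **Theorem.** Suppose $\Gamma$ is a Jacobi-associative LHS-commutation system. Let $r\ge1$ and let $(L_{2r},\underline e)$ be a separable $\underline{\mathcal D}^\Gamma$-kernel over the $\underline{\mathcal D}^\Gamma$-field $(K,\underline e)$. If the minimal-separable leaders of $L_{2r}$ are the same as those of $L_r$, then $L_{2r}$ has a principal realisation. -/

import Mathlib

open scoped TensorProduct

noncomputable section

namespace DGamma

/-! ### Local operator-systems -/

/-- The power `𝔪 ^ i` of the maximal ideal of a local `k`-algebra, as a `k`-subspace. -/
def maxPow (k A : Type*) [Field k] [CommRing A] [Algebra k A] [IsLocalRing A] (i : ℕ) :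
    Submodule k A :=
  (IsLocalRing.maximalIdeal A ^ i).restrictScalars k

/-- The `k`-vector space `𝔪 ^ i / 𝔪 ^ (i + 1)`, as a subspace of `A / 𝔪 ^ (i + 1)`. -/
def gradedPiece (k A : Type*) [Field k] [CommRing A] [Algebra k A] [IsLocalRing A] (i : ℕ) :
    Submodule k (A ⧸ maxPow k A (i + 1)) :=
  (maxPow k A i).map (maxPow k A (i + 1)).mkQ

/-- `blockStart k A i = ∑_{j < i} dim_k (𝔪 ^ j / 𝔪 ^ (j + 1))`, the position at which the
`i`-th block of a ranked basis starts. -/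
def blockStart (k A : Type*) [Field k] [CommRing A] [Algebra k A] [IsLocalRing A] (i : ℕ) : ℕ :=
  ∑ j ∈ Finset.range i, Module.finrank k (gradedPiece k A j)

/-- A basis `(ε_0 = 1, ε_1, …, ε_m)` is ranked if, for each `i`, its `i`-th block yields a basis of
`𝔪 ^ i / 𝔪 ^ (i + 1)`. -/
structure IsRankedBasis {k A : Type*} [Field k] [CommRing A] [Algebra k A] [IsLocalRing A]
    {m : ℕ} (b : Module.Basis (Fin (m + 1)) k A) : Prop where
  zero_eq_one : b 0 = 1
  linearIndependent_block : ∀ i : ℕ, LinearIndependent k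
    (fun p : {p : Fin (m + 1) // blockStart k A i ≤ p.val ∧ p.val < blockStart k A (i + 1)} =>
      (maxPow k A (i + 1)).mkQ (b p.1))
  span_block : ∀ i : ℕ, Submodule.span k (Set.range
    (fun p : {p : Fin (m + 1) // blockStart k A i ≤ p.val ∧ p.val < blockStart k A (i + 1)} =>
      (maxPow k A (i + 1)).mkQ (b p.1))) = gradedPiece k A i

/-- A local operator-system over `k`: a finite dimensional local `k`-algebra with residue field
`k`, together with a ranked basis. -/
structure LocalOperatorSystem.{u, v} (k : Type u) [Field k] where
  Alg : Type v
  [commRing : CommRing Alg]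
  [algebra : Algebra k Alg]
  [isLocalRing : IsLocalRing Alg]
  residue_bijective : Function.Bijective (algebraMap k (IsLocalRing.ResidueField Alg))
  m : ℕ
  basis : Module.Basis (Fin (m + 1)) k Alg
  ranked : IsRankedBasis basis

attribute [instance] LocalOperatorSystem.commRing LocalOperatorSystem.algebra
  LocalOperatorSystem.isLocalRing

namespace LocalOperatorSystem

/-- The basis element `ε_i`, for `1 ≤ i ≤ m` (indexed by `Fin m`, shifted by one). -/
def eps {k : Type*} [Field k] (𝒟 : LocalOperatorSystem k) (i : Fin 𝒟.m) : 𝒟.Alg :=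
  𝒟.basis i.succ

/-- `α_i^{pq}`, the coefficient of `ε_i` in the product `ε_p * ε_q`. -/
def alpha {k : Type*} [Field k] (𝒟 : LocalOperatorSystem k) (i p q : Fin 𝒟.m) : k :=
  𝒟.basis.repr (𝒟.eps p * 𝒟.eps q) i.succ

/-- The indices `q` with `ε_q * 𝔪 = 0`. -/
def null {k : Type*} [Field k] (𝒟 : LocalOperatorSystem k) : Set (Fin 𝒟.m) :=
  {q | ∀ x ∈ IsLocalRing.maximalIdeal 𝒟.Alg, 𝒟.eps q * x = 0}

/-- The residue map `π : 𝒟 → k`. -/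
def residue {k : Type*} [Field k] (𝒟 : LocalOperatorSystem k) : 𝒟.Alg →ₐ[k] k :=
  ((AlgEquiv.ofBijective (Algebra.ofId k (IsLocalRing.ResidueField 𝒟.Alg))
    𝒟.residue_bijective).symm.toAlgHom).comp
      (IsScalarTower.toAlgHom k 𝒟.Alg (IsLocalRing.ResidueField 𝒟.Alg))

/-- The base change `π^S : 𝒟(S) = 𝒟 ⊗ S → S` of the residue map. -/
def residueOn {k : Type*} [Field k] (𝒟 : LocalOperatorSystem k) (S : Type*) [CommRing S]
    [Algebra k S] : 𝒟.Alg ⊗[k] S →ₐ[k] S :=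
  (Algebra.TensorProduct.lid k S).toAlgHom.comp
    (Algebra.TensorProduct.map 𝒟.residue (AlgHom.id k S))

/-- The functorial map `𝒟(φ) : 𝒟(R) → 𝒟(S)`. -/
def map {k : Type*} [Field k] (𝒟 : LocalOperatorSystem k) {R S : Type*} [CommRing R]
    [Algebra k R] [CommRing S] [Algebra k S] (φ : R →ₐ[k] S) :
    𝒟.Alg ⊗[k] R →ₐ[k] 𝒟.Alg ⊗[k] S :=
  Algebra.TensorProduct.map (AlgHom.id k 𝒟.Alg) φ

/-- `e : R → 𝒟(S)` is a `𝒟`-operator with respect to `φ : R → S`. -/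
def IsOperator {k : Type*} [Field k] (𝒟 : LocalOperatorSystem k) {R S : Type*} [CommRing R]
    [Algebra k R] [CommRing S] [Algebra k S] (φ : R →ₐ[k] S) (e : R →ₐ[k] 𝒟.Alg ⊗[k] S) : Prop :=
  (𝒟.residueOn S).comp e = φ

/-- The operator `∂_i`, for `1 ≤ i ≤ m`: the coefficient of `ε_i` in
`e(x) = 1 ⊗ x + ε_1 ⊗ ∂_1 x + ⋯ + ε_m ⊗ ∂_m x`. -/
def op {k : Type*} [Field k] (𝒟 : LocalOperatorSystem k) {R S : Type*} [CommRing R]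
    [Algebra k R] [CommRing S] [Algebra k S] (e : R →ₐ[k] 𝒟.Alg ⊗[k] S) (i : Fin 𝒟.m) :
    R →ₗ[k] S :=
  (TensorProduct.lid k S).toLinearMap ∘ₗ LinearMap.rTensor S (𝒟.basis.coord i.succ) ∘ₗ
    e.toLinearMap

end LocalOperatorSystem

/-! ### Commutativity -/

/-- The lift `r^ι : 𝒟₂(R) → 𝒟₁(𝒟₂(S))` of `r : 𝒟₂ → 𝒟₁ ⊗ 𝒟₂(F)`, for `j : R → S` and an
`F`-algebra `S` with structure map `ψ`; it sends `d ⊗ x` to `r(d) * (1 ⊗ 1 ⊗ x)`. -/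
def liftIota {k : Type*} [Field k] (𝒟₁ 𝒟₂ : LocalOperatorSystem k) {F R S : Type*} [CommRing F]
    [Algebra k F] [CommRing R] [Algebra k R] [CommRing S] [Algebra k S]
    (r : 𝒟₂.Alg →ₐ[k] 𝒟₁.Alg ⊗[k] (𝒟₂.Alg ⊗[k] F)) (ψ : F →ₐ[k] S) (j : R →ₐ[k] S) :
    𝒟₂.Alg ⊗[k] R →ₐ[k] 𝒟₁.Alg ⊗[k] (𝒟₂.Alg ⊗[k] S) :=
  Algebra.TensorProduct.productMap ((𝒟₁.map (𝒟₂.map ψ)).comp r)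
    ((Algebra.TensorProduct.includeRight : 𝒟₂.Alg ⊗[k] S →ₐ[k] 𝒟₁.Alg ⊗[k] (𝒟₂.Alg ⊗[k] S)).comp
      ((Algebra.TensorProduct.includeRight : S →ₐ[k] 𝒟₂.Alg ⊗[k] S).comp j))

/-- The lift `r^{e₁} : 𝒟₂(R) → 𝒟₁(𝒟₂(S))` of `r : 𝒟₂ → 𝒟₁ ⊗ 𝒟₂(F)` along `e₁ : R → 𝒟₁(S)`, for an
`F`-algebra `S` with structure map `ψ`; it sends `d ⊗ x` to `r(d) * 𝒟₁(ι)(e₁ x)`. -/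
def liftOp {k : Type*} [Field k] (𝒟₁ 𝒟₂ : LocalOperatorSystem k) {F R S : Type*} [CommRing F]
    [Algebra k F] [CommRing R] [Algebra k R] [CommRing S] [Algebra k S]
    (r : 𝒟₂.Alg →ₐ[k] 𝒟₁.Alg ⊗[k] (𝒟₂.Alg ⊗[k] F)) (ψ : F →ₐ[k] S)
    (e₁ : R →ₐ[k] 𝒟₁.Alg ⊗[k] S) :
    𝒟₂.Alg ⊗[k] R →ₐ[k] 𝒟₁.Alg ⊗[k] (𝒟₂.Alg ⊗[k] S) :=
  Algebra.TensorProduct.productMap ((𝒟₁.map (𝒟₂.map ψ)).comp r)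
    ((𝒟₁.map (Algebra.TensorProduct.includeRight : S →ₐ[k] 𝒟₂.Alg ⊗[k] S)).comp e₁)

/-- `(e₁, e₂)` commute on `(A, R, S)` with respect to a lift `rs`, where `j : R → S` is the
inclusion: for `a ∈ A` the elements `e₁ a`, `e₂ a` come from elements `y₁`, `y₂` of `𝒟₁(R)`,
`𝒟₂(R)`, and `𝒟₁(e₂) y₁ = rs y₂`. (For injective `j`, the only case of interest, `y₁` and `y₂` are
unique, so that this is the commutativity of the square.) -/
def CommuteOn {k : Type*} [Field k] (𝒟₁ 𝒟₂ : LocalOperatorSystem k) {R S : Type*} [CommRing R]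
    [Algebra k R] [CommRing S] [Algebra k S] (j : R →ₐ[k] S) (A : Set R)
    (e₁ : R →ₐ[k] 𝒟₁.Alg ⊗[k] S) (e₂ : R →ₐ[k] 𝒟₂.Alg ⊗[k] S)
    (rs : 𝒟₂.Alg ⊗[k] R →ₐ[k] 𝒟₁.Alg ⊗[k] (𝒟₂.Alg ⊗[k] S)) : Prop :=
  ∀ a ∈ A, ∃ (y₁ : 𝒟₁.Alg ⊗[k] R) (y₂ : 𝒟₂.Alg ⊗[k] R),
    𝒟₁.map j y₁ = e₁ a ∧ 𝒟₂.map j y₂ = e₂ a ∧ 𝒟₁.map e₂ y₁ = rs y₂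

/-! ### Commutation systems of Lie-Hasse-Schmidt type -/

/-- `r` is of Lie-commutation type with Lie-coefficients `c ℓ i j = c_ℓ^{ij}`. With these, `e`
commutes with respect to `r^e` on a ring if and only if `[∂_i, ∂_j] = ∑_ℓ c_ℓ^{ij} ∂_ℓ`. -/
def IsLieType {k : Type*} [Field k] (𝒟 : LocalOperatorSystem k) {F : Type*} [CommRing F]
    [Algebra k F] (r : 𝒟.Alg →ₐ[k] 𝒟.Alg ⊗[k] (𝒟.Alg ⊗[k] F))
    (c : Fin 𝒟.m → Fin 𝒟.m → Fin 𝒟.m → F) : Prop :=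
  (∀ ℓ, r (𝒟.eps ℓ) = 1 ⊗ₜ[k] (𝒟.eps ℓ ⊗ₜ[k] 1) +
    ∑ i, ∑ j, 𝒟.eps i ⊗ₜ[k] (𝒟.eps j ⊗ₜ[k] c ℓ j i)) ∧
  ∀ ℓ i j, ¬ (i ∈ 𝒟.null ∧ j ∈ 𝒟.null) → c ℓ j i = 0

/-- `r` is of Hasse-Schmidt-iteration type with HS-coefficients `c ℓ i j = c_ℓ^{ij}`. With these,
`e` commutes with respect to `r^ι` on a ring if and only if `∂_i ∂_j = ∑_ℓ c_ℓ^{ij} ∂_ℓ`. -/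
def IsHSType {k : Type*} [Field k] (𝒟 : LocalOperatorSystem k) {F : Type*} [CommRing F]
    [Algebra k F] (r : 𝒟.Alg →ₐ[k] 𝒟.Alg ⊗[k] (𝒟.Alg ⊗[k] F))
    (c : Fin 𝒟.m → Fin 𝒟.m → Fin 𝒟.m → F) : Prop :=
  ∀ ℓ, r (𝒟.eps ℓ) = 𝒟.eps ℓ ⊗ₜ[k] (1 ⊗ₜ[k] 1) + 1 ⊗ₜ[k] (𝒟.eps ℓ ⊗ₜ[k] 1) +
    ∑ i, ∑ j, 𝒟.eps i ⊗ₜ[k] (𝒟.eps j ⊗ₜ[k] c ℓ j i)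

/-- The Jacobi condition on Lie-coefficients over a `𝒟`-field `(F, e)`. -/
structure IsJacobi {k : Type*} [Field k] (𝒟 : LocalOperatorSystem k) {F : Type*} [CommRing F]
    [Algebra k F] (e : F →ₐ[k] 𝒟.Alg ⊗[k] F) (c : Fin 𝒟.m → Fin 𝒟.m → Fin 𝒟.m → F) : Prop where
  skew : ∀ ℓ i j, c ℓ i j = - c ℓ j i
  jacobi : ∀ i j s r,
    ∑ ℓ, (c ℓ i j * c r ℓ s + c ℓ s i * c r ℓ j + c ℓ j s * c r ℓ i) =
      𝒟.op e i (c r j s) + 𝒟.op e s (c r i j) + 𝒟.op e j (c r s i)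
  diagonal : ∀ i j s r,
    ∑ p, (𝒟.alpha i p r • 𝒟.op e p (c r j s) + 𝒟.alpha s p r • 𝒟.op e p (c r i j) +
      𝒟.alpha j p r • 𝒟.op e p (c r s i)) = 0
  off_diagonal : ∀ i j s q r, q < r →
    ∑ p, (𝒟.alpha i p q • 𝒟.op e p (c r j s) + 𝒟.alpha s p q • 𝒟.op e p (c r i j) +
      𝒟.alpha j p q • 𝒟.op e p (c r s i) + 𝒟.alpha i p r • 𝒟.op e p (c q j s) +
      𝒟.alpha s p r • 𝒟.op e p (c q i j) + 𝒟.alpha j p r • 𝒟.op e p (c q s i)) = 0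

/-- The associativity condition on HS-coefficients over a `𝒟`-field `(F, e)`. -/
def IsAssociative {k : Type*} [Field k] (𝒟 : LocalOperatorSystem k) {F : Type*} [CommRing F]
    [Algebra k F] (e : F →ₐ[k] 𝒟.Alg ⊗[k] F) (c : Fin 𝒟.m → Fin 𝒟.m → Fin 𝒟.m → F) : Prop :=
  ∀ i j s r,
    ∑ ℓ, (c ℓ i j * c r ℓ s - c ℓ j s * c r i ℓ -
      ∑ p, ∑ q, 𝒟.alpha i p q • (𝒟.op e p (c ℓ j s) * c r q ℓ)) = 𝒟.op e i (c r j s)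

/-- The two kinds of operators; the pair of local operator-systems is indexed by them, `lie` being
the first and `hs` (Hasse-Schmidt) the second. -/
inductive OpType
  | lie
  | hs
  deriving DecidableEq

/-- A commutation system of Lie-Hasse-Schmidt type for the pair `𝓓` over `F`, together with its
(uniquely determined) coefficients `c u ℓ i j = c_{u,ℓ}^{ij}`. -/
structure LHSSystem {k : Type*} [Field k] (𝓓 : OpType → LocalOperatorSystem k) (F : Type*)
    [CommRing F] [Algebra k F] where
  r : ∀ u, (𝓓 u).Alg →ₐ[k] (𝓓 u).Alg ⊗[k] ((𝓓 u).Alg ⊗[k] F)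
  c : ∀ u, Fin (𝓓 u).m → Fin (𝓓 u).m → Fin (𝓓 u).m → F
  isLieType : IsLieType (𝓓 .lie) (r .lie) (c .lie)
  isHSType : IsHSType (𝓓 .hs) (r .hs) (c .hs)

/-- The canonical embedding `r₁₂ : 𝒟₂ → 𝒟₁ ⊗ 𝒟₂(F)`, `x ↦ 1 ⊗ x`. -/
def canonicalEmbedding {k : Type*} [Field k] (𝒟₁ 𝒟₂ : LocalOperatorSystem k) (F : Type*)
    [CommRing F] [Algebra k F] : 𝒟₂.Alg →ₐ[k] 𝒟₁.Alg ⊗[k] (𝒟₂.Alg ⊗[k] F) :=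
  (Algebra.TensorProduct.includeRight : 𝒟₂.Alg ⊗[k] F →ₐ[k] 𝒟₁.Alg ⊗[k] (𝒟₂.Alg ⊗[k] F)).comp
    Algebra.TensorProduct.includeLeft

/-- Jacobi-associativity of a commutation system of Lie-Hasse-Schmidt type over `(F, e)`. -/
structure LHSSystem.IsJacobiAssociative {k : Type*} [Field k] {𝓓 : OpType → LocalOperatorSystem k}
    {F : Type*} [CommRing F] [Algebra k F] (Γ : LHSSystem 𝓓 F)
    (e : ∀ u, F →ₐ[k] (𝓓 u).Alg ⊗[k] F) : Prop where
  jacobi : IsJacobi (𝓓 .lie) (e .lie) (Γ.c .lie)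
  assoc : IsAssociative (𝓓 .hs) (e .hs) (Γ.c .hs)
  mixed : ∀ u v, u ≠ v → ∀ (s : Fin (𝓓 u).m) (i j r : Fin (𝓓 v).m),
    (𝓓 u).op (e u) s (Γ.c v r i j) = 0

/-- The pair `e : R → 𝓓(S)` commutes on `(A, R, S)` with respect to `Γ`; here `j : R → S` is the
inclusion and `ψ : F → S` the structure map. -/
structure GammaCommuteOn {k : Type*} [Field k] {𝓓 : OpType → LocalOperatorSystem k}
    {F R S : Type*} [CommRing F] [Algebra k F] [CommRing R] [Algebra k R] [CommRing S]
    [Algebra k S] (Γ : LHSSystem 𝓓 F) (ψ : F →ₐ[k] S) (j : R →ₐ[k] S) (A : Set R)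
    (e : ∀ u, R →ₐ[k] (𝓓 u).Alg ⊗[k] S) : Prop where
  lie : CommuteOn (𝓓 .lie) (𝓓 .lie) j A (e .lie) (e .lie)
    (liftOp (𝓓 .lie) (𝓓 .lie) (Γ.r .lie) ψ (e .lie))
  hs : CommuteOn (𝓓 .hs) (𝓓 .hs) j A (e .hs) (e .hs)
    (liftIota (𝓓 .hs) (𝓓 .hs) (Γ.r .hs) ψ j)
  mixed : CommuteOn (𝓓 .lie) (𝓓 .hs) j A (e .lie) (e .hs)
    (liftOp (𝓓 .lie) (𝓓 .hs) (canonicalEmbedding (𝓓 .lie) (𝓓 .hs) F) ψ (e .lie))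

/-- `(R, e)` is a `𝓓^Γ`-field over the `𝓓`-field `(F, eF)`, with structure map `ψ : F → R`. -/
structure IsDGammaField {k : Type*} [Field k] {𝓓 : OpType → LocalOperatorSystem k}
    {F R : Type*} [Field F] [Algebra k F] [Field R] [Algebra k R] (Γ : LHSSystem 𝓓 F)
    (eF : ∀ u, F →ₐ[k] (𝓓 u).Alg ⊗[k] F) (ψ : F →ₐ[k] R)
    (e : ∀ u, R →ₐ[k] (𝓓 u).Alg ⊗[k] R) : Prop where
  isOperator : ∀ u, (𝓓 u).IsOperator (AlgHom.id k R) (e u)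
  extends_base : ∀ u, ((𝓓 u).map ψ).comp (eF u) = (e u).comp ψ
  commute : GammaCommuteOn Γ ψ (AlgHom.id k R) Set.univ e

/-! ### Indices, orders and leaders -/

/-- The set `𝔡` of pairs `(u, i)` with `1 ≤ i ≤ m_u`. -/
abbrev Idx {k : Type*} [Field k] (𝓓 : OpType → LocalOperatorSystem k) : Type :=
  Σ u : OpType, Fin (𝓓 u).m

/-- The position of an element of `𝔡` in the order
`(hs, 1) < ⋯ < (hs, m₂) < (lie, 1) < ⋯ < (lie, m₁)`. -/
def Idx.rank {k : Type*} [Field k] {𝓓 : OpType → LocalOperatorSystem k} : Idx 𝓓 → ℕ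
  | ⟨.hs, i⟩ => i
  | ⟨.lie, i⟩ => (𝓓 .hs).m + i

/-- Membership in `ℕ^𝔡_{<∞}`: the entries are weakly decreasing and at most one of them is of
Hasse-Schmidt type. -/
def IsNormal {k : Type*} [Field k] {𝓓 : OpType → LocalOperatorSystem k} (ξ : List (Idx 𝓓)) :
    Prop :=
  ξ.Pairwise (fun i j => Idx.rank j ≤ Idx.rank i) ∧ ξ.countP (fun i => i.1 = OpType.hs) ≤ 1

/-- The strict order `(ξ, t) ◁ (η, t')`: lexicographic comparison of the length, the variable, and
the numbers of occurrences of the elements of `𝔡`, from the largest element to the smallest. -/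
def TriLT {k : Type*} [Field k] {𝓓 : OpType → LocalOperatorSystem k} {n : ℕ}
    (x y : List (Idx 𝓓) × Fin n) : Prop :=
  x.1.length < y.1.length ∨ (x.1.length = y.1.length ∧ (x.2 < y.2 ∨ (x.2 = y.2 ∧
    ∃ i : Idx 𝓓, x.1.count i < y.1.count i ∧
      ∀ j : Idx 𝓓, i.rank < j.rank → x.1.count j = y.1.count j)))

/-- The product order `(ξ, t) ≤ (η, t')`. -/
def ProdLE {k : Type*} [Field k] {𝓓 : OpType → LocalOperatorSystem k} {n : ℕ}
    (x y : List (Idx 𝓓) × Fin n) : Prop :=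
  x.2 = y.2 ∧ ∀ i : Idx 𝓓, x.1.count i ≤ y.1.count i

section Leaders

variable {k : Type*} [Field k] {𝓓 : OpType → LocalOperatorSystem k} {L : Type*} [Field L]
  {n : ℕ}

/-- The field generated over `K` by the `a^η_{t'}` with `η ∈ ℕ^𝔡_{<∞}` and
`(η, t') ◁ (ξ, t)`. -/
def fieldBelow (K : Type*) [Field K] [Algebra K L] (a : List (Idx 𝓓) → Fin n → L)
    (x : List (Idx 𝓓) × Fin n) : IntermediateField K L :=
  IntermediateField.adjoin K {z | ∃ y : List (Idx 𝓓) × Fin n,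
    IsNormal y.1 ∧ TriLT y x ∧ z = a y.1 y.2}

/-- The separable leaders of length at most `s` of a family `a` (take `s = ⊤` for an infinite
family). -/
def sepLeaders (K : Type*) [Field K] [Algebra K L] (a : List (Idx 𝓓) → Fin n → L) (s : ℕ∞) :
    Set (List (Idx 𝓓) × Fin n) :=
  {x | IsNormal x.1 ∧ (x.1.length : ℕ∞) ≤ s ∧ IsSeparable (fieldBelow K a x) (a x.1 x.2)}

/-- The inseparable leaders of length at most `s`. -/
def insepLeaders (K : Type*) [Field K] [Algebra K L] (a : List (Idx 𝓓) → Fin n → L) (s : ℕ∞) :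
    Set (List (Idx 𝓓) × Fin n) :=
  {x | IsNormal x.1 ∧ (x.1.length : ℕ∞) ≤ s ∧ IsAlgebraic (fieldBelow K a x) (a x.1 x.2) ∧
    ¬ IsSeparable (fieldBelow K a x) (a x.1 x.2)}

/-- The minimal-separable leaders of length at most `s`. -/
def minSepLeaders (K : Type*) [Field K] [Algebra K L] (a : List (Idx 𝓓) → Fin n → L) (s : ℕ∞) :
    Set (List (Idx 𝓓) × Fin n) :=
  {x | x ∈ sepLeaders K a s ∧ ∀ y ∈ sepLeaders K a s, ProdLE y x → y = x}

end Leaders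

/-! ### Kernels and their realisations -/

/-- The field `K(a^ξ_t : |ξ| < s)`; so `levelField K a (s + 1)` is `L_s` and
`levelField K a 0` is `L_{-1} = K`. -/
def levelField {k : Type*} [Field k] {𝓓 : OpType → LocalOperatorSystem k} (K : Type*) {L : Type*}
    [Field K] [Field L] [Algebra K L] {n : ℕ} (a : List (Idx 𝓓) → Fin n → L) (s : ℕ) :
    IntermediateField K L :=
  IntermediateField.adjoin K {z | ∃ (ξ : List (Idx 𝓓)) (t : Fin n), ξ.length < s ∧ z = a ξ t}

/-- A `𝓓`-kernel of length `s` in `n` variables over `(K, eK)`, with underlying field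
`L = L_s = K(a^ξ_t : |ξ| ≤ s)` and operators `e : L_{s-1} → 𝓓(L_s)`. Only the values of `a` at
tuples of length at most `s` matter. -/
structure DKernel {k : Type*} [Field k] {𝓓 : OpType → LocalOperatorSystem k} {K : Type*} [Field K]
    [Algebra k K] (eK : ∀ u, K →ₐ[k] (𝓓 u).Alg ⊗[k] K) (n s : ℕ) (L : Type*) [Field L]
    [Algebra k L] [Algebra K L] [IsScalarTower k K L] where
  a : List (Idx 𝓓) → Fin n → L
  generates : levelField K a (s + 1) = ⊤
  e : ∀ u, levelField K a s →ₐ[k] (𝓓 u).Alg ⊗[k] L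
  isOperator : ∀ u, (𝓓 u).IsOperator ((levelField K a s).val.restrictScalars k) (e u)
  extends_base : ∀ u, ((𝓓 u).map (IsScalarTower.toAlgHom k K L)).comp (eK u) =
    (e u).comp (IsScalarTower.toAlgHom k K (levelField K a s))
  e_apply : ∀ u (ξ : List (Idx 𝓓)) (t : Fin n) (h : ξ.length < s),
    e u ⟨a ξ t, IntermediateField.subset_adjoin K _ ⟨ξ, t, h, rfl⟩⟩ =
      1 ⊗ₜ[k] a ξ t + ∑ i : Fin (𝓓 u).m, (𝓓 u).eps i ⊗ₜ[k] a (⟨u, i⟩ :: ξ) t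

/-- The structure map `F → L` of a field extension `L` of `K`. -/
def baseMap (k F K L : Type*) [Field k] [Field F] [Field K] [Field L] [Algebra k F] [Algebra k K]
    [Algebra k L] [Algebra F K] [Algebra K L] [IsScalarTower k F K] [IsScalarTower k K L] :
    F →ₐ[k] L :=
  (IsScalarTower.toAlgHom k K L).comp (IsScalarTower.toAlgHom k F K)

section Kernels

variable {k : Type*} [Field k] {𝓓 : OpType → LocalOperatorSystem k} {F K L : Type*} [Field F]
  [Field K] [Field L] [Algebra k F] [Algebra k K] [Algebra k L] [Algebra F K] [Algebra K L]
  [IsScalarTower k F K] [IsScalarTower k K L]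

/-- A kernel of length `s ≥ 2` is a `𝓓^Γ`-kernel if its operators commute on
`(L_{s-2}, L_{s-1}, L_s)` with respect to `Γ`. -/
def DKernel.IsDGammaKernel {eK : ∀ u, K →ₐ[k] (𝓓 u).Alg ⊗[k] K} {n s : ℕ}
    (𝓛 : DKernel eK n s L) (Γ : LHSSystem 𝓓 F) : Prop :=
  2 ≤ s ∧ GammaCommuteOn Γ (baseMap k F K L) ((levelField K 𝓛.a s).val.restrictScalars k)
    {x | (x : L) ∈ levelField K 𝓛.a (s - 1)} 𝓛.e

/-- A kernel of length `s` is separable if it has no inseparable leader of length `s`. -/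
def DKernel.IsSeparable {eK : ∀ u, K →ₐ[k] (𝓓 u).Alg ⊗[k] K} {n s : ℕ}
    (𝓛 : DKernel eK n s L) : Prop :=
  ∀ x ∈ insepLeaders K 𝓛.a s, x.1.length ≠ s

end Kernels

/-- A regular realisation of a kernel `𝓛 = L_s`: a `𝓓^Γ`-field `(E, e)` extending `(K, eK)`, which
contains `L_s` (via `ι`), whose operators extend those of the kernel, and which is generated as a
`𝓓`-field over `K` by the tuple `a^∅_1, …, a^∅_n`. -/
structure RegularRealisation.{w} {k : Type*} [Field k] {𝓓 : OpType → LocalOperatorSystem k}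
    {F K : Type*} {L : Type w} [Field F] [Field K] [Field L] [Algebra k F] [Algebra k K]
    [Algebra k L] [Algebra F K] [Algebra K L] [IsScalarTower k F K] [IsScalarTower k K L]
    {eK : ∀ u, K →ₐ[k] (𝓓 u).Alg ⊗[k] K} {n s : ℕ} (𝓛 : DKernel eK n s L)
    (eF : ∀ u, F →ₐ[k] (𝓓 u).Alg ⊗[k] F) (Γ : LHSSystem 𝓓 F) where
  E : Type w
  [field : Field E]
  [algebraBase : Algebra k E]
  [algebra : Algebra K E]
  [isScalarTower : IsScalarTower k K E]
  e : ∀ u, E →ₐ[k] (𝓓 u).Alg ⊗[k] E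
  isDGammaField : IsDGammaField Γ eF (baseMap k F K E) e
  extends_K : ∀ u, ((𝓓 u).map (IsScalarTower.toAlgHom k K E)).comp (eK u) =
    (e u).comp (IsScalarTower.toAlgHom k K E)
  ι : L →ₐ[K] E
  extends_kernel : ∀ u, ((𝓓 u).map (ι.restrictScalars k)).comp (𝓛.e u) =
    (e u).comp ((ι.comp (levelField K 𝓛.a s).val).restrictScalars k)
  generates : ∀ M : IntermediateField K E,
    (∀ u, ∀ x ∈ M, e u x ∈ ((𝓓 u).map (M.val.restrictScalars k)).range) →
    (∀ t, ι (𝓛.a [] t) ∈ M) → M = ⊤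

attribute [instance] RegularRealisation.field RegularRealisation.algebraBase
  RegularRealisation.algebra RegularRealisation.isScalarTower

section Realisations

variable {k : Type*} [Field k] {𝓓 : OpType → LocalOperatorSystem k} {F K L : Type*} [Field F]
  [Field K] [Field L] [Algebra k F] [Algebra k K] [Algebra k L] [Algebra F K] [Algebra K L]
  [IsScalarTower k F K] [IsScalarTower k K L]

/-- The family `a^ξ_t = ∂_ξ a_t = ∂_{i_1} ⋯ ∂_{i_l} a_t`, for `ξ = (i_1, …, i_l)`, in a regular
realisation. -/
def RegularRealisation.family {eK : ∀ u, K →ₐ[k] (𝓓 u).Alg ⊗[k] K} {n s : ℕ}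
    {𝓛 : DKernel eK n s L} {eF : ∀ u, F →ₐ[k] (𝓓 u).Alg ⊗[k] F} {Γ : LHSSystem 𝓓 F}
    (ρ : RegularRealisation 𝓛 eF Γ) (ξ : List (Idx 𝓓)) (t : Fin n) : ρ.E :=
  ξ.foldr (fun i x => (𝓓 i.1).op (ρ.e i.1) i.2 x) (ρ.ι (𝓛.a [] t))

/-- A regular realisation is principal if its minimal-separable leaders and its inseparable
leaders are those of the kernel. -/
def RegularRealisation.IsPrincipal {eK : ∀ u, K →ₐ[k] (𝓓 u).Alg ⊗[k] K} {n s : ℕ}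
    {𝓛 : DKernel eK n s L} {eF : ∀ u, F →ₐ[k] (𝓓 u).Alg ⊗[k] F} {Γ : LHSSystem 𝓓 F}
    (ρ : RegularRealisation 𝓛 eF Γ) : Prop :=
  minSepLeaders K ρ.family ⊤ = minSepLeaders K 𝓛.a s ∧
    insepLeaders K ρ.family ⊤ = insepLeaders K 𝓛.a s

end Realisations

end DGamma

end

open DGamma

open scoped TensorProduct

set_option linter.unusedSectionVars false

noncomputable section

/-! The realisation lives on a field `E = L(z)`, where `L = L_{2r}` and the `z` are independent
elements, one for each normal index longer than `2r` that is not above a minimal-separable leader.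
The task is to find operators on `E` and a family `A` extending `a^ξ` such that `∂_i A(ξ)` is given
by a universal normal form.

These normal forms are computed in a polynomial ring in variables indexed by words: `wordD` rewrites
the word `iξ` into normal words by commuting letters. Jacobi-associativity is the consistency of the
rewriting, as in the Poincaré–Birkhoff–Witt theorem. On normal words the Hasse-Schmidt and mixed
relations hold exactly (`defectHS_X`, `defectMix_X`). The Lie relations hold modulo the consequences
of `∑ c_l^{pp} ∂_l = 0` (`defectLie_X_mem_succ`): in characteristic 2 skew-symmetry does not force
`c^{pp} = 0`, but these relations are available in the kernel.

The second ingredient is rigidity. For a ranked basis the `i`-th coordinate of a product involves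
only coordinates up to `i`, so conditions on the components up to `i` cut out subrings and
subfields. Since the maximal ideal is nilpotent, Hensel's lemma carries identities, memberships and
values of operators from a field to every element separable over it (`eq_of_sepOver`,
`mem_coordSubring_of_sepOver`, `dd_congr_of_sepOver`). Conversely, operators extend with arbitrary
prescribed values on a separating transcendence basis (`exists_extension`).

At an index not above a leader the values of the operators are therefore prescribed to be the normal
forms. At a long index above a leader, `A` has no freedom: it is a derivative of `A(η)`, with `η`
one letter shorter and still above a leader, corrected by shorter words. Operators and family define
each other, but `A(x)` depends only on values at indices smaller for `◁`, so both come from a fixed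
point (`exists_isPrincipalFamily`).

What remains is independence of the chosen `η`, which is `intertwines`. Let a word `ζ` longer than
`2r` be a rearrangement of both `iξ` and `jη`, with `ξ` above a leader `μ` and `η` above a leader
`ν`. Leaders have length at most `r`, so `|ζ| > |μ| + |ν|` and some letter `q` can be removed from
`ζ` without leaving `μ` or `ν`. Commuting `∂_i` with `∂_q` at the index `ξ` without `q` carries the
relation between `(i, ξ)` and `(q, ζ without q)`, and likewise for `(j, η)`. The commutation is
legitimate because the value of `A` there is separable over smaller elements, on which it is known
by induction. This is the only use of the comparison of the leaders of `L_{2r}` and `L_r`.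

All relations then hold on generators, hence on `E`. The leaders can be read off: beyond length
`2r`, an index above a leader has its value in the field generated by smaller ones, and the other
indices carry transcendental elements. -/

namespace DGamma

namespace LocalOperatorSystem

/-! ### Ranked bases and triangularity of the multiplication -/

section Ranked

variable {k : Type*} [Field k] (𝒟 : LocalOperatorSystem k)

/-- The index `p` belongs to the `i`-th block of the ranked basis. -/
def InBlock (i : ℕ) (p : Fin (𝒟.m + 1)) : Prop :=
  blockStart k 𝒟.Alg i ≤ p.val ∧ p.val < blockStart k 𝒟.Alg (i + 1)

theorem blockStart_mono : Monotone (blockStart k 𝒟.Alg) := fun i j h => by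
  unfold blockStart
  exact Finset.sum_le_sum_of_subset (Finset.range_subset_range.2 h)

theorem basis_mem_maxPow {i : ℕ} {p : Fin (𝒟.m + 1)} (h : 𝒟.InBlock i p) :
    𝒟.basis p ∈ maxPow k 𝒟.Alg i := by
  have h1 : (maxPow k 𝒟.Alg (i + 1)).mkQ (𝒟.basis p) ∈ gradedPiece k 𝒟.Alg i := by
    rw [← 𝒟.ranked.span_block i]
    exact Submodule.subset_span ⟨⟨p, h⟩, rfl⟩
  obtain ⟨y, hy, hyp⟩ := h1
  have h2 : y - 𝒟.basis p ∈ maxPow k 𝒟.Alg (i + 1) := by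
    rw [← Submodule.ker_mkQ (maxPow k 𝒟.Alg (i + 1)), LinearMap.mem_ker, map_sub, hyp, sub_self]
  have h3 : maxPow k 𝒟.Alg (i + 1) ≤ maxPow k 𝒟.Alg i := fun x hx =>
    Ideal.pow_le_pow_right (Nat.le_succ i) hx
  have := sub_mem hy (h3 h2)
  simpa using this

/-- Descending induction from a vanishing power of `𝔪`: modulo `𝔪 ^ (i + 1)`, an element of `𝔪 ^ i`
is a combination of the `i`-th block. -/
theorem maxPow_le_span (i : ℕ) :
    maxPow k 𝒟.Alg i ≤ Submodule.span k (𝒟.basis '' {p | ∃ j, i ≤ j ∧ 𝒟.InBlock j p}) := by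
  have : Module.Finite k 𝒟.Alg := Module.Finite.of_basis 𝒟.basis
  have : IsArtinianRing 𝒟.Alg := IsArtinianRing.of_finite k 𝒟.Alg
  obtain ⟨N, hN⟩ : IsNilpotent (IsLocalRing.maximalIdeal 𝒟.Alg) := by
    rw [← IsLocalRing.jacobson_eq_maximalIdeal ⊥ bot_ne_top]
    exact IsArtinianRing.isNilpotent_jacobson_bot
  suffices H : ∀ d i, N ≤ i + d → maxPow k 𝒟.Alg i ≤
      Submodule.span k (𝒟.basis '' {p | ∃ j, i ≤ j ∧ 𝒟.InBlock j p}) from H N i (by omega)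
  intro d
  induction d with
  | zero =>
    intro i hi x hx
    have : x ∈ IsLocalRing.maximalIdeal 𝒟.Alg ^ N := Ideal.pow_le_pow_right (by omega) hx
    rw [hN] at this
    rw [show x = 0 by simpa using this]
    exact zero_mem _
  | succ d ih =>
    intro i hi x hx
    have h1 : (maxPow k 𝒟.Alg (i + 1)).mkQ x ∈ gradedPiece k 𝒟.Alg i := ⟨x, hx, rfl⟩
    rw [← 𝒟.ranked.span_block i,
      show (Set.range fun p : {p : Fin (𝒟.m + 1) // blockStart k 𝒟.Alg i ≤ p.val ∧
        p.val < blockStart k 𝒟.Alg (i + 1)} => (maxPow k 𝒟.Alg (i + 1)).mkQ (𝒟.basis p.1)) =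
        (maxPow k 𝒟.Alg (i + 1)).mkQ '' (𝒟.basis '' {p | 𝒟.InBlock i p}) by
          ext z; simp [InBlock], ← Submodule.map_span] at h1
    obtain ⟨y, hy, hyx⟩ := h1
    have h2 : x - y ∈ maxPow k 𝒟.Alg (i + 1) := by
      rw [← Submodule.ker_mkQ (maxPow k 𝒟.Alg (i + 1)), LinearMap.mem_ker, map_sub, hyx, sub_self]
    have h3 := ih (i + 1) (by omega) h2
    rw [← sub_add_cancel x y]
    refine add_mem (Submodule.span_mono (Set.image_mono ?_) h3)
      (Submodule.span_mono (Set.image_mono ?_) hy)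
    · rintro p ⟨j, hj, hp⟩
      exact ⟨j, by omega, hp⟩
    · intro p hp
      exact ⟨i, le_rfl, hp⟩

theorem exists_inBlock_of_repr_ne_zero {i : ℕ} {x : 𝒟.Alg} (hx : x ∈ maxPow k 𝒟.Alg i)
    {p : Fin (𝒟.m + 1)} (hp : 𝒟.basis.repr x p ≠ 0) : ∃ j, i ≤ j ∧ 𝒟.InBlock j p := by
  have h := 𝒟.maxPow_le_span i hx
  rw [Module.Basis.mem_span_image] at h
  exact h (by simpa using hp)

theorem exists_inBlock (p : Fin (𝒟.m + 1)) : ∃ j, 𝒟.InBlock j p := by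
  obtain ⟨j, -, hj⟩ := 𝒟.exists_inBlock_of_repr_ne_zero (i := 0) (x := 𝒟.basis p)
    (by simp [maxPow]) (p := p) (by simp)
  exact ⟨j, hj⟩

theorem basis_zero : 𝒟.basis 0 = 1 := 𝒟.ranked.zero_eq_one

/-- The residue field is `k`, so block `0` is exhausted by `1`: another basis vector in it would be
a multiple of `1` modulo `𝔪`, against independence. -/
theorem basis_succ_mem (p : Fin 𝒟.m) :
    ∃ j, 1 ≤ j ∧ 𝒟.InBlock j p.succ := by
  obtain ⟨j, hj⟩ := 𝒟.exists_inBlock p.succ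
  refine ⟨j, ?_, hj⟩
  by_contra hj0
  obtain rfl : j = 0 := by omega
  obtain ⟨j', hj'⟩ := 𝒟.exists_inBlock 0
  obtain rfl : j' = 0 := by
    by_contra hne
    have := 𝒟.basis_mem_maxPow hj'
    rw [basis_zero] at this
    have h1 : (1 : 𝒟.Alg) ∈ IsLocalRing.maximalIdeal 𝒟.Alg := Ideal.pow_le_self hne this
    exact (Ideal.ne_top_iff_one _).1 (IsLocalRing.maximalIdeal.isMaximal 𝒟.Alg).ne_top h1
  obtain ⟨c, hc⟩ := 𝒟.residue_bijective.2 (IsLocalRing.residue 𝒟.Alg (𝒟.basis p.succ))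
  have h1 : 𝒟.basis p.succ - algebraMap k 𝒟.Alg c ∈ maxPow k 𝒟.Alg (0 + 1) := by
    change _ ∈ IsLocalRing.maximalIdeal 𝒟.Alg ^ (0 + 1)
    rw [zero_add, pow_one, ← IsLocalRing.residue_eq_zero_iff, map_sub, sub_eq_zero, ← hc]
    rfl
  have h2 : (maxPow k 𝒟.Alg (0 + 1)).mkQ (𝒟.basis p.succ) =
      c • (maxPow k 𝒟.Alg (0 + 1)).mkQ (𝒟.basis 0) := by
    rw [← map_smul, ← sub_eq_zero, ← map_sub, basis_zero, ← Algebra.algebraMap_eq_smul_one,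
      ← LinearMap.mem_ker, Submodule.ker_mkQ]
    exact h1
  have hli := 𝒟.ranked.linearIndependent_block 0
  have := hli.notMem_span_image (s := {⟨0, hj'⟩}) (x := ⟨p.succ, hj⟩)
    (by simp [Subtype.ext_iff, Fin.succ_ne_zero])
  apply this
  rw [Set.image_singleton, Submodule.mem_span_singleton]
  exact ⟨c, h2.symm⟩

theorem eps_mem_maximalIdeal (p : Fin 𝒟.m) :
    𝒟.eps p ∈ IsLocalRing.maximalIdeal 𝒟.Alg := by
  obtain ⟨j, hj, hp⟩ := 𝒟.basis_succ_mem p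
  exact Ideal.pow_le_self (by omega) (𝒟.basis_mem_maxPow hp)

/-- The structure constants of the multiplication in terms of the ranked basis. -/
def beta (i p q : Fin (𝒟.m + 1)) : k := 𝒟.basis.repr (𝒟.basis p * 𝒟.basis q) i

theorem beta_zero_left (i q : Fin (𝒟.m + 1)) : 𝒟.beta i 0 q = if q = i then 1 else 0 := by
  simp [beta, basis_zero, Finsupp.single_apply]

theorem beta_zero_right (i q : Fin (𝒟.m + 1)) : 𝒟.beta i q 0 = if q = i then 1 else 0 := by
  simp [beta, basis_zero, Finsupp.single_apply]

/-- Multiplying a vector of the `j`-th block by an element of `𝔪` lands in `𝔪 ^ (j + 1)`, which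
involves only later blocks. This triangularity is what makes induction on the components of an
operator possible. -/
theorem lt_of_beta_ne_zero {i : Fin (𝒟.m + 1)} {p q : Fin 𝒟.m}
    (h : 𝒟.beta i p.succ q.succ ≠ 0) : p.succ < i ∧ q.succ < i := by
  have key : ∀ p q : Fin 𝒟.m, 𝒟.beta i p.succ q.succ ≠ 0 → p.succ < i := by
    intro p q h
    obtain ⟨j, hj, hp⟩ := 𝒟.basis_succ_mem p
    have h1 : 𝒟.basis p.succ * 𝒟.basis q.succ ∈ maxPow k 𝒟.Alg (j + 1) := by
      change _ ∈ IsLocalRing.maximalIdeal 𝒟.Alg ^ (j + 1)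
      rw [pow_succ]
      exact Ideal.mul_mem_mul (𝒟.basis_mem_maxPow hp) (𝒟.eps_mem_maximalIdeal q)
    obtain ⟨j', hj', hi⟩ := 𝒟.exists_inBlock_of_repr_ne_zero h1 h
    exact Fin.lt_def.2 (lt_of_lt_of_le hp.2 ((𝒟.blockStart_mono hj').trans hi.1))
  exact ⟨key p q h, key q p (by rw [beta, mul_comm]; exact h)⟩

theorem lt_of_alpha_ne_zero {i p q : Fin 𝒟.m} (h : 𝒟.alpha i p q ≠ 0) : p < i ∧ q < i := by
  have := 𝒟.lt_of_beta_ne_zero (i := i.succ) (p := p) (q := q) h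
  simpa using this

theorem beta_zero_succ (p q : Fin 𝒟.m) : 𝒟.beta 0 p.succ q.succ = 0 := by
  by_contra h
  exact absurd (𝒟.lt_of_beta_ne_zero h).1 (by simp)

theorem residue_eps (p : Fin 𝒟.m) : 𝒟.residue (𝒟.eps p) = 0 := by
  unfold residue
  simp only [AlgHom.comp_apply]
  have : IsScalarTower.toAlgHom k 𝒟.Alg (IsLocalRing.ResidueField 𝒟.Alg) (𝒟.eps p) = 0 := by
    change IsLocalRing.residue 𝒟.Alg (𝒟.eps p) = 0
    rw [IsLocalRing.residue_eq_zero_iff]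
    exact 𝒟.eps_mem_maximalIdeal p
  rw [this, map_zero]

end Ranked

/-! ### Coordinates on `𝒟(S)`: product rule, ideals, nilpotents and units -/

section Coordinates

variable {k : Type*} [Field k] (𝒟 : LocalOperatorSystem k) {S T : Type*} [CommRing S] [Algebra k S]
  [CommRing T] [Algebra k T]

/-- The coordinate functions of `𝒟(S)`. -/
def crd (i : Fin (𝒟.m + 1)) : 𝒟.Alg ⊗[k] S →ₗ[k] S :=
  (TensorProduct.lid k S).toLinearMap ∘ₗ LinearMap.rTensor S (𝒟.basis.coord i)

@[simp] theorem crd_tmul (i : Fin (𝒟.m + 1)) (d : 𝒟.Alg) (s : S) :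
    𝒟.crd i (d ⊗ₜ[k] s) = 𝒟.basis.repr d i • s := by
  simp [crd]

theorem sum_crd (x : 𝒟.Alg ⊗[k] S) : ∑ i, 𝒟.basis i ⊗ₜ[k] 𝒟.crd i x = x := by
  induction x with
  | zero => simp
  | add x y hx hy => simp only [map_add, TensorProduct.tmul_add, Finset.sum_add_distrib, hx, hy]
  | tmul d s =>
    simp only [crd_tmul, ← TensorProduct.smul_tmul]
    rw [← TensorProduct.sum_tmul, 𝒟.basis.sum_repr]

theorem crd_ext {x y : 𝒟.Alg ⊗[k] S} (h : ∀ i, 𝒟.crd i x = 𝒟.crd i y) : x = y := by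
  rw [← 𝒟.sum_crd x, ← 𝒟.sum_crd y]
  simp [h]

theorem crd_basis_tmul (i j : Fin (𝒟.m + 1)) (s : S) :
    𝒟.crd i (𝒟.basis j ⊗ₜ[k] s) = if j = i then s else 0 := by
  rw [crd_tmul, Module.Basis.repr_self, Finsupp.single_apply]
  split <;> simp

theorem crd_one_tmul_zero (s : S) : 𝒟.crd 0 ((1 : 𝒟.Alg) ⊗ₜ[k] s) = s := by
  rw [← basis_zero, crd_basis_tmul, if_pos rfl]

theorem crd_one_tmul_succ (i : Fin 𝒟.m) (s : S) : 𝒟.crd i.succ ((1 : 𝒟.Alg) ⊗ₜ[k] s) = 0 := by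
  rw [← basis_zero, crd_basis_tmul, if_neg (Fin.succ_ne_zero i).symm]

theorem crd_eps_tmul_zero (i : Fin 𝒟.m) (s : S) : 𝒟.crd 0 (𝒟.eps i ⊗ₜ[k] s) = 0 := by
  rw [eps, crd_basis_tmul, if_neg (Fin.succ_ne_zero i)]

theorem crd_eps_tmul_succ (i j : Fin 𝒟.m) (s : S) :
    𝒟.crd j.succ (𝒟.eps i ⊗ₜ[k] s) = if i = j then s else 0 := by
  rw [eps, crd_basis_tmul]
  simp

theorem crd_mul (i : Fin (𝒟.m + 1)) (x y : 𝒟.Alg ⊗[k] S) :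
    𝒟.crd i (x * y) = ∑ p, ∑ q, 𝒟.beta i p q • (𝒟.crd p x * 𝒟.crd q y) := by
  conv_lhs => rw [← 𝒟.sum_crd x, ← 𝒟.sum_crd y]
  simp only [Finset.sum_mul, Finset.mul_sum, map_sum, Algebra.TensorProduct.tmul_mul_tmul, crd_tmul]
  exact Finset.sum_comm

theorem crd_mul_zero (x y : 𝒟.Alg ⊗[k] S) :
    𝒟.crd 0 (x * y) = 𝒟.crd 0 x * 𝒟.crd 0 y := by
  rw [crd_mul, Fin.sum_univ_succ, Fin.sum_univ_succ]
  simp only [Fin.sum_univ_succ (n := 𝒟.m), beta_zero_left, beta_zero_right, beta_zero_succ]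
  simp

theorem crd_mul_succ (i : Fin 𝒟.m) (x y : 𝒟.Alg ⊗[k] S) :
    𝒟.crd i.succ (x * y) = 𝒟.crd 0 x * 𝒟.crd i.succ y + 𝒟.crd i.succ x * 𝒟.crd 0 y +
      ∑ p, ∑ q, 𝒟.alpha i p q • (𝒟.crd p.succ x * 𝒟.crd q.succ y) := by
  rw [crd_mul, Fin.sum_univ_succ]
  simp only [beta_zero_left, Fin.sum_univ_succ (n := 𝒟.m), beta_zero_right]
  simp only [ite_smul, one_smul, zero_smul, Fin.succ_inj, Finset.sum_ite_eq', Finset.mem_univ,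
    if_true, Finset.sum_add_distrib]
  rw [if_neg (Fin.succ_ne_zero i).symm, zero_add, add_assoc]
  rfl

theorem crd_one_zero : 𝒟.crd 0 (1 : 𝒟.Alg ⊗[k] S) = 1 := 𝒟.crd_one_tmul_zero 1

theorem crd_map (φ : S →ₐ[k] T) (i : Fin (𝒟.m + 1)) (x : 𝒟.Alg ⊗[k] S) :
    𝒟.crd i (𝒟.map φ x) = φ (𝒟.crd i x) := by
  rw [← 𝒟.sum_crd x]
  simp only [map_sum]
  refine Finset.sum_congr rfl fun j _ => ?_
  rw [map, Algebra.TensorProduct.map_tmul, crd_tmul, crd_tmul, map_smul]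
  rfl

theorem residueOn_eq_crd (x : 𝒟.Alg ⊗[k] S) : 𝒟.residueOn S x = 𝒟.crd 0 x := by
  rw [← 𝒟.sum_crd x]
  simp only [map_sum]
  refine Finset.sum_congr rfl fun j _ => ?_
  have : 𝒟.residueOn S (𝒟.basis j ⊗ₜ[k] 𝒟.crd j x) = 𝒟.residue (𝒟.basis j) • 𝒟.crd j x := by
    simp [residueOn]
  rw [this, crd_tmul]
  congr 1
  refine Fin.cases ?_ (fun j => ?_) j
  · rw [Module.Basis.repr_self, Finsupp.single_apply, if_pos rfl, basis_zero, map_one]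
  · have := 𝒟.residue_eps j
    rw [eps] at this
    rw [this, Module.Basis.repr_self, Finsupp.single_apply, if_neg (Fin.succ_ne_zero j)]

theorem isOperator_iff {R : Type*} [CommRing R] [Algebra k R] {φ : R →ₐ[k] S}
    {e : R →ₐ[k] 𝒟.Alg ⊗[k] S} : 𝒟.IsOperator φ e ↔ ∀ x, 𝒟.crd 0 (e x) = φ x := by
  unfold IsOperator
  rw [AlgHom.ext_iff]
  simp [residueOn_eq_crd]

/-- The elements of `𝒟(S)` whose coordinates up to the `i`-th lie in an ideal of `S`. -/
def coordIdeal (i : Fin (𝒟.m + 1)) (J : Ideal S) : Ideal (𝒟.Alg ⊗[k] S) where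
  carrier := {x | ∀ p ≤ i, 𝒟.crd p x ∈ J}
  add_mem' hx hy p hp := by rw [map_add]; exact J.add_mem (hx p hp) (hy p hp)
  zero_mem' p _ := by rw [map_zero]; exact J.zero_mem
  smul_mem' c x hx p hp := by
    refine Fin.cases (fun hp => ?_) (fun p hp => ?_) p hp
    · rw [smul_eq_mul, crd_mul_zero]
      exact J.mul_mem_left _ (hx 0 hp)
    · rw [smul_eq_mul, crd_mul_succ]
      refine J.add_mem (J.add_mem (J.mul_mem_left _ (hx _ hp))
        (J.mul_mem_left _ (hx 0 (Fin.zero_le _)))) (J.sum_mem fun a _ => J.sum_mem fun b _ => ?_)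
      by_cases h : 𝒟.alpha p a b = 0
      · rw [h, zero_smul]; exact J.zero_mem
      · rw [Algebra.smul_def]
        exact J.mul_mem_left _ (J.mul_mem_left _ (hx _
          ((Fin.succ_lt_succ_iff.2 (𝒟.lt_of_alpha_ne_zero h).2).le.trans hp)))

theorem mem_coordIdeal {i : Fin (𝒟.m + 1)} {J : Ideal S} {x : 𝒟.Alg ⊗[k] S} :
    x ∈ 𝒟.coordIdeal i J ↔ ∀ p ≤ i, 𝒟.crd p x ∈ J := Iff.rfl

/-- The elements of `𝒟(S)` whose coordinates up to the `i`-th lie in a subalgebra of `S`. -/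
def coordSubring (i : Fin (𝒟.m + 1)) (W : Subalgebra k S) : Subring (𝒟.Alg ⊗[k] S) where
  carrier := {x | ∀ p ≤ i, 𝒟.crd p x ∈ W}
  add_mem' hx hy p hp := by rw [map_add]; exact W.add_mem (hx p hp) (hy p hp)
  zero_mem' p _ := by rw [map_zero]; exact W.zero_mem
  neg_mem' hx p hp := by rw [map_neg]; exact W.neg_mem (hx p hp)
  one_mem' p hp := by
    refine Fin.cases ?_ (fun p => ?_) p
    · rw [crd_one_zero]; exact W.one_mem
    · rw [Algebra.TensorProduct.one_def, crd_one_tmul_succ]; exact W.zero_mem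
  mul_mem' {x y} hx hy p hp := by
    refine Fin.cases (fun hp => ?_) (fun p hp => ?_) p hp
    · rw [crd_mul_zero]
      exact W.mul_mem (hx 0 hp) (hy 0 hp)
    · rw [crd_mul_succ]
      refine W.add_mem (W.add_mem (W.mul_mem (hx 0 (Fin.zero_le _)) (hy _ hp))
        (W.mul_mem (hx _ hp) (hy 0 (Fin.zero_le _))))
        (W.sum_mem fun a _ => W.sum_mem fun b _ => ?_)
      by_cases h : 𝒟.alpha p a b = 0
      · rw [h, zero_smul]; exact W.zero_mem
      · have h' := 𝒟.lt_of_alpha_ne_zero h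
        exact W.smul_mem (W.mul_mem (hx _ ((Fin.succ_lt_succ_iff.2 h'.1).le.trans hp))
          (hy _ ((Fin.succ_lt_succ_iff.2 h'.2).le.trans hp))) _

theorem isNilpotent_maximalIdeal : IsNilpotent (IsLocalRing.maximalIdeal 𝒟.Alg) := by
  have : Module.Finite k 𝒟.Alg := Module.Finite.of_basis 𝒟.basis
  have : IsArtinianRing 𝒟.Alg := IsArtinianRing.of_finite k 𝒟.Alg
  rw [← IsLocalRing.jacobson_eq_maximalIdeal ⊥ bot_ne_top]
  exact IsArtinianRing.isNilpotent_jacobson_bot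

theorem ker_residueOn_le : RingHom.ker (𝒟.residueOn S) ≤
    (IsLocalRing.maximalIdeal 𝒟.Alg).map
      (Algebra.TensorProduct.includeLeft : 𝒟.Alg →ₐ[k] 𝒟.Alg ⊗[k] S) := by
  intro x hx
  rw [RingHom.mem_ker, residueOn_eq_crd] at hx
  rw [← 𝒟.sum_crd x, Fin.sum_univ_succ, hx, TensorProduct.tmul_zero, zero_add]
  refine Ideal.sum_mem _ fun p _ => ?_
  rw [show 𝒟.basis p.succ ⊗ₜ[k] 𝒟.crd p.succ x =
    (1 ⊗ₜ[k] 𝒟.crd p.succ x) * ((Algebra.TensorProduct.includeLeft : 𝒟.Alg →ₐ[k] 𝒟.Alg ⊗[k] S)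
      (𝒟.eps p)) by simp [eps]]
  exact Ideal.mul_mem_left _ _ (Ideal.mem_map_of_mem _ (𝒟.eps_mem_maximalIdeal p))

theorem isNilpotent_ker_residueOn : IsNilpotent (RingHom.ker (𝒟.residueOn S)) := by
  obtain ⟨N, hN⟩ := 𝒟.isNilpotent_maximalIdeal
  refine ⟨N, ?_⟩
  rw [Ideal.zero_eq_bot, eq_bot_iff]
  refine (Ideal.pow_right_mono 𝒟.ker_residueOn_le N).trans ?_
  rw [← Ideal.map_pow, hN, Ideal.zero_eq_bot, Ideal.map_bot]

theorem isNilpotent_of_crd_zero {x : 𝒟.Alg ⊗[k] S} (h : 𝒟.crd 0 x = 0) : IsNilpotent x := by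
  obtain ⟨N, hN⟩ := 𝒟.isNilpotent_ker_residueOn (S := S)
  refine ⟨N, ?_⟩
  have : x ^ N ∈ RingHom.ker (𝒟.residueOn S) ^ N :=
    Ideal.pow_mem_pow (by rwa [RingHom.mem_ker, residueOn_eq_crd]) N
  rw [hN] at this
  simpa using this

theorem isNilpotent_of_crd_zero' {x : 𝒟.Alg ⊗[k] S} (h : IsNilpotent (𝒟.crd 0 x)) :
    IsNilpotent x := by
  obtain ⟨N, hN⟩ := h
  have h1 : 𝒟.crd 0 (x ^ N) = 0 := by
    rw [← residueOn_eq_crd, map_pow, residueOn_eq_crd, hN]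
  exact (isNilpotent_of_crd_zero _ h1).of_pow

theorem isUnit_of_crd_zero {x : 𝒟.Alg ⊗[k] S} (h : IsUnit (𝒟.crd 0 x)) : IsUnit x := by
  have h1 : IsNilpotent (x - 1 ⊗ₜ[k] 𝒟.crd 0 x) := by
    apply isNilpotent_of_crd_zero
    rw [map_sub, crd_one_tmul_zero, sub_self]
  have h2 : IsUnit ((1 : 𝒟.Alg) ⊗ₜ[k] 𝒟.crd 0 x) :=
    h.map (Algebra.TensorProduct.includeRight : S →ₐ[k] 𝒟.Alg ⊗[k] S)
  have := h1.isUnit_add_left_of_commute h2 (Commute.all _ _)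
  simpa using this

end Coordinates

end LocalOperatorSystem

/-! ### Rigidity of homomorphisms on separable elements -/

open Polynomial in
-- Taylor expansion gives `0 = f y - f x = (y - x) * (f' x + c * (y - x))`, and the second factor is
-- a unit plus a nilpotent. This is the uniqueness half of Hensel's lemma.
theorem eq_of_isRoot_of_isNilpotent_sub {A : Type*} [CommRing A] {f : A[X]} {x y : A}
    (hx : f.eval x = 0) (hy : f.eval y = 0) (hu : IsUnit (f.derivative.eval x))
    (h : IsNilpotent (y - x)) : y = x := by
  obtain ⟨c, hc⟩ := f.binomExpansion x (y - x)
  rw [add_sub_cancel, hx, hy, zero_add] at hc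
  have h1 : (y - x) * (f.derivative.eval x + c * (y - x)) = 0 := by rw [hc]; ring
  have h2 : IsUnit (f.derivative.eval x + c * (y - x)) :=
    (((Commute.all c (y - x)).isNilpotent_mul_left h)).isUnit_add_left_of_commute hu
      (Commute.all _ _)
  exact sub_eq_zero.1 ((h2.mul_left_eq_zero).1 h1)

section SepOver

variable {E : Type*} [Field E]

/-- `b` is a root of a separable polynomial with coefficients in `Z`. -/
def SepOver (Z : Set E) (b : E) : Prop :=
  ∃ p : Polynomial E, (∀ n, p.coeff n ∈ Z) ∧ p.Separable ∧ p.eval b = 0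

theorem SepOver.mono {Z Z' : Set E} {b : E} (h : SepOver Z b) (hZ : Z ⊆ Z') : SepOver Z' b := by
  obtain ⟨p, h1, h2⟩ := h
  exact ⟨p, fun n => hZ (h1 n), h2⟩

theorem eval_derivative_ne_zero_of_separable {p : Polynomial E} (h : p.Separable) {b : E}
    (hb : p.eval b = 0) : p.derivative.eval b ≠ 0 := by
  have := h.eval₂_derivative_ne_zero (RingHom.id E) (x := b) (by simpa [Polynomial.eval₂_id] using hb)
  simpa [Polynomial.eval₂_id] using this

/-- Both homomorphisms carry the separable polynomial of `b` to the same polynomial, so `φ b` and `ψ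
b` are two roots of it with nilpotent difference and unit derivative. -/
theorem eq_of_sepOver {A : Type*} [CommRing A] {φ ψ : E →+* A} {b : E}
    (h : SepOver {x | φ x = ψ x} b) (hb : IsNilpotent (φ b - ψ b)) : φ b = ψ b := by
  obtain ⟨p, h1, h2, h3⟩ := h
  have hp : p.map φ = p.map ψ := by
    ext n; simpa using h1 n
  refine eq_of_isRoot_of_isNilpotent_sub (f := p.map ψ) ?_ ?_ ?_ hb
  · rw [Polynomial.eval_map_apply, h3, map_zero]
  · rw [← hp, Polynomial.eval_map_apply, h3, map_zero]
  · rw [Polynomial.derivative_map, Polynomial.eval_map_apply]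
    exact (isUnit_iff_ne_zero.2 (eval_derivative_ne_zero_of_separable h2 h3)).map ψ

/-- The subfield on which two ring homomorphisms agree modulo an ideal. -/
def agreeField {A : Type*} [CommRing A] (φ ψ : E →+* A) (J : Ideal A) : Subfield E where
  carrier := {x | φ x - ψ x ∈ J}
  add_mem' {x y} hx hy := by
    have := J.add_mem hx hy
    simp only [Set.mem_ofPred_eq, map_add]
    rwa [add_sub_add_comm]
  zero_mem' := by simp
  neg_mem' {x} hx := by
    have := J.neg_mem hx
    simp only [Set.mem_ofPred_eq, map_neg]
    rwa [neg_sub_neg, ← neg_sub]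
  one_mem' := by simp
  mul_mem' {x y} hx hy := by
    simp only [Set.mem_ofPred_eq, map_mul]
    rw [show φ x * φ y - ψ x * ψ y = (φ x - ψ x) * φ y + ψ x * (φ y - ψ y) by ring]
    exact J.add_mem (J.mul_mem_right _ hx) (J.mul_mem_left _ hy)
  inv_mem' x hx := by
    rcases eq_or_ne x 0 with rfl | h0
    · simp
    simp only [Set.mem_ofPred_eq] at hx ⊢
    have h1 : φ x⁻¹ * φ x = 1 := by rw [← map_mul, inv_mul_cancel₀ h0, map_one]
    have h2 : ψ x⁻¹ * ψ x = 1 := by rw [← map_mul, inv_mul_cancel₀ h0, map_one]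
    rw [show φ x⁻¹ - ψ x⁻¹ = -(φ x⁻¹ * ψ x⁻¹) * (φ x - ψ x) by
      linear_combination (- φ x⁻¹) * h2 + (ψ x⁻¹) * h1]
    exact J.mul_mem_left _ hx

theorem mem_agreeField {A : Type*} [CommRing A] {φ ψ : E →+* A} {J : Ideal A} {x : E} :
    x ∈ agreeField φ ψ J ↔ φ x - ψ x ∈ J := Iff.rfl

theorem mem_agreeField_of_sepOver {A : Type*} [CommRing A] {φ ψ : E →+* A} {J : Ideal A} {b : E}
    (hn : IsNilpotent (φ b - ψ b)) (h : SepOver (agreeField φ ψ J) b) : b ∈ agreeField φ ψ J := by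
  rw [mem_agreeField, ← Ideal.Quotient.mk_eq_mk_iff_sub_mem]
  refine eq_of_sepOver (φ := (Ideal.Quotient.mk J).comp φ) (ψ := (Ideal.Quotient.mk J).comp ψ)
    (h.mono fun x hx => ?_) ?_
  · exact (Ideal.Quotient.mk_eq_mk_iff_sub_mem _ _).2 hx
  · have := hn.map (Ideal.Quotient.mk J)
    simpa using this

/-- The subring on which two ring homomorphisms agree modulo an ideal. -/
def agreeSubring {R A : Type*} [CommRing R] [CommRing A] (φ ψ : R →+* A) (J : Ideal A) :
    Subring R :=
  ((Ideal.Quotient.mk J).comp φ).eqLocus ((Ideal.Quotient.mk J).comp ψ)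

theorem mem_agreeSubring {R A : Type*} [CommRing R] [CommRing A] {φ ψ : R →+* A} {J : Ideal A}
    {x : R} : x ∈ agreeSubring φ ψ J ↔ φ x - ψ x ∈ J :=
  Ideal.Quotient.mk_eq_mk_iff_sub_mem _ _

end SepOver

/-! ### Hensel lifting inside a subring cut out by coordinates -/

section Coord

variable {k : Type*} [Field k] (𝒟 : LocalOperatorSystem k) {E : Type*} [Field E] [Algebra k E]

/-- The element is an invertible constant from `G` plus a nilpotent, both inside the subring, so the
inverse does not leave it. -/
theorem LocalOperatorSystem.isUnit_coordSubring {i : Fin (𝒟.m + 1)} {G : IntermediateField k E}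
    {w : 𝒟.coordSubring i G.toSubalgebra} (h : 𝒟.crd 0 (w : 𝒟.Alg ⊗[k] E) ≠ 0) : IsUnit w := by
  have hmem : ∀ c ∈ G, (1 : 𝒟.Alg) ⊗ₜ[k] c ∈ 𝒟.coordSubring i G.toSubalgebra := by
    intro c hc p _
    refine Fin.cases ?_ (fun p => ?_) p
    · rwa [crd_one_tmul_zero]
    · rw [crd_one_tmul_succ]; exact G.zero_mem
  have hw : 𝒟.crd 0 (w : 𝒟.Alg ⊗[k] E) ∈ G := w.2 0 (Fin.zero_le _)
  set c := 𝒟.crd 0 (w : 𝒟.Alg ⊗[k] E) with hc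
  have h2 : IsUnit (⟨1 ⊗ₜ[k] c, hmem c hw⟩ : 𝒟.coordSubring i G.toSubalgebra) := by
    refine IsUnit.of_mul_eq_one ⟨1 ⊗ₜ[k] c⁻¹, hmem _ (G.inv_mem hw)⟩ ?_
    ext
    simp [mul_inv_cancel₀ h, Algebra.TensorProduct.one_def]
  have h1 : IsNilpotent (w - ⟨1 ⊗ₜ[k] c, hmem c hw⟩) := by
    rw [← IsNilpotent.map_iff (f := (𝒟.coordSubring i G.toSubalgebra).subtype)
      Subtype.val_injective]
    apply isNilpotent_of_crd_zero
    simp only [map_sub, Subring.subtype_apply]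
    rw [crd_one_tmul_zero, ← hc, sub_self]
  have := h1.isUnit_add_left_of_commute h2 (Commute.all _ _)
  simpa using this

/-- Existence in Hensel's lemma is applied inside the subring, starting from the approximate root `1
⊗ b`; uniqueness in all of `𝒟(E)` identifies the root found with `e b`. Only coordinates up to `i`
of the coefficients need to be controlled. -/
theorem LocalOperatorSystem.mem_coordSubring_of_sepOver {e : E →ₐ[k] 𝒟.Alg ⊗[k] E}
    (he : ∀ x, 𝒟.crd 0 (e x) = x) {i : Fin (𝒟.m + 1)} {G : IntermediateField k E} {b : E}
    (hb : b ∈ G) (h : SepOver {x | e x ∈ 𝒟.coordSubring i G.toSubalgebra} b) :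
    e b ∈ 𝒟.coordSubring i G.toSubalgebra := by
  obtain ⟨p, h1, h2, h3⟩ := h
  set W := 𝒟.coordSubring i G.toSubalgebra
  have hcoef : (↑(p.map (e : E →+* 𝒟.Alg ⊗[k] E)).coeffs : Set (𝒟.Alg ⊗[k] E)) ⊆ W := by
    intro z hz
    obtain ⟨n, -, rfl⟩ := Polynomial.mem_coeffs_iff.1 hz
    rw [Polynomial.coeff_map]
    exact h1 n
  set P := (p.map (e : E →+* 𝒟.Alg ⊗[k] E)).toSubring W hcoef with hP
  have hPm : P.map W.subtype = p.map (e : E →+* 𝒟.Alg ⊗[k] E) := by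
    ext n; simp [hP]
  have hb1 : (1 : 𝒟.Alg) ⊗ₜ[k] b ∈ W := by
    intro q _
    refine Fin.cases ?_ (fun q => ?_) q
    · rwa [crd_one_tmul_zero]
    · rw [crd_one_tmul_succ]; exact G.zero_mem
  have hres : ∀ f : Polynomial E, 𝒟.crd 0 ((f.map (e : E →+* 𝒟.Alg ⊗[k] E)).eval
      ((1 : 𝒟.Alg) ⊗ₜ[k] b)) = f.eval b := by
    intro f
    have key : ((𝒟.residueOn E : 𝒟.Alg ⊗[k] E →+* E)).comp (e : E →+* 𝒟.Alg ⊗[k] E) =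
        RingHom.id E := by
      ext x
      simp [residueOn_eq_crd, he]
    rw [← residueOn_eq_crd, ← AlgHom.coe_toRingHom, ← Polynomial.eval_map_apply,
      Polynomial.map_map]
    have h4 : ((𝒟.residueOn E : 𝒟.Alg ⊗[k] E →+* E)) ((1 : 𝒟.Alg) ⊗ₜ[k] b) = b := by
      change 𝒟.residueOn E _ = b
      rw [residueOn_eq_crd, crd_one_tmul_zero]
    rw [h4]
    erw [key]
    rw [Polynomial.map_id]
  have hev : ∀ f : Polynomial W, ((f.eval ⟨1 ⊗ₜ[k] b, hb1⟩ : W) : 𝒟.Alg ⊗[k] E) =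
      (f.map W.subtype).eval (1 ⊗ₜ[k] b) := by
    intro f
    exact (Polynomial.eval_map_apply (f := W.subtype) (p := f) ⟨1 ⊗ₜ[k] b, hb1⟩).symm
  have hnil : IsNilpotent (Polynomial.aeval (⟨1 ⊗ₜ[k] b, hb1⟩ : W) P) := by
    rw [← IsNilpotent.map_iff (f := W.subtype) Subtype.val_injective]
    apply isNilpotent_of_crd_zero
    rw [Polynomial.coe_aeval_eq_eval, Subring.subtype_apply, hev, hPm, hres, h3]
  have hunit : IsUnit (Polynomial.aeval (⟨1 ⊗ₜ[k] b, hb1⟩ : W) P.derivative) := by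
    apply isUnit_coordSubring
    rw [Polynomial.coe_aeval_eq_eval, hev, ← Polynomial.derivative_map, hPm,
      Polynomial.derivative_map, hres]
    exact eval_derivative_ne_zero_of_separable h2 h3
  obtain ⟨r, ⟨hr1, hr2⟩, -⟩ :=
    Polynomial.existsUnique_nilpotent_sub_and_aeval_eq_zero hnil hunit
  have hroot : (p.map (e : E →+* 𝒟.Alg ⊗[k] E)).eval (r : 𝒟.Alg ⊗[k] E) = 0 := by
    rw [← hPm]
    erw [Polynomial.eval_map_apply (f := W.subtype) (p := P) r]
    rw [Polynomial.coe_aeval_eq_eval] at hr2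
    rw [hr2, map_zero]
  have heq : (r : 𝒟.Alg ⊗[k] E) = e b := by
    refine eq_of_isRoot_of_isNilpotent_sub (f := p.map (e : E →+* 𝒟.Alg ⊗[k] E)) ?_ hroot ?_ ?_
    · erw [Polynomial.eval_map_apply]
      rw [h3, map_zero]
    · rw [Polynomial.derivative_map]
      erw [Polynomial.eval_map_apply]
      exact (isUnit_iff_ne_zero.2 (eval_derivative_ne_zero_of_separable h2 h3)).map _
    · apply isNilpotent_of_crd_zero
      have h5 : IsNilpotent (W.subtype (⟨1 ⊗ₜ[k] b, hb1⟩ - r)) := hr1.map W.subtype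
      have h6 : IsNilpotent (𝒟.residueOn E (W.subtype (⟨1 ⊗ₜ[k] b, hb1⟩ - r))) := h5.map _
      have h7 := h6.eq_zero
      rw [residueOn_eq_crd, map_sub, map_sub] at h7
      simp only [Subring.subtype_apply] at h7
      rw [crd_one_tmul_zero] at h7
      rw [map_sub, he, ← sub_eq_zero.1 h7, sub_self]
  rw [← heq]
  exact r.2

end Coord

/-! ### Normal words and the two orders on indices -/

section Order

variable {k : Type*} [Field k] {𝓓 : OpType → LocalOperatorSystem k}

instance : Fintype OpType := ⟨{.lie, .hs}, fun x => by cases x <;> simp⟩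

theorem Idx.rank_injective : Function.Injective (Idx.rank (𝓓 := 𝓓)) := by
  rintro ⟨u, i⟩ ⟨v, j⟩ h
  cases u <;> cases v <;> simp only [Idx.rank] at h
  · rw [Fin.ext (show i.val = j.val by omega)]
  · omega
  · omega
  · rw [Fin.ext h]

theorem Idx.rank_hs_lt_lie (h : Fin (𝓓 .hs).m) (i : Fin (𝓓 .lie).m) :
    Idx.rank (𝓓 := 𝓓) ⟨.hs, h⟩ < Idx.rank (𝓓 := 𝓓) ⟨.lie, i⟩ := by
  simp only [Idx.rank]; omega

theorem Idx.rank_le_rank {u : OpType} {i j : Fin (𝓓 u).m} :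
    Idx.rank (𝓓 := 𝓓) ⟨u, i⟩ ≤ Idx.rank (𝓓 := 𝓓) ⟨u, j⟩ ↔ i ≤ j := by
  cases u
  · exact Nat.add_le_add_iff_left
  · exact Iff.rfl

theorem Idx.rank_lt_rank {u : OpType} {i j : Fin (𝓓 u).m} :
    Idx.rank (𝓓 := 𝓓) ⟨u, i⟩ < Idx.rank (𝓓 := 𝓓) ⟨u, j⟩ ↔ i < j := by
  rw [← not_le, Idx.rank_le_rank, not_le]

/-- Insertion of a letter into a weakly decreasing word. -/
def ins (i : Idx 𝓓) (ξ : List (Idx 𝓓)) : List (Idx 𝓓) :=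
  ξ.orderedInsert (fun a b => b.rank ≤ a.rank) i

theorem ins_cons (i j : Idx 𝓓) (ξ : List (Idx 𝓓)) :
    ins i (j :: ξ) = if j.rank ≤ i.rank then i :: j :: ξ else j :: ins i ξ := rfl

theorem perm_ins (i : Idx 𝓓) (ξ : List (Idx 𝓓)) : (ins i ξ).Perm (i :: ξ) :=
  List.perm_orderedInsert _ _ _

@[simp] theorem length_ins (i : Idx 𝓓) (ξ : List (Idx 𝓓)) : (ins i ξ).length = ξ.length + 1 := by
  simpa using (perm_ins i ξ).length_eq

instance : IsTrans (Idx 𝓓) (fun a b => b.rank ≤ a.rank) := ⟨fun _ _ _ h h' => h'.trans h⟩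
instance : Std.Total (fun a b : Idx 𝓓 => b.rank ≤ a.rank) := ⟨fun _ _ => le_total _ _⟩

theorem pairwise_ins (i : Idx 𝓓) {ξ : List (Idx 𝓓)}
    (h : ξ.Pairwise (fun i j => Idx.rank j ≤ Idx.rank i)) :
    (ins i ξ).Pairwise (fun i j => Idx.rank j ≤ Idx.rank i) :=
  List.Pairwise.orderedInsert i ξ h

theorem IsNormal.eq_of_perm {ξ η : List (Idx 𝓓)} (hξ : IsNormal ξ) (hη : IsNormal η)
    (h : ξ.Perm η) : ξ = η :=
  h.eq_of_pairwise (fun _ _ _ _ h1 h2 => Idx.rank_injective (le_antisymm h2 h1)) hξ.1 hη.1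

theorem isNormal_nil : IsNormal ([] : List (Idx 𝓓)) := ⟨List.Pairwise.nil, by simp⟩

theorem IsNormal.tail {i : Idx 𝓓} {ξ : List (Idx 𝓓)} (h : IsNormal (i :: ξ)) : IsNormal ξ :=
  ⟨(List.pairwise_cons.1 h.1).2, le_trans (by rw [List.countP_cons]; omega) h.2⟩

theorem IsNormal.erase (i : Idx 𝓓) {ξ : List (Idx 𝓓)} (h : IsNormal ξ) : IsNormal (ξ.erase i) :=
  ⟨h.1.sublist List.erase_sublist, (List.Sublist.countP_le List.erase_sublist).trans h.2⟩

theorem isNormal_ins {i : Idx 𝓓} {ξ : List (Idx 𝓓)} (h : IsNormal ξ)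
    (h' : (i :: ξ).countP (fun i => i.1 = OpType.hs) ≤ 1) : IsNormal (ins i ξ) :=
  ⟨pairwise_ins i h.1, by rwa [(perm_ins i ξ).countP_eq]⟩

theorem isNormal_ins_lie {i : Fin (𝓓 .lie).m} {ξ : List (Idx 𝓓)} (h : IsNormal ξ) :
    IsNormal (ins ⟨.lie, i⟩ ξ) :=
  isNormal_ins h (by simpa using h.2)

/-- All letters of the word are of Lie type. -/
def IsLie (ξ : List (Idx 𝓓)) : Prop := ∀ i ∈ ξ, i.1 = OpType.lie

theorem IsLie.countP {ξ : List (Idx 𝓓)} (h : IsLie ξ) :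
    ξ.countP (fun i => i.1 = OpType.hs) = 0 := by
  rw [List.countP_eq_zero]
  intro a ha
  simp [h a ha]

theorem isNormal_ins_of_isLie (i : Idx 𝓓) {ξ : List (Idx 𝓓)} (h : IsNormal ξ) (hl : IsLie ξ) :
    IsNormal (ins i ξ) :=
  isNormal_ins h (by rw [List.countP_cons, hl.countP]; split <;> omega)

theorem ins_hs_of_isLie (h : Fin (𝓓 .hs).m) {ξ : List (Idx 𝓓)} (hl : IsLie ξ) :
    ins ⟨.hs, h⟩ ξ = ξ ++ [⟨.hs, h⟩] := by
  induction ξ with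
  | nil => rfl
  | cons j ξ ih =>
    obtain ⟨u, j⟩ := j
    obtain rfl : u = .lie := hl _ (List.mem_cons_self)
    rw [ins_cons, if_neg (not_le.2 (Idx.rank_hs_lt_lie h j)),
      ih fun i hi => hl i (List.mem_cons_of_mem _ hi), List.cons_append]

/-- Hasse-Schmidt letters rank below all Lie letters, so in a decreasing word the single possible
one stands at the end. -/
theorem IsNormal.isLie_or {ξ : List (Idx 𝓓)} (hξ : IsNormal ξ) : IsLie ξ ∨
    ∃ (lam : List (Idx 𝓓)) (h : Fin (𝓓 .hs).m), IsLie lam ∧ IsNormal lam ∧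
      ξ = lam ++ [⟨.hs, h⟩] := by
  induction ξ with
  | nil => left; intro i hi; simp at hi
  | cons j ξ ih =>
    obtain ⟨u, j⟩ := j
    cases u with
    | lie =>
      rcases ih hξ.tail with h | ⟨lam, h, h1, h2, rfl⟩
      · left
        intro i hi
        rcases List.mem_cons.1 hi with rfl | hi
        · rfl
        · exact h i hi
      · right
        refine ⟨⟨.lie, j⟩ :: lam, h, ?_, ?_, rfl⟩
        · intro i hi
          rcases List.mem_cons.1 hi with rfl | hi
          · rfl
          · exact h1 i hi
        · refine ⟨List.pairwise_cons.2 ⟨fun a ha => (List.pairwise_cons.1 hξ.1).1 a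
            (List.mem_append_left _ ha), h2.1⟩, ?_⟩
          simpa using h2.2
    | hs =>
      right
      have hl : IsLie ξ := by
        intro i hi
        by_contra hne
        have hh : i.1 = .hs := by cases hi' : i.1 <;> simp_all
        have h2 := hξ.2
        rw [List.countP_cons] at h2
        have : 0 < ξ.countP (fun i => i.1 = OpType.hs) :=
          List.countP_pos_iff.2 ⟨i, hi, by simp [hh]⟩
        simp only [decide_true, if_true] at h2
        omega
      obtain rfl : ξ = [] := by
        rcases ξ with _ | ⟨⟨v, b⟩, ξ⟩
        · rfl
        · obtain rfl : v = .lie := hl ⟨v, b⟩ (List.mem_cons_self)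
          exact absurd ((List.pairwise_cons.1 hξ.1).1 _ (List.mem_cons_self))
            (not_le.2 (Idx.rank_hs_lt_lie j b))
      exact ⟨[], j, by intro i hi; simp at hi, isNormal_nil, rfl⟩

theorem isNormal_append_hs {lam : List (Idx 𝓓)} (hl : IsLie lam) (hn : IsNormal lam)
    (h : Fin (𝓓 .hs).m) : IsNormal (lam ++ [⟨.hs, h⟩]) := by
  rw [← ins_hs_of_isLie h hl]
  exact isNormal_ins_of_isLie _ hn hl

variable {n : ℕ}

theorem triLT_of_length_lt {x y : List (Idx 𝓓) × Fin n} (h : x.1.length < y.1.length) :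
    TriLT x y := Or.inl h

theorem TriLT.length_le {x y : List (Idx 𝓓) × Fin n} (h : TriLT x y) :
    x.1.length ≤ y.1.length := by
  rcases h with h | h
  · exact h.le
  · exact h.1.le

theorem TriLT.irrefl (x : List (Idx 𝓓) × Fin n) : ¬ TriLT x x := by
  rintro (h | ⟨-, h | ⟨-, i, h, -⟩⟩) <;> exact lt_irrefl _ h

theorem TriLT.trans {x y z : List (Idx 𝓓) × Fin n} (h : TriLT x y) (h' : TriLT y z) :
    TriLT x z := by
  rcases h with h | ⟨h1, h⟩
  · exact Or.inl (h.trans_le h'.length_le)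
  rcases h' with h' | ⟨h1', h'⟩
  · exact Or.inl (h1.trans_lt h')
  refine Or.inr ⟨h1.trans h1', ?_⟩
  rcases h with h | ⟨h2, i, hi, h⟩
  · rcases h' with h' | ⟨h2', -⟩
    · exact Or.inl (h.trans h')
    · exact Or.inl (h2' ▸ h)
  rcases h' with h' | ⟨h2', i', hi', h'⟩
  · exact Or.inl (h2 ▸ h')
  refine Or.inr ⟨h2.trans h2', ?_⟩
  rcases lt_trichotomy i.rank i'.rank with hr | hr | hr
  · exact ⟨i', (h i' hr).trans_lt hi', fun j hj => (h j (hr.trans hj)).trans (h' j hj)⟩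
  · obtain rfl := Idx.rank_injective hr
    exact ⟨i, hi.trans hi', fun j hj => (h j hj).trans (h' j hj)⟩
  · exact ⟨i, hi.trans_eq (h' i hr), fun j hj => (h j hj).trans (h' j (hr.trans hj))⟩

theorem finite_triLT (y : List (Idx 𝓓) × Fin n) : {x | TriLT x y}.Finite := by
  refine Set.Finite.subset (Set.Finite.prod (List.finite_length_le (Idx 𝓓) y.1.length)
    (Set.finite_univ (α := Fin n))) ?_
  intro x hx
  exact ⟨hx.length_le, trivial⟩

/-- Smaller indices are not longer, so each index has finitely many predecessors, and their number
increases strictly along the order. -/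
theorem wellFounded_triLT : WellFounded (TriLT (𝓓 := 𝓓) (n := n)) := by
  refine Subrelation.wf (r := InvImage (· < ·) fun y => {x | TriLT (𝓓 := 𝓓) (n := n) x y}.ncard) ?_
    (InvImage.wf _ wellFounded_lt)
  intro x y h
  refine Set.ncard_lt_ncard ⟨fun z hz => TriLT.trans hz h, fun hsub => ?_⟩ (finite_triLT y)
  exact TriLT.irrefl x (hsub h)

theorem TriLT.congr {x x' y y' : List (Idx 𝓓) × Fin n} (h : TriLT x y) (hx : x.1.Perm x'.1)
    (hx2 : x.2 = x'.2) (hy : y.1.Perm y'.1) (hy2 : y.2 = y'.2) : TriLT x' y' := by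
  unfold TriLT at *
  simpa only [← hx.length_eq, ← hy.length_eq, ← hx2, ← hy2, ← fun i => hx.count_eq i,
    ← fun i => hy.count_eq i] using h

/-- The preorder associated with `TriLT`, which identifies permuted words. -/
def TriLE (x y : List (Idx 𝓓) × Fin n) : Prop := TriLT x y ∨ (x.1.Perm y.1 ∧ x.2 = y.2)

theorem TriLE.refl (x : List (Idx 𝓓) × Fin n) : TriLE x x := Or.inr ⟨List.Perm.refl _, rfl⟩

theorem TriLE.trans_lt {x y z : List (Idx 𝓓) × Fin n} (h : TriLE x y) (h' : TriLT y z) :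
    TriLT x z := by
  rcases h with h | ⟨h, h2⟩
  · exact h.trans h'
  · exact h'.congr h.symm h2.symm (List.Perm.refl _) rfl

theorem TriLT.trans_le {x y z : List (Idx 𝓓) × Fin n} (h : TriLT x y) (h' : TriLE y z) :
    TriLT x z := by
  rcases h' with h' | ⟨h', h2⟩
  · exact h.trans h'
  · exact h.congr (List.Perm.refl _) rfl h' h2

theorem TriLE.length_le {x y : List (Idx 𝓓) × Fin n} (h : TriLE x y) :
    x.1.length ≤ y.1.length := by
  rcases h with h | ⟨h, h2⟩
  · exact h.length_le
  · exact h.length_eq.le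

/-- Differentiation respects the order. Different letters `p ≤ q` are allowed because the product
rule for `∂_q` also brings in `∂_p` with `p < q`. -/
theorem TriLT.cons {ν η : List (Idx 𝓓)} {t t' : Fin n} (h : TriLT (ν, t) (η, t')) {p q : Idx 𝓓}
    (hpq : p.rank ≤ q.rank) : TriLT (p :: ν, t) (q :: η, t') := by
  rcases h with h | ⟨h1, h⟩
  · exact Or.inl (by simpa using h)
  refine Or.inr ⟨by simpa using h1, ?_⟩
  rcases h with h | ⟨h2, i, hi, h⟩
  · exact Or.inl h
  refine Or.inr ⟨h2, ?_⟩
  simp only at hi h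
  rcases hpq.eq_or_lt with hpq | hpq
  · obtain rfl := Idx.rank_injective hpq
    refine ⟨i, ?_, fun j hj => ?_⟩
    · simp only [List.count_cons]; omega
    · simp only [List.count_cons]; rw [h j hj]
  -- The position deciding the new comparison is the larger of `i` and `q`.
  rcases lt_or_ge i.rank q.rank with hr | hr
  · refine ⟨q, ?_, fun j hj => ?_⟩
    · simp only [List.count_cons, beq_self_eq_true, if_true, h q hr]
      rw [if_neg (by rw [beq_iff_eq]; rintro rfl; exact lt_irrefl _ hpq)]
      omega
    · simp only [List.count_cons, h j (hr.trans hj)]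
      rw [if_neg (by rw [beq_iff_eq]; rintro rfl; exact lt_asymm hpq hj),
        if_neg (by rw [beq_iff_eq]; rintro rfl; exact lt_irrefl _ hj)]
  · refine ⟨i, ?_, fun j hj => ?_⟩
    · simp only [List.count_cons]
      rw [if_neg (by rw [beq_iff_eq]; rintro rfl; exact absurd hr (not_le.2 hpq))]
      omega
    · simp only [List.count_cons, h j hj]
      rw [if_neg (by rw [beq_iff_eq]; rintro rfl; exact lt_asymm (hpq.trans_le hr) hj),
        if_neg (by rw [beq_iff_eq]; rintro rfl; exact absurd hj (not_lt.2 hr))]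

theorem triLT_cons_of_rank_lt (η : List (Idx 𝓓)) (t : Fin n) {p q : Idx 𝓓}
    (hpq : p.rank < q.rank) : TriLT (p :: η, t) (q :: η, t) := by
  refine Or.inr ⟨by simp, Or.inr ⟨rfl, q, ?_, fun j hj => ?_⟩⟩
  · simp only [List.count_cons, beq_self_eq_true, if_true]
    rw [if_neg (by rw [beq_iff_eq]; rintro rfl; exact lt_irrefl _ hpq)]
    omega
  · simp only [List.count_cons]
    rw [if_neg (by rw [beq_iff_eq]; rintro rfl; exact lt_asymm hpq hj),
      if_neg (by rw [beq_iff_eq]; rintro rfl; exact lt_irrefl _ hj)]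

theorem TriLE.cons {ν η : List (Idx 𝓓)} {t t' : Fin n} (h : TriLE (ν, t) (η, t')) {p q : Idx 𝓓}
    (hpq : p.rank ≤ q.rank) : TriLE (p :: ν, t) (q :: η, t') := by
  rcases h with h | ⟨h, h2⟩
  · exact Or.inl (h.cons hpq)
  simp only at h h2
  subst h2
  rcases hpq.eq_or_lt with hpq | hpq
  · obtain rfl := Idx.rank_injective hpq
    exact Or.inr ⟨h.cons p, rfl⟩
  · exact Or.inl ((triLT_cons_of_rank_lt η t hpq).congr (h.symm.cons p) rfl (List.Perm.refl _) rfl)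

theorem triLT_cons_self (η : List (Idx 𝓓)) (t t' : Fin n) (p : Idx 𝓓) :
    TriLT (η, t) (p :: η, t') := Or.inl (by simp)

theorem triLT_trichotomy {x y : List (Idx 𝓓) × Fin n} (hx : IsNormal x.1) (hy : IsNormal y.1) :
    TriLT x y ∨ x = y ∨ TriLT y x := by
  rcases lt_trichotomy x.1.length y.1.length with h | h | h
  · exact Or.inl (Or.inl h)
  · rcases lt_trichotomy x.2 y.2 with h' | h' | h'
    · exact Or.inl (Or.inr ⟨h, Or.inl h'⟩)
    · by_cases hc : ∀ i, x.1.count i = y.1.count i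
      · right; left
        exact Prod.ext (hx.eq_of_perm hy (List.perm_iff_count.2 hc)) h'
      · push Not at hc
        have hfin : {i : Idx 𝓓 | x.1.count i ≠ y.1.count i}.Finite := Set.toFinite _
        obtain ⟨i, hi, hmax⟩ := Set.exists_max_image _ Idx.rank hfin hc
        have hab : ∀ j : Idx 𝓓, i.rank < j.rank → x.1.count j = y.1.count j := by
          intro j hj
          by_contra hne
          exact absurd (hmax j hne) (not_le.2 hj)
        rcases lt_or_gt_of_ne hi with hlt | hlt
        · exact Or.inl (Or.inr ⟨h, Or.inr ⟨h', i, hlt, hab⟩⟩)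
        · exact Or.inr (Or.inr (Or.inr ⟨h.symm, Or.inr ⟨h'.symm, i, hlt,
            fun j hj => (hab j hj).symm⟩⟩))
    · exact Or.inr (Or.inr (Or.inr ⟨h.symm, Or.inl h'⟩))
  · exact Or.inr (Or.inr (Or.inl h))

theorem ProdLE.refl (x : List (Idx 𝓓) × Fin n) : ProdLE x x := ⟨rfl, fun _ => le_rfl⟩

theorem ProdLE.trans {x y z : List (Idx 𝓓) × Fin n} (h : ProdLE x y) (h' : ProdLE y z) :
    ProdLE x z := ⟨h.1.trans h'.1, fun i => (h.2 i).trans (h'.2 i)⟩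

theorem ProdLE.length_le {x y : List (Idx 𝓓) × Fin n} (h : ProdLE x y) :
    x.1.length ≤ y.1.length := by
  have : (x.1 : Multiset (Idx 𝓓)) ≤ (y.1 : Multiset (Idx 𝓓)) :=
    Multiset.le_iff_count.2 fun i => by simpa using h.2 i
  simpa using Multiset.card_le_card this

theorem ProdLE.perm_of_length_le {x y : List (Idx 𝓓) × Fin n} (h : ProdLE x y)
    (hl : y.1.length ≤ x.1.length) : x.1.Perm y.1 := by
  have : (x.1 : Multiset (Idx 𝓓)) ≤ (y.1 : Multiset (Idx 𝓓)) :=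
    Multiset.le_iff_count.2 fun i => by simpa using h.2 i
  exact Multiset.coe_eq_coe.1 (Multiset.eq_of_le_of_card_le this (by simpa using hl))

theorem ProdLE.eq_of_length_le {x y : List (Idx 𝓓) × Fin n} (h : ProdLE x y)
    (hx : IsNormal x.1) (hy : IsNormal y.1) (hl : y.1.length ≤ x.1.length) : x = y :=
  Prod.ext (hx.eq_of_perm hy (h.perm_of_length_le hl)) h.1

theorem exists_count_lt {μ ζ : List (Idx 𝓓)} (h : μ.length < ζ.length) :
    ∃ i, μ.count i < ζ.count i := by
  by_contra! hc
  have : (ζ : Multiset (Idx 𝓓)) ≤ (μ : Multiset (Idx 𝓓)) :=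
    Multiset.le_iff_count.2 fun i => by simpa using hc i
  have := Multiset.card_le_card this
  simp at this
  omega

/-- Counting against the concatenation `μ ++ ν` handles both words at once. With `μ` and `ν` leaders
of length at most `r` and `ζ` longer than `2r`, it provides a letter that can be removed from `ζ`
while staying above both. -/
theorem exists_count_lt_and_count_lt {μ ν ζ : List (Idx 𝓓)}
    (h : μ.length + ν.length < ζ.length) : ∃ i, μ.count i < ζ.count i ∧ ν.count i < ζ.count i := by
  obtain ⟨i, hi⟩ := exists_count_lt (μ := μ ++ ν) (ζ := ζ) (by simpa using h)
  rw [List.count_append] at hi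
  exact ⟨i, by omega, by omega⟩

theorem ProdLE.erase {μ : List (Idx 𝓓) × Fin n} {ζ : List (Idx 𝓓)} {t : Fin n}
    (h : ProdLE μ (ζ, t)) {i : Idx 𝓓} (hi : μ.1.count i < ζ.count i) :
    ProdLE μ (ζ.erase i, t) := by
  refine ⟨h.1, fun j => ?_⟩
  by_cases hij : j = i
  · subst hij
    simp only [List.count_erase_self]
    omega
  · simp only [List.count_erase_of_ne hij]
    exact h.2 j

theorem perm_cons_erase_of_count_lt {c : ℕ} {i : Idx 𝓓} {ζ : List (Idx 𝓓)}
    (hi : c < ζ.count i) : ζ.Perm (i :: ζ.erase i) :=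
  List.perm_cons_erase (List.count_pos_iff.1 (by omega))

end Order

/-! ### Fixed points of causal operators -/

/-- A strictly causal operator on families indexed by a well-founded set has a fixed point. -/
theorem exists_fixedPoint_of_causal {ι α : Type*} [Inhabited α] {r : ι → ι → Prop}
    (hr : WellFounded r) (Φ : (ι → α) → ι → α)
    (hΦ : ∀ a b x, (∀ y, r y x → a y = b y) → Φ a x = Φ b x) : ∃ a, ∀ x, a x = Φ a x := by
  classical
  -- Values at places not preceding `x` are filled in arbitrarily; causality makes them irrelevant.
  let F : (x : ι) → ((y : ι) → r y x → α) → α := fun x f =>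
    Φ (fun y => if h : r y x then f y h else default) x
  refine ⟨hr.fix F, fun x => ?_⟩
  rw [hr.fix_eq]
  apply hΦ
  intro y hy
  rw [dif_pos hy]

/-! ### Commutation defects as differences of homomorphisms -/

section Defect

variable {k : Type*} [Field k]

theorem LocalOperatorSystem.eps_mul_eps_of_null {𝒟 : LocalOperatorSystem k} {p q : Fin 𝒟.m}
    (h : p ∈ 𝒟.null) : 𝒟.eps p * 𝒟.eps q = 0 := h _ (𝒟.eps_mem_maximalIdeal q)

theorem LocalOperatorSystem.alpha_of_null_left {𝒟 : LocalOperatorSystem k} {i p q : Fin 𝒟.m}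
    (h : p ∈ 𝒟.null) : 𝒟.alpha i p q = 0 := by
  rw [alpha, eps_mul_eps_of_null h]; simp

theorem LocalOperatorSystem.alpha_of_null_right {𝒟 : LocalOperatorSystem k} {i p q : Fin 𝒟.m}
    (h : q ∈ 𝒟.null) : 𝒟.alpha i p q = 0 := by
  rw [alpha, mul_comm, eps_mul_eps_of_null h]; simp

variable (𝒟₁ 𝒟₂ : LocalOperatorSystem k) {F R S : Type*} [CommRing F] [Algebra k F] [CommRing R]
  [Algebra k R] [CommRing S] [Algebra k S]

open LocalOperatorSystem

theorem crd_map_includeRight (p : Fin (𝒟₁.m + 1)) (x : 𝒟₁.Alg ⊗[k] S) :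
    𝒟₁.crd p (𝒟₁.map (Algebra.TensorProduct.includeRight : S →ₐ[k] 𝒟₂.Alg ⊗[k] S) x) =
      1 ⊗ₜ[k] 𝒟₁.crd p x := by
  rw [crd_map]; rfl

theorem map_map_tmul (φ : S →ₐ[k] R) (a : 𝒟₁.Alg) (b : 𝒟₂.Alg) (s : S) :
    𝒟₁.map (𝒟₂.map φ) (a ⊗ₜ[k] (b ⊗ₜ[k] s)) = a ⊗ₜ[k] (b ⊗ₜ[k] φ s) := rfl

theorem productMap_sum {A : Type*} [CommRing A] [Algebra k A] (f : 𝒟₂.Alg →ₐ[k] A)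
    (g : R →ₐ[k] A) (y : 𝒟₂.Alg ⊗[k] R) :
    Algebra.TensorProduct.productMap f g y =
      g (𝒟₂.crd 0 y) + ∑ l : Fin 𝒟₂.m, f (𝒟₂.eps l) * g (𝒟₂.crd l.succ y) := by
  conv_lhs => rw [← 𝒟₂.sum_crd y]
  rw [map_sum, Fin.sum_univ_succ]
  simp only [Algebra.TensorProduct.productMap_apply_tmul, basis_zero, map_one, one_mul]
  rfl

theorem crd_eq_ite {𝒟 : LocalOperatorSystem k} (p : Fin 𝒟.m) (q : Fin (𝒟.m + 1)) (s : S) :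
    𝒟.crd q (𝒟.eps p ⊗ₜ[k] s) = if p.succ = q then s else 0 := crd_basis_tmul _ _ _ _

theorem crd_one_tmul (𝒟 : LocalOperatorSystem k) (q : Fin (𝒟.m + 1)) (s : S) :
    𝒟.crd q ((1 : 𝒟.Alg) ⊗ₜ[k] s) = if 0 = q then s else 0 := by
  rw [← basis_zero]; exact crd_basis_tmul _ _ _ _

/-- Multiplication by an element of `𝔪`-type `ε_i ⊗ z`, with `i` null, only sees the zeroth
coordinate. -/
theorem eps_tmul_mul_of_null {i : Fin 𝒟₁.m} (hi : i ∈ 𝒟₁.null) (z : S) (x : 𝒟₁.Alg ⊗[k] S) :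
    𝒟₁.eps i ⊗ₜ[k] z * x = 𝒟₁.eps i ⊗ₜ[k] (z * 𝒟₁.crd 0 x) := by
  conv_lhs => rw [← 𝒟₁.sum_crd x]
  rw [Fin.sum_univ_succ, mul_add, Finset.mul_sum]
  rw [Finset.sum_eq_zero, add_zero, Algebra.TensorProduct.tmul_mul_tmul, basis_zero, mul_one]
  intro j _
  rw [Algebra.TensorProduct.tmul_mul_tmul]
  erw [eps_mul_eps_of_null hi]
  rw [TensorProduct.zero_tmul]

theorem crd_one_tmul_mul (p : Fin (𝒟₁.m + 1)) (z : S) (x : 𝒟₁.Alg ⊗[k] S) :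
    𝒟₁.crd p ((1 : 𝒟₁.Alg) ⊗ₜ[k] z * x) = z * 𝒟₁.crd p x := by
  conv_lhs => rw [← 𝒟₁.sum_crd x]
  rw [Finset.mul_sum, map_sum]
  simp only [Algebra.TensorProduct.tmul_mul_tmul, one_mul, crd_basis_tmul]
  simp

variable {𝒟₁ 𝒟₂}

/-- The Lie-coefficients sit only at null indices, and a null `ε_i` annihilates `𝔪`; so in the
correction term only the zeroth coordinate of `e (𝒟.crd l.succ y)` survives. -/
theorem crd_liftOp_lie {𝒟 : LocalOperatorSystem k}
    {r : 𝒟.Alg →ₐ[k] 𝒟.Alg ⊗[k] (𝒟.Alg ⊗[k] F)} {c : Fin 𝒟.m → Fin 𝒟.m → Fin 𝒟.m → F}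
    (hr : IsLieType 𝒟 r c) (ψ : F →ₐ[k] S) (e : R →ₐ[k] 𝒟.Alg ⊗[k] S) (y : 𝒟.Alg ⊗[k] R)
    (p q : Fin (𝒟.m + 1)) :
    𝒟.crd q (𝒟.crd p (liftOp 𝒟 𝒟 r ψ e y)) = 𝒟.crd p (e (𝒟.crd q y)) +
      ∑ l : Fin 𝒟.m, (∑ i, ∑ j, if i.succ = p ∧ j.succ = q then ψ (c l j i) else 0) *
        𝒟.crd 0 (e (𝒟.crd l.succ y)) := by
  have h1 : ∀ (l : Fin 𝒟.m) (V : 𝒟.Alg ⊗[k] S),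
      𝒟.crd q (𝒟.crd p ((𝒟.map (𝒟.map ψ)) (r (𝒟.eps l)) *
        𝒟.map (Algebra.TensorProduct.includeRight : S →ₐ[k] 𝒟.Alg ⊗[k] S) V)) =
      (if l.succ = q then 𝒟.crd p V else 0) +
      (∑ i, ∑ j, if i.succ = p ∧ j.succ = q then ψ (c l j i) else 0) * 𝒟.crd 0 V := by
    intro l V
    rw [hr.1 l, map_add, add_mul, map_add, map_add]
    congr 1
    · rw [map_map_tmul, crd_one_tmul_mul, crd_map_includeRight,
        Algebra.TensorProduct.tmul_mul_tmul, map_one, one_mul, mul_one, crd_eq_ite]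
    · simp only [map_sum, Finset.sum_mul]
      refine Finset.sum_congr rfl fun i _ => Finset.sum_congr rfl fun j _ => ?_
      rw [map_map_tmul]
      by_cases hij : i ∈ 𝒟.null ∧ j ∈ 𝒟.null
      · rw [eps_tmul_mul_of_null _ hij.1, crd_map_includeRight, Algebra.TensorProduct.tmul_mul_tmul, mul_one, crd_eq_ite]
        by_cases hp : i.succ = p
        · rw [if_pos hp, crd_eq_ite]
          by_cases hq : j.succ = q <;> simp [hp, hq]
        · simp [hp]
      · rw [hr.2 l i j hij]
        simp
  rw [liftOp, productMap_sum, map_add, map_add, map_sum, map_sum]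
  simp only [AlgHom.comp_apply, h1]
  rw [crd_map_includeRight, crd_one_tmul, Finset.sum_add_distrib, ← add_assoc]
  congr 1
  refine Fin.cases ?_ (fun q => ?_) q
  · simp
  · simp only [Fin.succ_inj]
    rw [if_neg (Fin.succ_ne_zero q).symm]
    simp

theorem crd_liftIota {𝒟 : LocalOperatorSystem k}
    {r : 𝒟.Alg →ₐ[k] 𝒟.Alg ⊗[k] (𝒟.Alg ⊗[k] F)} {c : Fin 𝒟.m → Fin 𝒟.m → Fin 𝒟.m → F}
    (hr : IsHSType 𝒟 r c) (ψ : F →ₐ[k] S) (j : R →ₐ[k] S) (y : 𝒟.Alg ⊗[k] R)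
    (p q : Fin (𝒟.m + 1)) :
    𝒟.crd q (𝒟.crd p (liftIota 𝒟 𝒟 r ψ j y)) =
      (if 0 = p then j (𝒟.crd q y) else if 0 = q then j (𝒟.crd p y) else 0) +
      ∑ l : Fin 𝒟.m, (∑ i, ∑ j, if i.succ = p ∧ j.succ = q then ψ (c l j i) else 0) *
        j (𝒟.crd l.succ y) := by
  have h1 : ∀ (l : Fin 𝒟.m) (s : S),
      𝒟.crd q (𝒟.crd p ((𝒟.map (𝒟.map ψ)) (r (𝒟.eps l)) *
        ((Algebra.TensorProduct.includeRight : 𝒟.Alg ⊗[k] S →ₐ[k] 𝒟.Alg ⊗[k] (𝒟.Alg ⊗[k] S))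
          ((Algebra.TensorProduct.includeRight : S →ₐ[k] 𝒟.Alg ⊗[k] S) s)))) =
      (if l.succ = p ∧ 0 = q then s else 0) + (if 0 = p ∧ l.succ = q then s else 0) +
      (∑ i, ∑ j, if i.succ = p ∧ j.succ = q then ψ (c l j i) else 0) * s := by
    intro l s
    rw [hr l, map_add, map_add, add_mul, add_mul, map_add, map_add, map_add, map_add]
    congr 1
    · simp only [LocalOperatorSystem.map, Algebra.TensorProduct.map_tmul, map_one, AlgHom.id_apply,
        Algebra.TensorProduct.includeRight_apply, Algebra.TensorProduct.tmul_mul_tmul, one_mul,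
        mul_one, crd_eq_ite, crd_one_tmul]
      congr 1
      · split_ifs <;> simp_all [crd_one_tmul, -crd_tmul]
      · split_ifs <;> simp_all [crd_eq_ite, -crd_tmul]
    · simp only [map_sum, Finset.sum_mul]
      refine Finset.sum_congr rfl fun i _ => Finset.sum_congr rfl fun j _ => ?_
      simp only [LocalOperatorSystem.map, Algebra.TensorProduct.map_tmul, AlgHom.id_apply,
        Algebra.TensorProduct.includeRight_apply, Algebra.TensorProduct.tmul_mul_tmul, mul_one,
        crd_eq_ite]
      split_ifs <;> simp_all [crd_eq_ite, -crd_tmul]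
  rw [liftIota, productMap_sum, map_add, map_add, map_sum, map_sum]
  simp only [AlgHom.comp_apply, h1]
  rw [Finset.sum_add_distrib, ← add_assoc]
  congr 1
  simp only [Algebra.TensorProduct.includeRight_apply, crd_one_tmul]
  refine Fin.cases ?_ (fun p => ?_) p <;> refine Fin.cases ?_ (fun q => ?_) q
  · simp [crd_one_tmul, -crd_tmul]
  · simp [crd_one_tmul, -crd_tmul, (Fin.succ_ne_zero _).symm]
  · simp [(Fin.succ_ne_zero _).symm]
  · simp [(Fin.succ_ne_zero _).symm]

theorem crd_liftOp_canonical (ψ : F →ₐ[k] S) (e : R →ₐ[k] 𝒟₁.Alg ⊗[k] S) (y : 𝒟₂.Alg ⊗[k] R)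
    (p : Fin (𝒟₁.m + 1)) (q : Fin (𝒟₂.m + 1)) :
    𝒟₂.crd q (𝒟₁.crd p (liftOp 𝒟₁ 𝒟₂ (canonicalEmbedding 𝒟₁ 𝒟₂ F) ψ e y)) =
      𝒟₁.crd p (e (𝒟₂.crd q y)) := by
  have h1 : ∀ (l : Fin 𝒟₂.m) (V : 𝒟₁.Alg ⊗[k] S),
      𝒟₂.crd q (𝒟₁.crd p ((𝒟₁.map (𝒟₂.map ψ)) (canonicalEmbedding 𝒟₁ 𝒟₂ F (𝒟₂.eps l)) *
        𝒟₁.map (Algebra.TensorProduct.includeRight : S →ₐ[k] 𝒟₂.Alg ⊗[k] S) V)) =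
      (if l.succ = q then 𝒟₁.crd p V else 0) := by
    intro l V
    have : (𝒟₁.map (𝒟₂.map ψ)) (canonicalEmbedding 𝒟₁ 𝒟₂ F (𝒟₂.eps l)) =
      1 ⊗ₜ[k] (𝒟₂.eps l ⊗ₜ[k] 1) := by
      simp [canonicalEmbedding, LocalOperatorSystem.map]
    rw [this, crd_one_tmul_mul, crd_map_includeRight, Algebra.TensorProduct.tmul_mul_tmul, one_mul,
      mul_one, crd_eq_ite]
  rw [liftOp, productMap_sum, map_add, map_add, map_sum, map_sum]
  simp only [AlgHom.comp_apply, h1]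
  rw [crd_map_includeRight, crd_one_tmul]
  refine Fin.cases ?_ (fun q => ?_) q
  · simp
  · simp only [Fin.succ_inj]
    rw [if_neg (Fin.succ_ne_zero q).symm]
    simp

theorem sum_ite_succ {m : ℕ} (f : Fin m → Fin m → S) (p q : Fin m) :
    (∑ i, ∑ j, if i.succ = p.succ ∧ j.succ = q.succ then f j i else 0) = f q p := by
  simp [ite_and]

theorem sum_ite_zero_right {m : ℕ} (f : Fin m → Fin m → S) (p : Fin (m + 1)) :
    (∑ i : Fin m, ∑ j : Fin m, if i.succ = p ∧ j.succ = 0 then f j i else 0) = 0 := by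
  simp [Fin.succ_ne_zero]

/-- Multiplicativity of `r`, computed in two ways: the coordinate of `r (ε_p) * r (ε_q)` at `i ≥ 1`
vanishes because the coefficients are concentrated on null indices, while expanding `ε_p * ε_q`
first produces the sum. -/
theorem IsLieType.sum_alpha_mul_c {𝒟 : LocalOperatorSystem k}
    {r : 𝒟.Alg →ₐ[k] 𝒟.Alg ⊗[k] (𝒟.Alg ⊗[k] F)} {c : Fin 𝒟.m → Fin 𝒟.m → Fin 𝒟.m → F}
    (hr : IsLieType 𝒟 r c) (p q i j : Fin 𝒟.m) : ∑ l, 𝒟.alpha l p q • c l j i = 0 := by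
  have hcr : ∀ (l : Fin 𝒟.m) (i : Fin (𝒟.m + 1)), 𝒟.crd i (r (𝒟.eps l)) =
      (if 0 = i then 𝒟.eps l ⊗ₜ[k] 1 else 0) +
        ∑ i', if i'.succ = i then ∑ j, 𝒟.eps j ⊗ₜ[k] c l j i' else 0 := by
    intro l i
    rw [hr.1 l, map_add, crd_one_tmul, map_sum]
    congr 1
    refine Finset.sum_congr rfl fun i' _ => ?_
    rw [map_sum]
    split_ifs with h
    · simp only [crd_eq_ite, if_pos h]
    · simp only [crd_eq_ite, if_neg h, Finset.sum_const_zero]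
  have hcz : ∀ l, 𝒟.crd 0 (r (𝒟.eps l)) = 𝒟.eps l ⊗ₜ[k] 1 := by
    intro l; rw [hcr]; simp [Fin.succ_ne_zero]
  have hcs : ∀ l (i : Fin 𝒟.m), 𝒟.crd i.succ (r (𝒟.eps l)) = ∑ j, 𝒟.eps j ⊗ₜ[k] c l j i := by
    intro l i; rw [hcr, if_neg (Fin.succ_ne_zero i).symm]; simp
  have hz : ∀ l p i, (𝒟.eps p ⊗ₜ[k] (1 : F)) * ∑ j, 𝒟.eps j ⊗ₜ[k] c l j i = 0 := by
    intro l p i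
    rw [Finset.mul_sum]
    refine Finset.sum_eq_zero fun j _ => ?_
    by_cases hij : i ∈ 𝒟.null ∧ j ∈ 𝒟.null
    · rw [Algebra.TensorProduct.tmul_mul_tmul, mul_comm (𝒟.eps p), eps_mul_eps_of_null hij.2,
        TensorProduct.zero_tmul]
    · rw [hr.2 l i j hij, TensorProduct.tmul_zero, mul_zero]
  have h1 : 𝒟.crd i.succ (r (𝒟.eps p * 𝒟.eps q)) = 0 := by
    rw [map_mul, crd_mul_succ, hcz, hcz, hcs, hcs, hz, mul_comm, hz, zero_add, zero_add]
    refine Finset.sum_eq_zero fun a _ => Finset.sum_eq_zero fun b _ => ?_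
    by_cases ha : a ∈ 𝒟.null
    · rw [alpha_of_null_left ha, zero_smul]
    · rw [hcs, Finset.sum_eq_zero (f := fun j => 𝒟.eps j ⊗ₜ[k] c p j a), zero_mul, smul_zero]
      intro j _
      rw [hr.2 p a j fun h => ha h.1, TensorProduct.tmul_zero]
  have h2 : 𝒟.eps p * 𝒟.eps q = ∑ l, 𝒟.alpha l p q • 𝒟.eps l := by
    conv_lhs => rw [← 𝒟.basis.sum_repr (𝒟.eps p * 𝒟.eps q)]
    rw [Fin.sum_univ_succ]
    have : 𝒟.basis.repr (𝒟.eps p * 𝒟.eps q) 0 = 0 := 𝒟.beta_zero_succ p q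
    rw [this, zero_smul, zero_add]
    rfl
  rw [h2] at h1
  simp only [map_sum, map_smul, hcs] at h1
  have h3 := congrArg (𝒟.crd j.succ) h1
  simpa [crd_eq_ite, -crd_tmul, map_sum] using h3

/-- `δ` records the coordinates of the difference of two homomorphisms
`Φ, Ψ : R → 𝒟₁(𝒟₂(R))` which agree in the border coordinates. -/
def IsDefect (Φ Ψ : R →ₐ[k] 𝒟₁.Alg ⊗[k] (𝒟₂.Alg ⊗[k] R)) (δ : Fin 𝒟₁.m → Fin 𝒟₂.m → R → R) :
    Prop :=
  (∀ x q, 𝒟₂.crd q (𝒟₁.crd 0 (Φ x - Ψ x)) = 0) ∧ (∀ x p, 𝒟₂.crd 0 (𝒟₁.crd p (Φ x - Ψ x)) = 0) ∧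
    ∀ x p q, 𝒟₂.crd q.succ (𝒟₁.crd p.succ (Φ x - Ψ x)) = δ p q x

variable {Φ Ψ : R →ₐ[k] 𝒟₁.Alg ⊗[k] (𝒟₂.Alg ⊗[k] R)} {δ : Fin 𝒟₁.m → Fin 𝒟₂.m → R → R}

theorem IsDefect.sub_mem_iff (h : IsDefect Φ Ψ δ) (i : Fin 𝒟₁.m) (j : Fin 𝒟₂.m) (J : Ideal R)
    (x : R) : Φ x - Ψ x ∈ 𝒟₁.coordIdeal i.succ (𝒟₂.coordIdeal j.succ J) ↔
      ∀ p ≤ i, ∀ q ≤ j, δ p q x ∈ J := by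
  simp only [mem_coordIdeal]
  constructor
  · intro H p hp q hq
    rw [← h.2.2]
    exact H _ (Fin.succ_le_succ_iff.2 hp) _ (Fin.succ_le_succ_iff.2 hq)
  · intro H p hp q hq
    revert hp
    refine Fin.cases (fun _ => ?_) (fun p hp => ?_) p
    · rw [h.1]; exact J.zero_mem
    · revert hq
      refine Fin.cases (fun _ => ?_) (fun q hq => ?_) q
      · rw [h.2.1]; exact J.zero_mem
      · rw [h.2.2]
        exact H p (Fin.succ_le_succ_iff.1 hp) q (Fin.succ_le_succ_iff.1 hq)

theorem IsDefect.eq_of_forall (h : IsDefect Φ Ψ δ) {x : R} (hx : ∀ p q, δ p q x = 0) :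
    Φ x = Ψ x := by
  rw [← sub_eq_zero]
  refine 𝒟₁.crd_ext fun p => 𝒟₂.crd_ext fun q => ?_
  rw [map_zero, map_zero]
  refine Fin.cases ?_ (fun p => ?_) p
  · exact h.1 x q
  · refine Fin.cases ?_ (fun q => ?_) q
    · exact h.2.1 x _
    · rw [h.2.2, hx]

theorem IsDefect.isNilpotent_sub (h : IsDefect Φ Ψ δ) (x : R) : IsNilpotent (Φ x - Ψ x) := by
  apply isNilpotent_of_crd_zero'
  apply isNilpotent_of_crd_zero
  exact h.1 x 0

/-- The polynomial-ring version of the vanishing of a defect: it can be checked on generators. -/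
theorem IsDefect.mem_of_mem_adjoin {B : Type*} [CommRing B] [Algebra B R]
    (h : IsDefect Φ Ψ δ) (J : Ideal R) {s : Set R} (hB : ∀ b p q, δ p q (algebraMap B R b) ∈ J)
    (hs : ∀ x ∈ s, ∀ p q, δ p q x ∈ J) {x : R} (hx : x ∈ Algebra.adjoin B s) (p : Fin 𝒟₁.m)
    (q : Fin 𝒟₂.m) : δ p q x ∈ J := by
  set T := agreeSubring (Φ : R →+* _) (Ψ : R →+* _)
    (𝒟₁.coordIdeal p.succ (𝒟₂.coordIdeal q.succ J))
  have key : ∀ z, z ∈ T ↔ ∀ p' ≤ p, ∀ q' ≤ q, δ p' q' z ∈ J := fun z =>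
    mem_agreeSubring.trans (h.sub_mem_iff p q J z)
  have hT : ∀ z ∈ Algebra.adjoin B s, z ∈ T := by
    intro z hz
    induction hz using Algebra.adjoin_induction with
    | mem z hz => exact (key z).2 fun p' _ q' _ => hs z hz p' q'
    | algebraMap b => exact (key _).2 fun p' _ q' _ => hB b p' q'
    | add _ _ _ _ h1 h2 => exact T.add_mem h1 h2
    | mul _ _ _ _ h1 h2 => exact T.mul_mem h1 h2
  exact (key x).1 (hT x hx) p le_rfl q le_rfl

/-- The subfield on which a defect vanishes up to a given position. -/
def defectField {E : Type*} [Field E] [Algebra k E]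
    (Φ Ψ : E →ₐ[k] 𝒟₁.Alg ⊗[k] (𝒟₂.Alg ⊗[k] E)) (i : Fin 𝒟₁.m) (j : Fin 𝒟₂.m) : Subfield E :=
  agreeField Φ.toRingHom Ψ.toRingHom (𝒟₁.coordIdeal i.succ (𝒟₂.coordIdeal j.succ (⊥ : Ideal E)))

theorem IsDefect.mem_defectField {E : Type*} [Field E] [Algebra k E]
    {Φ Ψ : E →ₐ[k] 𝒟₁.Alg ⊗[k] (𝒟₂.Alg ⊗[k] E)} {δ : Fin 𝒟₁.m → Fin 𝒟₂.m → E → E}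
    (h : IsDefect Φ Ψ δ) {i : Fin 𝒟₁.m} {j : Fin 𝒟₂.m} {x : E} :
    x ∈ defectField Φ Ψ i j ↔ ∀ p ≤ i, ∀ q ≤ j, δ p q x = 0 := by
  exact h.sub_mem_iff i j ⊥ x

/-- The two homomorphisms differ by nilpotents, so by rigidity commutation relations pass from a
field to elements separable over it, for all positions up to `(i, j)` together. -/
theorem IsDefect.mem_defectField_of_sepOver {E : Type*} [Field E] [Algebra k E]
    {Φ Ψ : E →ₐ[k] 𝒟₁.Alg ⊗[k] (𝒟₂.Alg ⊗[k] E)} {δ : Fin 𝒟₁.m → Fin 𝒟₂.m → E → E}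
    (h : IsDefect Φ Ψ δ) {i : Fin 𝒟₁.m} {j : Fin 𝒟₂.m} {x : E}
    (hx : SepOver (defectField Φ Ψ i j) x) : x ∈ defectField Φ Ψ i j :=
  mem_agreeField_of_sepOver (h.isNilpotent_sub x) hx

end Defect

/-! ### The three commutation defects of a ring with operators -/

section DRing

variable {k F K : Type*} [Field k] [Field F] [Field K] [Algebra k F] [Algebra k K] [Algebra F K]
  [IsScalarTower k F K] {𝓓 : OpType → LocalOperatorSystem k}

open LocalOperatorSystem

/-- `(R, e)` is a ring with `𝓓`-operators extending those of `(K, eK)`. -/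
structure IsDRing (eK : ∀ u, K →ₐ[k] (𝓓 u).Alg ⊗[k] K) {R : Type*} [CommRing R] [Algebra k R]
    [Algebra K R] [IsScalarTower k K R] (e : ∀ u, R →ₐ[k] (𝓓 u).Alg ⊗[k] R) : Prop where
  crd_zero : ∀ u x, (𝓓 u).crd 0 (e u x) = x
  map_algebraMap : ∀ u c, e u (algebraMap K R c) =
    (𝓓 u).map (IsScalarTower.toAlgHom k K R) (eK u c)

/-- The operator with index `i`. -/
def dd {R : Type*} [CommRing R] [Algebra k R] (e : ∀ u, R →ₐ[k] (𝓓 u).Alg ⊗[k] R) (i : Idx 𝓓) :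
    R →ₗ[k] R := (𝓓 i.1).op (e i.1) i.2

variable {R : Type*} [CommRing R] [Algebra k R] [Algebra K R] [IsScalarTower k K R]
  {eK : ∀ u, K →ₐ[k] (𝓓 u).Alg ⊗[k] K} {e : ∀ u, R →ₐ[k] (𝓓 u).Alg ⊗[k] R}

theorem crd_succ_eq_dd (u : OpType) (i : Fin (𝓓 u).m) (x : R) :
    (𝓓 u).crd i.succ (e u x) = dd e ⟨u, i⟩ x := rfl

theorem IsDRing.dd_algebraMap (h : IsDRing eK e) (i : Idx 𝓓) (c : K) :
    dd e i (algebraMap K R c) = algebraMap K R (dd eK i c) := by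
  obtain ⟨u, i⟩ := i
  rw [← crd_succ_eq_dd, h.map_algebraMap, crd_map]; rfl

theorem IsDRing.dd_mul (h : IsDRing eK e) (u : OpType) (i : Fin (𝓓 u).m) (x y : R) :
    dd e ⟨u, i⟩ (x * y) = x * dd e ⟨u, i⟩ y + dd e ⟨u, i⟩ x * y +
      ∑ p, ∑ q, (𝓓 u).alpha i p q • (dd e ⟨u, p⟩ x * dd e ⟨u, q⟩ y) := by
  simp only [← crd_succ_eq_dd]
  rw [map_mul, crd_mul_succ, h.crd_zero, h.crd_zero]

theorem IsDRing.self (heK : ∀ u, (𝓓 u).IsOperator (AlgHom.id k K) (eK u)) : IsDRing eK eK where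
  crd_zero u := (isOperator_iff _).1 (heK u)
  map_algebraMap u c := by
    rw [Algebra.algebraMap_self_apply]
    refine (𝓓 u).crd_ext fun i => ?_
    rw [crd_map]
    rfl

variable (Γ : LHSSystem 𝓓 F) (eK e)

/-- The coefficients of a commutation system, in a `K`-algebra. -/
def cf (R : Type*) [CommRing R] [Algebra K R] (u : OpType) (l i j : Fin (𝓓 u).m) : R :=
  algebraMap K R (algebraMap F K (Γ.c u l i j))

/-- `∂_q ∂_p - ∂_p ∂_q - ∑ c_l^{qp} ∂_l`, for the operators of Lie type. -/
def defectLie (K : Type*) [Field K] [Algebra F K] [Algebra K R] (p q : Fin (𝓓 .lie).m) (x : R) : R :=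
  dd e ⟨.lie, q⟩ (dd e ⟨.lie, p⟩ x) - dd e ⟨.lie, p⟩ (dd e ⟨.lie, q⟩ x) -
    ∑ l, cf (K := K) Γ R .lie l q p * dd e ⟨.lie, l⟩ x

/-- `∂_q ∂_p - ∑ c_l^{qp} ∂_l`, for the operators of Hasse-Schmidt type. -/
def defectHS (K : Type*) [Field K] [Algebra F K] [Algebra K R] (p q : Fin (𝓓 .hs).m) (x : R) : R :=
  dd e ⟨.hs, q⟩ (dd e ⟨.hs, p⟩ x) - ∑ l, cf (K := K) Γ R .hs l q p * dd e ⟨.hs, l⟩ x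

/-- `∂_q ∂_p - ∂_p ∂_q`, for `p` of Lie type and `q` of Hasse-Schmidt type. -/
def defectMix (p : Fin (𝓓 .lie).m) (q : Fin (𝓓 .hs).m) (x : R) : R :=
  dd e ⟨.hs, q⟩ (dd e ⟨.lie, p⟩ x) - dd e ⟨.lie, p⟩ (dd e ⟨.hs, q⟩ x)

variable {e}

theorem isDefect_lie (ψ : F →ₐ[k] R) (hψ : ∀ c, ψ c = algebraMap K R (algebraMap F K c))
    (he : ∀ u x, (𝓓 u).crd 0 (e u x) = x) :
    IsDefect (((𝓓 .lie).map (e .lie)).comp (e .lie))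
      ((liftOp (𝓓 .lie) (𝓓 .lie) (Γ.r .lie) ψ (e .lie)).comp (e .lie))
      (defectLie (e := e) Γ K) := by
  refine ⟨fun x q => ?_, fun x p => ?_, fun x p q => ?_⟩
  · rw [AlgHom.comp_apply, AlgHom.comp_apply, map_sub, map_sub, crd_map, he,
      crd_liftOp_lie Γ.isLieType, he]
    simp
  · rw [AlgHom.comp_apply, AlgHom.comp_apply, map_sub, map_sub, crd_map, he,
      crd_liftOp_lie Γ.isLieType, he]
    simp
  · rw [AlgHom.comp_apply, AlgHom.comp_apply, map_sub, map_sub, crd_map,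
      crd_liftOp_lie Γ.isLieType, defectLie, sub_sub]
    congr 2
    refine Finset.sum_congr rfl fun l _ => ?_
    rw [sum_ite_succ (fun a b => ψ (Γ.c .lie l a b)), he, hψ]
    rfl

theorem isDefect_hs (ψ : F →ₐ[k] R) (hψ : ∀ c, ψ c = algebraMap K R (algebraMap F K c))
    (he : ∀ u x, (𝓓 u).crd 0 (e u x) = x) :
    IsDefect (((𝓓 .hs).map (e .hs)).comp (e .hs))
      ((liftIota (𝓓 .hs) (𝓓 .hs) (Γ.r .hs) ψ (AlgHom.id k R)).comp (e .hs))
      (defectHS (e := e) Γ K) := by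
  refine ⟨fun x q => ?_, fun x p => ?_, fun x p q => ?_⟩
  · rw [AlgHom.comp_apply, AlgHom.comp_apply, map_sub, map_sub, crd_map, he,
      crd_liftIota Γ.isHSType]
    simp
  · rw [AlgHom.comp_apply, AlgHom.comp_apply, map_sub, map_sub, crd_map, he,
      crd_liftIota Γ.isHSType, if_pos rfl]
    simp only [sum_ite_zero_right, AlgHom.id_apply, zero_mul, Finset.sum_const_zero, add_zero]
    split_ifs with h
    · rw [h, sub_self]
    · rw [sub_self]
  · rw [AlgHom.comp_apply, AlgHom.comp_apply, map_sub, map_sub, crd_map,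
      crd_liftIota Γ.isHSType, defectHS, if_neg (Fin.succ_ne_zero _).symm,
      if_neg (Fin.succ_ne_zero _).symm, zero_add]
    congr 1
    refine Finset.sum_congr rfl fun l _ => ?_
    rw [sum_ite_succ (fun a b => ψ (Γ.c .hs l a b)), hψ]
    rfl

theorem isDefect_mix (ψ : F →ₐ[k] R) (he : ∀ u x, (𝓓 u).crd 0 (e u x) = x) :
    IsDefect (((𝓓 .lie).map (e .hs)).comp (e .lie))
      ((liftOp (𝓓 .lie) (𝓓 .hs) (canonicalEmbedding (𝓓 .lie) (𝓓 .hs) F) ψ (e .lie)).comp (e .hs))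
      (defectMix e) := by
  refine ⟨fun x q => ?_, fun x p => ?_, fun x p q => ?_⟩
  · rw [AlgHom.comp_apply, AlgHom.comp_apply, map_sub, map_sub, crd_map, he,
      crd_liftOp_canonical, he, sub_self]
  · rw [AlgHom.comp_apply, AlgHom.comp_apply, map_sub, map_sub, crd_map, he,
      crd_liftOp_canonical, he, sub_self]
  · rw [AlgHom.comp_apply, AlgHom.comp_apply, map_sub, map_sub, crd_map,
      crd_liftOp_canonical, defectMix]
    rfl

theorem map_id_apply (𝒟 : LocalOperatorSystem k) (y : 𝒟.Alg ⊗[k] R) :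
    𝒟.map (AlgHom.id k R) y = y := by
  refine 𝒟.crd_ext fun i => ?_
  rw [crd_map]
  rfl

theorem commuteOn_univ_iff {𝒟₁ 𝒟₂ : LocalOperatorSystem k} {e₁ : R →ₐ[k] 𝒟₁.Alg ⊗[k] R}
    {e₂ : R →ₐ[k] 𝒟₂.Alg ⊗[k] R} {rs : 𝒟₂.Alg ⊗[k] R →ₐ[k] 𝒟₁.Alg ⊗[k] (𝒟₂.Alg ⊗[k] R)} :
    CommuteOn 𝒟₁ 𝒟₂ (AlgHom.id k R) Set.univ e₁ e₂ rs ↔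
      ∀ x, ((𝒟₁.map e₂).comp e₁) x = (rs.comp e₂) x := by
  constructor
  · intro h x
    obtain ⟨y₁, y₂, h1, h2, h3⟩ := h x trivial
    rw [map_id_apply] at h1 h2
    subst h1 h2
    exact h3
  · intro h x _
    exact ⟨e₁ x, e₂ x, map_id_apply _ _, map_id_apply _ _, h x⟩

/-- The border coordinates of both sides of each square agree automatically, so commutativity of the
diagrams amounts to operator identities. -/
theorem gammaCommuteOn_univ_iff (ψ : F →ₐ[k] R)
    (hψ : ∀ c, ψ c = algebraMap K R (algebraMap F K c))
    (he : ∀ u x, (𝓓 u).crd 0 (e u x) = x) :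
    GammaCommuteOn Γ ψ (AlgHom.id k R) Set.univ e ↔
      (∀ x p q, defectLie (e := e) Γ K p q x = 0) ∧ (∀ x p q, defectHS (e := e) Γ K p q x = 0) ∧
        ∀ x p q, defectMix e p q x = 0 := by
  have h1 := isDefect_lie (K := K) Γ ψ hψ he
  have h2 := isDefect_hs (K := K) Γ ψ hψ he
  have h3 := isDefect_mix (𝓓 := 𝓓) ψ he
  constructor
  · rintro ⟨a, b, c⟩
    rw [commuteOn_univ_iff] at a b c
    refine ⟨fun x p q => ?_, fun x p q => ?_, fun x p q => ?_⟩
    · rw [← h1.2.2, a, sub_self, map_zero, map_zero]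
    · rw [← h2.2.2, b, sub_self, map_zero, map_zero]
    · rw [← h3.2.2, c, sub_self, map_zero, map_zero]
  · rintro ⟨a, b, c⟩
    refine ⟨commuteOn_univ_iff.2 fun x => ?_, commuteOn_univ_iff.2 fun x => ?_,
      commuteOn_univ_iff.2 fun x => ?_⟩
    · exact h1.eq_of_forall (a x)
    · exact h2.eq_of_forall (b x)
    · exact h3.eq_of_forall (c x)

end DRing

/-! ### Operators on the polynomial ring in the words -/

section FreeRing

variable {k F K : Type*} [Field k] [Field F] [Field K] [Algebra k F] [Algebra k K] [Algebra F K]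
  [IsScalarTower k F K] {𝓓 : OpType → LocalOperatorSystem k}

open LocalOperatorSystem MvPolynomial

/-- The homomorphism out of a polynomial ring determined by its values on coefficients and
variables. -/
def polyHom {B σ A : Type*} [CommRing B] [Algebra k B] [CommRing A] [Algebra k A]
    (g : B →ₐ[k] A) (f : σ → A) : MvPolynomial σ B →ₐ[k] A :=
  { eval₂Hom g.toRingHom f with
    commutes' := fun c => by
      rw [IsScalarTower.algebraMap_apply k B (MvPolynomial σ B)]
      simp [MvPolynomial.algebraMap_eq] }

@[simp] theorem polyHom_C {B σ A : Type*} [CommRing B] [Algebra k B] [CommRing A] [Algebra k A]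
    (g : B →ₐ[k] A) (f : σ → A) (b : B) : polyHom g f (C b) = g b := by
  change eval₂Hom g.toRingHom f (C b) = _
  simp

@[simp] theorem polyHom_X {B σ A : Type*} [CommRing B] [Algebra k B] [CommRing A] [Algebra k A]
    (g : B →ₐ[k] A) (f : σ → A) (s : σ) : polyHom g f (X s) = f s := by
  change eval₂Hom g.toRingHom f (X s) = _
  simp

variable (K 𝓓) in
/-- The polynomial ring over `K` in variables indexed by the words in the operators. -/
abbrev WordRing : Type _ := MvPolynomial (List (Idx 𝓓)) K

variable (eK : ∀ u, K →ₐ[k] (𝓓 u).Alg ⊗[k] K)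

/-- The operators on the word ring with prescribed values on the variables. -/
def wordOp (D : Idx 𝓓 → List (Idx 𝓓) → WordRing K 𝓓) (u : OpType) :
    WordRing K 𝓓 →ₐ[k] (𝓓 u).Alg ⊗[k] WordRing K 𝓓 :=
  polyHom (((𝓓 u).map (IsScalarTower.toAlgHom k K (WordRing K 𝓓))).comp (eK u))
    fun ξ => 1 ⊗ₜ[k] X ξ + ∑ i : Fin (𝓓 u).m, (𝓓 u).eps i ⊗ₜ[k] D ⟨u, i⟩ ξ

theorem crd_zero_std {R : Type*} [CommRing R] [Algebra k R] (𝒟 : LocalOperatorSystem k) (x : R)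
    (y : Fin 𝒟.m → R) : 𝒟.crd 0 (1 ⊗ₜ[k] x + ∑ i, 𝒟.eps i ⊗ₜ[k] y i) = x := by
  rw [map_add, map_sum, crd_one_tmul_zero]
  simp [crd_eps_tmul_zero, -crd_tmul]

theorem crd_succ_std {R : Type*} [CommRing R] [Algebra k R] (𝒟 : LocalOperatorSystem k) (x : R)
    (y : Fin 𝒟.m → R) (j : Fin 𝒟.m) :
    𝒟.crd j.succ (1 ⊗ₜ[k] x + ∑ i, 𝒟.eps i ⊗ₜ[k] y i) = y j := by
  rw [map_add, map_sum, crd_one_tmul_succ]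
  simp [crd_eps_tmul_succ, -crd_tmul]

variable {eK}

theorem dd_wordOp_X (D : Idx 𝓓 → List (Idx 𝓓) → WordRing K 𝓓) (i : Idx 𝓓) (ξ : List (Idx 𝓓)) :
    dd (wordOp eK D) i (X ξ) = D i ξ := by
  obtain ⟨u, i⟩ := i
  rw [← crd_succ_eq_dd, wordOp, polyHom_X, crd_succ_std]

theorem isDRing_wordOp (heK : ∀ u, (𝓓 u).IsOperator (AlgHom.id k K) (eK u))
    (D : Idx 𝓓 → List (Idx 𝓓) → WordRing K 𝓓) : IsDRing eK (wordOp eK D) where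
  crd_zero u x := by
    have : ((𝓓 u).residueOn (WordRing K 𝓓)).toRingHom.comp (wordOp eK D u).toRingHom =
        RingHom.id _ := by
      apply MvPolynomial.ringHom_ext
      · intro c
        change (𝓓 u).residueOn _ (wordOp eK D u (C c)) = C c
        rw [residueOn_eq_crd, wordOp, polyHom_C, AlgHom.comp_apply, crd_map,
          (isOperator_iff _).1 (heK u)]
        rfl
      · intro ξ
        change (𝓓 u).residueOn _ (wordOp eK D u (X ξ)) = X ξ
        rw [residueOn_eq_crd, wordOp, polyHom_X, crd_zero_std]
    have := RingHom.congr_fun this x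
    change (𝓓 u).residueOn _ (wordOp eK D u x) = x at this
    rwa [residueOn_eq_crd] at this
  map_algebraMap u c := by
    rw [MvPolynomial.algebraMap_eq, wordOp, polyHom_C]; rfl

/-- Two homomorphisms from a polynomial ring into `𝒟(R)` whose coordinates up to the `i`-th agree
on coefficients and on some of the variables do so on the polynomials in these variables. -/
theorem crd_eq_of_mem_supported {σ R : Type*} [CommRing R] [Algebra k R] {𝒟 : LocalOperatorSystem k}
    {φ ψ : MvPolynomial σ K →ₐ[k] 𝒟.Alg ⊗[k] R} {i : Fin (𝒟.m + 1)} {s : Set σ}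
    (hC : ∀ c, φ (C c) = ψ (C c)) (hX : ∀ x ∈ s, ∀ p ≤ i, 𝒟.crd p (φ (X x)) = 𝒟.crd p (ψ (X x)))
    {f : MvPolynomial σ K} (hf : f ∈ supported K s) : 𝒟.crd i (φ f) = 𝒟.crd i (ψ f) := by
  set T := agreeSubring φ.toRingHom ψ.toRingHom (𝒟.coordIdeal i (⊥ : Ideal R))
  have key : ∀ z, z ∈ T ↔ ∀ p ≤ i, 𝒟.crd p (φ z) = 𝒟.crd p (ψ z) := fun z => by
    refine mem_agreeSubring.trans ?_
    rw [mem_coordIdeal]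
    refine forall₂_congr fun p _ => ?_
    rw [Ideal.mem_bot, map_sub, sub_eq_zero]
    rfl
  have hT : ∀ z ∈ Algebra.adjoin K (X '' s : Set (MvPolynomial σ K)), z ∈ T := by
    intro z hz
    induction hz using Algebra.adjoin_induction with
    | mem z hz => 
      obtain ⟨x, hx, rfl⟩ := hz
      exact (key _).2 (hX x hx)
    | algebraMap b => exact (key _).2 fun p _ => by rw [MvPolynomial.algebraMap_eq, hC]
    | add _ _ _ _ h1 h2 => exact T.add_mem h1 h2
    | mul _ _ _ _ h1 h2 => exact T.mul_mem h1 h2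
  exact (key f).1 (hT f hf) i le_rfl

theorem dd_wordOp_congr {D D' : Idx 𝓓 → List (Idx 𝓓) → WordRing K 𝓓} {u : OpType}
    {s : Set (List (Idx 𝓓))} (h : ∀ i, ∀ ξ ∈ s, D ⟨u, i⟩ ξ = D' ⟨u, i⟩ ξ) (i : Fin (𝓓 u).m)
    {f : WordRing K 𝓓} (hf : f ∈ supported K s) :
    dd (wordOp eK D) ⟨u, i⟩ f = dd (wordOp eK D') ⟨u, i⟩ f := by
  refine crd_eq_of_mem_supported (φ := wordOp eK D u) (ψ := wordOp eK D' u) (s := s) ?_ ?_ hf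
  · intro c; simp only [wordOp, polyHom_C]
  · intro ξ hξ p _
    simp only [wordOp, polyHom_X, h _ ξ hξ]

theorem dd_mem_supported {e : ∀ u, WordRing K 𝓓 →ₐ[k] (𝓓 u).Alg ⊗[k] WordRing K 𝓓}
    (he : IsDRing eK e) {u : OpType} {s s' : Set (List (Idx 𝓓))} (hss : s ⊆ s')
    {i : Fin (𝓓 u).m} (h : ∀ j ≤ i, ∀ ξ ∈ s, dd e ⟨u, j⟩ (X ξ) ∈ supported K s')
    {f : WordRing K 𝓓} (hf : f ∈ supported K s) : dd e ⟨u, i⟩ f ∈ supported K s' := by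
  have hT : ∀ z ∈ Algebra.adjoin K (X '' s : Set (WordRing K 𝓓)),
      e u z ∈ (𝓓 u).coordSubring i.succ ((supported K s').restrictScalars k) := by
    intro z hz
    induction hz using Algebra.adjoin_induction with
    | mem z hz => 
      obtain ⟨x, hx, rfl⟩ := hz
      intro p hp
      revert hp
      refine Fin.cases (fun _ => ?_) (fun p hp => ?_) p
      · rw [he.crd_zero]
        exact X_mem_supported.2 (hss hx)
      · exact h p (Fin.succ_le_succ_iff.1 hp) x hx
    | algebraMap b => 
      intro p _
      rw [he.map_algebraMap, crd_map]
      exact (supported K s').algebraMap_mem _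
    | add _ _ _ _ h1 h2 => rw [map_add]; exact Subring.add_mem _ h1 h2
    | mul _ _ _ _ h1 h2 => rw [map_mul]; exact Subring.mul_mem _ h1 h2
  exact hT f hf i.succ le_rfl

end FreeRing

/-! ### Normal forms of words -/

section WordOperators

variable {k F K : Type*} [Field k] [Field F] [Field K] [Algebra k F] [Algebra k K] [Algebra F K]
  [IsScalarTower k F K] {𝓓 : OpType → LocalOperatorSystem k}

open LocalOperatorSystem MvPolynomial

variable (Γ : LHSSystem 𝓓 F) (eK : ∀ u, K →ₐ[k] (𝓓 u).Alg ⊗[k] K)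

theorem algHom_mem_of_mem_supported {σ A : Type*} [CommRing A] [Algebra K A]
    (φ : MvPolynomial σ K →ₐ[K] A) {s : Set σ} {W : Subalgebra K A} (h : ∀ ξ ∈ s, φ (X ξ) ∈ W)
    {f : MvPolynomial σ K} (hf : f ∈ supported K s) : φ f ∈ W := by
  have : supported K s ≤ W.comap φ := by
    refine Algebra.adjoin_le ?_
    rintro _ ⟨ξ, hξ, rfl⟩
    exact h ξ hξ
  exact this hf

variable (K) in
/-- The normal form of `∂_h a^ξ` for `h` of Hasse-Schmidt type. -/
def hsWord (h : Fin (𝓓 .hs).m) : List (Idx 𝓓) → WordRing K 𝓓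
  | [] => X [⟨.hs, h⟩]
  | ⟨.hs, h'⟩ :: _ => ∑ l, cf (K := K) Γ (WordRing K 𝓓) .hs l h h' * X [⟨.hs, l⟩]
  | ⟨.lie, j⟩ :: ξ => rename (List.cons ⟨.lie, j⟩) (hsWord h ξ)

/-- The normal forms of the words `i ξ`, given the lower order terms for `i` of Lie type. -/
def wordDOf (ρ : List (Idx 𝓓) × Fin (𝓓 .lie).m → WordRing K 𝓓) :
    Idx 𝓓 → List (Idx 𝓓) → WordRing K 𝓓
  | ⟨.lie, i⟩, ξ => X (ins ⟨.lie, i⟩ ξ) + ρ (ξ, i)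
  | ⟨.hs, h⟩, ξ => hsWord K Γ h ξ

open Classical in
/-- One step of the recursion for the lower order terms of normal forms. -/
def lieRemStep (ρ : List (Idx 𝓓) × Fin (𝓓 .lie).m → WordRing K 𝓓) :
    List (Idx 𝓓) × Fin (𝓓 .lie).m → WordRing K 𝓓
  | ([], _) => 0
  | (⟨.hs, _⟩ :: _, _) => 0
  | (⟨.lie, j⟩ :: ξ, i) =>
    -- For `j ≤ i` the word `i j ξ` needs no rearrangement. Otherwise the rule is `∂_i ∂_j = ∂_j ∂_i
    -- + ∑ c_l^{ij} ∂_l`. The test on the support ensures that only remainders of words of length at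
    -- most `|ξ|` enter, which makes the recursion well-founded; it is always passed for the
    -- remainders of normal words.
    if j ≤ i then 0 else
      dd (wordOp eK (wordDOf Γ ρ)) ⟨.lie, j⟩
        (if ρ (ξ, i) ∈ supported K {η : List (Idx 𝓓) | η.length ≤ ξ.length} then ρ (ξ, i) else 0) +
      ∑ l, cf (K := K) Γ (WordRing K 𝓓) .lie l i j * wordDOf Γ ρ ⟨.lie, l⟩ ξ

theorem exists_lieRem : ∃ ρ : List (Idx 𝓓) × Fin (𝓓 .lie).m → WordRing K 𝓓,
    ∀ x, ρ x = lieRemStep Γ eK ρ x := by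
  refine exists_fixedPoint_of_causal
    (r := InvImage (· < ·) fun x : List (Idx 𝓓) × Fin (𝓓 .lie).m => x.1.length)
    (InvImage.wf _ wellFounded_lt) (lieRemStep Γ eK) ?_
  rintro a b ⟨ξ, i⟩ h
  rcases ξ with _ | ⟨⟨_ | _, j⟩, ξ⟩
  · rfl
  · simp only [lieRemStep]
    have hD : ∀ (l : Fin (𝓓 .lie).m) (η : List (Idx 𝓓)), η.length ≤ ξ.length →
        wordDOf Γ a ⟨.lie, l⟩ η = wordDOf Γ b ⟨.lie, l⟩ η := by
      intro l η hη
      simp only [wordDOf]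
      rw [h (η, l) (by simp [InvImage]; omega)]
    rw [h (ξ, i) (by simp [InvImage])]
    split_ifs with h1 h2
    · rfl
    · rw [dd_wordOp_congr (D' := wordDOf Γ b) (fun l η hη => hD l η hη) j h2]
      simp only [hD _ ξ le_rfl]
    · simp only [hD _ ξ le_rfl, map_zero]
  · rfl

/-- The lower order terms of the normal forms of words. -/
def lieRem : List (Idx 𝓓) × Fin (𝓓 .lie).m → WordRing K 𝓓 := (exists_lieRem Γ eK).choose

theorem lieRem_eq (x : List (Idx 𝓓) × Fin (𝓓 .lie).m) :
    lieRem Γ eK x = lieRemStep Γ eK (lieRem Γ eK) x := (exists_lieRem Γ eK).choose_spec x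

/-- The normal form of the word `i ξ`, for `ξ` normal. -/
def wordD : Idx 𝓓 → List (Idx 𝓓) → WordRing K 𝓓 := wordDOf Γ (lieRem Γ eK)

/-- The operators on the word ring. -/
def wordE (u : OpType) : WordRing K 𝓓 →ₐ[k] (𝓓 u).Alg ⊗[k] WordRing K 𝓓 :=
  wordOp eK (wordD Γ eK) u

theorem dd_wordE_X (i : Idx 𝓓) (ξ : List (Idx 𝓓)) :
    dd (wordE Γ eK) i (X ξ) = wordD Γ eK i ξ := dd_wordOp_X _ _ _

theorem wordD_lie (i : Fin (𝓓 .lie).m) (ξ : List (Idx 𝓓)) :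
    wordD Γ eK ⟨.lie, i⟩ ξ = X (ins ⟨.lie, i⟩ ξ) + lieRem Γ eK (ξ, i) := rfl

theorem hsWord_of_isLie (h : Fin (𝓓 .hs).m) {ξ : List (Idx 𝓓)} (hl : IsLie ξ) :
    hsWord K Γ h ξ = X (ξ ++ [⟨.hs, h⟩]) := by
  induction ξ with
  | nil => rfl
  | cons j ξ ih =>
    obtain ⟨u, j⟩ := j
    obtain rfl : u = .lie := hl _ (List.mem_cons_self)
    rw [hsWord, ih fun i hi => hl i (List.mem_cons_of_mem _ hi), rename_X]
    rfl

theorem cf_word (u : OpType) (l i j : Fin (𝓓 u).m) :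
    cf (K := K) Γ (WordRing K 𝓓) u l i j = C (cf (K := K) Γ K u l i j) := rfl

theorem hsWord_append (h h' : Fin (𝓓 .hs).m) {ξ : List (Idx 𝓓)} (hl : IsLie ξ) :
    hsWord K Γ h (ξ ++ [⟨.hs, h'⟩]) =
      ∑ l, C (cf (K := K) Γ K .hs l h h') * X (ξ ++ [⟨.hs, l⟩]) := by
  induction ξ with
  | nil => rfl
  | cons j ξ ih =>
    obtain ⟨u, j⟩ := j
    obtain rfl : u = .lie := hl _ (List.mem_cons_self)
    rw [List.cons_append, hsWord, ih fun i hi => hl i (List.mem_cons_of_mem _ hi), map_sum]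
    simp only [map_mul, rename_C, rename_X]
    rfl

theorem wordD_hs_of_isLie (h : Fin (𝓓 .hs).m) {ξ : List (Idx 𝓓)} (hl : IsLie ξ) :
    wordD Γ eK ⟨.hs, h⟩ ξ = X (ξ ++ [⟨.hs, h⟩]) := hsWord_of_isLie Γ h hl

theorem wordD_hs_append (h h' : Fin (𝓓 .hs).m) {ξ : List (Idx 𝓓)} (hl : IsLie ξ) :
    wordD Γ eK ⟨.hs, h⟩ (ξ ++ [⟨.hs, h'⟩]) =
      ∑ l, C (cf (K := K) Γ K .hs l h h') * X (ξ ++ [⟨.hs, l⟩]) := hsWord_append Γ h h' hl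

theorem lieRem_nil (i : Fin (𝓓 .lie).m) : lieRem Γ eK ([], i) = 0 := lieRem_eq Γ eK _

theorem lieRem_hs (h : Fin (𝓓 .hs).m) (ξ : List (Idx 𝓓)) (i : Fin (𝓓 .lie).m) :
    lieRem Γ eK (⟨.hs, h⟩ :: ξ, i) = 0 := lieRem_eq Γ eK _

theorem lieRem_of_le {j : Fin (𝓓 .lie).m} (ξ : List (Idx 𝓓)) {i : Fin (𝓓 .lie).m} (h : j ≤ i) :
    lieRem Γ eK (⟨.lie, j⟩ :: ξ, i) = 0 := by
  rw [lieRem_eq]; simp [lieRemStep, h]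

theorem lieRem_of_lt {j : Fin (𝓓 .lie).m} {ξ : List (Idx 𝓓)} {i : Fin (𝓓 .lie).m} (h : i < j)
    (hs : lieRem Γ eK (ξ, i) ∈ supported K {η : List (Idx 𝓓) | η.length ≤ ξ.length}) :
    lieRem Γ eK (⟨.lie, j⟩ :: ξ, i) = dd (wordE Γ eK) ⟨.lie, j⟩ (lieRem Γ eK (ξ, i)) +
      ∑ l, C (cf (K := K) Γ K .lie l i j) * wordD Γ eK ⟨.lie, l⟩ ξ := by
  rw [lieRem_eq]
  simp only [lieRemStep, if_neg (not_le.2 h), if_pos hs]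
  rfl

theorem wordD_of_isNormal_cons {i : Idx 𝓓} {ξ : List (Idx 𝓓)} (h : IsNormal (i :: ξ)) :
    wordD Γ eK i ξ = X (i :: ξ) := by
  obtain ⟨_ | _, i⟩ := i
  · rw [wordD_lie]
    rcases ξ with _ | ⟨⟨_ | _, j⟩, ξ⟩
    · rw [lieRem_nil, add_zero]; rfl
    · have := (List.pairwise_cons.1 h.1).1 _ (List.mem_cons_self)
      rw [lieRem_of_le _ _ _ (Idx.rank_le_rank.1 this), add_zero, ins_cons, if_pos this]
    · rw [lieRem_hs, add_zero, ins_cons, if_pos (Idx.rank_hs_lt_lie _ _).le]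
  · rcases h.isLie_or with h' | ⟨lam, h', hl, -, h1⟩
    · exact absurd (h' _ (List.mem_cons_self)) (by simp)
    · rcases lam with _ | ⟨j, lam⟩
      · simp at h1
        obtain ⟨rfl, rfl⟩ := h1
        rfl
      · rw [List.cons_append, List.cons.injEq] at h1
        have := hl _ (List.mem_cons_self)
        rw [← h1.1] at this
        exact absurd this (by simp)

/-! ### Linearity of normal forms and the mixed relation over the base field -/

section Field

variable {Γ eK}

/-- The commutation relations satisfied by the base field, with its coefficients. -/
structure BaseRelations (Γ : LHSSystem 𝓓 F) (eK : ∀ u, K →ₐ[k] (𝓓 u).Alg ⊗[k] K) : Prop where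
  isDRing : IsDRing eK eK
  lie : ∀ x p q, defectLie (e := eK) Γ K p q x = 0
  hs : ∀ x p q, defectHS (e := eK) Γ K p q x = 0
  mix : ∀ x p q, defectMix eK p q x = 0

variable (hB : BaseRelations Γ eK)
include hB

theorem BaseRelations.isDRing_word : IsDRing eK (wordE Γ eK) :=
  isDRing_wordOp (fun u => (isOperator_iff _).2 (hB.isDRing.crd_zero u)) _

theorem dd_wordE_C (i : Idx 𝓓) (c : K) : dd (wordE Γ eK) i (C c) = C (dd eK i c) :=
  hB.isDRing_word.dd_algebraMap i c

theorem dd_wordE_C_mul (u : OpType) (i : Fin (𝓓 u).m) (c : K) (f : WordRing K 𝓓) :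
    dd (wordE Γ eK) ⟨u, i⟩ (C c * f) = C c * dd (wordE Γ eK) ⟨u, i⟩ f + C (dd eK ⟨u, i⟩ c) * f +
      ∑ p, ∑ q, (𝓓 u).alpha i p q • (C (dd eK ⟨u, p⟩ c) * dd (wordE Γ eK) ⟨u, q⟩ f) := by
  rw [hB.isDRing_word.dd_mul]
  simp only [dd_wordE_C hB]

theorem dd_wordE_C_mul_of_const {u : OpType} (i : Fin (𝓓 u).m) {c : K}
    (hc : ∀ p, dd eK ⟨u, p⟩ c = 0) (f : WordRing K 𝓓) :
    dd (wordE Γ eK) ⟨u, i⟩ (C c * f) = C c * dd (wordE Γ eK) ⟨u, i⟩ f := by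
  rw [dd_wordE_C_mul hB]
  simp [hc]

omit hB in
/-- Linear forms in the variables of normal words of Lie type of length at most `N`, with
coefficients that are constants for the operators of Hasse-Schmidt type. -/
def lieLin (eK : ∀ u, K →ₐ[k] (𝓓 u).Alg ⊗[k] K) (N : ℕ) : AddSubgroup (WordRing K 𝓓) :=
  AddSubgroup.closure {f | ∃ (b : K) (μ : List (Idx 𝓓)), (∀ h, dd eK ⟨.hs, h⟩ b = 0) ∧ IsLie μ ∧
    IsNormal μ ∧ μ.length ≤ N ∧ f = C b * X μ}

omit hB in
theorem lieLin_mono {N N' : ℕ} (h : N ≤ N') : lieLin eK N ≤ lieLin eK N' := by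
  refine AddSubgroup.closure_mono ?_
  rintro f ⟨b, μ, h1, h2, h3, h4, rfl⟩
  exact ⟨b, μ, h1, h2, h3, h4.trans h, rfl⟩

theorem C_mul_mem_lieLin {N : ℕ} {b : K} (hb : ∀ h, dd eK ⟨.hs, h⟩ b = 0) {f : WordRing K 𝓓}
    (hf : f ∈ lieLin eK N) : C b * f ∈ lieLin eK N := by
  induction hf using AddSubgroup.closure_induction with
  | mem f hf =>
    obtain ⟨c, μ, h1, h2, h3, h4, rfl⟩ := hf
    refine AddSubgroup.subset_closure ⟨b * c, μ, fun h => ?_, h2, h3, h4, ?_⟩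
    · rw [hB.isDRing.dd_mul]
      simp [hb, h1]
    · rw [C_mul, mul_assoc]
  | zero => rw [mul_zero]; exact zero_mem _
  | add _ _ _ _ h1 h2 => rw [mul_add]; exact add_mem h1 h2
  | neg _ _ h1 => rw [mul_neg]; exact neg_mem h1

omit hB in
theorem smul_mem_lieLin {N : ℕ} (a : k) {f : WordRing K 𝓓}
    (hf : f ∈ lieLin eK N) : a • f ∈ lieLin eK N := by
  induction hf using AddSubgroup.closure_induction with
  | mem f hf =>
    obtain ⟨c, μ, h1, h2, h3, h4, rfl⟩ := hf
    refine AddSubgroup.subset_closure ⟨a • c, μ, fun h => ?_, h2, h3, h4, ?_⟩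
    · rw [map_smul, h1, smul_zero]
    · rw [← smul_mul_assoc]
      congr 1
      rw [Algebra.smul_def, Algebra.smul_def, C_mul,
        IsScalarTower.algebraMap_apply k K (WordRing K 𝓓), MvPolynomial.algebraMap_eq]
  | zero => rw [smul_zero]; exact zero_mem _
  | add _ _ _ _ h1 h2 => rw [smul_add]; exact add_mem h1 h2
  | neg _ _ h1 => rw [smul_neg]; exact neg_mem h1

omit hB in
theorem X_mem_lieLin {N : ℕ} {μ : List (Idx 𝓓)} (hl : IsLie μ) (hn : IsNormal μ)
    (h : μ.length ≤ N) : X μ ∈ lieLin eK N :=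
  AddSubgroup.subset_closure ⟨1, μ, fun h => by
    have : (1 : K) = algebraMap k K 1 := (map_one _).symm
    change (𝓓 .hs).crd _ (eK .hs 1) = 0
    rw [map_one, Algebra.TensorProduct.one_def, crd_one_tmul_succ], hl, hn, h, by
    rw [C_1, one_mul]⟩

omit hB in
theorem lieLin_le_supported {N : ℕ} {f : WordRing K 𝓓} (hf : f ∈ lieLin eK N) :
    f ∈ supported K {η : List (Idx 𝓓) | IsLie η ∧ IsNormal η ∧ η.length ≤ N} := by
  induction hf using AddSubgroup.closure_induction with
  | mem f hf =>
    obtain ⟨c, μ, h1, h2, h3, h4, rfl⟩ := hf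
    exact mul_mem (Subalgebra.algebraMap_mem _ c) (X_mem_supported.2 ⟨h2, h3, h4⟩)
  | zero => exact zero_mem _
  | add _ _ _ _ h1 h2 => exact add_mem h1 h2
  | neg _ _ h1 => exact neg_mem h1

theorem dd_lie_const {b : K} (hb : ∀ h, dd eK ⟨.hs, h⟩ b = 0) (j : Fin (𝓓 .lie).m) :
    ∀ h, dd eK ⟨.hs, h⟩ (dd eK ⟨.lie, j⟩ b) = 0 := by
  intro h
  have := hB.mix b j h
  rw [defectMix, hb, map_zero, sub_zero] at this
  exact this

omit hB in
theorem isLie_ins {i : Fin (𝓓 .lie).m} {μ : List (Idx 𝓓)} (h : IsLie μ) :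
    IsLie (ins ⟨.lie, i⟩ μ) := by
  intro a ha
  rcases List.mem_cons.1 ((perm_ins _ _).mem_iff.1 ha) with rfl | ha
  · rfl
  · exact h a ha

/-- The shape of the remainders is a hypothesis here, because the statement is needed inside the
induction that establishes it. -/
theorem dd_mem_lieLin_of {N : ℕ}
    (hN : ∀ μ : List (Idx 𝓓), IsLie μ → IsNormal μ → μ.length ≤ N → ∀ i,
      lieRem Γ eK (μ, i) ∈ lieLin eK μ.length) {f : WordRing K 𝓓} (hf : f ∈ lieLin eK N)
    (j : Fin (𝓓 .lie).m) : dd (wordE Γ eK) ⟨.lie, j⟩ f ∈ lieLin eK (N + 1) := by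
  induction hf using AddSubgroup.closure_induction with
  | mem f hf =>
    obtain ⟨c, μ, h1, h2, h3, h4, rfl⟩ := hf
    have hD : ∀ q, dd (wordE Γ eK) ⟨.lie, q⟩ (X μ) ∈ lieLin eK (N + 1) := by
      intro q
      rw [dd_wordE_X, wordD_lie]
      exact add_mem (X_mem_lieLin (isLie_ins h2) (isNormal_ins_lie h3) (by simpa using h4))
        (lieLin_mono (h4.trans (Nat.le_succ N)) (hN μ h2 h3 h4 q))
    rw [dd_wordE_C_mul hB]
    refine add_mem (add_mem (C_mul_mem_lieLin hB h1 (hD j)) (C_mul_mem_lieLin hB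
      (dd_lie_const hB h1 j) (X_mem_lieLin h2 h3 (h4.trans (Nat.le_succ N)))))
      (sum_mem fun p _ => sum_mem fun q _ => smul_mem_lieLin _
        (C_mul_mem_lieLin hB (dd_lie_const hB h1 p) (hD q)))
  | zero => rw [map_zero]; exact zero_mem _
  | add _ _ _ _ h1 h2 => rw [map_add]; exact add_mem h1 h2
  | neg _ _ h1 => rw [map_neg]; exact neg_mem h1

omit hB in
theorem IsLie.tail {i : Idx 𝓓} {ξ : List (Idx 𝓓)} (h : IsLie (i :: ξ)) : IsLie ξ :=
  fun a ha => h a (List.mem_cons_of_mem _ ha)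

variable (hc : ∀ l i j h, dd eK ⟨.hs, h⟩ (cf (K := K) Γ K .lie l i j) = 0)
include hc

/-- The recursion creates coefficients only from the Lie-coefficients and their Lie derivatives.
These are constants for the Hasse-Schmidt operators, by `hc` and because the two kinds of operators
commute on the base field. -/
theorem lieRem_mem_lieLin {ξ : List (Idx 𝓓)} (hl : IsLie ξ) (hn : IsNormal ξ)
    (i : Fin (𝓓 .lie).m) : lieRem Γ eK (ξ, i) ∈ lieLin eK ξ.length := by
  induction hN : ξ.length using Nat.strong_induction_on generalizing ξ i with
  | _ N ih =>
  subst hN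
  rcases ξ with _ | ⟨⟨_ | _, j⟩, ξ⟩
  · rw [lieRem_nil]; exact zero_mem _
  · rcases le_or_gt j i with hji | hji
    · rw [lieRem_of_le _ _ _ hji]; exact zero_mem _
    · have h1 : ∀ i, lieRem Γ eK (ξ, i) ∈ lieLin eK ξ.length := fun i =>
        ih _ (by simp) hl.tail hn.tail i rfl
      rw [lieRem_of_lt _ _ hji (supported_mono (fun η hη => hη.2.2) (lieLin_le_supported (h1 i)))]
      refine add_mem (dd_mem_lieLin_of hB (fun μ h2 h3 h4 i' => ih _ (by simp; omega) h2 h3 i' rfl)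
        (h1 i) j) (sum_mem fun l _ => C_mul_mem_lieLin hB (hc l i j) ?_)
      rw [wordD_lie]
      exact add_mem (X_mem_lieLin (isLie_ins hl.tail) (isNormal_ins_lie hn.tail) (by simp))
        (lieLin_mono (by simp) (h1 l))
  · exact absurd (hl _ (List.mem_cons_self)) (by simp)

theorem dd_mem_lieLin {N : ℕ} {f : WordRing K 𝓓} (hf : f ∈ lieLin eK N)
    (j : Fin (𝓓 .lie).m) : dd (wordE Γ eK) ⟨.lie, j⟩ f ∈ lieLin eK (N + 1) :=
  dd_mem_lieLin_of hB (fun _ h1 h2 _ i => lieRem_mem_lieLin hB hc h1 h2 i) hf j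

omit hc in
variable (K) in
/-- Appending a letter of Hasse-Schmidt type to all words. -/
def appHS (h : Fin (𝓓 .hs).m) : WordRing K 𝓓 →ₐ[K] WordRing K 𝓓 :=
  rename fun ξ => ξ ++ [⟨.hs, h⟩]

omit hB hc in
theorem appHS_X (h : Fin (𝓓 .hs).m) (ξ : List (Idx 𝓓)) :
    appHS K h (X ξ) = X (ξ ++ [⟨.hs, h⟩]) := rename_X _ _

omit hB hc in
theorem appHS_C (h : Fin (𝓓 .hs).m) (c : K) : appHS (𝓓 := 𝓓) K h (C c) = C c := rename_C _ _

omit hB hc in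
theorem ins_lie_append (i : Fin (𝓓 .lie).m) (ξ : List (Idx 𝓓)) (h : Fin (𝓓 .hs).m) :
    ins ⟨.lie, i⟩ (ξ ++ [⟨.hs, h⟩]) = ins ⟨.lie, i⟩ ξ ++ [⟨.hs, h⟩] := by
  induction ξ with
  | nil => rw [List.nil_append, ins_cons, if_pos (Idx.rank_hs_lt_lie _ _).le]; rfl
  | cons j ξ ih =>
    rw [List.cons_append, ins_cons, ins_cons, ih]
    split_ifs <;> rfl

omit hc in
theorem dd_lie_appHS_of {N : ℕ} (h : Fin (𝓓 .hs).m)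
    (hN : ∀ μ : List (Idx 𝓓), IsLie μ → IsNormal μ → μ.length ≤ N → ∀ i,
      lieRem Γ eK (μ ++ [⟨.hs, h⟩], i) = appHS K h (lieRem Γ eK (μ, i)))
    {f : WordRing K 𝓓} (hf : f ∈ lieLin eK N) (j : Fin (𝓓 .lie).m) :
    dd (wordE Γ eK) ⟨.lie, j⟩ (appHS K h f) = appHS K h (dd (wordE Γ eK) ⟨.lie, j⟩ f) := by
  induction hf using AddSubgroup.closure_induction with
  | mem f hf =>
    obtain ⟨c, μ, h1, h2, h3, h4, rfl⟩ := hf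
    have hD : ∀ q, dd (wordE Γ eK) ⟨.lie, q⟩ (X (μ ++ [⟨.hs, h⟩])) =
        appHS K h (dd (wordE Γ eK) ⟨.lie, q⟩ (X μ)) := by
      intro q
      rw [dd_wordE_X, dd_wordE_X, wordD_lie, wordD_lie, hN μ h2 h3 h4, ins_lie_append, map_add]
      rw [appHS_X]
    have hsm : ∀ (a : k) (f : WordRing K 𝓓), appHS K h (a • f) = a • appHS K h f := fun a f =>
      map_smul ((appHS K h).restrictScalars k) a f
    rw [map_mul, appHS_X, appHS_C, dd_wordE_C_mul hB, dd_wordE_C_mul hB]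
    simp only [map_add, map_mul, map_sum, appHS_C, appHS_X, hD, hsm]
  | zero => simp
  | add _ _ _ _ h1 h2 => simp only [map_add, h1, h2]
  | neg _ _ h1 => simp only [map_neg, h1]

/-- Rearranging Lie letters never touches a final Hasse-Schmidt letter: both sides obey the same
recursion. -/
theorem lieRem_append {ξ : List (Idx 𝓓)} (hl : IsLie ξ) (hn : IsNormal ξ)
    (i : Fin (𝓓 .lie).m) (h : Fin (𝓓 .hs).m) :
    lieRem Γ eK (ξ ++ [⟨.hs, h⟩], i) = appHS K h (lieRem Γ eK (ξ, i)) := by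
  induction hN : ξ.length using Nat.strong_induction_on generalizing ξ i with
  | _ N ih =>
  subst hN
  rcases ξ with _ | ⟨⟨_ | _, j⟩, ξ⟩
  · rw [List.nil_append, lieRem_hs, lieRem_nil, map_zero]
  · rw [List.cons_append]
    rcases le_or_gt j i with hji | hji
    · rw [lieRem_of_le _ _ _ hji, lieRem_of_le _ _ _ hji, map_zero]
    · have h1 : ∀ i, lieRem Γ eK (ξ ++ [⟨.hs, h⟩], i) = appHS K h (lieRem Γ eK (ξ, i)) := fun i =>
        ih _ (by simp) hl.tail hn.tail i rfl
      have h2 : ∀ i, lieRem Γ eK (ξ, i) ∈ supported K {η : List (Idx 𝓓) | η.length ≤ ξ.length} :=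
        fun i => supported_mono (fun η hη => hη.2.2)
          (lieLin_le_supported (lieRem_mem_lieLin hB hc hl.tail hn.tail i))
      have h3 : lieRem Γ eK (ξ ++ [⟨.hs, h⟩], i) ∈
          supported K {η : List (Idx 𝓓) | η.length ≤ ξ.length + 1} := by
        rw [h1]
        refine algHom_mem_of_mem_supported (appHS K h) (fun η hη => ?_) (h2 i)
        rw [appHS_X]
        exact X_mem_supported.2 (by simpa using hη)
      rw [lieRem_of_lt _ _ hji (by simpa using h3), lieRem_of_lt _ _ hji (h2 i), h1, map_add, map_sum,
        dd_lie_appHS_of hB h (fun μ h2 h3 h4 i' => ih _ (by simp; omega) h2 h3 i' rfl)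
          (lieRem_mem_lieLin hB hc hl.tail hn.tail i)]
      congr 1
      refine Finset.sum_congr rfl fun l _ => ?_
      rw [map_mul, wordD_lie, wordD_lie, h1, ins_lie_append, map_add]
      congr 1
      · rw [appHS_C]
      · rw [appHS_X]
  · exact absurd (hl _ (List.mem_cons_self)) (by simp)

theorem dd_lie_appHS {N : ℕ} (h : Fin (𝓓 .hs).m) {f : WordRing K 𝓓} (hf : f ∈ lieLin eK N)
    (j : Fin (𝓓 .lie).m) :
    dd (wordE Γ eK) ⟨.lie, j⟩ (appHS K h f) = appHS K h (dd (wordE Γ eK) ⟨.lie, j⟩ f) :=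
  dd_lie_appHS_of hB h (fun _ h1 h2 _ i => lieRem_append hB hc h1 h2 i h) hf j

theorem lieRem_mem_supported {ξ : List (Idx 𝓓)} (hn : IsNormal ξ) (i : Fin (𝓓 .lie).m) :
    lieRem Γ eK (ξ, i) ∈
      supported K {η : List (Idx 𝓓) | IsNormal η ∧ η.length ≤ ξ.length} := by
  rcases hn.isLie_or with hl | ⟨lam, h, hl, hlam, rfl⟩
  · exact supported_mono (fun η hη => hη.2) (lieLin_le_supported (lieRem_mem_lieLin hB hc hl hn i))
  · rw [lieRem_append hB hc hl hlam]
    refine algHom_mem_of_mem_supported (appHS K h)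
      (s := {η | IsLie η ∧ IsNormal η ∧ η.length ≤ lam.length}) (fun η hη => ?_) ?_
    · rw [appHS_X]
      exact X_mem_supported.2 ⟨isNormal_append_hs hη.1 hη.2.1 h, by simpa using hη.2.2⟩
    · exact lieLin_le_supported (lieRem_mem_lieLin hB hc hl hlam i)

theorem wordD_mem_supported {ξ : List (Idx 𝓓)} (hn : IsNormal ξ) (i : Idx 𝓓) :
    wordD Γ eK i ξ ∈
      supported K {η : List (Idx 𝓓) | IsNormal η ∧ (η.Perm (i :: ξ) ∨ η.length ≤ ξ.length)} := by
  obtain ⟨_ | _, i⟩ := i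
  · rw [wordD_lie]
    refine add_mem (X_mem_supported.2 ⟨isNormal_ins_lie hn, Or.inl (perm_ins _ _)⟩)
      (supported_mono ?_ (lieRem_mem_supported hB hc hn i))
    rintro η ⟨h1, h2⟩
    exact ⟨h1, Or.inr h2⟩
  · rcases hn.isLie_or with hl | ⟨lam, h, hl, hlam, rfl⟩
    · rw [wordD_hs_of_isLie _ _ _ hl]
      refine X_mem_supported.2 ⟨isNormal_append_hs hl hn i, Or.inl ?_⟩
      exact List.perm_append_singleton _ _
    · rw [wordD_hs_append _ _ _ _ hl]
      refine sum_mem fun l _ => mul_mem (Subalgebra.algebraMap_mem _ _)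
        (X_mem_supported.2 ⟨isNormal_append_hs hl hlam l, Or.inr (by simp)⟩)

/-- When `i ξ` can be rearranged into a normal word, this word is the leading term. -/
theorem wordD_sub_mem_supported {ξ : List (Idx 𝓓)} {i : Idx 𝓓} (hn : IsNormal ξ)
    (hi : IsNormal (ins i ξ)) : wordD Γ eK i ξ - X (ins i ξ) ∈
      supported K {η : List (Idx 𝓓) | IsNormal η ∧ η.length ≤ ξ.length} := by
  obtain ⟨_ | _, i⟩ := i
  · rw [wordD_lie, add_sub_cancel_left]
    exact lieRem_mem_supported hB hc hn i
  · rcases hn.isLie_or with hl | ⟨lam, h, hl, hlam, rfl⟩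
    · rw [wordD_hs_of_isLie _ _ _ hl, ins_hs_of_isLie _ hl, sub_self]
      exact zero_mem _
    · exfalso
      have := hi.2
      rw [(perm_ins _ _).countP_eq] at this
      simp at this

/-- The commutation relation that defines the normal forms. -/
theorem defectLie_X_of_lt {ξ : List (Idx 𝓓)} {i j : Fin (𝓓 .lie).m} (hij : i < j)
    (hn : IsNormal (⟨.lie, j⟩ :: ξ)) :
    defectLie (e := wordE Γ eK) Γ K j i (X ξ) = 0 := by
  have h2 : lieRem Γ eK (ξ, i) ∈ supported K {η : List (Idx 𝓓) | η.length ≤ ξ.length} :=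
    supported_mono (fun η hη => hη.2) (lieRem_mem_supported hB hc hn.tail i)
  have hjn : IsNormal ((⟨.lie, j⟩ : Idx 𝓓) :: ins ⟨.lie, i⟩ ξ) := by
    refine ⟨List.pairwise_cons.2 ⟨fun a ha => ?_, pairwise_ins _ hn.tail.1⟩, ?_⟩
    · rcases List.mem_cons.1 ((perm_ins _ _).mem_iff.1 ha) with rfl | ha
      · exact (Idx.rank_lt_rank.2 hij).le
      · exact (List.pairwise_cons.1 hn.1).1 a ha
    · have := (isNormal_ins_lie (i := i) hn.tail).2
      simpa using this
  rw [defectLie, dd_wordE_X, dd_wordE_X, wordD_of_isNormal_cons _ _ hn, dd_wordE_X, wordD_lie,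
    wordD_lie, lieRem_of_lt _ _ hij h2, map_add, dd_wordE_X, wordD_of_isNormal_cons _ _ hjn,
    ins_cons, if_neg (not_le.2 (Idx.rank_lt_rank.2 hij))]
  simp only [dd_wordE_X, cf_word]
  ring

theorem dd_hs_lieLin {N : ℕ} (h : Fin (𝓓 .hs).m) {f : WordRing K 𝓓} (hf : f ∈ lieLin eK N) :
    dd (wordE Γ eK) ⟨.hs, h⟩ f = appHS K h f := by
  induction hf using AddSubgroup.closure_induction with
  | mem f hf =>
    obtain ⟨c, μ, h1, h2, h3, h4, rfl⟩ := hf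
    rw [dd_wordE_C_mul_of_const hB _ h1, dd_wordE_X, wordD_hs_of_isLie _ _ _ h2, map_mul, appHS_X,
      appHS_C]
  | zero => simp
  | add _ _ _ _ h1 h2 => simp only [map_add, h1, h2]
  | neg _ _ h1 => simp only [map_neg, h1]

theorem dd_hs_appHS_lieLin {N : ℕ} (h h' : Fin (𝓓 .hs).m) {f : WordRing K 𝓓}
    (hf : f ∈ lieLin eK N) : dd (wordE Γ eK) ⟨.hs, h⟩ (appHS K h' f) =
      ∑ l, C (cf (K := K) Γ K .hs l h h') * appHS K l f := by
  induction hf using AddSubgroup.closure_induction with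
  | mem f hf =>
    obtain ⟨c, μ, h1, h2, h3, h4, rfl⟩ := hf
    simp only [map_mul, appHS_X, appHS_C]
    rw [dd_wordE_C_mul_of_const hB _ h1, dd_wordE_X, wordD_hs_append _ _ _ _ h2, Finset.mul_sum]
    refine Finset.sum_congr rfl fun l _ => ?_
    ring
  | zero => simp
  | add _ _ _ _ h1 h2 => simp only [map_add, h1, h2, mul_add, Finset.sum_add_distrib]
  | neg _ _ h1 => simp only [map_neg, h1, mul_neg, Finset.sum_neg_distrib]

variable (hc' : ∀ l i j p, dd eK ⟨.lie, p⟩ (cf (K := K) Γ K .hs l i j) = 0)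
include hc'

/-- On Lie forms with constant coefficients `∂_q` appends the letter `q`, and appending commutes
with `∂_p`. If a Hasse-Schmidt letter is already present, `∂_q` replaces it with coefficients that
are constants for `∂_p`. -/
theorem defectMix_X {ξ : List (Idx 𝓓)} (hn : IsNormal ξ) (p : Fin (𝓓 .lie).m)
    (q : Fin (𝓓 .hs).m) : defectMix (wordE Γ eK) p q (X ξ) = 0 := by
  rw [defectMix, sub_eq_zero]
  rcases hn.isLie_or with hl | ⟨lam, h, hl, hlam, rfl⟩
  · have h1 : (X ξ : WordRing K 𝓓) ∈ lieLin eK ξ.length := X_mem_lieLin hl hn le_rfl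
    rw [dd_hs_lieLin hB hc q h1, dd_hs_lieLin hB hc q (dd_mem_lieLin hB hc h1 p),
      dd_lie_appHS hB hc q h1]
  · have h1 : (X lam : WordRing K 𝓓) ∈ lieLin eK lam.length := X_mem_lieLin hl hlam le_rfl
    have h2 : (X (lam ++ [⟨.hs, h⟩]) : WordRing K 𝓓) = appHS K h (X lam) :=
      (appHS_X h lam).symm
    rw [h2, dd_lie_appHS hB hc h h1, dd_hs_appHS_lieLin hB hc q h h1,
      dd_hs_appHS_lieLin hB hc q h (dd_mem_lieLin hB hc h1 p), map_sum]
    refine Finset.sum_congr rfl fun l _ => ?_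
    rw [dd_wordE_C_mul_of_const hB p (hc' l q h), dd_lie_appHS hB hc l h1]

end Field

end WordOperators

/-! ### Relations between the coefficients over the base field -/

section Coefficients

variable {k F K : Type*} [Field k] [Field F] [Field K] [Algebra k F] [Algebra k K] [Algebra F K]
  [IsScalarTower k F K] {𝓓 : OpType → LocalOperatorSystem k}

open LocalOperatorSystem MvPolynomial

/-- The relations between the coefficients of a Jacobi-associative commutation system over a
`𝓓^Γ`-field. -/
structure CoefRelations (Γ : LHSSystem 𝓓 F) (eK : ∀ u, K →ₐ[k] (𝓓 u).Alg ⊗[k] K) : Prop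
    extends BaseRelations (K := K) Γ eK where
  skew : ∀ l i j, cf (K := K) Γ K .lie l i j = - cf (K := K) Γ K .lie l j i
  jacobi : ∀ i j s r,
    ∑ l, (cf (K := K) Γ K .lie l i j * cf (K := K) Γ K .lie r l s +
      cf (K := K) Γ K .lie l s i * cf (K := K) Γ K .lie r l j +
      cf (K := K) Γ K .lie l j s * cf (K := K) Γ K .lie r l i) =
      dd eK ⟨.lie, i⟩ (cf (K := K) Γ K .lie r j s) + dd eK ⟨.lie, s⟩ (cf (K := K) Γ K .lie r i j) +
        dd eK ⟨.lie, j⟩ (cf (K := K) Γ K .lie r s i)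
  diagonal : ∀ i j s r,
    ∑ p, ((𝓓 .lie).alpha i p r • dd eK ⟨.lie, p⟩ (cf (K := K) Γ K .lie r j s) +
      (𝓓 .lie).alpha s p r • dd eK ⟨.lie, p⟩ (cf (K := K) Γ K .lie r i j) +
      (𝓓 .lie).alpha j p r • dd eK ⟨.lie, p⟩ (cf (K := K) Γ K .lie r s i)) = 0
  off_diagonal : ∀ i j s q r, q < r →
    ∑ p, ((𝓓 .lie).alpha i p q • dd eK ⟨.lie, p⟩ (cf (K := K) Γ K .lie r j s) +
      (𝓓 .lie).alpha s p q • dd eK ⟨.lie, p⟩ (cf (K := K) Γ K .lie r i j) +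
      (𝓓 .lie).alpha j p q • dd eK ⟨.lie, p⟩ (cf (K := K) Γ K .lie r s i) +
      (𝓓 .lie).alpha i p r • dd eK ⟨.lie, p⟩ (cf (K := K) Γ K .lie q j s) +
      (𝓓 .lie).alpha s p r • dd eK ⟨.lie, p⟩ (cf (K := K) Γ K .lie q i j) +
      (𝓓 .lie).alpha j p r • dd eK ⟨.lie, p⟩ (cf (K := K) Γ K .lie q s i)) = 0
  assoc : ∀ i j s r,
    ∑ l, (cf (K := K) Γ K .hs l i j * cf (K := K) Γ K .hs r l s -
      cf (K := K) Γ K .hs l j s * cf (K := K) Γ K .hs r i l -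
      ∑ p, ∑ q, (𝓓 .hs).alpha i p q •
        (dd eK ⟨.hs, p⟩ (cf (K := K) Γ K .hs l j s) * cf (K := K) Γ K .hs r q l)) =
      dd eK ⟨.hs, i⟩ (cf (K := K) Γ K .hs r j s)
  lie_const : ∀ l i j h, dd eK ⟨.hs, h⟩ (cf (K := K) Γ K .lie l i j) = 0
  hs_const : ∀ l i j p, dd eK ⟨.lie, p⟩ (cf (K := K) Γ K .hs l i j) = 0

theorem coefRelations {Γ : LHSSystem 𝓓 F} {eF : ∀ u, F →ₐ[k] (𝓓 u).Alg ⊗[k] F}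
    {eK : ∀ u, K →ₐ[k] (𝓓 u).Alg ⊗[k] K} (hΓ : Γ.IsJacobiAssociative eF)
    (hK : IsDGammaField Γ eF (IsScalarTower.toAlgHom k F K) eK) : CoefRelations Γ eK := by
  have hd : ∀ (u : OpType) (i : Fin (𝓓 u).m) (x : F), dd eK ⟨u, i⟩ (algebraMap F K x) =
      algebraMap F K ((𝓓 u).op (eF u) i x) := by
    intro u i x
    have h1 := AlgHom.congr_fun (hK.extends_base u) x
    simp only [AlgHom.comp_apply] at h1
    rw [← crd_succ_eq_dd]
    change (𝓓 u).crd i.succ (eK u (IsScalarTower.toAlgHom k F K x)) = _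
    rw [← h1, crd_map]
    rfl
  have hcf : ∀ u l i j, cf (K := K) Γ K u l i j = algebraMap F K (Γ.c u l i j) := fun _ _ _ _ => rfl
  have hsm : ∀ (a : k) (x : F), a • algebraMap F K x = algebraMap F K (a • x) := fun a x =>
    (map_smul (IsScalarTower.toAlgHom k F K) a x).symm
  have h0 := IsDRing.self hK.isOperator
  obtain ⟨h1, h2, h3⟩ := (gammaCommuteOn_univ_iff (K := K) Γ (IsScalarTower.toAlgHom k F K)
    (fun c => rfl) h0.crd_zero).1 hK.commute
  refine ⟨⟨h0, h1, h2, h3⟩, ?_, ?_, ?_, ?_, ?_, ?_, ?_⟩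
  · intro l i j
    rw [hcf, hcf, hΓ.jacobi.skew l i j, map_neg]
  · intro i j s r
    simp only [hcf, hd, ← map_mul, ← map_add, ← map_sum, hΓ.jacobi.jacobi i j s r]
  · intro i j s r
    simp only [hcf, hd, hsm, ← map_add, ← map_sum]
    rw [hΓ.jacobi.diagonal i j s r, map_zero]
  · intro i j s q r hqr
    simp only [hcf, hd, hsm, ← map_add, ← map_sum]
    rw [hΓ.jacobi.off_diagonal i j s q r hqr, map_zero]
  · intro i j s r
    simp only [hcf, hd, hsm, ← map_mul, ← map_sub, ← map_sum, hΓ.assoc i j s r]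
  · intro l i j h
    rw [hcf, hd, hΓ.mixed .hs .lie (by decide) h, map_zero]
  · intro l i j p
    rw [hcf, hd, hΓ.mixed .lie .hs (by decide) p, map_zero]

variable {Γ : LHSSystem 𝓓 F} {eK : ∀ u, K →ₐ[k] (𝓓 u).Alg ⊗[k] K}

theorem cf_eq_zero_of_not_null {l i j : Fin (𝓓 .lie).m}
    (h : ¬ (j ∈ (𝓓 .lie).null ∧ i ∈ (𝓓 .lie).null)) : cf (K := K) Γ K .lie l i j = 0 := by
  rw [cf, Γ.isLieType.2 l j i h]; simp

theorem sum_alpha_cf (p q i j : Fin (𝓓 .lie).m) :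
    ∑ l, (𝓓 .lie).alpha l p q • cf (K := K) Γ K .lie l j i = 0 := by
  have h := congrArg (IsScalarTower.toAlgHom k F K) (Γ.isLieType.sum_alpha_mul_c p q i j)
  rw [map_sum, map_zero] at h
  simp only [map_smul] at h
  exact h

section DRing

variable {R : Type*} [CommRing R] [Algebra k R] [Algebra K R] [IsScalarTower k K R]
  {e : ∀ u, R →ₐ[k] (𝓓 u).Alg ⊗[k] R}

theorem cf_eq (u : OpType) (l i j : Fin (𝓓 u).m) :
    cf (K := K) Γ R u l i j = algebraMap K R (cf (K := K) Γ K u l i j) := rfl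

theorem BaseRelations.defectLie_algebraMap (hB : BaseRelations (K := K) Γ eK) (he : IsDRing eK e)
    (p q : Fin (𝓓 .lie).m) (c : K) : defectLie (e := e) Γ K p q (algebraMap K R c) = 0 := by
  have h := congrArg (algebraMap K R) (hB.lie c p q)
  rw [map_zero] at h
  rw [← h]
  simp only [defectLie, he.dd_algebraMap, map_sub, map_sum, map_mul, cf_eq (R := R)]

theorem BaseRelations.defectHS_algebraMap (hB : BaseRelations (K := K) Γ eK) (he : IsDRing eK e)
    (p q : Fin (𝓓 .hs).m) (c : K) : defectHS (e := e) Γ K p q (algebraMap K R c) = 0 := by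
  have h := congrArg (algebraMap K R) (hB.hs c p q)
  rw [map_zero] at h
  rw [← h]
  simp only [defectHS, he.dd_algebraMap, map_sub, map_sum, map_mul, cf_eq (R := R)]

theorem BaseRelations.defectMix_algebraMap (hB : BaseRelations (K := K) Γ eK) (he : IsDRing eK e)
    (p : Fin (𝓓 .lie).m) (q : Fin (𝓓 .hs).m) (c : K) :
    defectMix e p q (algebraMap K R c) = 0 := by
  have h := congrArg (algebraMap K R) (hB.mix c p q)
  rw [map_zero] at h
  rw [← h]
  simp only [defectMix, he.dd_algebraMap, map_sub]

theorem CoefRelations.defectLie_swap (hB : CoefRelations (K := K) Γ eK)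
    (p q : Fin (𝓓 .lie).m) (x : R) :
    defectLie (e := e) Γ K p q x = - defectLie (e := e) Γ K q p x := by
  simp only [defectLie, cf_eq (R := R), hB.skew _ q p, map_neg, neg_mul, Finset.sum_neg_distrib]
  ring

variable (Γ e) in
/-- The operator `∑ c_l^{ii} ∂_l`, which vanishes on every `𝓓^Γ`-field. -/
def squareOp (K : Type*) [Field K] [Algebra F K] [Algebra K R] (i : Fin (𝓓 .lie).m) (x : R) : R :=
  ∑ l, cf (K := K) Γ R .lie l i i * dd e ⟨.lie, l⟩ x

theorem defectLie_self (i : Fin (𝓓 .lie).m) (x : R) :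
    defectLie (e := e) Γ K i i x = - squareOp Γ e K i x := by
  rw [defectLie, squareOp, sub_self, zero_sub]

/-- The quadratic terms of the product rule cancel by `sum_alpha_cf`, so this combination is a
derivation although the single `∂_l` need not be. -/
theorem squareOp_mul (he : IsDRing eK e) (i : Fin (𝓓 .lie).m) (x y : R) :
    squareOp Γ e K i (x * y) = x * squareOp Γ e K i y + squareOp Γ e K i x * y := by
  simp only [squareOp, he.dd_mul, mul_add, Finset.sum_add_distrib]
  have : ∑ l, cf (K := K) Γ R .lie l i i * ∑ p, ∑ q, (𝓓 .lie).alpha l p q •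
      (dd e ⟨.lie, p⟩ x * dd e ⟨.lie, q⟩ y) = 0 := by
    simp only [Finset.mul_sum]
    rw [Finset.sum_comm]
    refine Finset.sum_eq_zero fun p _ => ?_
    rw [Finset.sum_comm]
    refine Finset.sum_eq_zero fun q _ => ?_
    have h1 : ∀ l, cf (K := K) Γ R .lie l i i * (𝓓 .lie).alpha l p q •
        (dd e ⟨.lie, p⟩ x * dd e ⟨.lie, q⟩ y) =
        algebraMap K R ((𝓓 .lie).alpha l p q • cf (K := K) Γ K .lie l i i) *
        (dd e ⟨.lie, p⟩ x * dd e ⟨.lie, q⟩ y) := by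
      intro l
      rw [mul_smul_comm, ← smul_mul_assoc, cf_eq]
      congr 1
      exact (map_smul (IsScalarTower.toAlgHom k K R) _ _).symm
    simp only [h1]
    rw [← Finset.sum_mul, ← map_sum, sum_alpha_cf, map_zero, zero_mul]
  rw [this, add_zero, Finset.mul_sum, Finset.sum_mul]
  congr 1
  · exact Finset.sum_congr rfl fun l _ => by ring
  · exact Finset.sum_congr rfl fun l _ => by ring

end DRing

end Coefficients

/-! ### Alternating quadratic expressions -/

section Quadratic

/-- A quadratic expression with alternating coefficients. -/
theorem sum_alternating_mem {S : Type*} [CommRing S] {m : ℕ} (J : Ideal S) (A g : Fin m → Fin m → S)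
    (hd : ∀ i, A i i = 0) (hs : ∀ i j, i < j → A i j + A j i = 0)
    (hg : ∀ i j, i ≠ j → A i j * (g i j - g j i) ∈ J) : ∑ i, ∑ j, A i j * g i j ∈ J := by
  -- Induction on the index set: inserting `a` adds the terms `(a, i)` and `(i, a)` in pairs.
  -- Halving a symmetrised sum would fail in characteristic 2.
  have h1 : ∀ s : Finset (Fin m), ∑ i ∈ s, ∑ j ∈ s, A i j * g i j ∈ J := by
    classical
    intro s
    induction s using Finset.induction_on with
    | empty => simp
    | insert a s ha ih =>
      rw [Finset.sum_insert ha, Finset.sum_insert ha, hd, zero_mul, zero_add]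
      simp only [Finset.sum_insert ha]
      rw [Finset.sum_add_distrib, ← add_assoc, ← Finset.sum_add_distrib]
      refine J.add_mem (J.sum_mem fun i hi => ?_) ih
      have hne : a ≠ i := by rintro rfl; exact ha hi
      have h2 : A i a = - A a i := by
        rcases lt_or_gt_of_ne hne with h | h
        · exact eq_neg_of_add_eq_zero_right (hs a i h)
        · exact eq_neg_of_add_eq_zero_left (hs i a h)
      have := hg a i hne
      rw [h2]
      convert this using 1
      ring
  exact h1 Finset.univ

end Quadratic

/-! ### The Hasse-Schmidt relation and the ideal of square relations -/

section PBW

variable {k F K : Type*} [Field k] [Field F] [Field K] [Algebra k F] [Algebra k K] [Algebra F K]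
  [IsScalarTower k F K] {𝓓 : OpType → LocalOperatorSystem k}

open LocalOperatorSystem MvPolynomial

variable {Γ : LHSSystem 𝓓 F} {eK : ∀ u, K →ₐ[k] (𝓓 u).Alg ⊗[k] K}

section HS

variable (hB : CoefRelations (K := K) Γ eK)
include hB

/-- Without a Hasse-Schmidt letter the relation is the rewriting rule itself. For a word ending in
`h`, comparing the coefficients of each `X (lam ++ [r])` gives exactly the associativity condition.
-/
theorem defectHS_X {ξ : List (Idx 𝓓)} (hn : IsNormal ξ) (p q : Fin (𝓓 .hs).m) :
    defectHS (e := wordE Γ eK) Γ K p q (X ξ) = 0 := by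
  have hC : ∀ (a : k) (b : K) (f : WordRing K 𝓓), a • (C b * f) = C (a • b) * f := by
    intro a b f
    rw [← smul_mul_assoc]
    congr 1
    exact (map_smul (IsScalarTower.toAlgHom k K (WordRing K 𝓓)) a b).symm
  rw [defectHS, sub_eq_zero]
  rcases hn.isLie_or with hl | ⟨lam, h, hl, hlam, rfl⟩
  · rw [dd_wordE_X, wordD_hs_of_isLie _ _ _ hl, dd_wordE_X, wordD_hs_append _ _ _ _ hl]
    refine Finset.sum_congr rfl fun l _ => ?_
    rw [dd_wordE_X, wordD_hs_of_isLie _ _ _ hl, cf_word]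
  · simp only [dd_wordE_X, wordD_hs_append _ _ _ _ hl, map_sum, cf_word,
      dd_wordE_C_mul hB.toBaseRelations, Finset.mul_sum, Finset.smul_sum]
    have key : ∀ r, ∑ l, (C (cf (K := K) Γ K .hs l p h) * (C (cf (K := K) Γ K .hs r q l) *
        X (lam ++ [⟨.hs, r⟩])) + ∑ a, ∑ b, (𝓓 .hs).alpha q a b •
        (C (dd eK ⟨.hs, a⟩ (cf (K := K) Γ K .hs l p h)) * (C (cf (K := K) Γ K .hs r b l) *
          X (lam ++ [⟨.hs, r⟩])))) + C (dd eK ⟨.hs, q⟩ (cf (K := K) Γ K .hs r p h)) *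
          X (lam ++ [⟨.hs, r⟩]) =
        ∑ l, C (cf (K := K) Γ K .hs l q p) * (C (cf (K := K) Γ K .hs r l h) *
          X (lam ++ [⟨.hs, r⟩])) := by
      intro r
      simp only [← mul_assoc, ← C_mul, hC, ← Finset.sum_mul, ← map_sum, ← add_mul, ← map_add]
      congr 2
      rw [← hB.assoc q p h r, ← Finset.sum_add_distrib]
      refine Finset.sum_congr rfl fun l _ => ?_
      ring
    conv_rhs => rw [Finset.sum_comm]
    rw [← Finset.sum_congr rfl fun r _ => key r]
    simp only [Finset.sum_add_distrib]
    have e1 := Finset.sum_comm (s := Finset.univ) (t := Finset.univ) (f := fun x y =>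
      C (cf (K := K) Γ K .hs x p h) * (C (cf (K := K) Γ K .hs y q x) *
        (X (lam ++ [⟨.hs, y⟩]) : WordRing K 𝓓)))
    have e3 : ∀ T : Fin (𝓓 .hs).m → Fin (𝓓 .hs).m → Fin (𝓓 .hs).m → Fin (𝓓 .hs).m → WordRing K 𝓓,
        ∑ x, ∑ a, ∑ b, ∑ r, T x a b r = ∑ r, ∑ x, ∑ a, ∑ b, T x a b r := by
      intro T
      conv_rhs => rw [Finset.sum_comm]
      refine Finset.sum_congr rfl fun x _ => ?_
      conv_rhs => rw [Finset.sum_comm]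
      refine Finset.sum_congr rfl fun a _ => ?_
      conv_rhs => rw [Finset.sum_comm]
    rw [e1, e3]
    abel

end HS

variable (Γ eK) in
/-- The ideal generated by the relations `∑ c_l^{pp} ∂_l a^τ = 0`, for `τ` of length less than
`N`. -/
def squareIdeal (N : ℕ) : Ideal (WordRing K 𝓓) :=
  Ideal.span {f | ∃ (p : Fin (𝓓 .lie).m) (τ : List (Idx 𝓓)), IsNormal τ ∧ τ.length < N ∧
    f = squareOp Γ (wordE Γ eK) K p (X τ)}

theorem squareIdeal_mono {N N' : ℕ} (h : N ≤ N') : squareIdeal Γ eK N ≤ squareIdeal Γ eK N' := by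
  refine Ideal.span_mono ?_
  rintro f ⟨p, τ, h1, h2, rfl⟩
  exact ⟨p, τ, h1, h2.trans_le h, rfl⟩

theorem squareOp_X_mem {N : ℕ} {τ : List (Idx 𝓓)} (hn : IsNormal τ) (h : τ.length < N)
    (p : Fin (𝓓 .lie).m) : squareOp Γ (wordE Γ eK) K p (X τ) ∈ squareIdeal Γ eK N :=
  Ideal.subset_span ⟨p, τ, hn, h, rfl⟩

variable (hB : CoefRelations (K := K) Γ eK)
include hB

theorem squareOp_mem {N : ℕ} {f : WordRing K 𝓓}
    (hf : f ∈ supported K {η : List (Idx 𝓓) | IsNormal η ∧ η.length < N}) (p : Fin (𝓓 .lie).m) :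
    squareOp Γ (wordE Γ eK) K p f ∈ squareIdeal Γ eK N := by
  change f ∈ Algebra.adjoin K _ at hf
  induction hf using Algebra.adjoin_induction with
  | mem f hf =>
    obtain ⟨τ, h, rfl⟩ := hf
    exact squareOp_X_mem h.1 h.2 p
  | algebraMap c =>
    have := hB.defectLie_algebraMap hB.isDRing_word p p c
    rw [defectLie_self, neg_eq_zero] at this
    rw [this]
    exact zero_mem _
  | add x y _ _ h1 h2 =>
    have : squareOp Γ (wordE Γ eK) K p (x + y) = squareOp Γ (wordE Γ eK) K p x +
        squareOp Γ (wordE Γ eK) K p y := by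
      simp only [squareOp, map_add, mul_add, Finset.sum_add_distrib]
    rw [this]
    exact add_mem h1 h2
  | mul x y _ _ h1 h2 =>
    rw [squareOp_mul hB.isDRing_word]
    exact add_mem (Ideal.mul_mem_left _ _ h2) (Ideal.mul_mem_right _ _ h1)

theorem defectLie_mem_of_supported (J : Ideal (WordRing K 𝓓)) {s : Set (List (Idx 𝓓))}
    (h : ∀ ξ ∈ s, ∀ p q, defectLie (e := wordE Γ eK) Γ K p q (X ξ) ∈ J) {f : WordRing K 𝓓}
    (hf : f ∈ supported K s) (p q : Fin (𝓓 .lie).m) :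
    defectLie (e := wordE Γ eK) Γ K p q f ∈ J := by
  refine (isDefect_lie (K := K) Γ ((IsScalarTower.toAlgHom k K (WordRing K 𝓓)).comp
    (IsScalarTower.toAlgHom k F K)) (fun c => rfl) hB.isDRing_word.crd_zero).mem_of_mem_adjoin
    (B := K) J (s := X '' s) ?_ ?_ hf p q
  · intro b p q
    rw [hB.defectLie_algebraMap hB.isDRing_word]
    exact zero_mem _
  · rintro _ ⟨ξ, hξ, rfl⟩
    exact h ξ hξ

end PBW

/-! ### The Jacobi identity for the Lie defects -/

section JacobiIdentity

variable {k F K : Type*} [Field k] [Field F] [Field K] [Algebra k F] [Algebra k K] [Algebra F K]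
  [IsScalarTower k F K] {𝓓 : OpType → LocalOperatorSystem k}

open LocalOperatorSystem MvPolynomial

variable {Γ : LHSSystem 𝓓 F} {eK : ∀ u, K →ₐ[k] (𝓓 u).Alg ⊗[k] K}

variable {R : Type*} [CommRing R] [Algebra k R] [Algebra K R] [IsScalarTower k K R]
  {e : ∀ u, R →ₐ[k] (𝓓 u).Alg ⊗[k] R}

/-- The product rule, with `∂_s ∂_l x` turned into `∂_l ∂_s x` at the price of a defect. The last
two sums are the first-order terms and the quadratic terms due to `α`, in the form in which their
cyclic sums are needed. -/
theorem dd_lieSum (he : IsDRing eK e) (i j s : Fin (𝓓 .lie).m) (x : R) :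
    dd e ⟨.lie, s⟩ (∑ l, cf (K := K) Γ R .lie l i j * dd e ⟨.lie, l⟩ x) =
      ∑ l, cf (K := K) Γ R .lie l i j * dd e ⟨.lie, l⟩ (dd e ⟨.lie, s⟩ x) +
      (∑ l, cf (K := K) Γ R .lie l i j * defectLie (e := e) Γ K l s x +
      ∑ r, algebraMap K R (∑ l, cf (K := K) Γ K .lie l i j * cf (K := K) Γ K .lie r s l +
        dd eK ⟨.lie, s⟩ (cf (K := K) Γ K .lie r i j)) * dd e ⟨.lie, r⟩ x +
      ∑ b, ∑ l, algebraMap K R (∑ a, (𝓓 .lie).alpha s a b •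
        dd eK ⟨.lie, a⟩ (cf (K := K) Γ K .lie l i j)) *
          dd e ⟨.lie, b⟩ (dd e ⟨.lie, l⟩ x)) := by
  have h1 : ∀ (a : k) (c : K), algebraMap K R (a • c) = a • algebraMap K R c := fun a c =>
    map_smul (IsScalarTower.toAlgHom k K R) a c
  have h2 : ∀ l, dd e ⟨.lie, s⟩ (cf (K := K) Γ R .lie l i j * dd e ⟨.lie, l⟩ x) =
      cf (K := K) Γ R .lie l i j * dd e ⟨.lie, l⟩ (dd e ⟨.lie, s⟩ x) +
      cf (K := K) Γ R .lie l i j * defectLie (e := e) Γ K l s x +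
      ∑ r, cf (K := K) Γ R .lie l i j * cf (K := K) Γ R .lie r s l * dd e ⟨.lie, r⟩ x +
      algebraMap K R (dd eK ⟨.lie, s⟩ (cf (K := K) Γ K .lie l i j)) * dd e ⟨.lie, l⟩ x +
      ∑ b, algebraMap K R (∑ a, (𝓓 .lie).alpha s a b •
        dd eK ⟨.lie, a⟩ (cf (K := K) Γ K .lie l i j)) *
          dd e ⟨.lie, b⟩ (dd e ⟨.lie, l⟩ x) := by
    intro l
    rw [he.dd_mul, Finset.sum_comm]
    simp only [cf_eq (R := R), he.dd_algebraMap, defectLie, map_sum, h1, Finset.sum_mul,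
      smul_mul_assoc, mul_sub, Finset.mul_sum, mul_assoc]
    ring
  rw [map_sum, Finset.sum_congr rfl fun l _ => h2 l]
  simp only [Finset.sum_add_distrib, map_add, add_mul, map_sum, map_mul, Finset.sum_mul]
  simp only [← cf_eq (R := R)]
  rw [Finset.sum_comm (f := fun l r => cf (K := K) Γ R .lie l i j *
    cf (K := K) Γ R .lie r s l * dd e ⟨.lie, r⟩ x)]
  conv_lhs => rw [Finset.sum_comm (f := fun l b => ∑ a, algebraMap K R ((𝓓 .lie).alpha s a b •
        dd eK ⟨.lie, a⟩ (cf (K := K) Γ K .lie l i j)) *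
          dd e ⟨.lie, b⟩ (dd e ⟨.lie, l⟩ x))]
  ring

variable (Γ eK) in
/-- The coefficients of the quadratic part of the Jacobi identity. -/
def jacobiCoef (i j s b l : Fin (𝓓 .lie).m) : K :=
  ∑ a, ((𝓓 .lie).alpha i a b • dd eK ⟨.lie, a⟩ (cf (K := K) Γ K .lie l j s) +
      (𝓓 .lie).alpha s a b • dd eK ⟨.lie, a⟩ (cf (K := K) Γ K .lie l i j) +
      (𝓓 .lie).alpha j a b • dd eK ⟨.lie, a⟩ (cf (K := K) Γ K .lie l s i))

theorem jacobiCoef_eq_zero_of_null {i j s b l : Fin (𝓓 .lie).m} (hb : b ∈ (𝓓 .lie).null) :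
    jacobiCoef Γ eK i j s b l = 0 := by
  refine Finset.sum_eq_zero fun a _ => ?_
  rw [alpha_of_null_right hb, alpha_of_null_right hb, alpha_of_null_right hb]
  simp

/-- In the cyclic sum the threefold derivatives cancel, and the first-order terms cancel by the
Jacobi condition on the coefficients. What is left are multiples of defects at `x` and a quadratic
form in the `∂_b ∂_l x`, whose coefficients are alternating by the two conditions involving `α`. -/
theorem CoefRelations.jacobi_mem (hB : CoefRelations (K := K) Γ eK) (he : IsDRing eK e)
    (J : Ideal R) {x : R} (h : ∀ p q, defectLie (e := e) Γ K p q x ∈ J) (i j s : Fin (𝓓 .lie).m) :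
    (defectLie (e := e) Γ K j i (dd e ⟨.lie, s⟩ x) - dd e ⟨.lie, s⟩ (defectLie (e := e) Γ K j i x)) +
    (defectLie (e := e) Γ K s j (dd e ⟨.lie, i⟩ x) - dd e ⟨.lie, i⟩ (defectLie (e := e) Γ K s j x)) +
    (defectLie (e := e) Γ K i s (dd e ⟨.lie, j⟩ x) - dd e ⟨.lie, j⟩ (defectLie (e := e) Γ K i s x))
      ∈ J := by
  have key : (defectLie (e := e) Γ K j i (dd e ⟨.lie, s⟩ x) -
        dd e ⟨.lie, s⟩ (defectLie (e := e) Γ K j i x)) +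
      (defectLie (e := e) Γ K s j (dd e ⟨.lie, i⟩ x) -
        dd e ⟨.lie, i⟩ (defectLie (e := e) Γ K s j x)) +
      (defectLie (e := e) Γ K i s (dd e ⟨.lie, j⟩ x) -
        dd e ⟨.lie, j⟩ (defectLie (e := e) Γ K i s x)) =
      (∑ l, cf (K := K) Γ R .lie l i j * defectLie (e := e) Γ K l s x +
        ∑ l, cf (K := K) Γ R .lie l j s * defectLie (e := e) Γ K l i x +
        ∑ l, cf (K := K) Γ R .lie l s i * defectLie (e := e) Γ K l j x) +
      ∑ b, ∑ l, algebraMap K R (jacobiCoef Γ eK i j s b l) *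
        dd e ⟨.lie, b⟩ (dd e ⟨.lie, l⟩ x) := by
    have hlin : ∀ r, algebraMap K R (∑ l, cf (K := K) Γ K .lie l i j * cf (K := K) Γ K .lie r s l +
          dd eK ⟨.lie, s⟩ (cf (K := K) Γ K .lie r i j)) +
        algebraMap K R (∑ l, cf (K := K) Γ K .lie l j s * cf (K := K) Γ K .lie r i l +
          dd eK ⟨.lie, i⟩ (cf (K := K) Γ K .lie r j s)) +
        algebraMap K R (∑ l, cf (K := K) Γ K .lie l s i * cf (K := K) Γ K .lie r j l +
          dd eK ⟨.lie, j⟩ (cf (K := K) Γ K .lie r s i)) = 0 := by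
      intro r
      rw [← map_add, ← map_add]
      refine (congrArg _ ?_).trans (map_zero _)
      have h1 := hB.jacobi i j s r
      have h2 : ∀ p q t, ∑ l, cf (K := K) Γ K .lie l p q * cf (K := K) Γ K .lie r t l =
          - ∑ l, cf (K := K) Γ K .lie l p q * cf (K := K) Γ K .lie r l t := by
        intro p q t
        rw [← Finset.sum_neg_distrib]
        exact Finset.sum_congr rfl fun l _ => by rw [hB.skew r t l, mul_neg]
      simp only [Finset.sum_add_distrib] at h1
      rw [h2, h2, h2]
      linear_combination -h1
    have hlin' : ∑ r, algebraMap K R (∑ l, cf (K := K) Γ K .lie l i j * cf (K := K) Γ K .lie r s l +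
          dd eK ⟨.lie, s⟩ (cf (K := K) Γ K .lie r i j)) * dd e ⟨.lie, r⟩ x +
        ∑ r, algebraMap K R (∑ l, cf (K := K) Γ K .lie l j s * cf (K := K) Γ K .lie r i l +
          dd eK ⟨.lie, i⟩ (cf (K := K) Γ K .lie r j s)) * dd e ⟨.lie, r⟩ x +
        ∑ r, algebraMap K R (∑ l, cf (K := K) Γ K .lie l s i * cf (K := K) Γ K .lie r j l +
          dd eK ⟨.lie, j⟩ (cf (K := K) Γ K .lie r s i)) * dd e ⟨.lie, r⟩ x = 0 := by
      rw [← Finset.sum_add_distrib, ← Finset.sum_add_distrib]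
      exact Finset.sum_eq_zero fun r _ => by rw [← add_mul, ← add_mul, hlin, zero_mul]
    have e1 := dd_lieSum (Γ := Γ) he i j s x
    have e2 := dd_lieSum (Γ := Γ) he j s i x
    have e3 := dd_lieSum (Γ := Γ) he s i j x
    have hq : ∑ b, ∑ l, algebraMap K R (jacobiCoef Γ eK i j s b l) *
        dd e ⟨.lie, b⟩ (dd e ⟨.lie, l⟩ x) =
        ∑ b, ∑ l, algebraMap K R (∑ a, (𝓓 .lie).alpha i a b •
          dd eK ⟨.lie, a⟩ (cf (K := K) Γ K .lie l j s)) * dd e ⟨.lie, b⟩ (dd e ⟨.lie, l⟩ x) +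
        ∑ b, ∑ l, algebraMap K R (∑ a, (𝓓 .lie).alpha s a b •
          dd eK ⟨.lie, a⟩ (cf (K := K) Γ K .lie l i j)) * dd e ⟨.lie, b⟩ (dd e ⟨.lie, l⟩ x) +
        ∑ b, ∑ l, algebraMap K R (∑ a, (𝓓 .lie).alpha j a b •
          dd eK ⟨.lie, a⟩ (cf (K := K) Γ K .lie l s i)) * dd e ⟨.lie, b⟩ (dd e ⟨.lie, l⟩ x) := by
      simp only [← Finset.sum_add_distrib, ← add_mul, ← map_add]
      rfl
    rw [hq]
    have d1 : ∀ p q t, defectLie (e := e) Γ K q p (dd e ⟨.lie, t⟩ x) -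
        dd e ⟨.lie, t⟩ (defectLie (e := e) Γ K q p x) =
        dd e ⟨.lie, p⟩ (dd e ⟨.lie, q⟩ (dd e ⟨.lie, t⟩ x)) -
        dd e ⟨.lie, q⟩ (dd e ⟨.lie, p⟩ (dd e ⟨.lie, t⟩ x)) -
        dd e ⟨.lie, t⟩ (dd e ⟨.lie, p⟩ (dd e ⟨.lie, q⟩ x)) +
        dd e ⟨.lie, t⟩ (dd e ⟨.lie, q⟩ (dd e ⟨.lie, p⟩ x)) +
        (dd e ⟨.lie, t⟩ (∑ l, cf (K := K) Γ R .lie l p q * dd e ⟨.lie, l⟩ x) -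
          ∑ l, cf (K := K) Γ R .lie l p q * dd e ⟨.lie, l⟩ (dd e ⟨.lie, t⟩ x)) := by
      intro p q t
      simp only [defectLie, map_sub]
      ring
    rw [d1, d1, d1]
    linear_combination e1 + e2 + e3 + hlin'
  rw [key]
  refine J.add_mem (J.add_mem (J.add_mem ?_ ?_) ?_) ?_
  · exact J.sum_mem fun l _ => J.mul_mem_left _ (h _ _)
  · exact J.sum_mem fun l _ => J.mul_mem_left _ (h _ _)
  · exact J.sum_mem fun l _ => J.mul_mem_left _ (h _ _)
  · refine sum_alternating_mem J _ (fun b l => dd e ⟨.lie, b⟩ (dd e ⟨.lie, l⟩ x)) ?_ ?_ ?_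
    · intro b
      rw [jacobiCoef, hB.diagonal i j s b, map_zero]
    · intro b l hbl
      rw [← map_add]
      refine (congrArg _ ?_).trans (map_zero _)
      rw [← hB.off_diagonal i j s b l hbl, jacobiCoef, jacobiCoef, ← Finset.sum_add_distrib]
      refine Finset.sum_congr rfl fun a _ => ?_
      ring
    · intro b l _
      have h1 : dd e ⟨.lie, b⟩ (dd e ⟨.lie, l⟩ x) - dd e ⟨.lie, l⟩ (dd e ⟨.lie, b⟩ x) =
          defectLie (e := e) Γ K l b x +
            ∑ r, cf (K := K) Γ R .lie r b l * dd e ⟨.lie, r⟩ x := by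
        rw [defectLie]; ring
      rw [h1, mul_add, Finset.mul_sum]
      refine J.add_mem (J.mul_mem_left _ (h _ _)) (J.sum_mem fun r _ => ?_)
      -- If `b` is null, the factors `α` with `b` as last index vanish; otherwise the
      -- Lie-coefficients `c^{bl}` do. So commuting `∂_b` and `∂_l` leaves no first-order term.
      by_cases hb : b ∈ (𝓓 .lie).null
      · rw [jacobiCoef_eq_zero_of_null hb]; simp
      · rw [cf_eq, cf_eq_zero_of_not_null (fun h => hb h.2)]; simp

/-- The Jacobi identity with two equal indices: the other two cyclic terms cancel by skew-symmetry.
-/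
theorem CoefRelations.squareOp_comm_mem (hB : CoefRelations (K := K) Γ eK) (he : IsDRing eK e)
    (J : Ideal R) {x : R} (h : ∀ p q, defectLie (e := e) Γ K p q x ∈ J) (p s : Fin (𝓓 .lie).m) :
    dd e ⟨.lie, s⟩ (squareOp Γ e K p x) - squareOp Γ e K p (dd e ⟨.lie, s⟩ x) ∈ J := by
  have h1 := hB.jacobi_mem he J h p p s
  rw [hB.defectLie_swap p s, hB.defectLie_swap p s, defectLie_self, defectLie_self] at h1
  convert h1 using 1
  simp only [map_neg]
  ring

end JacobiIdentity

/-! ### Consistency of the Lie rewriting on normal words -/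

section PBW

variable {k F K : Type*} [Field k] [Field F] [Field K] [Algebra k F] [Algebra k K] [Algebra F K]
  [IsScalarTower k F K] {𝓓 : OpType → LocalOperatorSystem k}

open LocalOperatorSystem MvPolynomial

variable {Γ : LHSSystem 𝓓 F} {eK : ∀ u, K →ₐ[k] (𝓓 u).Alg ⊗[k] K}
  (hB : CoefRelations (K := K) Γ eK)

theorem IsNormal.lie_cons_or {σ : List (Idx 𝓓)} (h : IsNormal σ) (j : Fin (𝓓 .lie).m) :
    IsNormal ((⟨.lie, j⟩ : Idx 𝓓) :: σ) ∨ ∃ s τ, σ = (⟨.lie, s⟩ : Idx 𝓓) :: τ ∧ j < s := by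
  have h2 : ∀ (hh : ∀ a ∈ σ, Idx.rank a ≤ Idx.rank (𝓓 := 𝓓) ⟨.lie, j⟩),
      IsNormal ((⟨.lie, j⟩ : Idx 𝓓) :: σ) := fun hh =>
    ⟨List.pairwise_cons.2 ⟨hh, h.1⟩, by simpa using h.2⟩
  rcases σ with _ | ⟨⟨_ | _, s⟩, τ⟩
  · left; exact h2 (by simp)
  · rcases lt_or_ge j s with hj | hj
    · exact Or.inr ⟨s, τ, rfl, hj⟩
    · left
      refine h2 fun a ha => ?_
      rcases List.mem_cons.1 ha with rfl | ha
      · exact Idx.rank_le_rank.2 hj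
      · exact ((List.pairwise_cons.1 h.1).1 a ha).trans (Idx.rank_le_rank.2 hj)
  · left
    refine h2 fun a ha => ?_
    rcases List.mem_cons.1 ha with rfl | ha
    · exact (Idx.rank_hs_lt_lie _ _).le
    · exact ((List.pairwise_cons.1 h.1).1 a ha).trans (Idx.rank_hs_lt_lie _ _).le

include hB

theorem defectLie_X_mem_succ_of {σ : List (Idx 𝓓)} (hσ : IsNormal σ)
    (h : ∀ p q, p ≠ q → defectLie (e := wordE Γ eK) Γ K p q (X σ) ∈ squareIdeal Γ eK σ.length)
    (p q : Fin (𝓓 .lie).m) :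
    defectLie (e := wordE Γ eK) Γ K p q (X σ) ∈ squareIdeal Γ eK (σ.length + 1) := by
  by_cases hpq : p = q
  · subst hpq
    rw [defectLie_self]
    exact neg_mem (squareOp_X_mem hσ (Nat.lt_succ_self _) p)
  · exact squareIdeal_mono (Nat.le_succ _) (h p q hpq)

/-- The derivative of a generator at `τ` is congruent to the square operator applied to `∂_s X_τ`,
and the latter involves words at most one letter longer than `τ`. The hypothesis is supplied by the
induction in which this is used. -/
theorem dd_squareIdeal_of {n : ℕ}
    (h : ∀ τ : List (Idx 𝓓), IsNormal τ → τ.length < n → ∀ p q,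
      defectLie (e := wordE Γ eK) Γ K p q (X τ) ∈ squareIdeal Γ eK (τ.length + 1))
    {f : WordRing K 𝓓} (hf : f ∈ squareIdeal Γ eK n) (s : Fin (𝓓 .lie).m) :
    dd (wordE Γ eK) ⟨.lie, s⟩ f ∈ squareIdeal Γ eK (n + 1) := by
  -- All `∂_s` are treated together with membership itself, since `∂_s` of a multiple of a generator
  -- involves other `∂_q` of that generator.
  have key : f ∈ squareIdeal Γ eK (n + 1) ∧ ∀ s : Fin (𝓓 .lie).m,
      dd (wordE Γ eK) ⟨.lie, s⟩ f ∈ squareIdeal Γ eK (n + 1) := by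
    refine Submodule.span_induction ?_ ⟨zero_mem _, fun s => by rw [map_zero]; exact zero_mem _⟩
      ?_ ?_ hf
    · rintro f ⟨p, τ, h1, h2, rfl⟩
      refine ⟨squareOp_X_mem h1 (h2.trans n.lt_succ_self) p, fun s => ?_⟩
      have h3 := squareIdeal_mono (N' := n + 1) (by omega)
        (hB.squareOp_comm_mem hB.isDRing_word _ (h τ h1 h2) p s)
      refine (Submodule.sub_mem_iff_left _ (squareOp_mem hB ?_ p)).1 h3
      rw [dd_wordE_X]
      refine supported_mono ?_ (wordD_mem_supported hB.toBaseRelations hB.lie_const h1 _)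
      rintro η ⟨h4, h5⟩
      refine ⟨h4, ?_⟩
      rcases h5 with h5 | h5
      · have := h5.length_eq
        simp at this
        omega
      · omega
    · rintro x y _ _ ⟨h1, h2⟩ ⟨h3, h4⟩
      exact ⟨add_mem h1 h3, fun s => by rw [map_add]; exact add_mem (h2 s) (h4 s)⟩
    · rintro a x _ ⟨h1, h2⟩
      refine ⟨Ideal.mul_mem_left _ _ h1, fun s => ?_⟩
      rw [smul_eq_mul, hB.isDRing_word.dd_mul]
      refine add_mem (add_mem (Ideal.mul_mem_left _ _ (h2 s)) (Ideal.mul_mem_left _ _ h1))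
        (sum_mem fun p _ => sum_mem fun q _ => ?_)
      rw [← mul_smul_comm, mul_comm, smul_mul_assoc, mul_comm, ← smul_mul_assoc]
      exact Ideal.mul_mem_left _ _ (h2 q)
  exact key.2 s

/-- If the larger letter can stand in front of `σ`, the relation is built into the normal forms.
Otherwise `σ = sτ` with `s` larger than both letters, and the Jacobi identity at `τ` trades the
defect for defects involving `s`. The bound `σ.length`, sharper than for equal indices, leaves room
for the one differentiation in this step. -/
theorem defectLie_X_mem {σ : List (Idx 𝓓)} (hσ : IsNormal σ) {i j : Fin (𝓓 .lie).m} (hij : i ≠ j) :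
    defectLie (e := wordE Γ eK) Γ K i j (X σ) ∈ squareIdeal Γ eK σ.length := by
  obtain ⟨n, hn⟩ : ∃ n, σ.length < n := ⟨_, Nat.lt_succ_self _⟩
  induction n generalizing σ i j with
  | zero => omega
  | succ n ih =>
    have ih' : ∀ τ : List (Idx 𝓓), IsNormal τ → τ.length < n → ∀ p q,
        defectLie (e := wordE Γ eK) Γ K p q (X τ) ∈ squareIdeal Γ eK (τ.length + 1) :=
      fun τ h1 h2 => defectLie_X_mem_succ_of hB h1 fun p q hpq => ih h1 hpq h2
    have main : ∀ {i j : Fin (𝓓 .lie).m}, i < j →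
        defectLie (e := wordE Γ eK) Γ K j i (X σ) ∈ squareIdeal Γ eK σ.length := by
      intro i j hij
      rcases hσ.lie_cons_or j with h | ⟨s, τ, rfl, hjs⟩
      · rw [defectLie_X_of_lt hB.toBaseRelations hB.lie_const hij h]
        exact zero_mem _
      · have hτ : IsNormal τ := hσ.tail
        have hlen : τ.length < n := by simpa using hn
        set J := squareIdeal Γ eK ((⟨.lie, s⟩ : Idx 𝓓) :: τ).length with hJ
        have hJ' : squareIdeal Γ eK (τ.length + 1) = J := by rw [hJ, List.length_cons]
        have hX : (X ((⟨.lie, s⟩ : Idx 𝓓) :: τ) : WordRing K 𝓓) =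
            dd (wordE Γ eK) ⟨.lie, s⟩ (X τ) := by
          rw [dd_wordE_X, wordD_of_isNormal_cons _ _ hσ]
        have h1 : ∀ p q, defectLie (e := wordE Γ eK) Γ K p q (X τ) ∈ J := by
          rw [← hJ']; exact ih' τ hτ hlen
        have h2 : ∀ p q t, p ≠ q → dd (wordE Γ eK) ⟨.lie, t⟩
            (defectLie (e := wordE Γ eK) Γ K p q (X τ)) ∈ J := by
          intro p q t hpq
          rw [← hJ']
          exact dd_squareIdeal_of hB (fun τ' h3 h4 => ih' τ' h3 (h4.trans hlen)) (ih hτ hpq hlen) t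
        -- As `s` is the largest letter, it can stand in front of `ins p τ`, where the defect
        -- vanishes by construction. The difference between `∂_p X_τ` and this variable involves
        -- only words no longer than `τ`, covered by induction.
        have h3 : ∀ p q, p < s → q < s → defectLie (e := wordE Γ eK) Γ K s q
            (dd (wordE Γ eK) ⟨.lie, p⟩ (X τ)) ∈ J := by
          intro p q hp hq
          have h4 : IsNormal ((⟨.lie, s⟩ : Idx 𝓓) :: ins ⟨.lie, p⟩ τ) := by
            refine ⟨List.pairwise_cons.2 ⟨fun a ha => ?_, pairwise_ins _ hτ.1⟩, ?_⟩
            · rcases List.mem_cons.1 ((perm_ins _ _).mem_iff.1 ha) with rfl | ha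
              · exact (Idx.rank_lt_rank.2 hp).le
              · exact (List.pairwise_cons.1 hσ.1).1 a ha
            · simpa using (isNormal_ins_lie hτ).2
          have h5 := defectLie_X_of_lt hB.toBaseRelations hB.lie_const hq h4
          have h6 := wordD_sub_mem_supported hB.toBaseRelations hB.lie_const (i := ⟨.lie, p⟩) hτ
            (isNormal_ins_lie hτ)
          have h7 := defectLie_mem_of_supported hB J (fun ξ hξ p q => ?_) h6 s q
          · rw [← dd_wordE_X] at h7
            have h8 : ∀ x y : WordRing K 𝓓, defectLie (e := wordE Γ eK) Γ K s q (x - y) =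
                defectLie (e := wordE Γ eK) Γ K s q x - defectLie (e := wordE Γ eK) Γ K s q y := by
              intro x y
              simp only [defectLie, map_sub, mul_sub, Finset.sum_sub_distrib]
              ring
            rw [h8, h5, sub_zero] at h7
            exact h7
          · rw [← hJ']
            exact squareIdeal_mono (Nat.succ_le_succ hξ.2) (ih' ξ hξ.1 (hξ.2.trans_lt hlen) p q)
        have h4 := hB.jacobi_mem hB.isDRing_word J h1 i j s
        have his := hij.trans hjs
        rw [hX]
        have h5 := J.sub_mem (h3 i j his hjs) (h2 s j i hjs.ne')
        have h6 : defectLie (e := wordE Γ eK) Γ K i s (dd (wordE Γ eK) ⟨.lie, j⟩ (X τ)) -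
            dd (wordE Γ eK) ⟨.lie, j⟩ (defectLie (e := wordE Γ eK) Γ K i s (X τ)) ∈ J := by
          refine J.sub_mem ?_ (h2 i s j his.ne)
          rw [hB.defectLie_swap]
          exact J.neg_mem (h3 j i hjs his)
        have h7 := (Submodule.add_mem_iff_left _ h5).1 ((Submodule.add_mem_iff_left _ h6).1 h4)
        exact (Submodule.sub_mem_iff_left _ (h2 j i s hij.ne')).1 h7
    rcases lt_or_gt_of_ne hij with h | h
    · rw [hB.defectLie_swap]
      exact neg_mem (main h)
    · exact main h

theorem defectLie_X_mem_succ {σ : List (Idx 𝓓)} (hσ : IsNormal σ) (i j : Fin (𝓓 .lie).m) :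
    defectLie (e := wordE Γ eK) Γ K i j (X σ) ∈ squareIdeal Γ eK (σ.length + 1) :=
  defectLie_X_mem_succ_of hB hσ (fun _ _ h => defectLie_X_mem hB hσ h) i j

theorem squareOp_X_comm_mem {σ : List (Idx 𝓓)} (hσ : IsNormal σ) (p s : Fin (𝓓 .lie).m) :
    dd (wordE Γ eK) ⟨.lie, s⟩ (squareOp Γ (wordE Γ eK) K p (X σ)) -
      squareOp Γ (wordE Γ eK) K p (dd (wordE Γ eK) ⟨.lie, s⟩ (X σ)) ∈
      squareIdeal Γ eK (σ.length + 1) :=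
  hB.squareOp_comm_mem hB.isDRing_word _ (defectLie_X_mem_succ hB hσ) p s

end PBW

/-! ### Evaluation of normal forms -/

section WordEval

variable {k F K : Type*} [Field k] [Field F] [Field K] [Algebra k F] [Algebra k K] [Algebra F K]
  [IsScalarTower k F K] {𝓓 : OpType → LocalOperatorSystem k}

open LocalOperatorSystem MvPolynomial

variable {Γ : LHSSystem 𝓓 F} {eK : ∀ u, K →ₐ[k] (𝓓 u).Alg ⊗[k] K}
  (hB : CoefRelations (K := K) Γ eK)
include hB

/-- Evaluation of words intertwines the operators on the word ring with those of a partial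
`𝓓`-ring as soon as it does so on the relevant words. -/
theorem crd_aeval {R S : Type*} [CommRing R] [Algebra k R] [Algebra K R] [IsScalarTower k K R]
    [CommRing S] [Algebra k S] [Algebra K S] [IsScalarTower k K S] {u : OpType}
    {e : R →ₐ[k] (𝓓 u).Alg ⊗[k] S}
    (hK : ∀ c, e (algebraMap K R c) = (𝓓 u).map (IsScalarTower.toAlgHom k K S) (eK u c))
    {b : List (Idx 𝓓) → R} {a : List (Idx 𝓓) → S} {T : Set (List (Idx 𝓓))} {i : Fin (𝓓 u).m}
    (h0 : ∀ ξ ∈ T, (𝓓 u).crd 0 (e (b ξ)) = a ξ)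
    (h : ∀ ξ ∈ T, ∀ p ≤ i, (𝓓 u).crd p.succ (e (b ξ)) = aeval a (wordD Γ eK ⟨u, p⟩ ξ))
    {f : WordRing K 𝓓} (hf : f ∈ supported K T) :
    (𝓓 u).crd i.succ (e (aeval b f)) = aeval a (dd (wordE Γ eK) ⟨u, i⟩ f) := by
  have key := crd_eq_of_mem_supported (i := i.succ) (𝒟 := 𝓓 u)
    (φ := e.comp ((aeval b : WordRing K 𝓓 →ₐ[K] R).restrictScalars k))
    (ψ := ((𝓓 u).map ((aeval a : WordRing K 𝓓 →ₐ[K] S).restrictScalars k)).comp (wordE Γ eK u))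
    (s := T) ?_ ?_ hf
  · refine Eq.trans key ?_
    rw [AlgHom.comp_apply, crd_map]
    rfl
  · intro c
    have h1 : wordE Γ eK u (C c) = (𝓓 u).map (IsScalarTower.toAlgHom k K _) (eK u c) :=
      hB.isDRing_word.map_algebraMap u c
    simp only [AlgHom.comp_apply]
    rw [h1]
    refine (𝓓 u).crd_ext fun p => ?_
    rw [crd_map, crd_map]
    change (𝓓 u).crd p (e (aeval b (C c))) = aeval a (C _)
    rw [aeval_C, aeval_C, hK, crd_map]
    rfl
  · intro ξ hξ p hp
    simp only [AlgHom.comp_apply]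
    rw [crd_map]
    change (𝓓 u).crd p (e (aeval b (X ξ))) = aeval a _
    rw [aeval_X]
    revert hp
    refine Fin.cases (fun _ => ?_) (fun p hp => ?_) p
    · rw [h0 ξ hξ, hB.isDRing_word.crd_zero, aeval_X]
    · rw [h ξ hξ p (Fin.succ_le_succ_iff.1 hp), crd_succ_eq_dd, dd_wordE_X]

theorem wordD_lie_cons {i j : Fin (𝓓 .lie).m} (hij : i < j) {ξ : List (Idx 𝓓)}
    (h : IsNormal ((⟨.lie, j⟩ : Idx 𝓓) :: ξ)) :
    wordD Γ eK ⟨.lie, i⟩ (⟨.lie, j⟩ :: ξ) = dd (wordE Γ eK) ⟨.lie, j⟩ (wordD Γ eK ⟨.lie, i⟩ ξ) +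
      ∑ l, C (cf (K := K) Γ K .lie l i j) * wordD Γ eK ⟨.lie, l⟩ ξ := by
  have h1 := defectLie_X_of_lt hB.toBaseRelations hB.lie_const hij h
  rw [defectLie, dd_wordE_X, wordD_of_isNormal_cons _ _ h, sub_sub, sub_eq_zero] at h1
  simp only [dd_wordE_X] at h1
  exact h1

theorem wordD_hs_lie_cons (i : Fin (𝓓 .hs).m) {j : Fin (𝓓 .lie).m} {ξ : List (Idx 𝓓)}
    (h : IsNormal ((⟨.lie, j⟩ : Idx 𝓓) :: ξ)) :
    wordD Γ eK ⟨.hs, i⟩ (⟨.lie, j⟩ :: ξ) =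
      dd (wordE Γ eK) ⟨.lie, j⟩ (wordD Γ eK ⟨.hs, i⟩ ξ) := by
  have h1 := defectMix_X hB.toBaseRelations hB.lie_const hB.hs_const h.tail j i
  rw [defectMix, sub_eq_zero, dd_wordE_X, wordD_of_isNormal_cons _ _ h] at h1
  simp only [dd_wordE_X] at h1
  exact h1

end WordEval

theorem IsNormal.eq_nil_of_hs {k : Type*} [Field k] {𝓓 : OpType → LocalOperatorSystem k}
    {j : Fin (𝓓 .hs).m} {ξ : List (Idx 𝓓)} (h : IsNormal ((⟨.hs, j⟩ : Idx 𝓓) :: ξ)) : ξ = [] := by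
  rcases ξ with _ | ⟨⟨_ | _, l⟩, ξ⟩
  · rfl
  · have := (List.pairwise_cons.1 h.1).1 _ (List.mem_cons_self)
    exact absurd (Idx.rank_hs_lt_lie j l) (not_lt.2 this)
  · have := h.2
    simp at this

/-! ### Kernels are generated by normal words -/

section Kernel

variable {k F K L : Type*} [Field k] [Field F] [Field K] [Field L] [Algebra k F] [Algebra k K]
  [Algebra k L] [Algebra F K] [Algebra K L] [IsScalarTower k F K] [IsScalarTower k K L]
  {𝓓 : OpType → LocalOperatorSystem k} {Γ : LHSSystem 𝓓 F}
  {eK : ∀ u, K →ₐ[k] (𝓓 u).Alg ⊗[k] K} {n s : ℕ} (𝓛 : DKernel eK n s L)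

open LocalOperatorSystem MvPolynomial

/-- The element `a^ξ_t`, for `|ξ| < s`, of the domain of the operators of a kernel. -/
def DKernel.elt (ξ : List (Idx 𝓓)) (t : Fin n) (h : ξ.length < s) : levelField K 𝓛.a s :=
  ⟨𝓛.a ξ t, IntermediateField.subset_adjoin K _ ⟨ξ, t, h, rfl⟩⟩

theorem DKernel.crd_zero_e (u : OpType) (x : levelField K 𝓛.a s) :
    (𝓓 u).crd 0 (𝓛.e u x) = x := (isOperator_iff _).1 (𝓛.isOperator u) x

theorem DKernel.crd_succ_elt (u : OpType) (i : Fin (𝓓 u).m) {ξ : List (Idx 𝓓)} {t : Fin n}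
    (h : ξ.length < s) : (𝓓 u).crd i.succ (𝓛.e u (𝓛.elt ξ t h)) = 𝓛.a (⟨u, i⟩ :: ξ) t := by
  rw [DKernel.elt, 𝓛.e_apply u ξ t h, crd_succ_std]

theorem DKernel.e_algebraMap (u : OpType) (c : K) :
    𝓛.e u (algebraMap K (levelField K 𝓛.a s) c) =
      (𝓓 u).map (IsScalarTower.toAlgHom k K L) (eK u c) :=
  (AlgHom.congr_fun (𝓛.extends_base u) c).symm

variable {𝓛}

theorem DKernel.crd_eq_elt {u : OpType} {ξ : List (Idx 𝓓)} {t : Fin n} (h : ξ.length + 1 < s)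
    {y : (𝓓 u).Alg ⊗[k] levelField K 𝓛.a s}
    (hy : (𝓓 u).map ((levelField K 𝓛.a s).val.restrictScalars k) y =
      𝓛.e u (𝓛.elt ξ t (by omega))) (i : Fin (𝓓 u).m) :
    (𝓓 u).crd i.succ y = 𝓛.elt (⟨u, i⟩ :: ξ) t (by simpa using h) := by
  apply Subtype.ext
  have h1 := congrArg ((𝓓 u).crd i.succ) hy
  rw [crd_map, 𝓛.crd_succ_elt] at h1
  exact h1

theorem DKernel.lie_relation (h𝓛 : 𝓛.IsDGammaKernel Γ) {ξ : List (Idx 𝓓)} (t : Fin n)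
    (h : ξ.length + 1 < s) (p q : Fin (𝓓 .lie).m) :
    𝓛.a (⟨.lie, q⟩ :: ⟨.lie, p⟩ :: ξ) t = 𝓛.a (⟨.lie, p⟩ :: ⟨.lie, q⟩ :: ξ) t +
      ∑ l, cf (K := K) Γ L .lie l q p * 𝓛.a (⟨.lie, l⟩ :: ξ) t := by
  obtain ⟨y₁, y₂, h1, h2, h3⟩ := h𝓛.2.lie (𝓛.elt ξ t (by omega))
    (IntermediateField.subset_adjoin K _ ⟨ξ, t, by omega, rfl⟩)
  have h4 := congrArg (fun z => (𝓓 .lie).crd q.succ ((𝓓 .lie).crd p.succ z)) h3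
  rw [crd_map, crd_liftOp_lie Γ.isLieType, DKernel.crd_eq_elt h h1,
    DKernel.crd_eq_elt h h2, 𝓛.crd_succ_elt, 𝓛.crd_succ_elt] at h4
  rw [h4]
  congr 1
  refine Finset.sum_congr rfl fun l _ => ?_
  rw [sum_ite_succ (fun a b => baseMap k F K L (Γ.c .lie l a b)),
    DKernel.crd_eq_elt h h2, 𝓛.crd_zero_e]
  rfl

theorem DKernel.hs_relation (h𝓛 : 𝓛.IsDGammaKernel Γ) {ξ : List (Idx 𝓓)} (t : Fin n)
    (h : ξ.length + 1 < s) (p q : Fin (𝓓 .hs).m) :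
    𝓛.a (⟨.hs, q⟩ :: ⟨.hs, p⟩ :: ξ) t =
      ∑ l, cf (K := K) Γ L .hs l q p * 𝓛.a (⟨.hs, l⟩ :: ξ) t := by
  obtain ⟨y₁, y₂, h1, h2, h3⟩ := h𝓛.2.hs (𝓛.elt ξ t (by omega))
    (IntermediateField.subset_adjoin K _ ⟨ξ, t, by omega, rfl⟩)
  have h4 := congrArg (fun z => (𝓓 .hs).crd q.succ ((𝓓 .hs).crd p.succ z)) h3
  rw [crd_map, crd_liftIota Γ.isHSType, DKernel.crd_eq_elt h h1, 𝓛.crd_succ_elt,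
    if_neg (Fin.succ_ne_zero _).symm, if_neg (Fin.succ_ne_zero _).symm, zero_add] at h4
  rw [h4]
  refine Finset.sum_congr rfl fun l _ => ?_
  rw [sum_ite_succ (fun a b => baseMap k F K L (Γ.c .hs l a b)),
    DKernel.crd_eq_elt h h2]
  rfl

theorem DKernel.mix_relation (h𝓛 : 𝓛.IsDGammaKernel Γ) {ξ : List (Idx 𝓓)} (t : Fin n)
    (h : ξ.length + 1 < s) (p : Fin (𝓓 .lie).m) (q : Fin (𝓓 .hs).m) :
    𝓛.a (⟨.hs, q⟩ :: ⟨.lie, p⟩ :: ξ) t = 𝓛.a (⟨.lie, p⟩ :: ⟨.hs, q⟩ :: ξ) t := by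
  obtain ⟨y₁, y₂, h1, h2, h3⟩ := h𝓛.2.mixed (𝓛.elt ξ t (by omega))
    (IntermediateField.subset_adjoin K _ ⟨ξ, t, by omega, rfl⟩)
  have h4 := congrArg (fun z => (𝓓 .hs).crd q.succ ((𝓓 .lie).crd p.succ z)) h3
  rw [crd_map, crd_liftOp_canonical, DKernel.crd_eq_elt h h1,
    DKernel.crd_eq_elt h h2, 𝓛.crd_succ_elt, 𝓛.crd_succ_elt] at h4
  exact h4

theorem DKernel.crd_e_aeval (hB : CoefRelations (K := K) Γ eK) {t : Fin n} {u : OpType}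
    {j : Fin (𝓓 u).m} {T : Set (List (Idx 𝓓))} (hT : ∀ ξ ∈ T, ξ.length < s)
    (h : ∀ ξ ∈ T, ∀ p ≤ j, 𝓛.a (⟨u, p⟩ :: ξ) t =
      aeval (fun ξ => 𝓛.a ξ t) (wordD Γ eK ⟨u, p⟩ ξ)) {f : WordRing K 𝓓}
    (hf : f ∈ supported K T) {y : levelField K 𝓛.a s}
    (hy : (y : L) = aeval (fun ξ => 𝓛.a ξ t) f) :
    (𝓓 u).crd j.succ (𝓛.e u y) =
      aeval (fun ξ => 𝓛.a ξ t) (dd (wordE Γ eK) ⟨u, j⟩ f) := by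
  classical
  -- The domain of the operators contains `a^ξ` only for `|ξ| < s`; longer words do not occur in `f`
  -- and may be given the value zero.
  set b : List (Idx 𝓓) → levelField K 𝓛.a s :=
    fun ξ => if h : ξ.length < s then 𝓛.elt ξ t h else 0 with hb
  have hbT : ∀ ξ (hξ : ξ ∈ T), b ξ = 𝓛.elt ξ t (hT ξ hξ) := fun ξ hξ => dif_pos (hT ξ hξ)
  have hyb : y = aeval b f := by
    apply Subtype.ext
    rw [hy]
    have h1 : ((aeval b f : levelField K 𝓛.a s) : L) = aeval (fun ξ => (b ξ : L)) f := by
      change (levelField K 𝓛.a s).val (aeval b f) = _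
      rw [MvPolynomial.comp_aeval_apply]
      rfl
    rw [h1]
    refine MvPolynomial.eval₂Hom_congr' rfl ?_ rfl
    intro ξ hξ _
    rw [hbT ξ (MvPolynomial.mem_supported.1 hf hξ)]
    rfl
  rw [hyb]
  refine crd_aeval hB (𝓛.e_algebraMap u) (T := T) ?_ ?_ hf
  · intro ξ hξ
    rw [𝓛.crd_zero_e, hbT ξ hξ]
    rfl
  · intro ξ hξ p hp
    rw [hbT ξ hξ, 𝓛.crd_succ_elt]
    exact h ξ hξ p hp

/-- In a kernel, the `a^{(i,ξ)}` with normal `ξ` are expressed by the words in normal form. -/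
theorem DKernel.a_cons_eq (h𝓛 : 𝓛.IsDGammaKernel Γ) (hB : CoefRelations (K := K) Γ eK) (t : Fin n)
    (i : Idx 𝓓) {ξ : List (Idx 𝓓)} (hn : IsNormal ξ) (h : ξ.length < s) :
    𝓛.a (i :: ξ) t = aeval (fun ξ => 𝓛.a ξ t) (wordD Γ eK i ξ) := by
  have main : ∀ (x : List (Idx 𝓓) × Fin n) (i : Idx 𝓓) (ξ : List (Idx 𝓓)), x.1 = i :: ξ →
      x.2 = t → IsNormal ξ → ξ.length < s →
      𝓛.a (i :: ξ) t = aeval (fun ξ => 𝓛.a ξ t) (wordD Γ eK i ξ) := by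
    intro x
    induction x using wellFounded_triLT.induction with
    | _ x ih =>
    rintro i ξ hx ht hn h
    have ih' : ∀ (i' : Idx 𝓓) (ξ' : List (Idx 𝓓)), IsNormal ξ' → ξ'.length < s →
        TriLT (i' :: ξ', t) (i :: ξ, t) →
        𝓛.a (i' :: ξ') t = aeval (fun ξ => 𝓛.a ξ t) (wordD Γ eK i' ξ') := by
      intro i' ξ' h1 h2 h3
      refine ih (i' :: ξ', t) ?_ i' ξ' rfl rfl h1 h2
      rwa [show x = (i :: ξ, t) from Prod.ext hx ht]
    -- `∂_j` is applied to the normal form of `∂_i a^{ξ'}`. Components `p < j` appear as well, but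
    -- lead to smaller indices; for `p = j` and a word of full length, `j` goes in front and the
    -- result is already normal.
    have step : ∀ (j : Fin (𝓓 .lie).m) (ξ' : List (Idx 𝓓)), ξ = ⟨.lie, j⟩ :: ξ' →
        i.rank < Idx.rank (𝓓 := 𝓓) ⟨.lie, j⟩ → 𝓛.a (⟨.lie, j⟩ :: i :: ξ') t =
          aeval (fun ξ => 𝓛.a ξ t) (dd (wordE Γ eK) ⟨.lie, j⟩ (wordD Γ eK i ξ')) := by
      rintro j ξ' rfl hj
      have h1 : (i :: ξ').length < s := by simpa using h
      rw [← 𝓛.crd_succ_elt .lie j h1]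
      refine DKernel.crd_e_aeval hB ?_ ?_
        (wordD_mem_supported hB.toBaseRelations hB.lie_const hn.tail i) ?_
      · rintro η ⟨-, hη | hη⟩
        · rwa [hη.length_eq]
        · simp at h1; omega
      · rintro η ⟨hη, hη'⟩ p hp
        rcases hη' with hη' | hη'
        · rcases hp.lt_or_eq with hp | rfl
          · refine ih' _ _ hη (by rwa [hη'.length_eq]) ?_
            refine (triLT_cons_of_rank_lt η t (Idx.rank_lt_rank.2 hp)).congr (List.Perm.refl _) rfl
              ?_ rfl
            exact (List.Perm.cons _ hη').trans (List.Perm.swap _ _ _)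
          · rw [wordD_of_isNormal_cons, aeval_X]
            refine ⟨List.pairwise_cons.2 ⟨fun a ha => ?_, hη.1⟩, by simpa using hη.2⟩
            rcases List.mem_cons.1 (hη'.mem_iff.1 ha) with rfl | ha
            · exact hj.le
            · exact (List.pairwise_cons.1 hn.1).1 a ha
        · refine ih' _ _ hη (by simp at h1; omega) (triLT_of_length_lt ?_)
          simp; omega
      · exact ih' i ξ' hn.tail (by simp at h1; omega) (triLT_of_length_lt (by simp))
    by_cases hni : IsNormal (i :: ξ)
    · rw [wordD_of_isNormal_cons _ _ hni, aeval_X]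
    obtain ⟨_ | _, i⟩ := i
    · obtain ⟨j, ξ', rfl, hij⟩ := (hn.lie_cons_or i).resolve_left hni
      have h1 : ξ'.length + 1 < s := by simpa using h
      rw [DKernel.lie_relation h𝓛 t h1, step j ξ' rfl (Idx.rank_lt_rank.2 hij),
        wordD_lie_cons hB hij hn, map_add, map_sum]
      congr 1
      refine Finset.sum_congr rfl fun l _ => ?_
      rw [map_mul, aeval_C, ih' _ _ hn.tail (by omega) (triLT_of_length_lt (by simp))]
      rfl
    · rcases ξ with _ | ⟨⟨_ | _, j⟩, ξ'⟩
      · exact absurd ⟨by simp, by simp⟩ hni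
      · have h1 : ξ'.length + 1 < s := by simpa using h
        rw [DKernel.mix_relation h𝓛 t h1, step j ξ' rfl (Idx.rank_hs_lt_lie _ _),
          wordD_hs_lie_cons hB _ hn]
      · obtain rfl := hn.eq_nil_of_hs
        rw [DKernel.hs_relation h𝓛 t (by simpa using h)]
        have := wordD_hs_append Γ eK i j (ξ := []) (by intro a ha; simp at ha)
        rw [List.nil_append] at this
        rw [this, map_sum]
        refine Finset.sum_congr rfl fun l _ => ?_
        rw [map_mul, aeval_C, aeval_X]
        rfl
  exact main (i :: ξ, t) i ξ rfl rfl hn h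

theorem mem_supported_normal_of_wordD (hB : CoefRelations (K := K) Γ eK) {N : ℕ} {f : WordRing K 𝓓}
    (hf : f ∈ supported K {η : List (Idx 𝓓) | IsNormal η ∧ η.length < N}) (i : Idx 𝓓) :
    dd (wordE Γ eK) i f ∈ supported K {η : List (Idx 𝓓) | IsNormal η ∧ η.length < N + 1} := by
  have hss : {η : List (Idx 𝓓) | IsNormal η ∧ η.length < N} ⊆
      {η : List (Idx 𝓓) | IsNormal η ∧ η.length < N + 1} := by
    rintro η ⟨h1, h2⟩
    exact ⟨h1, h2.trans N.lt_succ_self⟩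
  obtain ⟨u, i⟩ := i
  refine dd_mem_supported hB.isDRing_word hss ?_ hf
  intro j _ ξ hξ
  rw [dd_wordE_X]
  refine supported_mono ?_ (wordD_mem_supported hB.toBaseRelations hB.lie_const hξ.1 _)
  rintro η ⟨h1, h2⟩
  have := hξ.2
  refine ⟨h1, ?_⟩
  rcases h2 with h2 | h2
  · rw [h2.length_eq, List.length_cons]; omega
  · omega

theorem DKernel.exists_aeval_eq (h𝓛 : 𝓛.IsDGammaKernel Γ) (hB : CoefRelations (K := K) Γ eK)
    (t : Fin n) {ξ : List (Idx 𝓓)} (h : ξ.length ≤ s) :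
    ∃ f ∈ supported K {η : List (Idx 𝓓) | IsNormal η ∧ η.length < ξ.length + 1},
      𝓛.a ξ t = aeval (fun ξ => 𝓛.a ξ t) f := by
  induction ξ with
  | nil => exact ⟨X [], X_mem_supported.2 ⟨isNormal_nil, by simp⟩, by rw [aeval_X]⟩
  | cons i ξ ih =>
    have h' : ξ.length < s := by simpa using h
    obtain ⟨f, hf, hfa⟩ := ih h'.le
    refine ⟨dd (wordE Γ eK) i f, mem_supported_normal_of_wordD hB hf i, ?_⟩
    obtain ⟨u, i⟩ := i
    rw [← 𝓛.crd_succ_elt u i h']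
    refine DKernel.crd_e_aeval hB (fun η hη => lt_of_lt_of_le hη.2 h') ?_ hf hfa
    intro η hη p _
    exact DKernel.a_cons_eq h𝓛 hB t _ hη.1 (lt_of_lt_of_le hη.2 h')

/-- The level fields of a kernel are generated by the `a^ξ` with normal `ξ`. -/
theorem DKernel.levelField_eq (h𝓛 : 𝓛.IsDGammaKernel Γ) (hB : CoefRelations (K := K) Γ eK)
    {N : ℕ} (hN : N ≤ s + 1) : levelField K 𝓛.a N = IntermediateField.adjoin K
      {z | ∃ (ξ : List (Idx 𝓓)) (t : Fin n), IsNormal ξ ∧ ξ.length < N ∧ z = 𝓛.a ξ t} := by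
  apply le_antisymm
  · refine IntermediateField.adjoin_le_iff.2 ?_
    rintro z ⟨ξ, t, h, rfl⟩
    obtain ⟨f, hf, hfa⟩ := DKernel.exists_aeval_eq h𝓛 hB t (ξ := ξ) (by omega)
    rw [hfa]
    refine algHom_mem_of_mem_supported (aeval fun ξ => 𝓛.a ξ t)
      (W := (IntermediateField.adjoin K _).toSubalgebra) ?_ hf
    intro η hη
    rw [aeval_X]
    exact IntermediateField.subset_adjoin K _ ⟨η, t, hη.1, by have := hη.2; omega, rfl⟩
  · refine IntermediateField.adjoin.mono _ _ _ ?_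
    rintro z ⟨ξ, t, -, h, rfl⟩
    exact ⟨ξ, t, h, rfl⟩

end Kernel

/-! ### Separability in terms of coefficients in a set -/

section Separable

variable {E : Type*} [Field E]

theorem isSeparable_iff_sepOver {F : Type*} [Field F] [Algebra F E] {b : E} :
    IsSeparable F b ↔ SepOver (Set.range (algebraMap F E)) b := by
  constructor
  · intro h
    refine ⟨(minpoly F b).map (algebraMap F E), fun n => ?_, Polynomial.Separable.map h, ?_⟩
    · rw [Polynomial.coeff_map]; exact ⟨_, rfl⟩
    · rw [Polynomial.eval_map_algebraMap, minpoly.aeval]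
  · rintro ⟨p, h1, h2, h3⟩
    obtain ⟨q, rfl⟩ : ∃ q : Polynomial F, q.map (algebraMap F E) = p :=
      (Polynomial.lifts_iff_coeff_lifts p).2 h1
    rw [Polynomial.separable_map] at h2
    rw [Polynomial.eval_map_algebraMap] at h3
    exact h2.of_dvd (minpoly.dvd F b h3)

theorem isSeparable_iff_sepOver_coe {K : Type*} [Field K] [Algebra K E]
    {G : IntermediateField K E} {b : E} : IsSeparable G b ↔ SepOver (G : Set E) b := by
  rw [isSeparable_iff_sepOver]
  have : Set.range (algebraMap G E) = (G : Set E) := Subtype.range_coe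
  rw [this]

theorem sepOver_map_iff {E' : Type*} [Field E'] (g : E →+* E') {Z : Set E} {b : E} :
    SepOver (g '' Z) (g b) ↔ SepOver Z b := by
  constructor
  · rintro ⟨p, h1, h2, h3⟩
    have h4 : ∀ n, p.coeff n ∈ Set.range g := fun n => by
      obtain ⟨x, -, hx⟩ := h1 n; exact ⟨x, hx⟩
    obtain ⟨q, rfl⟩ : ∃ q : Polynomial E, q.map g = p :=
      (Polynomial.lifts_iff_coeff_lifts p).2 h4
    refine ⟨q, fun n => ?_, (Polynomial.separable_map g).1 h2, ?_⟩
    · obtain ⟨x, hx, hx'⟩ := h1 n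
      rw [Polynomial.coeff_map] at hx'
      rwa [← g.injective hx']
    · rw [Polynomial.eval_map_apply] at h3
      exact (map_eq_zero g).1 h3
  · rintro ⟨p, h1, h2, h3⟩
    refine ⟨p.map g, fun n => ?_, h2.map, ?_⟩
    · rw [Polynomial.coeff_map]; exact ⟨_, h1 n, rfl⟩
    · rw [Polynomial.eval_map_apply, h3, map_zero]

theorem sepOver_of_mem {G : Subfield E} {b : E} (hb : b ∈ G) : SepOver (G : Set E) b := by
  refine ⟨Polynomial.X - Polynomial.C b, fun n => ?_, Polynomial.separable_X_sub_C, by simp⟩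
  rw [Polynomial.coeff_sub, Polynomial.coeff_X, Polynomial.coeff_C]
  refine G.sub_mem ?_ ?_
  · split_ifs
    exacts [G.one_mem, G.zero_mem]
  · split_ifs
    exacts [hb, G.zero_mem]

theorem isSeparable_of_sepOver_separableClosure {F : Type*} [Field F] [Algebra F E] {b : E}
    (h : SepOver (separableClosure F E : Set E) b) : IsSeparable F b :=
  IsSeparable.of_algebra_isSeparable_of_isSeparable F (E := separableClosure F E)
    (isSeparable_iff_sepOver_coe.2 h)

end Separable

/-! ### Independence from successive transcendence -/

section AlgebraicIndependent

theorem transcendental_adjoin_of_subset {R K A : Type*} [Field R] [Field K] [Field A] [Algebra R A]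
    [Algebra K A] {G : IntermediateField K A} {s : Set A} {b : A}
    (hR : ∀ c, algebraMap R A c ∈ G) (hs : s ⊆ G) (h : Transcendental G b) :
    Transcendental (Algebra.adjoin R s) b := by
  have hle : ∀ x ∈ Algebra.adjoin R s, x ∈ G := by
    intro x hx
    induction hx using Algebra.adjoin_induction with
    | mem x hx => exact hs hx
    | algebraMap c => exact hR c
    | add _ _ _ _ h1 h2 => exact G.add_mem h1 h2
    | mul _ _ _ _ h1 h2 => exact G.mul_mem h1 h2
  let f : Algebra.adjoin R s →+* G :=
    { toFun := fun x => ⟨x, hle x x.2⟩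
      map_one' := rfl
      map_mul' := fun _ _ => rfl
      map_zero' := rfl
      map_add' := fun _ _ => rfl }
  refine Transcendental.of_ringHom_of_comp_eq (S := G) (B := A) f (RingHom.id A) h ?_ ?_
  · intro x y hxy
    exact Subtype.ext (congrArg (fun z : G => (z : A)) hxy)
  · rfl

/-- In a finite subfamily the largest member is transcendental over the algebra generated by the
rest, so it can be split off. -/
theorem algebraicIndependent_of_transcendental {ι R A : Type*} [Field R] [Field A]
    [Algebra R A] (x : ι → A) (lt : ι → ι → Prop) (hirr : ∀ i, ¬ lt i i)
    (htrans : ∀ i j l, lt i j → lt j l → lt i l) (htri : ∀ i j, lt i j ∨ i = j ∨ lt j i)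
    (h : ∀ i, Transcendental (Algebra.adjoin R (x '' {j | lt j i})) (x i)) :
    AlgebraicIndependent R x := by
  classical
  refine algebraicIndependent_of_finite_type fun t ht => ?_
  obtain ⟨t, rfl⟩ := ht.exists_finset_coe
  clear ht
  induction hc : t.card generalizing t with
  | zero =>
    rw [Finset.card_eq_zero] at hc
    subst hc
    have : IsEmpty ((∅ : Finset ι) : Set ι) := by simp
    exact algebraicIndependent_empty_type_iff.2 (algebraMap R A).injective
  | succ n ih =>
    obtain ⟨i, hi, hmax⟩ : ∃ i ∈ t, ∀ j ∈ t, ¬ lt i j := by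
      let : Preorder ι :=
        { le := fun a b => lt a b ∨ a = b
          lt := lt
          le_refl := fun a => Or.inr rfl
          le_trans := by
            rintro a b c (h1 | rfl) (h2 | rfl)
            exacts [Or.inl (htrans _ _ _ h1 h2), Or.inl h1, Or.inl h2, Or.inr rfl]
          lt_iff_le_not_ge := by
            intro a b
            constructor
            · intro h1
              refine ⟨Or.inl h1, ?_⟩
              rintro (h2 | rfl)
              exacts [hirr _ (htrans _ _ _ h1 h2), hirr _ h1]
            · rintro ⟨h1 | rfl, h2⟩
              exacts [h1, absurd (Or.inr rfl) h2] }
      obtain ⟨i, hi⟩ := t.exists_maximal (Finset.card_pos.1 (by omega))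
      exact ⟨i, hi.1, fun j hj hij => (hirr i) (by
        rcases hi.2 hj (Or.inl hij) with h1 | h1
        · exact htrans _ _ _ hij h1
        · rwa [h1] at hij)⟩
    have h1 := ih (t.erase i) (by rw [Finset.card_erase_of_mem hi, hc]; rfl)
    have h2 : AlgebraicIndepOn R x (insert i ((t.erase i : Finset ι) : Set ι)) := by
      refine AlgebraicIndepOn.insert h1 ?_
      have h3 : Algebra.adjoin R (x '' ((t.erase i : Finset ι) : Set ι)) ≤
          Algebra.adjoin R (x '' {j | lt j i}) := by
        refine Algebra.adjoin_mono (Set.image_mono fun j hj => ?_)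
        obtain ⟨hj1, hj2⟩ := Finset.mem_erase.1 hj
        rcases htri j i with h4 | h4 | h4
        · exact h4
        · exact absurd h4 hj1
        · exact absurd h4 (hmax j hj2)
      refine Transcendental.of_ringHom_of_comp_eq (S := Algebra.adjoin R (x '' {j | lt j i}))
        (B := A) (Subalgebra.inclusion h3).toRingHom (RingHom.id A) (h i)
        (Subalgebra.inclusion_injective h3) rfl
    have h3 : insert i ((t.erase i : Finset ι) : Set ι) = (t : Set ι) := by
      rw [← Finset.coe_insert, Finset.insert_erase hi]
    rw [h3] at h2
    exact h2

end AlgebraicIndependent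

/-! ### Extending operators with prescribed values -/

section Extension

/-- Separable algebraic extensions are formally étale, hence lift along surjections with nilpotent
kernel. -/
theorem exists_lift_of_isSeparable {F M T A : Type*} [Field F] [Field M] [Algebra F M]
    [Algebra.IsSeparable F M] [CommRing T] [CommRing A] (π : T →+* A)
    (hπ : Function.Surjective π) (hker : IsNilpotent (RingHom.ker π)) (g : F →+* T) (φ : M →+* A)
    (h : π.comp g = φ.comp (algebraMap F M)) :
    ∃ G : M →+* T, G.comp (algebraMap F M) = g ∧ π.comp G = φ := by
  let : Algebra F T := g.toAlgebra
  let : Algebra F A := (φ.comp (algebraMap F M)).toAlgebra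
  let π' : T →ₐ[F] A := { π with commutes' := fun c => RingHom.congr_fun h c }
  let φ' : M →ₐ[F] A := { φ with commutes' := fun c => rfl }
  have := Algebra.FormallyEtale.of_isSeparable F M
  let G := Algebra.FormallySmooth.liftOfSurjective φ' π' hπ hker
  refine ⟨G, ?_, ?_⟩
  · ext c
    exact G.commutes c
  · ext x
    exact Algebra.FormallySmooth.liftOfSurjective_apply φ' π' hπ hker x

open LocalOperatorSystem MvPolynomial

/-- Operators extend to a separable algebraic extension of a purely transcendental extension, with
prescribed values on a transcendence basis. -/
theorem exists_extension {k B M A ι : Type*} [Field k] [Field B] [Field M] [Field A] [Algebra k B]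
    [Algebra k M] [Algebra k A] [Algebra B M] [IsScalarTower k B M] (𝒟 : LocalOperatorSystem k)
    {y : ι → M} (hy : AlgebraicIndependent B y)
    (hsep : Algebra.IsSeparable (IntermediateField.adjoin B (Set.range y)) M)
    (φ : M →ₐ[k] A) (g : B →ₐ[k] 𝒟.Alg ⊗[k] A) (hg : ∀ b, 𝒟.crd 0 (g b) = φ (algebraMap B M b))
    (v : ι → Fin 𝒟.m → A) : ∃ G : M →ₐ[k] 𝒟.Alg ⊗[k] A, (∀ x, 𝒟.crd 0 (G x) = φ x) ∧
      (∀ b, G (algebraMap B M b) = g b) ∧ ∀ s i, 𝒟.crd i.succ (G (y s)) = v s i := by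
  set P : MvPolynomial ι B →ₐ[k] 𝒟.Alg ⊗[k] A :=
    polyHom g fun s => 1 ⊗ₜ[k] φ (y s) + ∑ i, 𝒟.eps i ⊗ₜ[k] v s i with hP
  have hπP : ∀ f, 𝒟.crd 0 (P f) = φ (aeval y f) := by
    have : ((𝒟.residueOn A).comp P).toRingHom =
        φ.toRingHom.comp (aeval y : MvPolynomial ι B →ₐ[B] M).toRingHom := by
      apply MvPolynomial.ringHom_ext
      · intro c
        change 𝒟.residueOn A (P (C c)) = φ (aeval y (C c))
        rw [residueOn_eq_crd, hP, polyHom_C, hg, aeval_C]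
      · intro s
        change 𝒟.residueOn A (P (X s)) = φ (aeval y (X s))
        rw [residueOn_eq_crd, hP, polyHom_X, crd_zero_std, aeval_X]
    intro f
    rw [← residueOn_eq_crd]
    exact RingHom.congr_fun this f
  have hinj : Function.Injective (aeval y : MvPolynomial ι B →ₐ[B] M) :=
    algebraicIndependent_iff_injective_aeval.1 hy
  -- The zeroth coordinate of `P f` is the image of `f (y)`, nonzero by independence; so `P f` is a
  -- unit and `P` extends to rational functions.
  have hunit : ∀ f : nonZeroDivisors (MvPolynomial ι B), 
      IsUnit ((P : MvPolynomial ι B →+* 𝒟.Alg ⊗[k] A) (f : MvPolynomial ι B)) := by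
    intro f
    apply isUnit_of_crd_zero
    rw [isUnit_iff_ne_zero]
    change 𝒟.crd 0 (P f) ≠ 0
    rw [hπP, Ne, map_eq_zero, map_eq_zero_iff _ hinj]
    exact nonZeroDivisors.ne_zero f.2
  let Q : FractionRing (MvPolynomial ι B) →+* 𝒟.Alg ⊗[k] A := IsLocalization.lift hunit
  have hQ : ∀ f, Q (algebraMap _ _ f) = P f := fun f => IsLocalization.lift_eq hunit f
  set F := IntermediateField.adjoin B (Set.range y) with hF
  let g₁ : F →+* 𝒟.Alg ⊗[k] A := Q.comp hy.aevalEquivField.symm.toRingHom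
  have hg₁ : ∀ f : MvPolynomial ι B, ∀ z : F, (z : M) = aeval y f → g₁ z = P f := by
    intro f z hz
    rw [← hQ]
    change Q (hy.aevalEquivField.symm z) = _
    congr 1
    rw [AlgEquiv.symm_apply_eq]
    apply Subtype.ext
    rw [hy.aevalEquivField_algebraMap_apply_coe, hz]
  have hcomp : ((𝒟.residueOn A : _ →+* A)).comp g₁ = (φ : M →+* A).comp (algebraMap F M) := by
    have : (((𝒟.residueOn A : _ →+* A)).comp g₁).comp hy.aevalEquivField.toRingHom =
        ((φ : M →+* A).comp (algebraMap F M)).comp hy.aevalEquivField.toRingHom := by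
      apply IsLocalization.ringHom_ext (nonZeroDivisors (MvPolynomial ι B))
      refine RingHom.ext fun f => ?_
      change 𝒟.residueOn A (g₁ (hy.aevalEquivField (algebraMap _ _ f))) =
        φ (hy.aevalEquivField (algebraMap _ _ f) : F)
      rw [hg₁ f _ (hy.aevalEquivField_algebraMap_apply_coe f), residueOn_eq_crd, hπP,
        hy.aevalEquivField_algebraMap_apply_coe]
    ext z
    obtain ⟨w, rfl⟩ := hy.aevalEquivField.surjective z
    exact RingHom.congr_fun this w
  obtain ⟨G, hG1, hG2⟩ := exists_lift_of_isSeparable (𝒟.residueOn A : _ →+* A)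
    (fun a => ⟨1 ⊗ₜ[k] a, by
      change 𝒟.residueOn A _ = a
      rw [residueOn_eq_crd, crd_one_tmul_zero]⟩) 𝒟.isNilpotent_ker_residueOn g₁ (φ : M →+* A) hcomp
  have hGB : ∀ b, G (algebraMap B M b) = g b := by
    intro b
    have h1 : algebraMap B M b = algebraMap F M (algebraMap B F b) :=
      IsScalarTower.algebraMap_apply B F M b
    rw [h1, ← RingHom.comp_apply, hG1, hg₁ (C b), hP, polyHom_C]
    rw [aeval_C]; rfl
  refine ⟨{ G with commutes' := fun c => ?_ }, ?_, hGB, ?_⟩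
  · change G (algebraMap k M c) = _
    rw [IsScalarTower.algebraMap_apply k B M, hGB, AlgHom.commutes]
  · intro x
    rw [← residueOn_eq_crd]
    exact RingHom.congr_fun hG2 x
  · intro s i
    change 𝒟.crd i.succ (G (y s)) = _
    have h1 : y s = algebraMap F M ⟨y s, IntermediateField.subset_adjoin _ _ ⟨s, rfl⟩⟩ := rfl
    rw [h1, ← RingHom.comp_apply, hG1, hg₁ (X s) _ (by rw [aeval_X]), hP, polyHom_X, crd_succ_std]

end Extension

/-! ### Subfields defined by the components of an operator -/

section OpField

open LocalOperatorSystem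

variable {k : Type*} [Field k] {𝒟 : LocalOperatorSystem k} {E : Type*} [Field E] [Algebra k E]

/-- The elements whose coordinates under an operator, up to the `i`-th, lie in a subfield. -/
def opField (e : E →ₐ[k] 𝒟.Alg ⊗[k] E) (he : ∀ x, 𝒟.crd 0 (e x) = x) (i : Fin (𝒟.m + 1))
    (G : IntermediateField k E) : Subfield E where
  __ := (𝒟.coordSubring i G.toSubalgebra).comap (e : E →+* 𝒟.Alg ⊗[k] E)
  inv_mem' x hx := by
    rcases eq_or_ne x 0 with rfl | h0
    · rw [inv_zero]; exact hx
    have hx' : e x ∈ 𝒟.coordSubring i G.toSubalgebra := hx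
    obtain ⟨w, hw⟩ := (isUnit_coordSubring 𝒟 (w := ⟨e x, hx'⟩) (by
      change 𝒟.crd 0 (e x) ≠ 0
      rwa [he])).exists_right_inv
    have h1 : e x * (w : 𝒟.Alg ⊗[k] E) = 1 := congrArg Subtype.val hw
    have h2 : e x⁻¹ = w := by
      have h3 : e x⁻¹ * e x = 1 := by rw [← map_mul, inv_mul_cancel₀ h0, map_one]
      calc e x⁻¹ = e x⁻¹ * (e x * w) := by rw [h1, mul_one]
        _ = w := by rw [← mul_assoc, h3, one_mul]
    change e x⁻¹ ∈ 𝒟.coordSubring i G.toSubalgebra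
    rw [h2]
    exact w.2

theorem mem_opField {e : E →ₐ[k] 𝒟.Alg ⊗[k] E} {he : ∀ x, 𝒟.crd 0 (e x) = x}
    {i : Fin (𝒟.m + 1)} {G : IntermediateField k E} {x : E} :
    x ∈ opField e he i G ↔ ∀ p ≤ i, 𝒟.crd p (e x) ∈ G := Iff.rfl

end OpField

/-! ### Indices above leaders, and extensions of the kernel by new transcendentals -/

section Setting

variable {k F K L : Type*} [Field k] [Field F] [Field K] [Field L] [Algebra k F] [Algebra k K]
  [Algebra k L] [Algebra F K] [Algebra K L] [IsScalarTower k F K] [IsScalarTower k K L]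
  {𝓓 : OpType → LocalOperatorSystem k} {Γ : LHSSystem 𝓓 F}
  {eK : ∀ u, K →ₐ[k] (𝓓 u).Alg ⊗[k] K} {n s : ℕ} (𝓛 : DKernel eK n s L)

open LocalOperatorSystem MvPolynomial

/-- `x` lies above a minimal-separable leader of the kernel. -/
def DKernel.IsAbove (x : List (Idx 𝓓) × Fin n) : Prop := ∃ μ ∈ minSepLeaders K 𝓛.a s, ProdLE μ x

/-- The indices of the new transcendental elements of the principal realisation. -/
def DKernel.free : Set (List (Idx 𝓓) × Fin n) :=
  {x | IsNormal x.1 ∧ s < x.1.length ∧ ¬ 𝓛.IsAbove x}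

variable {𝓛}

theorem DKernel.isAbove_of_mem_sepLeaders {x : List (Idx 𝓓) × Fin n}
    (hx : x ∈ sepLeaders K 𝓛.a s) : 𝓛.IsAbove x := by
  classical
  obtain ⟨N, hN⟩ : ∃ N, x.1.length < N := ⟨_, Nat.lt_succ_self _⟩
  induction N generalizing x with
  | zero => omega
  | succ N ih =>
    by_cases hm : x ∈ minSepLeaders K 𝓛.a s
    · exact ⟨x, hm, ProdLE.refl x⟩
    · have : ∃ y ∈ sepLeaders K 𝓛.a s, ProdLE y x ∧ y ≠ x := by
        by_contra! h
        exact hm ⟨hx, h⟩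
      obtain ⟨y, hy, hyx, hne⟩ := this
      have hlt : y.1.length < x.1.length := by
        by_contra! h
        exact hne (hyx.eq_of_length_le hy.1 hx.1 h)
      obtain ⟨μ, hμ, hμy⟩ := ih hy (by omega)
      exact ⟨μ, hμ, hμy.trans hyx⟩

/-- An index strictly longer than a leader below it has a letter to spare. -/
theorem DKernel.IsAbove.mem_or_exists {x : List (Idx 𝓓) × Fin n} (hx : 𝓛.IsAbove x)
    (hn : IsNormal x.1) : x ∈ minSepLeaders K 𝓛.a s ∨ ∃ (i : Idx 𝓓) (η : List (Idx 𝓓)),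
      IsNormal η ∧ x.1.Perm (i :: η) ∧ 𝓛.IsAbove (η, x.2) := by
  obtain ⟨μ, hμ, h⟩ := hx
  rcases lt_or_ge μ.1.length x.1.length with hlt | hge
  · obtain ⟨i, hi⟩ := exists_count_lt hlt
    exact Or.inr ⟨i, x.1.erase i, hn.erase i, perm_cons_erase_of_count_lt hi, μ, hμ,
      ProdLE.erase (ζ := x.1) (t := x.2) h hi⟩
  · left
    rwa [← h.eq_of_length_le hμ.1.1 hn hge]

theorem mem_minSepLeaders_length {x : List (Idx 𝓓) × Fin n} (hx : x ∈ minSepLeaders K 𝓛.a s) :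
    x.1.length ≤ s := by
  have := hx.1.2.1
  exact_mod_cast this

theorem IsNormal.ins_eq_of_perm {ξ η : List (Idx 𝓓)} {i : Idx 𝓓} (hξ : IsNormal ξ)
    (hη : IsNormal η) (h : ξ.Perm (i :: η)) : ins i η = ξ := by
  refine IsNormal.eq_of_perm (isNormal_ins hη ?_) hξ ((perm_ins i η).trans h.symm)
  rw [← h.countP_eq]
  exact hξ.2

theorem DKernel.levelField_le_fieldBelow (h𝓛 : 𝓛.IsDGammaKernel Γ)
    (hB : CoefRelations (K := K) Γ eK) {x : List (Idx 𝓓) × Fin n} (hx : x.1.length = s) :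
    levelField K 𝓛.a s ≤ fieldBelow K 𝓛.a x := by
  rw [DKernel.levelField_eq h𝓛 hB (Nat.le_succ s)]
  refine IntermediateField.adjoin.mono _ _ _ ?_
  rintro z ⟨ξ, t, h1, h2, rfl⟩
  exact ⟨(ξ, t), h1, triLT_of_length_lt (by rwa [hx]), rfl⟩

/-- A non-separable-leader of length `s` is no leader at all, since the kernel has no inseparable
leader of that length. So each of these elements is transcendental over `L_{s-1}` and the smaller
ones. -/
theorem DKernel.algebraicIndependent (h𝓛 : 𝓛.IsDGammaKernel Γ)
    (hB : CoefRelations (K := K) Γ eK) (hsep : 𝓛.IsSeparable) :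
    AlgebraicIndependent (levelField K 𝓛.a s)
      (fun x : {x : List (Idx 𝓓) × Fin n | IsNormal x.1 ∧ x.1.length = s ∧
        x ∉ sepLeaders K 𝓛.a s} => 𝓛.a x.1.1 x.1.2) := by
  refine algebraicIndependent_of_transcendental _ (fun x y => TriLT x.1 y.1)
    (fun x => TriLT.irrefl _) (fun _ _ _ h h' => h.trans h') ?_ ?_
  · intro x y
    rcases triLT_trichotomy x.2.1 y.2.1 with h | h | h
    exacts [Or.inl h, Or.inr (Or.inl (Subtype.ext h)), Or.inr (Or.inr h)]
  · rintro ⟨x, hn, hl, hx⟩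
    refine transcendental_adjoin_of_subset (G := fieldBelow K 𝓛.a x)
      (fun c => DKernel.levelField_le_fieldBelow h𝓛 hB hl c.2) ?_ ?_
    · rintro _ ⟨y, hy, rfl⟩
      exact IntermediateField.subset_adjoin K _ ⟨y.1, y.2.1, hy, rfl⟩
    · intro halg
      by_cases hs : _root_.IsSeparable (fieldBelow K 𝓛.a x) (𝓛.a x.1 x.2)
      · exact hx ⟨hn, by rw [hl], hs⟩
      · exact hsep x ⟨hn, by rw [hl], halg, hs⟩ hl

/-- Climbing along `◁`, a separable leader is separable over elements already reached. Hence the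
remaining elements of length `s` form a separating transcendence basis of `L` over `L_{s-1}`, and
operator values may be prescribed on them. -/
theorem DKernel.isSeparable_adjoin (h𝓛 : 𝓛.IsDGammaKernel Γ)
    (hB : CoefRelations (K := K) Γ eK) :
    Algebra.IsSeparable (IntermediateField.adjoin (levelField K 𝓛.a s) (Set.range
      (fun x : {x : List (Idx 𝓓) × Fin n | IsNormal x.1 ∧ x.1.length = s ∧
        x ∉ sepLeaders K 𝓛.a s} => 𝓛.a x.1.1 x.1.2))) L := by
  set M := IntermediateField.adjoin (levelField K 𝓛.a s) (Set.range
      (fun x : {x : List (Idx 𝓓) × Fin n | IsNormal x.1 ∧ x.1.length = s ∧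
        x ∉ sepLeaders K 𝓛.a s} => 𝓛.a x.1.1 x.1.2)) with hM
  have hbase : ∀ b ∈ levelField K 𝓛.a s, b ∈ separableClosure M L := by
    intro b hb
    exact isSeparable_algebraMap (F := M) (K := L) ⟨b, M.algebraMap_mem ⟨b, hb⟩⟩
  have hadj : ∀ S : Set L, S ⊆ separableClosure M L →
      ∀ b ∈ IntermediateField.adjoin K S, b ∈ separableClosure M L := by
    intro S hS b hb
    induction hb using IntermediateField.adjoin_induction with
    | mem x hx => exact hS hx
    | algebraMap c => exact hbase _ ((levelField K 𝓛.a s).algebraMap_mem c)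
    | add _ _ _ _ h1 h2 => exact add_mem h1 h2
    | inv _ _ h => exact inv_mem h
    | mul _ _ _ _ h1 h2 => exact mul_mem h1 h2
  have key : ∀ x : List (Idx 𝓓) × Fin n, IsNormal x.1 → x.1.length ≤ s →
      𝓛.a x.1 x.2 ∈ separableClosure M L := by
    intro x
    induction x using wellFounded_triLT.induction with
    | _ x ih =>
    intro hn hl
    rcases hl.lt_or_eq with hl | hl
    · exact hbase _ (IntermediateField.subset_adjoin K _ ⟨x.1, x.2, hl, rfl⟩)
    by_cases hx : x ∈ sepLeaders K 𝓛.a s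
    · refine isSeparable_of_sepOver_separableClosure ?_
      refine (isSeparable_iff_sepOver_coe.1 hx.2.2).mono ?_
      refine hadj _ ?_
      rintro z ⟨y, hy, hyx, rfl⟩
      exact ih y hyx hy (hyx.length_le.trans hl.le)
    · exact isSeparable_algebraMap (F := M) (K := L)
        ⟨𝓛.a x.1 x.2, IntermediateField.subset_adjoin _ _ ⟨⟨x, hn, hl, hx⟩, rfl⟩⟩
  rw [← separableClosure.eq_top_iff, eq_top_iff]
  intro b _
  have hb : b ∈ levelField K 𝓛.a (s + 1) := by rw [𝓛.generates]; trivial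
  rw [DKernel.levelField_eq h𝓛 hB le_rfl] at hb
  refine hadj _ ?_ b hb
  rintro z ⟨ξ, t, h1, h2, rfl⟩
  exact key (ξ, t) h1 (Nat.lt_succ_iff.1 h2)

variable {E : Type*} [Field E] [Algebra k E] [Algebra K E] [Algebra L E] [IsScalarTower k K E]
  [IsScalarTower k L E] [IsScalarTower K L E]

variable (𝓛) in
/-- Operators on an extension `E = L(z)` of a kernel `L` which extend those of the kernel and take
prescribed values `v` on a transcendence basis. -/
structure DKernel.IsExtension (z : 𝓛.free → E) (v : List (Idx 𝓓) × Fin n → Idx 𝓓 → E)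
    (e : ∀ u, E →ₐ[k] (𝓓 u).Alg ⊗[k] E) : Prop where
  crd_zero : ∀ u x, (𝓓 u).crd 0 (e u x) = x
  kernel : ∀ u (b : levelField K 𝓛.a s), e u (algebraMap L E b) =
    (𝓓 u).map (IsScalarTower.toAlgHom k L E) (𝓛.e u b)
  basis : ∀ x : List (Idx 𝓓) × Fin n, IsNormal x.1 → x.1.length = s → x ∉ sepLeaders K 𝓛.a s →
    ∀ i, dd e i (algebraMap L E (𝓛.a x.1 x.2)) = v x i
  free : ∀ (y : 𝓛.free) i, dd e i (z y) = v y i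

/-- Two extensions in a row: from `L_{s-1}` to `L` along the non-leaders of length `s`, then from
`L` to `L(z)`. -/
theorem DKernel.exists_isExtension (h𝓛 : 𝓛.IsDGammaKernel Γ)
    (hB : CoefRelations (K := K) Γ eK) (hsep : 𝓛.IsSeparable) {z : 𝓛.free → E}
    (hz : AlgebraicIndependent L z) (htop : IntermediateField.adjoin L (Set.range z) = ⊤)
    (v : List (Idx 𝓓) × Fin n → Idx 𝓓 → E) :
    ∃ e : ∀ u, E →ₐ[k] (𝓓 u).Alg ⊗[k] E, 𝓛.IsExtension z v e := by
  have htower : IsScalarTower k (levelField K 𝓛.a s) L :=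
    IsScalarTower.of_algebraMap_eq fun _ => rfl
  have hsep2 : Algebra.IsSeparable (IntermediateField.adjoin L (Set.range z)) E := by
    rw [htop]
    exact ⟨fun x => isSeparable_algebraMap (F := (⊤ : IntermediateField L E)) ⟨x, trivial⟩⟩
  have key : ∀ u, ∃ e : E →ₐ[k] (𝓓 u).Alg ⊗[k] E, (∀ x, (𝓓 u).crd 0 (e x) = x) ∧
      (∀ b : levelField K 𝓛.a s, e (algebraMap L E b) =
        (𝓓 u).map (IsScalarTower.toAlgHom k L E) (𝓛.e u b)) ∧
      (∀ x : List (Idx 𝓓) × Fin n, IsNormal x.1 → x.1.length = s → x ∉ sepLeaders K 𝓛.a s →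
        ∀ i, (𝓓 u).crd i.succ (e (algebraMap L E (𝓛.a x.1 x.2))) = v x ⟨u, i⟩) ∧
      ∀ (y : 𝓛.free) i, (𝓓 u).crd i.succ (e (z y)) = v y ⟨u, i⟩ := by
    intro u
    obtain ⟨G, hG1, hG2, hG3⟩ := exists_extension (𝓓 u) (DKernel.algebraicIndependent h𝓛 hB hsep)
      (DKernel.isSeparable_adjoin h𝓛 hB) (IsScalarTower.toAlgHom k L E)
      (((𝓓 u).map (IsScalarTower.toAlgHom k L E)).comp (𝓛.e u)) (fun b => by
        rw [AlgHom.comp_apply, crd_map, 𝓛.crd_zero_e]; rfl)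
      (fun x i => v x.1 ⟨u, i⟩)
    obtain ⟨e, he1, he2, he3⟩ := exists_extension (𝓓 u) hz hsep2 (AlgHom.id k E) G
      (fun b => hG1 b) (fun y i => v y.1 ⟨u, i⟩)
    refine ⟨e, he1, fun b => ?_, fun x h1 h2 h3 i => ?_, he3⟩
    · rw [he2]
      exact hG2 b
    · rw [he2]
      exact hG3 ⟨x, h1, h2, h3⟩ i
  choose e he1 he2 he3 he4 using key
  exact ⟨e, he1, he2, fun x h1 h2 h3 i => he3 i.1 x h1 h2 h3 i.2, fun y i => he4 i.1 y i.2⟩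

variable {z : 𝓛.free → E} {v : List (Idx 𝓓) × Fin n → Idx 𝓓 → E}
  {e : ∀ u, E →ₐ[k] (𝓓 u).Alg ⊗[k] E}

theorem DKernel.IsExtension.isDRing (he : 𝓛.IsExtension z v e) : IsDRing eK e where
  crd_zero := he.crd_zero
  map_algebraMap u c := by
    have h1 : algebraMap K E c = algebraMap L E (algebraMap K (levelField K 𝓛.a s) c) := by
      rw [IsScalarTower.algebraMap_apply K L E]; rfl
    rw [h1, he.kernel, 𝓛.e_algebraMap]
    refine (𝓓 u).crd_ext fun i => ?_
    rw [crd_map, crd_map, crd_map]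
    exact (IsScalarTower.algebraMap_apply K L E _).symm

theorem DKernel.IsExtension.dd_a (he : 𝓛.IsExtension z v e) (i : Idx 𝓓) {ξ : List (Idx 𝓓)}
    {t : Fin n} (h : ξ.length < s) :
    dd e i (algebraMap L E (𝓛.a ξ t)) = algebraMap L E (𝓛.a (i :: ξ) t) := by
  obtain ⟨u, i⟩ := i
  rw [← crd_succ_eq_dd]
  have := he.kernel u (𝓛.elt ξ t h)
  rw [show algebraMap L E (𝓛.a ξ t) = algebraMap L E (𝓛.elt ξ t h) from rfl, this, crd_map,
    𝓛.crd_succ_elt]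
  rfl

/-- The new elements together with the family of the kernel, and zero above the leaders. -/
def baseFamily (z : 𝓛.free → E) (ξ : List (Idx 𝓓)) (t : Fin n) : E := by
  classical
  exact if ξ.length ≤ s then algebraMap L E (𝓛.a ξ t) else
    -- The zeros enlarge no field, so the fields below an index are fixed before the true values
    -- above the leaders are known.
    if h : (ξ, t) ∈ 𝓛.free then z ⟨(ξ, t), h⟩ else 0

theorem baseFamily_of_le {ξ : List (Idx 𝓓)} (h : ξ.length ≤ s) (t : Fin n) :
    baseFamily z ξ t = algebraMap L E (𝓛.a ξ t) := by
  rw [baseFamily, if_pos h]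

theorem baseFamily_of_mem {x : List (Idx 𝓓) × Fin n} (h : x ∈ 𝓛.free) :
    baseFamily z x.1 x.2 = z ⟨x, h⟩ := by
  rw [baseFamily, if_neg (not_le.2 h.2.1), dif_pos h]

theorem baseFamily_of_isAbove {x : List (Idx 𝓓) × Fin n} (hx : s < x.1.length)
    (h : 𝓛.IsAbove x) : baseFamily z x.1 x.2 = 0 := by
  rw [baseFamily, if_neg (not_le.2 hx), dif_neg fun h' => h'.2.2 h]

theorem fieldBelow_baseFamily {x : List (Idx 𝓓) × Fin n} (hx : x.1.length ≤ s) :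
    fieldBelow K (baseFamily z) x =
      (fieldBelow K 𝓛.a x).map (IsScalarTower.toAlgHom K L E) := by
  rw [fieldBelow, fieldBelow, IntermediateField.adjoin_map]
  congr 1
  ext b
  constructor
  · rintro ⟨y, h1, h2, rfl⟩
    exact ⟨_, ⟨y, h1, h2, rfl⟩, (baseFamily_of_le (h2.length_le.trans hx) _).symm⟩
  · rintro ⟨_, ⟨y, h1, h2, rfl⟩, rfl⟩
    exact ⟨y, h1, h2, (baseFamily_of_le (h2.length_le.trans hx) _).symm⟩

theorem isSeparable_baseFamily_iff {x : List (Idx 𝓓) × Fin n} (hx : x.1.length ≤ s) :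
    SepOver (fieldBelow K (baseFamily z) x : Set E) (baseFamily z x.1 x.2) ↔
      IsSeparable (fieldBelow K 𝓛.a x) (𝓛.a x.1 x.2) := by
  rw [isSeparable_iff_sepOver_coe, baseFamily_of_le hx, fieldBelow_baseFamily hx]
  exact sepOver_map_iff (algebraMap L E)

theorem mem_fieldBelow_of_triLT {x y : List (Idx 𝓓) × Fin n} {a : List (Idx 𝓓) → Fin n → E}
    (hy : IsNormal y.1) (h : TriLT y x) : a y.1 y.2 ∈ fieldBelow K a x :=
  IntermediateField.subset_adjoin K _ ⟨y, hy, h, rfl⟩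

theorem fieldBelow_mono {x y : List (Idx 𝓓) × Fin n} {a : List (Idx 𝓓) → Fin n → E}
    (h : TriLE y x) : fieldBelow K a y ≤ fieldBelow K a x := by
  refine IntermediateField.adjoin.mono _ _ _ ?_
  rintro b ⟨w, h1, h2, rfl⟩
  exact ⟨w, h1, h2.trans_le h, rfl⟩

/-- Derivatives of an element which is separable over a smaller field. -/
theorem dd_mem_of_sepOver (he : IsDRing eK e) {u : OpType} {i : Fin (𝓓 u).m}
    {G : IntermediateField K E} {S : Set E} {c : E} (hc : c ∈ G)
    (hS : ∀ b ∈ S, b ∈ G ∧ ∀ p ≤ i, dd e ⟨u, p⟩ b ∈ G)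
    (hsep : SepOver (IntermediateField.adjoin K S : Set E) c) : dd e ⟨u, i⟩ c ∈ G := by
  have key : ∀ b, b ∈ opField (e u) (he.crd_zero u) i.succ (G.restrictScalars k) ↔
      b ∈ G ∧ ∀ p ≤ i, dd e ⟨u, p⟩ b ∈ G := by
    intro b
    rw [mem_opField]
    constructor
    · intro h
      refine ⟨?_, fun p hp => h p.succ (Fin.succ_le_succ_iff.2 hp)⟩
      have := h 0 (Fin.zero_le _)
      rwa [he.crd_zero] at this
    · rintro ⟨h1, h2⟩ p hp
      revert hp
      refine Fin.cases (fun _ => ?_) (fun p hp => ?_) p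
      · rw [he.crd_zero]; exact h1
      · exact h2 p (Fin.succ_le_succ_iff.1 hp)
  have hle : ∀ b ∈ IntermediateField.adjoin K S,
      b ∈ opField (e u) (he.crd_zero u) i.succ (G.restrictScalars k) := by
    intro b hb
    induction hb using IntermediateField.adjoin_induction with
    | mem x hx => exact (key x).2 (hS x hx)
    | algebraMap c =>
      refine (key _).2 ⟨G.algebraMap_mem c, fun p _ => ?_⟩
      rw [he.dd_algebraMap]
      exact G.algebraMap_mem _
    | add _ _ _ _ h1 h2 => exact add_mem h1 h2
    | inv _ _ h => exact inv_mem h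
    | mul _ _ _ _ h1 h2 => exact mul_mem h1 h2
  have := LocalOperatorSystem.mem_coordSubring_of_sepOver (𝓓 u) (he.crd_zero u) (i := i.succ)
    (G := G.restrictScalars k) hc (hsep.mono hle)
  exact this i.succ le_rfl

end Setting

/-! ### Fields generated up to an index -/

section Order

variable {k : Type*} [Field k] {𝓓 : OpType → LocalOperatorSystem k} {n : ℕ}

theorem TriLE.trans {x y z : List (Idx 𝓓) × Fin n} (h : TriLE x y) (h' : TriLE y z) :
    TriLE x z := by
  rcases h' with h' | ⟨h1, h2⟩
  · exact Or.inl (h.trans_lt h')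
  · rcases h with h | ⟨h3, h4⟩
    · exact Or.inl (h.trans_le (Or.inr ⟨h1, h2⟩))
    · exact Or.inr ⟨h3.trans h1, h4.trans h2⟩

/-- The words in the normal form of `∂_i a^ξ` are at most `(i, ξ)`. -/
theorem triLE_of_perm_or {i : Idx 𝓓} {ξ η : List (Idx 𝓓)}
    (h : η.Perm (i :: ξ) ∨ η.length ≤ ξ.length) (t : Fin n) : TriLE (η, t) (i :: ξ, t) := by
  rcases h with h | h
  · exact Or.inr ⟨h, rfl⟩
  · exact Or.inl (triLT_of_length_lt (by simp; omega))

variable {K E : Type*} [Field K] [Field E] [Algebra K E]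

/-- The field generated over `K` by the `a^η_{t'}` with `η` normal and `(η, t') ⊴ (ξ, t)`. -/
def fieldUpTo (K : Type*) [Field K] [Algebra K E] (a : List (Idx 𝓓) → Fin n → E)
    (x : List (Idx 𝓓) × Fin n) : IntermediateField K E :=
  IntermediateField.adjoin K {b | ∃ y : List (Idx 𝓓) × Fin n,
    IsNormal y.1 ∧ TriLE y x ∧ b = a y.1 y.2}

variable {a : List (Idx 𝓓) → Fin n → E} {x y : List (Idx 𝓓) × Fin n}

theorem fieldUpTo_mono (h : TriLE y x) : fieldUpTo K a y ≤ fieldUpTo K a x := by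
  refine IntermediateField.adjoin.mono _ _ _ ?_
  rintro b ⟨w, h1, h2, rfl⟩
  exact ⟨w, h1, h2.trans h, rfl⟩

theorem fieldUpTo_le_fieldBelow (h : TriLT y x) : fieldUpTo K a y ≤ fieldBelow K a x := by
  refine IntermediateField.adjoin.mono _ _ _ ?_
  rintro b ⟨w, h1, h2, rfl⟩
  exact ⟨w, h1, h2.trans_lt h, rfl⟩

theorem fieldBelow_le_fieldUpTo (h : TriLE y x) : fieldBelow K a y ≤ fieldUpTo K a x := by
  refine IntermediateField.adjoin.mono _ _ _ ?_
  rintro b ⟨w, h1, h2, rfl⟩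
  exact ⟨w, h1, Or.inl (h2.trans_le h), rfl⟩

theorem mem_fieldUpTo (hy : IsNormal y.1) (h : TriLE y x) : a y.1 y.2 ∈ fieldUpTo K a x :=
  IntermediateField.subset_adjoin K _ ⟨y, hy, h, rfl⟩

open MvPolynomial

theorem aeval_congr_of_mem_supported {σ : Type*} {a b : σ → E} {T : Set σ}
    (h : ∀ ξ ∈ T, a ξ = b ξ) {f : MvPolynomial σ K} (hf : f ∈ supported K T) :
    aeval a f = aeval b f :=
  MvPolynomial.eval₂Hom_congr' rfl
    (fun ξ hξ _ => h ξ (MvPolynomial.mem_supported.1 hf hξ)) rfl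

theorem aeval_mem_of_mem_supported {σ : Type*} {a : σ → E} {T : Set σ} {G : IntermediateField K E}
    (h : ∀ ξ ∈ T, a ξ ∈ G) {f : MvPolynomial σ K} (hf : f ∈ supported K T) : aeval a f ∈ G :=
  algHom_mem_of_mem_supported (aeval a) (W := G.toSubalgebra)
    (fun ξ hξ => by rw [aeval_X]; exact h ξ hξ) hf

end Order

/-! ### How operators on an extension depend on the prescribed values -/

section Setting

variable {k F K L : Type*} [Field k] [Field F] [Field K] [Field L] [Algebra k F] [Algebra k K]
  [Algebra k L] [Algebra F K] [Algebra K L] [IsScalarTower k F K] [IsScalarTower k K L]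
  {𝓓 : OpType → LocalOperatorSystem k} {Γ : LHSSystem 𝓓 F}
  {eK : ∀ u, K →ₐ[k] (𝓓 u).Alg ⊗[k] K} {n s : ℕ} {𝓛 : DKernel eK n s L}

open LocalOperatorSystem MvPolynomial

variable {E : Type*} [Field E] [Algebra k E] [Algebra K E] [Algebra L E] [IsScalarTower k K E]
  [IsScalarTower k L E] [IsScalarTower K L E]

variable {z : 𝓛.free → E} {v : List (Idx 𝓓) × Fin n → Idx 𝓓 → E}
  {e : ∀ u, E →ₐ[k] (𝓓 u).Alg ⊗[k] E}

variable (h𝓛 : 𝓛.IsDGammaKernel Γ) (hB : CoefRelations (K := K) Γ eK)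
include h𝓛 hB

theorem algebraMap_a_cons (i : Idx 𝓓) {ξ : List (Idx 𝓓)} (t : Fin n) (hn : IsNormal ξ)
    (h : ξ.length < s) : algebraMap L E (𝓛.a (i :: ξ) t) =
      aeval (fun ξ => baseFamily z ξ t) (wordD Γ eK i ξ) := by
  rw [DKernel.a_cons_eq h𝓛 hB t i hn h]
  have h1 : algebraMap L E (aeval (fun ξ => 𝓛.a ξ t) (wordD Γ eK i ξ)) =
      aeval (fun ξ => algebraMap L E (𝓛.a ξ t)) (wordD Γ eK i ξ) := by
    change IsScalarTower.toAlgHom K L E _ = _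
    rw [MvPolynomial.comp_aeval_apply]
    rfl
  rw [h1]
  refine aeval_congr_of_mem_supported ?_
    (wordD_mem_supported hB.toBaseRelations hB.lie_const hn i)
  rintro η ⟨-, hη⟩
  refine (baseFamily_of_le ?_ t).symm
  rcases hη with hη | hη
  · rw [hη.length_eq]; simpa using h
  · omega

theorem dd_baseFamily (he : 𝓛.IsExtension z v e) (i : Idx 𝓓) {ξ : List (Idx 𝓓)} (t : Fin n)
    (hn : IsNormal ξ) (h : ξ.length < s) : dd e i (baseFamily z ξ t) =
      aeval (fun ξ => baseFamily z ξ t) (wordD Γ eK i ξ) := by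
  rw [baseFamily_of_le h.le, he.dd_a i h, algebraMap_a_cons h𝓛 hB i t hn h]

/-- Up to the length of the kernel, the separable leaders are the indices above a minimal one. -/
theorem DKernel.IsAbove.mem_sepLeaders (he : 𝓛.IsExtension z v e) {x : List (Idx 𝓓) × Fin n}
    (hx : 𝓛.IsAbove x) (hn : IsNormal x.1) (hl : x.1.length ≤ s) : x ∈ sepLeaders K 𝓛.a s := by
  obtain ⟨N, hN⟩ : ∃ N, x.1.length < N := ⟨_, Nat.lt_succ_self _⟩
  induction N generalizing x with
  | zero => omega
  | succ N ih =>
    rcases hx.mem_or_exists hn with h | ⟨i, η, hη, hp, hab⟩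
    · exact h.1
    have hlen : x.1.length = η.length + 1 := by rw [hp.length_eq]; rfl
    have hsl := ih hab hη (by simp only; omega) (by simp only; omega)
    have hxi : TriLE (i :: η, x.2) x := Or.inr ⟨hp.symm, rfl⟩
    have hηx : TriLT (η, x.2) x := (triLT_cons_self η x.2 x.2 i).trans_le hxi
    have hsep : SepOver (fieldBelow K (baseFamily z) (η, x.2) : Set E) (baseFamily z η x.2) :=
      (isSeparable_baseFamily_iff (x := (η, x.2)) (by simp only; omega)).2 hsl.2.2
    -- Differentiating the separable equation of `a^η`: its coefficients lie below `η`, so their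
    -- derivatives lie below `x`. Since `∂_i a^η` differs from the element at `x` by shorter words,
    -- that element lies in the field below `x`.
    have h1 : dd e i (baseFamily z η x.2) ∈ fieldBelow K (baseFamily z) x := by
      obtain ⟨u, i⟩ := i
      refine dd_mem_of_sepOver he.isDRing (mem_fieldBelow_of_triLT (y := (η, x.2)) hη hηx) ?_ hsep
      rintro b ⟨w, hw, hwη, rfl⟩
      refine ⟨mem_fieldBelow_of_triLT hw (hwη.trans hηx), fun p hp => ?_⟩
      have hwl := hwη.length_le
      simp only at hwl
      rw [dd_baseFamily h𝓛 hB he _ _ hw (by omega)]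
      refine aeval_mem_of_mem_supported ?_
        (wordD_mem_supported hB.toBaseRelations hB.lie_const hw _)
      rintro ζ ⟨hζ, hζ'⟩
      refine mem_fieldBelow_of_triLT (y := (ζ, w.2)) hζ ?_
      exact (triLE_of_perm_or hζ' w.2).trans_lt
        ((hwη.cons (Idx.rank_le_rank.2 hp)).trans_le hxi)
    rw [dd_baseFamily h𝓛 hB he _ _ hη (by omega)] at h1
    have h2 : aeval (fun ξ => baseFamily z ξ x.2) (wordD Γ eK i η - X (ins i η)) ∈
        fieldBelow K (baseFamily z) x := by
      refine aeval_mem_of_mem_supported ?_ (wordD_sub_mem_supported hB.toBaseRelations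
        hB.lie_const hη (by rw [hn.ins_eq_of_perm hη hp]; exact hn))
      rintro ζ ⟨hζ, hζ'⟩
      exact mem_fieldBelow_of_triLT (y := (ζ, x.2)) hζ (triLT_of_length_lt (by simp only; omega))
    rw [map_sub, aeval_X, hn.ins_eq_of_perm hη hp] at h2
    have h3 : baseFamily z x.1 x.2 ∈ fieldBelow K (baseFamily z) x := by
      have := sub_mem h1 h2
      rwa [sub_sub_cancel] at this
    refine ⟨hn, by exact_mod_cast hl, (isSeparable_baseFamily_iff (z := z) hl).1 ?_⟩
    exact sepOver_of_mem (G := (fieldBelow K (baseFamily z) x).toSubfield) h3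

omit h𝓛 hB

/-- The value at `y` of a family, corrected if it is not of the expected form. -/
def clamp (z : 𝓛.free → E) (A : List (Idx 𝓓) × Fin n → E) (y : List (Idx 𝓓) × Fin n) : E := by
  classical
  exact if y.1.length ≤ s then baseFamily z y.1 y.2 else
    if A y ∈ fieldBelow K (baseFamily z) y then A y else 0

include h𝓛 hB

/-- This holds for an arbitrary family `A`. The recursion must make sense before the family is known
to be of the right form, which is the purpose of `clamp`. -/
theorem sepOver_clamp (he : 𝓛.IsExtension z v e) (A : List (Idx 𝓓) × Fin n → E)
    {y : List (Idx 𝓓) × Fin n} (hn : IsNormal y.1) (hy : 𝓛.IsAbove y) :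
    SepOver (fieldBelow K (baseFamily z) y : Set E) (clamp z A y) := by
  rw [clamp]
  split_ifs with h1 h2
  · exact (isSeparable_baseFamily_iff h1).2 (hy.mem_sepLeaders h𝓛 hB he hn h1).2.2
  · exact sepOver_of_mem (G := (fieldBelow K (baseFamily z) y).toSubfield) h2
  · exact sepOver_of_mem (G := (fieldBelow K (baseFamily z) y).toSubfield) (zero_mem _)

/-- The operators `∂_i` on an extension only depend on the prescribed values of the `∂_p` with
`p ≤ i`. -/
theorem dd_congr_of_sepOver {v' : List (Idx 𝓓) × Fin n → Idx 𝓓 → E}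
    {e' : ∀ u, E →ₐ[k] (𝓓 u).Alg ⊗[k] E} (he : 𝓛.IsExtension z v e) (he' : 𝓛.IsExtension z v' e')
    {u : OpType} {i : Fin (𝓓 u).m} {y : List (Idx 𝓓) × Fin n}
    (hv : ∀ w : List (Idx 𝓓) × Fin n, IsNormal w.1 → TriLT w y → ∀ p ≤ i, v w ⟨u, p⟩ = v' w ⟨u, p⟩)
    {c : E} (hc : SepOver (fieldBelow K (baseFamily z) y : Set E) c) :
    dd e ⟨u, i⟩ c = dd e' ⟨u, i⟩ c := by
  set T := agreeField (e u).toRingHom (e' u).toRingHom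
    ((𝓓 u).coordIdeal i.succ (⊥ : Ideal E)) with hT
  have hmem : ∀ b, b ∈ T ↔ ∀ p ≤ i, dd e ⟨u, p⟩ b = dd e' ⟨u, p⟩ b := by
    intro b
    rw [hT, mem_agreeField, mem_coordIdeal]
    have h1 : ∀ p, (𝓓 u).crd p ((e u).toRingHom b - (e' u).toRingHom b) ∈ (⊥ : Ideal E) ↔
        (𝓓 u).crd p (e u b) = (𝓓 u).crd p (e' u b) := by
      intro p
      rw [Ideal.mem_bot, map_sub, sub_eq_zero]
      rfl
    simp only [h1]
    constructor
    · intro h p hp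
      exact h p.succ (Fin.succ_le_succ_iff.2 hp)
    · intro h p hp
      revert hp
      refine Fin.cases (fun _ => ?_) (fun p hp => ?_) p
      · rw [he.crd_zero, he'.crd_zero]
      · exact h p (Fin.succ_le_succ_iff.1 hp)
  have hnil : ∀ b, IsNilpotent ((e u).toRingHom b - (e' u).toRingHom b) := by
    intro b
    apply isNilpotent_of_crd_zero
    rw [map_sub]
    change (𝓓 u).crd 0 (e u b) - (𝓓 u).crd 0 (e' u b) = 0
    rw [he.crd_zero, he'.crd_zero, sub_self]
  have hadj : ∀ S : Set E, S ⊆ T → ∀ b ∈ IntermediateField.adjoin K S, b ∈ T := by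
    intro S hS b hb
    induction hb using IntermediateField.adjoin_induction with
    | mem x hx => exact hS hx
    | algebraMap c =>
      refine (hmem _).2 fun p _ => ?_
      rw [he.isDRing.dd_algebraMap, he'.isDRing.dd_algebraMap]
    | add _ _ _ _ h1 h2 => exact add_mem h1 h2
    | inv _ _ h => exact inv_mem h
    | mul _ _ _ _ h1 h2 => exact mul_mem h1 h2
  -- Short words are governed by the kernel, separable leaders of length `s` by rigidity, long
  -- indices above a leader have the value zero, and all others carry prescribed values.
  have hbase : ∀ w : List (Idx 𝓓) × Fin n, IsNormal w.1 → TriLT w y →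
      baseFamily z w.1 w.2 ∈ T := by
    intro w
    induction w using wellFounded_triLT.induction with
    | _ w ih =>
    intro hn hw
    rcases lt_trichotomy w.1.length s with hl | hl | hl
    · refine (hmem _).2 fun p _ => ?_
      rw [dd_baseFamily h𝓛 hB he _ _ hn hl, dd_baseFamily h𝓛 hB he' _ _ hn hl]
    · by_cases hsl : w ∈ sepLeaders K 𝓛.a s
      · refine mem_agreeField_of_sepOver (hnil _) ?_
        refine ((isSeparable_baseFamily_iff (z := z) hl.le).2 hsl.2.2).mono ?_
        refine hadj _ ?_
        rintro _ ⟨w', h1, h2, rfl⟩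
        exact ih w' h2 h1 (h2.trans hw)
      · refine (hmem _).2 fun p hp => ?_
        rw [baseFamily_of_le hl.le, he.basis w hn hl hsl, he'.basis w hn hl hsl, hv w hn hw p hp]
    · by_cases hab : 𝓛.IsAbove w
      · rw [baseFamily_of_isAbove hl hab]
        exact zero_mem _
      · refine (hmem _).2 fun p hp => ?_
        rw [baseFamily_of_mem ⟨hn, hl, hab⟩, he.free, he'.free, hv w hn hw p hp]
  have h1 : c ∈ T := by
    refine mem_agreeField_of_sepOver (hnil _) (hc.mono (hadj _ ?_))
    rintro _ ⟨w, h1, h2, rfl⟩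
    exact hbase w h1 h2
  exact (hmem c).1 h1 i le_rfl

end Setting

/-! ### Simultaneous construction of the family and its operators -/

section Setting

variable {k F K L : Type*} [Field k] [Field F] [Field K] [Field L] [Algebra k F] [Algebra k K]
  [Algebra k L] [Algebra F K] [Algebra K L] [IsScalarTower k F K] [IsScalarTower k K L]
  {𝓓 : OpType → LocalOperatorSystem k} {Γ : LHSSystem 𝓓 F}
  {eK : ∀ u, K →ₐ[k] (𝓓 u).Alg ⊗[k] K} {n s : ℕ} {𝓛 : DKernel eK n s L}

open LocalOperatorSystem MvPolynomial

variable {E : Type*} [Field E] [Algebra k E] [Algebra K E] [Algebra L E] [IsScalarTower k K E]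
  [IsScalarTower k L E] [IsScalarTower K L E]

variable (Γ 𝓛) in
/-- A family `A` extending that of the kernel, and operators `e` on `E`, such that `A` is given by
new elements at the indices which are not above a leader of the kernel, and by one of its
derivations at the others. -/
structure DKernel.IsPrincipalFamily (z : 𝓛.free → E) (A : List (Idx 𝓓) × Fin n → E)
    (e : ∀ u, E →ₐ[k] (𝓓 u).Alg ⊗[k] E) : Prop where
  isExtension : 𝓛.IsExtension z (fun x i => aeval (fun ξ => A (ξ, x.2)) (wordD Γ eK i x.1)) e
  base : ∀ x, (x.1.length ≤ s ∨ ¬ 𝓛.IsAbove x) → A x = baseFamily z x.1 x.2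
  above : ∀ x, IsNormal x.1 → s < x.1.length → 𝓛.IsAbove x →
    ∃ (i : Idx 𝓓) (η : List (Idx 𝓓)), IsNormal η ∧ x.1.Perm (i :: η) ∧ 𝓛.IsAbove (η, x.2) ∧
      A x = dd e i (clamp z A (η, x.2)) -
        aeval (fun ξ => A (ξ, x.2)) (wordD Γ eK i η - X x.1)

variable {z : 𝓛.free → E}

/-- Operators are determined by the family through the prescribed values, and the family above the
leaders is determined by the operators. The composite is causal: for `x` a rearrangement of `iη`,
the value `∂_i (clamp z A η)` uses only prescribed values at `(p, w)` with `p ≤ i` and `w ◁ η`.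
Their normal forms involve words below `x`, so a fixed point exists. -/
theorem DKernel.exists_isPrincipalFamily (h𝓛 : 𝓛.IsDGammaKernel Γ)
    (hB : CoefRelations (K := K) Γ eK) (hsep : 𝓛.IsSeparable)
    (hz : AlgebraicIndependent L z) (htop : IntermediateField.adjoin L (Set.range z) = ⊤) :
    ∃ A e, 𝓛.IsPrincipalFamily Γ z A e := by
  classical
  choose ops hops using fun v => DKernel.exists_isExtension h𝓛 hB hsep hz htop v
  -- Minimal leaders have length at most `s`, so a longer index above one keeps a leader below it
  -- after removal of a suitable letter.
  have hpred : ∀ x : {x : List (Idx 𝓓) × Fin n // IsNormal x.1 ∧ s < x.1.length ∧ 𝓛.IsAbove x},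
      ∃ y : Idx 𝓓 × List (Idx 𝓓), IsNormal y.2 ∧ x.1.1.Perm (y.1 :: y.2) ∧
        𝓛.IsAbove (y.2, x.1.2) := by
    rintro ⟨x, hn, hl, hx⟩
    rcases hx.mem_or_exists hn with h | ⟨i, η, h⟩
    · exact absurd (mem_minSepLeaders_length h) (not_le.2 hl)
    · exact ⟨(i, η), h⟩
  choose pre hpre1 hpre2 hpre3 using hpred
  let V : (List (Idx 𝓓) × Fin n → E) → List (Idx 𝓓) × Fin n → Idx 𝓓 → E :=
    fun A x i => aeval (fun ξ => A (ξ, x.2)) (wordD Γ eK i x.1)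
  let Φ : (List (Idx 𝓓) × Fin n → E) → List (Idx 𝓓) × Fin n → E := fun A x =>
    if h : IsNormal x.1 ∧ s < x.1.length ∧ 𝓛.IsAbove x then
      dd (ops (V A)) (pre ⟨x, h⟩).1 (clamp z A ((pre ⟨x, h⟩).2, x.2)) -
        aeval (fun ξ => A (ξ, x.2)) (wordD Γ eK (pre ⟨x, h⟩).1 (pre ⟨x, h⟩).2 - X x.1)
    else baseFamily z x.1 x.2
  have hcaus : ∀ A B x, (∀ y, TriLT y x → A y = B y) → Φ A x = Φ B x := by
    intro A B x hAB
    by_cases h : IsNormal x.1 ∧ s < x.1.length ∧ 𝓛.IsAbove x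
    · simp only [Φ, dif_pos h]
      have hn := hpre1 ⟨x, h⟩
      have hp := hpre2 ⟨x, h⟩
      have hab := hpre3 ⟨x, h⟩
      generalize pre ⟨x, h⟩ = y at hn hp hab ⊢
      obtain ⟨⟨u, i⟩, η⟩ := y
      simp only at hn hp hab ⊢
      have hix : TriLE (⟨u, i⟩ :: η, x.2) x := Or.inr ⟨hp.symm, rfl⟩
      have hηx : TriLT (η, x.2) x := (triLT_cons_self η x.2 x.2 _).trans_le hix
      have h1 : clamp z A (η, x.2) = clamp z B (η, x.2) := by
        rw [clamp, clamp, hAB _ hηx]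
      have h2 : dd (ops (V A)) ⟨u, i⟩ (clamp z B (η, x.2)) =
          dd (ops (V B)) ⟨u, i⟩ (clamp z B (η, x.2)) := by
        refine dd_congr_of_sepOver h𝓛 hB (hops _) (hops _) (y := (η, x.2)) ?_
          (sepOver_clamp h𝓛 hB (hops (V A)) B hn hab)
        intro w hw hwη p hp'
        refine aeval_congr_of_mem_supported ?_
          (wordD_mem_supported hB.toBaseRelations hB.lie_const hw _)
        rintro ζ ⟨hζ, hζ'⟩
        exact hAB _ ((triLE_of_perm_or hζ' w.2).trans_lt
          ((hwη.cons (Idx.rank_le_rank.2 hp')).trans_le hix))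
      rw [h1, h2]
      congr 1
      refine aeval_congr_of_mem_supported ?_ ?_ (T := {η' | IsNormal η' ∧ η'.length ≤ η.length})
      · rintro ζ ⟨hζ, hζ'⟩
        refine hAB _ (triLT_of_length_lt ?_)
        rw [hp.length_eq]
        simpa using Nat.lt_succ_of_le hζ'
      · have := h.1.ins_eq_of_perm hn hp
        rw [← this]
        exact wordD_sub_mem_supported hB.toBaseRelations hB.lie_const hn (by rw [this]; exact h.1)
    · simp only [Φ, dif_neg h]
  have : Inhabited E := ⟨0⟩
  obtain ⟨A, hA⟩ := exists_fixedPoint_of_causal wellFounded_triLT Φ hcaus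
  refine ⟨A, ops (V A), hops _, ?_, ?_⟩
  · intro x hx
    rw [hA]
    exact dif_neg fun h => hx.elim (fun h' => absurd h.2.1 (not_lt.2 h')) fun h' => h' h.2.2
  · intro x h1 h2 h3
    refine ⟨(pre ⟨x, h1, h2, h3⟩).1, (pre ⟨x, h1, h2, h3⟩).2, hpre1 ⟨x, h1, h2, h3⟩,
      hpre2 ⟨x, h1, h2, h3⟩, hpre3 ⟨x, h1, h2, h3⟩, ?_⟩
    refine (hA x).trans ?_
    exact dif_pos ⟨h1, h2, h3⟩

variable {A : List (Idx 𝓓) × Fin n → E} {e : ∀ u, E →ₐ[k] (𝓓 u).Alg ⊗[k] E}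
variable (h𝓛 : 𝓛.IsDGammaKernel Γ) (hB : CoefRelations (K := K) Γ eK)
  (hA : 𝓛.IsPrincipalFamily Γ z A e)
include h𝓛 hB hA

/-- The two assertions feed each other: a value above a leader is a derivative of a separable
element over smaller ones, and prescribed derivatives are polynomials in values of `A`. Words are
taken up to permutation because `p :: w` need not be normal; the second assertion at `x` uses the
first at the same `x`. -/
theorem DKernel.IsPrincipalFamily.mem_fields (x : List (Idx 𝓓) × Fin n) :
    (∀ w : List (Idx 𝓓) × Fin n, IsNormal w.1 → w.1.Perm x.1 → w.2 = x.2 →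
      A w ∈ fieldUpTo K (baseFamily z) w ∧
        (s < w.1.length → 𝓛.IsAbove w → A w ∈ fieldBelow K (baseFamily z) w)) ∧
    ∀ (p : Idx 𝓓) (w : List (Idx 𝓓) × Fin n), IsNormal w.1 → (p :: w.1).Perm x.1 → w.2 = x.2 →
      dd e p (baseFamily z w.1 w.2) ∈ fieldUpTo K (baseFamily z) (p :: w.1, w.2) := by
  induction x using wellFounded_triLT.induction with
  | _ x ih =>
  have key : ∀ w : List (Idx 𝓓) × Fin n, IsNormal w.1 → w.1.Perm x.1 → w.2 = x.2 →
      A w ∈ fieldUpTo K (baseFamily z) w ∧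
        (s < w.1.length → 𝓛.IsAbove w → A w ∈ fieldBelow K (baseFamily z) w) := by
    intro w hw hwx ht
    have hwx' : TriLE w x := Or.inr ⟨hwx, ht⟩
    have habove : s < w.1.length → 𝓛.IsAbove w → A w ∈ fieldBelow K (baseFamily z) w := by
      intro hs hab
      obtain ⟨⟨u, i⟩, η, hη, hp, habη, hAw⟩ := hA.above w hw hs hab
      have hiw : TriLE (⟨u, i⟩ :: η, w.2) w := Or.inr ⟨hp.symm, rfl⟩
      have hηw : TriLT (η, w.2) w := (triLT_cons_self η w.2 w.2 _).trans_le hiw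
      rw [hAw]
      refine sub_mem ?_ ?_
      · refine dd_mem_of_sepOver hA.isExtension.isDRing ?_ ?_
          (sepOver_clamp h𝓛 hB hA.isExtension A hη habη)
        · rw [clamp]
          split_ifs with h1 h2
          · exact mem_fieldBelow_of_triLT (y := (η, w.2)) hη hηw
          · exact fieldBelow_mono (Or.inl hηw) h2
          · exact zero_mem _
        · rintro b ⟨w', hw', hw'η, rfl⟩
          refine ⟨mem_fieldBelow_of_triLT hw' (hw'η.trans hηw), fun p hp' => ?_⟩
          have h1 : TriLT (⟨u, p⟩ :: w'.1, w'.2) w :=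
            (hw'η.cons (Idx.rank_le_rank.2 hp')).trans_le hiw
          exact fieldUpTo_le_fieldBelow h1
            ((ih _ (h1.trans_le hwx')).2 ⟨u, p⟩ w' hw' (List.Perm.refl _) rfl)
      · have hins := hw.ins_eq_of_perm hη hp
        refine aeval_mem_of_mem_supported (T := {η' | IsNormal η' ∧ η'.length ≤ η.length}) ?_ ?_
        · rintro ζ ⟨hζ, hζ'⟩
          have h1 : TriLT (ζ, w.2) w := triLT_of_length_lt (by
            rw [hp.length_eq]; simpa using Nat.lt_succ_of_le hζ')
          exact fieldUpTo_le_fieldBelow h1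
            ((ih _ (h1.trans_le hwx')).1 (ζ, w.2) hζ (List.Perm.refl _) rfl).1
        · rw [← hins]
          exact wordD_sub_mem_supported hB.toBaseRelations hB.lie_const hη (by rw [hins]; exact hw)
    refine ⟨?_, habove⟩
    by_cases h : s < w.1.length ∧ 𝓛.IsAbove w
    · exact fieldBelow_le_fieldUpTo (TriLE.refl w) (habove h.1 h.2)
    · rw [hA.base w (by rw [not_and_or, not_lt] at h; exact h)]
      exact mem_fieldUpTo hw (TriLE.refl w)
  refine ⟨key, fun p w hw hpx ht => ?_⟩
  have hpx' : TriLE (p :: w.1, w.2) x := Or.inr ⟨hpx, ht⟩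
  have hval : aeval (fun ξ => A (ξ, w.2)) (wordD Γ eK p w.1) ∈
      fieldUpTo K (baseFamily z) (p :: w.1, w.2) := by
    refine aeval_mem_of_mem_supported ?_
      (wordD_mem_supported hB.toBaseRelations hB.lie_const hw _)
    rintro ζ ⟨hζ, hζ'⟩
    have h1 := triLE_of_perm_or hζ' w.2
    refine fieldUpTo_mono h1 ?_
    rcases h1 with h1 | ⟨h1, -⟩
    · exact ((ih _ (h1.trans_le hpx')).1 (ζ, w.2) hζ (List.Perm.refl _) rfl).1
    · exact (key (ζ, w.2) hζ (h1.trans hpx) ht).1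
  rcases lt_trichotomy w.1.length s with hl | hl | hl
  · rw [dd_baseFamily h𝓛 hB hA.isExtension p w.2 hw hl]
    refine aeval_mem_of_mem_supported ?_
      (wordD_mem_supported hB.toBaseRelations hB.lie_const hw _)
    rintro ζ ⟨hζ, hζ'⟩
    exact mem_fieldUpTo (y := (ζ, w.2)) hζ (triLE_of_perm_or hζ' w.2)
  · by_cases hsl : w ∈ sepLeaders K 𝓛.a s
    · obtain ⟨u, p⟩ := p
      have hwp : TriLT w (⟨u, p⟩ :: w.1, w.2) := triLT_cons_self w.1 w.2 w.2 _
      refine dd_mem_of_sepOver hA.isExtension.isDRing (mem_fieldUpTo hw (Or.inl hwp)) ?_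
        ((isSeparable_baseFamily_iff (z := z) hl.le).2 hsl.2.2)
      rintro b ⟨w', hw', hw'w, rfl⟩
      refine ⟨mem_fieldUpTo hw' (Or.inl (hw'w.trans hwp)), fun p' hp' => ?_⟩
      have h1 : TriLT (⟨u, p'⟩ :: w'.1, w'.2) (⟨u, p⟩ :: w.1, w.2) :=
        hw'w.cons (Idx.rank_le_rank.2 hp')
      exact fieldUpTo_mono (Or.inl h1)
        ((ih _ (h1.trans_le hpx')).2 ⟨u, p'⟩ w' hw' (List.Perm.refl _) rfl)
    · rw [baseFamily_of_le hl.le, hA.isExtension.basis w hw hl hsl]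
      exact hval
  · by_cases hab : 𝓛.IsAbove w
    · rw [baseFamily_of_isAbove hl hab, map_zero]
      exact zero_mem _
    · rw [baseFamily_of_mem ⟨hw, hl, hab⟩, hA.isExtension.free]
      exact hval

theorem DKernel.IsPrincipalFamily.mem_fieldBelow {x : List (Idx 𝓓) × Fin n} (hn : IsNormal x.1)
    (hl : s < x.1.length) (hx : 𝓛.IsAbove x) : A x ∈ fieldBelow K (baseFamily z) x :=
  ((hA.mem_fields h𝓛 hB x).1 x hn (List.Perm.refl _) rfl).2 hl hx

theorem DKernel.IsPrincipalFamily.mem_fieldUpTo {x : List (Idx 𝓓) × Fin n} (hn : IsNormal x.1) :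
    A x ∈ fieldUpTo K (baseFamily z) x :=
  ((hA.mem_fields h𝓛 hB x).1 x hn (List.Perm.refl _) rfl).1

theorem DKernel.IsPrincipalFamily.clamp_eq {x : List (Idx 𝓓) × Fin n} (hn : IsNormal x.1)
    (hx : 𝓛.IsAbove x) : clamp z A x = A x := by
  rw [clamp]
  split_ifs with h1 h2
  · rw [hA.base x (Or.inl h1)]
  · rfl
  · exact absurd (hA.mem_fieldBelow h𝓛 hB hn (not_le.1 h1) hx) h2

theorem DKernel.IsPrincipalFamily.sepOver {x : List (Idx 𝓓) × Fin n} (hn : IsNormal x.1)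
    (hx : 𝓛.IsAbove x) : SepOver (fieldBelow K (baseFamily z) x : Set E) (A x) := by
  rw [← hA.clamp_eq h𝓛 hB hn hx]
  exact sepOver_clamp h𝓛 hB hA.isExtension A hn hx

/-- The defining equation of `A x`, from which `clamp` has now disappeared. It gives the expected
derivative for one decomposition of `x` only. -/
theorem DKernel.IsPrincipalFamily.exists_derivation {x : List (Idx 𝓓) × Fin n}
    (hn : IsNormal x.1) (hl : s < x.1.length) (hx : 𝓛.IsAbove x) :
    ∃ (i : Idx 𝓓) (η : List (Idx 𝓓)), IsNormal η ∧ x.1.Perm (i :: η) ∧ 𝓛.IsAbove (η, x.2) ∧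
      dd e i (A (η, x.2)) = aeval (fun ξ => A (ξ, x.2)) (wordD Γ eK i η) := by
  obtain ⟨i, η, hη, hp, hab, h⟩ := hA.above x hn hl hx
  refine ⟨i, η, hη, hp, hab, ?_⟩
  rw [hA.clamp_eq h𝓛 hB (x := (η, x.2)) hη hab, map_sub, aeval_X] at h
  have h' : A x = A (x.1, x.2) := rfl
  rw [← h'] at h
  linear_combination -h

end Setting

/-! ### Transfer of normal-form identities to a family -/

section Intertwining

variable {k F K : Type*} [Field k] [Field F] [Field K] [Algebra k F] [Algebra k K] [Algebra F K]
  [IsScalarTower k F K] {𝓓 : OpType → LocalOperatorSystem k} (Γ : LHSSystem 𝓓 F)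
  (eK : ∀ u, K →ₐ[k] (𝓓 u).Alg ⊗[k] K) {R : Type*} [CommRing R] [Algebra k R] [Algebra K R]
  [IsScalarTower k K R]

open LocalOperatorSystem MvPolynomial

/-- `∂_i a^ξ` is given by its normal form. -/
def Intertwines (e : ∀ u, R →ₐ[k] (𝓓 u).Alg ⊗[k] R) (a : List (Idx 𝓓) → R) (i : Idx 𝓓)
    (ξ : List (Idx 𝓓)) : Prop :=
  dd e i (a ξ) = aeval a (wordD Γ eK i ξ)

variable {Γ eK} {e : ∀ u, R →ₐ[k] (𝓓 u).Alg ⊗[k] R} {a : List (Idx 𝓓) → R}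

theorem aeval_cf (u : OpType) (l i j : Fin (𝓓 u).m) :
    aeval a (cf (K := K) Γ (WordRing K 𝓓) u l i j) = cf (K := K) Γ R u l i j := by
  rw [cf_eq, AlgHom.commutes]; rfl

variable (hB : CoefRelations (K := K) Γ eK) (he : IsDRing eK e)
include hB he

theorem dd_aeval {T : Set (List (Idx 𝓓))} {u : OpType} {i : Fin (𝓓 u).m}
    (h : ∀ ξ ∈ T, ∀ p ≤ i, Intertwines Γ eK e a ⟨u, p⟩ ξ) {f : WordRing K 𝓓}
    (hf : f ∈ supported K T) : dd e ⟨u, i⟩ (aeval a f) = aeval a (dd (wordE Γ eK) ⟨u, i⟩ f) :=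
  crd_aeval hB (he.map_algebraMap u) (fun _ _ => he.crd_zero u _) h hf

theorem dd_dd_eq {i j : Idx 𝓓} {ξ : List (Idx 𝓓)} (hn : IsNormal ξ)
    (hj : Intertwines Γ eK e a j ξ)
    (h : ∀ τ, IsNormal τ → (τ.Perm (j :: ξ) ∨ τ.length ≤ ξ.length) →
      ∀ p : Idx 𝓓, p.rank ≤ i.rank → Intertwines Γ eK e a p τ) :
    dd e i (dd e j (a ξ)) = aeval a (dd (wordE Γ eK) i (dd (wordE Γ eK) j (X ξ))) := by
  obtain ⟨u, i⟩ := i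
  rw [hj, dd_wordE_X]
  exact dd_aeval hB he (fun τ hτ p hp => h τ hτ.1 hτ.2 ⟨u, p⟩ (Idx.rank_le_rank.2 hp))
    (wordD_mem_supported hB.toBaseRelations hB.lie_const hn _)

variable {ξ : List (Idx 𝓓)} (hn : IsNormal ξ)
    (h : ∀ τ, IsNormal τ → τ.length ≤ ξ.length → ∀ p, Intertwines Γ eK e a p τ)
include hn h

/-- `∂_j a^ξ` is the value at `ins j ξ` plus words no longer than `ξ`, on which `∂_i` is under
control. So `∂_i ∂_j a^ξ` misses its formal value by exactly the failure of `∂_i` at `ins j ξ`. -/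
theorem dd_dd_sub_eq (i : Idx 𝓓) {j : Idx 𝓓} (hj : IsNormal (ins j ξ)) :
    dd e i (dd e j (a ξ)) - aeval a (dd (wordE Γ eK) i (dd (wordE Γ eK) j (X ξ))) =
      dd e i (a (ins j ξ)) - aeval a (wordD Γ eK i (ins j ξ)) := by
  obtain ⟨u, i⟩ := i
  have h1 := dd_aeval hB he (a := a) (i := i) (fun τ hτ p _ => h τ hτ.1 hτ.2 ⟨u, p⟩)
    (wordD_sub_mem_supported hB.toBaseRelations hB.lie_const hn hj)
  rw [map_sub, map_sub, map_sub, map_sub, aeval_X, dd_wordE_X] at h1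
  rw [h ξ hn le_rfl j, dd_wordE_X]
  linear_combination h1

/-- When `ξ` already has a Hasse-Schmidt letter, `∂_j` does not lengthen it, so nothing about longer
words is required. -/
theorem dd_dd_eq_of_hs (i : Idx 𝓓) (j : Fin (𝓓 .hs).m) (hξ : ¬ IsLie ξ) :
    dd e i (dd e ⟨.hs, j⟩ (a ξ)) =
      aeval a (dd (wordE Γ eK) i (dd (wordE Γ eK) ⟨.hs, j⟩ (X ξ))) := by
  obtain ⟨u, i⟩ := i
  rw [h ξ hn le_rfl, dd_wordE_X]
  refine dd_aeval hB he (T := {τ | IsNormal τ ∧ τ.length ≤ ξ.length})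
    (fun τ hτ p _ => h τ hτ.1 hτ.2 ⟨u, p⟩) ?_
  obtain ⟨lam, l, hl, hlam, rfl⟩ := hn.isLie_or.resolve_left hξ
  rw [wordD_hs_append Γ eK j l hl]
  refine sum_mem fun l' _ => ?_
  refine mul_mem (Subalgebra.algebraMap_mem _ _) (X_mem_supported.2 ⟨?_, by simp⟩)
  exact isNormal_append_hs hl hlam l'

/-- The square operators commute with Lie operators modulo relations for shorter words, and exactly
with Hasse-Schmidt operators at the empty word because the Lie-coefficients are constants for them.
So the relations propagate from the empty word. -/
theorem aeval_squareIdeal_eq_zero (h0 : ∀ p, aeval a (squareOp Γ (wordE Γ eK) K p (X [])) = 0)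
    {f : WordRing K 𝓓} (hf : f ∈ squareIdeal Γ eK (ξ.length + 1)) : aeval a f = 0 := by
  obtain ⟨N, hN⟩ : ∃ N, ξ.length = N := ⟨_, rfl⟩
  rw [hN] at hf h
  clear hN hn
  have hspan : ∀ M, (∀ p τ, IsNormal τ → τ.length < M →
      aeval a (squareOp Γ (wordE Γ eK) K p (X τ)) = 0) →
      ∀ f ∈ squareIdeal Γ eK M, aeval a f = 0 := by
    intro M hM f hf
    rw [squareIdeal] at hf
    induction hf using Submodule.span_induction with
    | mem f hf =>
      obtain ⟨p, τ, h1, h2, rfl⟩ := hf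
      exact hM p τ h1 h2
    | zero => exact map_zero _
    | add _ _ _ _ h1 h2 => rw [map_add, h1, h2, add_zero]
    | smul c _ _ h => rw [smul_eq_mul, map_mul, h, mul_zero]
  suffices key : ∀ M, M ≤ N + 1 → ∀ p τ, IsNormal τ → τ.length < M →
      aeval a (squareOp Γ (wordE Γ eK) K p (X τ)) = 0 from hspan _ (key _ le_rfl) f hf
  intro M
  induction M with
  | zero => intro _ p τ _ hτ; omega
  | succ M ih =>
    intro hM p τ hτ hl
    rcases τ with _ | ⟨⟨_ | _, j⟩, τ⟩
    · exact h0 p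
    · have hτ' := hτ.tail
      have hlen : τ.length + 1 < M + 1 := by simpa using hl
      have h1 := hspan M (ih (by omega)) _
        (squareIdeal_mono (by omega) (squareOp_X_comm_mem hB hτ' p j))
      rw [map_sub, dd_wordE_X, wordD_of_isNormal_cons Γ eK hτ] at h1
      have h2 : squareOp Γ (wordE Γ eK) K p (X τ) ∈
          supported K {η : List (Idx 𝓓) | IsNormal η ∧ η.length ≤ N} := by
        refine sum_mem fun l _ => ?_
        rw [cf_eq, dd_wordE_X]
        refine mul_mem (Subalgebra.algebraMap_mem _ _) ?_
        refine supported_mono ?_ (wordD_mem_supported hB.toBaseRelations hB.lie_const hτ' _)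
        rintro η ⟨hη, hη'⟩
        refine ⟨hη, ?_⟩
        rcases hη' with hη' | hη'
        · rw [hη'.length_eq]; simp only [List.length_cons]; omega
        · omega
      rw [← dd_aeval hB he (fun η hη q _ => h η hη.1 hη.2 ⟨.lie, q⟩) h2,
        ih (by omega) p τ hτ' (by omega), map_zero, zero_sub, neg_eq_zero] at h1
      exact h1
    · obtain rfl := hτ.eq_nil_of_hs
      have h1 : squareOp Γ (wordE Γ eK) K p (X [⟨.hs, j⟩]) =
          dd (wordE Γ eK) ⟨.hs, j⟩ (squareOp Γ (wordE Γ eK) K p (X [])) := by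
        rw [squareOp, squareOp, map_sum]
        refine Finset.sum_congr rfl fun l _ => ?_
        have h2 := defectMix_X hB.toBaseRelations hB.lie_const hB.hs_const isNormal_nil l j
        rw [defectMix, sub_eq_zero, dd_wordE_X _ _ ⟨.hs, j⟩, wordD_of_isNormal_cons Γ eK hτ] at h2
        rw [← h2, cf_word, dd_wordE_C_mul_of_const hB.toBaseRelations]
        intro q
        exact hB.lie_const _ _ _ _
      have h2 : squareOp Γ (wordE Γ eK) K p (X []) ∈
          supported K {η : List (Idx 𝓓) | IsNormal η ∧ η.length ≤ N} := by
        refine sum_mem fun l _ => ?_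
        rw [cf_eq, dd_wordE_X]
        refine mul_mem (Subalgebra.algebraMap_mem _ _) ?_
        refine supported_mono ?_
          (wordD_mem_supported hB.toBaseRelations hB.lie_const isNormal_nil _)
        rintro η ⟨hη, hη'⟩
        refine ⟨hη, ?_⟩
        have : ([⟨.hs, j⟩] : List (Idx 𝓓)).length = 1 := rfl
        rcases hη' with hη' | hη'
        · rw [hη'.length_eq]; simp only [List.length_cons, List.length_nil]; omega
        · simp only [List.length_nil] at hη'; omega
      rw [h1, ← dd_aeval hB he (fun η hη q _ => h η hη.1 hη.2 ⟨.hs, q⟩) h2, h0, map_zero]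

end Intertwining

/-! ### Vanishing of the defects below an index and at leaders -/

section Setting

variable {k F K L : Type*} [Field k] [Field F] [Field K] [Field L] [Algebra k F] [Algebra k K]
  [Algebra k L] [Algebra F K] [Algebra K L] [IsScalarTower k F K] [IsScalarTower k K L]
  {𝓓 : OpType → LocalOperatorSystem k} {Γ : LHSSystem 𝓓 F}
  {eK : ∀ u, K →ₐ[k] (𝓓 u).Alg ⊗[k] K} {n s : ℕ} {𝓛 : DKernel eK n s L}

open LocalOperatorSystem MvPolynomial

variable {E : Type*} [Field E] [Algebra k E] [Algebra K E] [Algebra L E] [IsScalarTower k K E]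
  [IsScalarTower k L E] [IsScalarTower K L E]

variable {z : 𝓛.free → E} {A : List (Idx 𝓓) × Fin n → E} {e : ∀ u, E →ₐ[k] (𝓓 u).Alg ⊗[k] E}

section Fields

variable (hA : 𝓛.IsPrincipalFamily Γ z A e)
include hA

theorem DKernel.IsPrincipalFamily.baseFamily_eq_or (x : List (Idx 𝓓) × Fin n) :
    baseFamily z x.1 x.2 = A x ∨ baseFamily z x.1 x.2 = 0 := by
  by_cases h : x.1.length ≤ s ∨ ¬ 𝓛.IsAbove x
  · exact Or.inl (hA.base x h).symm
  · rw [not_or, not_le, not_not] at h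
    exact Or.inr (baseFamily_of_isAbove h.1 h.2)

/-- The subfield on which the defects up to `(i, j)` vanish contains the generators of the field
below `x`, and it absorbs elements separable over it. -/
theorem DKernel.IsPrincipalFamily.defect_eq_zero {u v : OpType}
    {Φ Ψ : E →ₐ[k] (𝓓 u).Alg ⊗[k] ((𝓓 v).Alg ⊗[k] E)}
    {δ : Fin (𝓓 u).m → Fin (𝓓 v).m → E → E} (hδ : IsDefect Φ Ψ δ)
    (hK : ∀ p q c, δ p q (algebraMap K E c) = 0) {i : Fin (𝓓 u).m} {j : Fin (𝓓 v).m}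
    {x : List (Idx 𝓓) × Fin n}
    (hx : ∀ w : List (Idx 𝓓) × Fin n, IsNormal w.1 → TriLT w x →
      ∀ p ≤ i, ∀ q ≤ j, δ p q (A w) = 0)
    {b : E} (hb : SepOver (fieldBelow K (baseFamily z) x : Set E) b) : δ i j b = 0 := by
  have hle : ∀ c ∈ fieldBelow K (baseFamily z) x, c ∈ defectField Φ Ψ i j := by
    intro c hc
    rw [fieldBelow] at hc
    induction hc using IntermediateField.adjoin_induction with
    | mem c hc =>
      obtain ⟨w, h1, h2, rfl⟩ := hc
      rcases hA.baseFamily_eq_or w with h | h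
      · rw [h]
        exact hδ.mem_defectField.2 (hx w h1 h2)
      · rw [h]
        exact zero_mem _
    | algebraMap c => exact hδ.mem_defectField.2 fun p _ q _ => hK p q c
    | add _ _ _ _ h1 h2 => exact add_mem h1 h2
    | inv _ _ h => exact inv_mem h
    | mul _ _ _ _ h1 h2 => exact mul_mem h1 h2
  exact hδ.mem_defectField.1 (hδ.mem_defectField_of_sepOver (hb.mono hle)) i le_rfl j le_rfl

variable (h𝓛 : 𝓛.IsDGammaKernel Γ)
include h𝓛

/-- The relation for `[∂_p, ∂_p]` at the empty word, available since the kernel has length at least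
2. -/
theorem DKernel.IsPrincipalFamily.aeval_squareOp_nil (p : Fin (𝓓 .lie).m) (t : Fin n) :
    aeval (fun ξ => A (ξ, t)) (squareOp Γ (wordE Γ eK) K p (X [])) = 0 := by
  have hs := h𝓛.1
  have h1 := DKernel.lie_relation h𝓛 (ξ := []) t (by simp only [List.length_nil]; omega) p p
  rw [left_eq_add] at h1
  have h2 := congrArg (algebraMap L E) h1
  rw [map_zero, map_sum] at h2
  rw [squareOp, map_sum, ← h2]
  refine Finset.sum_congr rfl fun l _ => ?_
  have hn : IsNormal ([⟨.lie, l⟩] : List (Idx 𝓓)) := isNormal_ins_lie (i := l) isNormal_nil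
  have hl : ([⟨.lie, l⟩] : List (Idx 𝓓)).length ≤ s := by simp; omega
  rw [map_mul, map_mul, aeval_cf, dd_wordE_X, wordD_of_isNormal_cons Γ eK hn, aeval_X,
    hA.base _ (Or.inl hl), baseFamily_of_le hl, cf, cf, ← IsScalarTower.algebraMap_apply K L E]

end Fields

section Below

variable {x : List (Idx 𝓓) × Fin n}
  (H : ∀ (l : Idx 𝓓) (τ : List (Idx 𝓓) × Fin n), IsNormal τ.1 → TriLT (l :: τ.1, τ.2) x →
    Intertwines Γ eK e (fun ξ => A (ξ, τ.2)) l τ.1)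
include H

theorem intertwines_of_length {N : ℕ} (hN : N + 1 < x.1.length) (t : Fin n) (τ : List (Idx 𝓓))
    (hτ : IsNormal τ) (hl : τ.length ≤ N) (p : Idx 𝓓) :
    Intertwines Γ eK e (fun ξ => A (ξ, t)) p τ :=
  H p (τ, t) hτ (triLT_of_length_lt (by simp only [List.length_cons]; omega))

variable (hB : CoefRelations (K := K) Γ eK) (he : IsDRing eK e)
include hB he

theorem dd_dd_eq_of_below {i j : Idx 𝓓} {w : List (Idx 𝓓) × Fin n} (hn : IsNormal w.1)
    (hw : TriLT (i :: j :: w.1, w.2) x) : dd e i (dd e j (A w)) =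
      aeval (fun ξ => A (ξ, w.2)) (dd (wordE Γ eK) i (dd (wordE Γ eK) j (X w.1))) := by
  refine dd_dd_eq hB he (a := fun ξ => A (ξ, w.2)) hn ?_ ?_
  · exact H j w hn ((triLT_cons_self _ _ _ _).trans hw)
  · intro τ hτ hτ' p hp
    exact H p (τ, w.2) hτ (((triLE_of_perm_or hτ' w.2).cons hp).trans_lt hw)

theorem defectHS_eq_zero_of_below {i j : Fin (𝓓 .hs).m} {w : List (Idx 𝓓) × Fin n}
    (hn : IsNormal w.1) (hw : TriLT (⟨.hs, i⟩ :: ⟨.hs, j⟩ :: w.1, w.2) x) :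
    defectHS (e := e) Γ K i j (A w) = 0 := by
  have h0 := congrArg (aeval fun ξ => A (ξ, w.2)) (defectHS_X hB hn i j)
  have hl := hw.length_le
  simp only [List.length_cons] at hl
  have hw' : TriLT (⟨.hs, j⟩ :: ⟨.hs, i⟩ :: w.1, w.2) x :=
    hw.congr (List.Perm.swap _ _ _) rfl (List.Perm.refl _) rfl
  have h1 : ∀ l, dd e ⟨.hs, l⟩ (A w) = aeval (fun ξ => A (ξ, w.2)) (wordD Γ eK ⟨.hs, l⟩ w.1) :=
    fun l => intertwines_of_length H (N := w.1.length) (by omega) w.2 w.1 hn le_rfl _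
  rw [defectHS, map_sub, map_sum, map_zero, ← dd_dd_eq_of_below H hB he hn hw'] at h0
  rw [defectHS, ← h0]
  congr 1
  refine Finset.sum_congr rfl fun l _ => ?_
  rw [map_mul, aeval_cf, dd_wordE_X, h1]

theorem defectMix_eq_zero_of_below {i : Fin (𝓓 .lie).m} {j : Fin (𝓓 .hs).m}
    {w : List (Idx 𝓓) × Fin n} (hn : IsNormal w.1)
    (hw : TriLT (⟨.lie, i⟩ :: ⟨.hs, j⟩ :: w.1, w.2) x) : defectMix e i j (A w) = 0 := by
  have h0 := congrArg (aeval fun ξ => A (ξ, w.2))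
    (defectMix_X hB.toBaseRelations hB.lie_const hB.hs_const hn i j)
  have hw' : TriLT (⟨.hs, j⟩ :: ⟨.lie, i⟩ :: w.1, w.2) x :=
    hw.congr (List.Perm.swap _ _ _) rfl (List.Perm.refl _) rfl
  rwa [defectMix, map_sub, map_zero, ← dd_dd_eq_of_below H hB he hn hw,
    ← dd_dd_eq_of_below H hB he hn hw'] at h0

variable (h𝓛 : 𝓛.IsDGammaKernel Γ) (hA : 𝓛.IsPrincipalFamily Γ z A e)
include h𝓛 hA

theorem aeval_squareIdeal_of_below {N : ℕ} {ξ : List (Idx 𝓓)} (hn : IsNormal ξ) (t : Fin n)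
    (hx : ξ.length + 1 < x.1.length) (hN : N ≤ ξ.length + 1) {f : WordRing K 𝓓}
    (hf : f ∈ squareIdeal Γ eK N) : aeval (fun ξ => A (ξ, t)) f = 0 :=
  aeval_squareIdeal_eq_zero hB he hn (intertwines_of_length H hx t)
    (fun p => hA.aeval_squareOp_nil h𝓛 p t) (squareIdeal_mono hN hf)

theorem aeval_defectLie_of_below {ξ : List (Idx 𝓓)} (hn : IsNormal ξ) (t : Fin n)
    (hx : ξ.length + 1 < x.1.length) (i j : Fin (𝓓 .lie).m) :
    aeval (fun ξ => A (ξ, t)) (dd (wordE Γ eK) ⟨.lie, j⟩ (dd (wordE Γ eK) ⟨.lie, i⟩ (X ξ))) -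
      aeval (fun ξ => A (ξ, t)) (dd (wordE Γ eK) ⟨.lie, i⟩ (dd (wordE Γ eK) ⟨.lie, j⟩ (X ξ))) =
      ∑ l, cf (K := K) Γ E .lie l j i * dd e ⟨.lie, l⟩ (A (ξ, t)) := by
  have h0 := aeval_squareIdeal_of_below H hB he h𝓛 hA hn t hx le_rfl
    (defectLie_X_mem_succ hB hn i j)
  rw [defectLie, map_sub, map_sub, sub_eq_zero, map_sum] at h0
  rw [h0]
  refine Finset.sum_congr rfl fun l _ => ?_
  rw [map_mul, aeval_cf, dd_wordE_X]
  congr 1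
  exact (intertwines_of_length H hx t ξ hn le_rfl _).symm

theorem defectLie_eq_zero_of_below {i j : Fin (𝓓 .lie).m} {w : List (Idx 𝓓) × Fin n}
    (hn : IsNormal w.1) (hw : TriLT (⟨.lie, i⟩ :: ⟨.lie, j⟩ :: w.1, w.2) x) :
    defectLie (e := e) Γ K i j (A w) = 0 := by
  have hl := hw.length_le
  simp only [List.length_cons] at hl
  have h0 := aeval_defectLie_of_below H hB he h𝓛 hA hn w.2 (by omega) i j
  have hw' : TriLT (⟨.lie, j⟩ :: ⟨.lie, i⟩ :: w.1, w.2) x :=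
    hw.congr (List.Perm.swap _ _ _) rfl (List.Perm.refl _) rfl
  rw [← dd_dd_eq_of_below H hB he hn hw, ← dd_dd_eq_of_below H hB he hn hw'] at h0
  rw [defectLie, h0, sub_self]

end Below

section Leader

variable (h𝓛 : 𝓛.IsDGammaKernel Γ) (hB : CoefRelations (K := K) Γ eK)
  (hA : 𝓛.IsPrincipalFamily Γ z A e) {x : List (Idx 𝓓) × Fin n}
  (H : ∀ (l : Idx 𝓓) (τ : List (Idx 𝓓) × Fin n), IsNormal τ.1 → TriLT (l :: τ.1, τ.2) x →
    Intertwines Γ eK e (fun ξ => A (ξ, τ.2)) l τ.1)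
  {σ : List (Idx 𝓓)} {t : Fin n} (hn : IsNormal σ) (hσ : 𝓛.IsAbove (σ, t))
include h𝓛 hB hA H hn hσ

/-- `A (σ, t)` is separable over smaller elements, where commutation concerns only indices strictly
below `x`. By rigidity the relation also holds at `σ`, even if `ijσ` rearranges to `x`, which the
inductive hypothesis does not reach. -/
theorem defectLie_eq_zero_of_isAbove {i j : Fin (𝓓 .lie).m}
    (hx : TriLE (⟨.lie, i⟩ :: ⟨.lie, j⟩ :: σ, t) x) :
    defectLie (e := e) Γ K i j (A (σ, t)) = 0 := by
  refine hA.defect_eq_zero (isDefect_lie (K := K) Γ (baseMap k F K E) (fun _ => rfl)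
    hA.isExtension.crd_zero) (hB.defectLie_algebraMap hA.isExtension.isDRing) (x := (σ, t))
    (fun w hw hwσ p hp q hq => ?_) (hA.sepOver h𝓛 hB (x := (σ, t)) hn hσ)
  exact defectLie_eq_zero_of_below H hB hA.isExtension.isDRing h𝓛 hA hw
    (((hwσ.cons (Idx.rank_le_rank.2 hq)).cons (Idx.rank_le_rank.2 hp)).trans_le hx)

theorem defectHS_eq_zero_of_isAbove {i j : Fin (𝓓 .hs).m}
    (hx : TriLE (⟨.hs, i⟩ :: ⟨.hs, j⟩ :: σ, t) x) :
    defectHS (e := e) Γ K i j (A (σ, t)) = 0 := by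
  refine hA.defect_eq_zero (isDefect_hs (K := K) Γ (baseMap k F K E) (fun _ => rfl)
    hA.isExtension.crd_zero) (hB.defectHS_algebraMap hA.isExtension.isDRing) (x := (σ, t))
    (fun w hw hwσ p hp q hq => ?_) (hA.sepOver h𝓛 hB (x := (σ, t)) hn hσ)
  exact defectHS_eq_zero_of_below H hB hA.isExtension.isDRing hw
    (((hwσ.cons (Idx.rank_le_rank.2 hq)).cons (Idx.rank_le_rank.2 hp)).trans_le hx)

theorem defectMix_eq_zero_of_isAbove {i : Fin (𝓓 .lie).m} {j : Fin (𝓓 .hs).m}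
    (hx : TriLE (⟨.lie, i⟩ :: ⟨.hs, j⟩ :: σ, t) x) : defectMix e i j (A (σ, t)) = 0 := by
  refine hA.defect_eq_zero (isDefect_mix (𝓓 := 𝓓) (baseMap k F K E)
    hA.isExtension.crd_zero) (hB.defectMix_algebraMap hA.isExtension.isDRing) (x := (σ, t))
    (fun w hw hwσ p hp q hq => ?_) (hA.sepOver h𝓛 hB (x := (σ, t)) hn hσ)
  exact defectMix_eq_zero_of_below H hB hA.isExtension.isDRing hw
    (((hwσ.cons (Idx.rank_le_rank.2 hq)).cons (Idx.rank_le_rank.2 hp)).trans_le hx)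

/-- The failures of two ways of differentiating a leader agree. -/
theorem intertwines_iff_lie {i j : Fin (𝓓 .lie).m}
    (hx : TriLE (⟨.lie, i⟩ :: ⟨.lie, j⟩ :: σ, t) x) :
    Intertwines Γ eK e (fun ξ => A (ξ, t)) ⟨.lie, i⟩ (ins ⟨.lie, j⟩ σ) ↔
      Intertwines Γ eK e (fun ξ => A (ξ, t)) ⟨.lie, j⟩ (ins ⟨.lie, i⟩ σ) := by
  have hl := hx.length_le
  simp only [List.length_cons] at hl
  have h0 := defectLie_eq_zero_of_isAbove h𝓛 hB hA H hn hσ hx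
  rw [defectLie, sub_eq_zero] at h0
  have h1 := aeval_defectLie_of_below H hB hA.isExtension.isDRing h𝓛 hA hn t (by omega) i j
  have hlen := intertwines_of_length H (N := σ.length) (by omega) t
  have h2 := dd_dd_sub_eq hB hA.isExtension.isDRing hn hlen ⟨.lie, i⟩
    (isNormal_ins_lie (i := j) hn)
  have h3 := dd_dd_sub_eq hB hA.isExtension.isDRing hn hlen ⟨.lie, j⟩
    (isNormal_ins_lie (i := i) hn)
  rw [Intertwines, Intertwines, ← sub_eq_zero, ← h2, ← sub_eq_zero (a := dd e _ _), ← h3]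
  have : ∀ a b c d : E, a - b = c - d → (b - d = 0 ↔ a - c = 0) := by
    intro a b c d h
    rw [show a - c = b - d by linear_combination h]
  exact this _ _ _ _ (h0.trans h1.symm)

theorem intertwines_iff_mix {i : Fin (𝓓 .lie).m} {j : Fin (𝓓 .hs).m}
    (hj : IsNormal (ins ⟨.hs, j⟩ σ)) (hx : TriLE (⟨.lie, i⟩ :: ⟨.hs, j⟩ :: σ, t) x) :
    Intertwines Γ eK e (fun ξ => A (ξ, t)) ⟨.lie, i⟩ (ins ⟨.hs, j⟩ σ) ↔
      Intertwines Γ eK e (fun ξ => A (ξ, t)) ⟨.hs, j⟩ (ins ⟨.lie, i⟩ σ) := by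
  have hl := hx.length_le
  simp only [List.length_cons] at hl
  have h0 := defectMix_eq_zero_of_isAbove h𝓛 hB hA H hn hσ hx
  rw [defectMix, sub_eq_zero] at h0
  have h1 := defectMix_X hB.toBaseRelations hB.lie_const hB.hs_const hn i j
  rw [defectMix, sub_eq_zero] at h1
  have hlen := intertwines_of_length H (N := σ.length) (by omega) t
  have h2 := dd_dd_sub_eq hB hA.isExtension.isDRing hn hlen ⟨.lie, i⟩ hj
  have h3 := dd_dd_sub_eq hB hA.isExtension.isDRing hn hlen ⟨.hs, j⟩
    (isNormal_ins_lie (i := i) hn)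
  rw [Intertwines, Intertwines, ← sub_eq_zero, ← h2, ← sub_eq_zero (a := dd e _ _), ← h3, h0, h1]

/-- Here one of the two orders of differentiation stays within known lengths, so commutation at the
leader proves the identity outright instead of comparing two failures. -/
theorem intertwines_hs_of_not_isLie {i : Fin (𝓓 .lie).m} {j : Fin (𝓓 .hs).m} (hl : ¬ IsLie σ)
    (hx : TriLE (⟨.lie, i⟩ :: ⟨.hs, j⟩ :: σ, t) x) :
    Intertwines Γ eK e (fun ξ => A (ξ, t)) ⟨.hs, j⟩ (ins ⟨.lie, i⟩ σ) := by
  have hle := hx.length_le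
  simp only [List.length_cons] at hle
  have h0 := defectMix_eq_zero_of_isAbove h𝓛 hB hA H hn hσ hx
  rw [defectMix, sub_eq_zero] at h0
  have h1 := defectMix_X hB.toBaseRelations hB.lie_const hB.hs_const hn i j
  rw [defectMix, sub_eq_zero] at h1
  have hlen := intertwines_of_length H (N := σ.length) (by omega) t
  have h2 := dd_dd_eq_of_hs hB hA.isExtension.isDRing hn hlen ⟨.lie, i⟩ j hl
  have h3 := dd_dd_sub_eq hB hA.isExtension.isDRing hn hlen ⟨.hs, j⟩
    (isNormal_ins_lie (i := i) hn)
  rw [Intertwines, ← sub_eq_zero, ← h3, h0, h1, h2, sub_self]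

theorem intertwines_hs_of_isLie {i j : Fin (𝓓 .hs).m} (hl : IsLie σ)
    (hx : TriLE (⟨.hs, i⟩ :: ⟨.hs, j⟩ :: σ, t) x) :
    Intertwines Γ eK e (fun ξ => A (ξ, t)) ⟨.hs, j⟩ (ins ⟨.hs, i⟩ σ) := by
  have hle := hx.length_le
  simp only [List.length_cons] at hle
  have h0 := defectHS_eq_zero_of_isAbove h𝓛 hB hA H hn hσ hx
  have h1 := congrArg (aeval fun ξ => A (ξ, t)) (defectHS_X hB hn i j)
  have hlen := intertwines_of_length H (N := σ.length) (by omega) t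
  have h3 := dd_dd_sub_eq hB hA.isExtension.isDRing hn hlen ⟨.hs, j⟩
    (isNormal_ins_of_isLie ⟨.hs, i⟩ hn hl)
  rw [defectHS, sub_eq_zero] at h0
  rw [defectHS, map_sub, map_zero, sub_eq_zero, map_sum] at h1
  rw [Intertwines, ← sub_eq_zero, ← h3, h0, h1, sub_eq_zero]
  refine Finset.sum_congr rfl fun l _ => ?_
  rw [map_mul, aeval_cf, dd_wordE_X]
  congr 1
  exact hlen σ hn le_rfl _

end Leader

end Setting

theorem triLE_of_perm {k : Type*} [Field k] {𝓓 : OpType → LocalOperatorSystem k} {n : ℕ}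
    {ξ ξ' : List (Idx 𝓓)} (h : ξ.Perm ξ') (t : Fin n) : TriLE (ξ, t) (ξ', t) :=
  Or.inr ⟨h, rfl⟩

/-! ### Independence of the chosen decomposition -/

section Setting

variable {k F K L : Type*} [Field k] [Field F] [Field K] [Field L] [Algebra k F] [Algebra k K]
  [Algebra k L] [Algebra F K] [Algebra K L] [IsScalarTower k F K] [IsScalarTower k K L]
  {𝓓 : OpType → LocalOperatorSystem k} {Γ : LHSSystem 𝓓 F}
  {eK : ∀ u, K →ₐ[k] (𝓓 u).Alg ⊗[k] K} {n s : ℕ} {𝓛 : DKernel eK n s L}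

open LocalOperatorSystem MvPolynomial

variable {E : Type*} [Field E] [Algebra k E] [Algebra K E] [Algebra L E] [IsScalarTower k K E]
  [IsScalarTower k L E] [IsScalarTower K L E]

variable {z : 𝓛.free → E} {A : List (Idx 𝓓) × Fin n → E} {e : ∀ u, E →ₐ[k] (𝓓 u).Alg ⊗[k] E}

variable (h𝓛 : 𝓛.IsDGammaKernel Γ) (hB : CoefRelations (K := K) Γ eK)
  (hA : 𝓛.IsPrincipalFamily Γ z A e)

include h𝓛 hB hA in
theorem intertwines_of_length_lt (i : Idx 𝓓) {ξ : List (Idx 𝓓)} (t : Fin n) (hn : IsNormal ξ)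
    (h : ξ.length < s) : Intertwines Γ eK e (fun ξ => A (ξ, t)) i ξ := by
  rw [Intertwines, hA.base (ξ, t) (Or.inl h.le), dd_baseFamily h𝓛 hB hA.isExtension i t hn h]
  refine aeval_congr_of_mem_supported ?_
    (wordD_mem_supported hB.toBaseRelations hB.lie_const hn i)
  rintro η ⟨-, hη⟩
  refine (hA.base (η, t) (Or.inl ?_)).symm
  rcases hη with hη | hη
  · simp only [hη.length_eq, List.length_cons]; omega
  · simp only; omega

include hA in
theorem intertwines_of_not_isAbove (i : Idx 𝓓) {x : List (Idx 𝓓) × Fin n} (hn : IsNormal x.1)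
    (hl : s ≤ x.1.length) (hx : ¬ 𝓛.IsAbove x) :
    Intertwines Γ eK e (fun ξ => A (ξ, x.2)) i x.1 := by
  rw [Intertwines, hA.base (x.1, x.2) (Or.inr hx)]
  rcases hl.lt_or_eq with hl | hl
  · rw [baseFamily_of_mem ⟨hn, hl, hx⟩, hA.isExtension.free]
  · rw [baseFamily_of_le hl.ge, hA.isExtension.basis x hn hl.symm
      fun h => hx (𝓛.isAbove_of_mem_sepLeaders h)]

variable {x : List (Idx 𝓓) × Fin n}
  (H : ∀ (l : Idx 𝓓) (τ : List (Idx 𝓓) × Fin n), IsNormal τ.1 → TriLT (l :: τ.1, τ.2) x →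
    Intertwines Γ eK e (fun ξ => A (ξ, τ.2)) l τ.1)
include h𝓛 hB hA H

/-- Two ways of obtaining the same word from words above the same leader. -/
theorem intertwines_iff_of_isAbove {i j : Idx 𝓓} {ξ η ζ : List (Idx 𝓓)} {t : Fin n}
    (hξ : IsNormal ξ) (hη : IsNormal η) (hζ : IsNormal ζ) (hiξ : ζ.Perm (i :: ξ))
    (hjη : ζ.Perm (j :: η)) (hx : TriLE (ζ, t) x) {μ : List (Idx 𝓓) × Fin n}
    (hμ : μ ∈ minSepLeaders K 𝓛.a s) (hμξ : ProdLE μ (ξ, t))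
    (hμj : μ.1.count j < ζ.count j) :
    Intertwines Γ eK e (fun ξ => A (ξ, t)) i ξ ↔ Intertwines Γ eK e (fun ξ => A (ξ, t)) j η := by
  by_cases hij : i = j
  · subst hij
    rw [hξ.eq_of_perm hη ((List.perm_cons i).1 (hiξ.symm.trans hjη))]
  -- Since `i ≠ j`, the surplus letter `j` already lies in `ξ`; removing it gives a common
  -- predecessor of `ξ` and `η` that is still above `μ`.
  have hcount : ζ.count j = ξ.count j := by
    rw [hiξ.count_eq, List.count_cons_of_ne hij]
  rw [hcount] at hμj
  have hpξ := perm_cons_erase_of_count_lt hμj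
  have hn := hξ.erase j
  have hab : 𝓛.IsAbove (ξ.erase j, t) := ⟨μ, hμ, hμξ.erase hμj⟩
  set σ := ξ.erase j with hσ
  have hpη : η.Perm (i :: σ) := by
    refine (List.perm_cons j).1 (hjη.symm.trans (hiξ.trans ?_))
    exact ((List.perm_cons i).2 hpξ).trans (List.Perm.swap _ _ _)
  have hξ' : ins j σ = ξ := hξ.ins_eq_of_perm hn hpξ
  have hη' : ins i σ = η := hη.ins_eq_of_perm hn hpη
  have hij' : ζ.Perm (i :: j :: σ) := hiξ.trans ((List.perm_cons i).2 hpξ)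
  have hx1 : TriLE (i :: j :: σ, t) x := (triLE_of_perm hij'.symm t).trans hx
  have hx2 : TriLE (j :: i :: σ, t) x :=
    (triLE_of_perm ((List.Perm.swap _ _ _).trans hij'.symm) t).trans hx
  rw [← hξ', ← hη']
  rw [← hξ'] at hξ
  rw [← hη'] at hη
  obtain ⟨_ | _, i⟩ := i <;> obtain ⟨_ | _, j⟩ := j
  · exact intertwines_iff_lie h𝓛 hB hA H hn hab hx1
  · exact intertwines_iff_mix h𝓛 hB hA H hn hab hξ hx1
  · exact (intertwines_iff_mix h𝓛 hB hA H hn hab hη hx2).symm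
  · have h1 := hζ.2
    rw [hij'.countP_eq] at h1
    simp at h1

variable {r : ℕ} (hr : 2 * r ≤ s) (hmin : ∀ μ ∈ minSepLeaders K 𝓛.a s, μ.1.length ≤ r)
include hr hmin

/-- Short words come from the kernel and indices off the leaders from the prescribed values. Above a
leader, the identity is known for one decomposition of the long word and moves to any other through
a common letter, which exists because the word is longer than two leaders together. -/
theorem intertwines_of_forall_triLT {i : Idx 𝓓} {ξ : List (Idx 𝓓)} {t : Fin n} (hξ : IsNormal ξ)
    (hx : TriLE (i :: ξ, t) x) : Intertwines Γ eK e (fun ξ => A (ξ, t)) i ξ := by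
  rcases lt_or_ge ξ.length s with hl | hl
  · exact intertwines_of_length_lt h𝓛 hB hA i t hξ hl
  by_cases hab : 𝓛.IsAbove (ξ, t)
  swap
  · exact intertwines_of_not_isAbove hA i (x := (ξ, t)) hξ hl hab
  have hs := h𝓛.1
  by_cases hζ : (i :: ξ).countP (fun i => i.1 = OpType.hs) ≤ 1
  · have hn := isNormal_ins hξ hζ
    have hp := perm_ins i ξ
    set ζ := ins i ξ with hζ'
    have hζl : ζ.length = ξ.length + 1 := by rw [hp.length_eq]; rfl
    have habζ : 𝓛.IsAbove (ζ, t) := by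
      obtain ⟨μ, hμ, h⟩ := hab
      refine ⟨μ, hμ, h.1, fun j => (h.2 j).trans ?_⟩
      rw [hp.count_eq]
      exact List.count_le_count_cons
    obtain ⟨j, η, hη, hjη, habη, hC⟩ :=
      hA.exists_derivation h𝓛 hB (x := (ζ, t)) hn (by simp only; omega) habζ
    obtain ⟨μ, hμ, hμξ⟩ := hab
    obtain ⟨ν, hν, hνη⟩ := habη
    have h1 := hmin μ hμ
    have h2 := hmin ν hν
    -- Here `|ζ| = |ξ| + 1 > s ≥ 2r ≥ |μ| + |ν|`. The decomposition `(q, ζ.erase q)` is comparable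
    -- with both the given and the designated one.
    obtain ⟨q, hq1, hq2⟩ := exists_count_lt_and_count_lt (μ := μ.1) (ν := ν.1) (ζ := ζ) (by omega)
    have hx' : TriLE (ζ, t) x := (triLE_of_perm hp t).trans hx
    have hq := perm_cons_erase_of_count_lt hq1
    exact (intertwines_iff_of_isAbove h𝓛 hB hA H hξ (hn.erase q) hn hp hq hx' hμ hμξ hq1).trans
      (intertwines_iff_of_isAbove h𝓛 hB hA H hη (hn.erase q) hn hjη hq hx' hν hνη hq2).symm
      |>.2 hC
  · obtain ⟨_ | _, i⟩ := i
    · exact absurd (by rw [List.countP_cons_of_neg (by simp)]; exact hξ.2) hζ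
    have hlie : ¬ IsLie ξ := by
      intro h
      have h1 := h.countP
      simp [h1] at hζ
    -- Two Hasse-Schmidt letters meet, so no normal word has these letters. Since `r < s ≤ |ξ|`, the
    -- index `ξ` is not itself minimal, and commutation is used at a shorter index above a leader.
    rcases hab.mem_or_exists hξ with h | ⟨j, σ, hσ, hp, habσ⟩
    · have h1 := hmin _ h
      simp only at h1
      omega
    have hins := hξ.ins_eq_of_perm hσ hp
    have hx1 : TriLE (j :: ⟨.hs, i⟩ :: σ, t) x := (triLE_of_perm ((List.Perm.swap _ _ _).trans
      ((List.perm_cons _).2 hp.symm)) t).trans hx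
    rw [← hins]
    obtain ⟨_ | _, j⟩ := j
    · refine intertwines_hs_of_not_isLie h𝓛 hB hA H hσ habσ (fun h => hlie ?_) hx1
      rw [← hins]
      exact isLie_ins h
    · refine intertwines_hs_of_isLie h𝓛 hB hA H hσ habσ ?_ hx1
      rcases hσ.isLie_or with h | ⟨lam, h, _, _, rfl⟩
      · exact h
      · have h1 := hξ.2
        rw [hp.countP_eq] at h1
        simp at h1

omit H

/-- The operators act on a principal family through the normal forms. -/
theorem intertwines (i : Idx 𝓓) {ξ : List (Idx 𝓓)} (hξ : IsNormal ξ) (t : Fin n) :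
    Intertwines Γ eK e (fun ξ => A (ξ, t)) i ξ := by
  suffices key : ∀ (x : List (Idx 𝓓) × Fin n) (i : Idx 𝓓) (ξ : List (Idx 𝓓)) (t : Fin n),
      IsNormal ξ → TriLE (i :: ξ, t) x → Intertwines Γ eK e (fun ξ => A (ξ, t)) i ξ from
    key (i :: ξ, t) i ξ t hξ (TriLE.refl _)
  intro x
  induction x using wellFounded_triLT.induction with
  | _ x ih =>
  intro i ξ t hξ hx
  exact intertwines_of_forall_triLT h𝓛 hB hA (fun l τ hτ hlt => ih _ hlt l τ.1 τ.2 hτ (TriLE.refl _))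
    hr hmin hξ hx

end Setting

theorem isAlgebraic_of_forall_mem {K L E : Type*} [Field K] [Field L] [Field E] [Algebra K E]
    [Algebra L E] {G : IntermediateField K E} {M : IntermediateField L E} (h : ∀ c ∈ G, c ∈ M)
    {b : E} (hb : IsAlgebraic G b) : IsAlgebraic M b := by
  let f : G →+* M :=
    { toFun := fun c => ⟨c, h c c.2⟩
      map_one' := rfl
      map_mul' := fun _ _ => rfl
      map_zero' := rfl
      map_add' := fun _ _ => rfl }
  exact hb.ringHom_of_comp_eq f (RingHom.id E) f.injective rfl

theorem isAlgebraic_map_iff {K L E : Type*} [Field K] [Field L] [Field E] [Algebra K L]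
    [Algebra K E] (g : L →ₐ[K] E) {G : IntermediateField K L} {b : L} :
    IsAlgebraic (G.map g) (g b) ↔ IsAlgebraic G b :=
  isAlgebraic_ringHom_iff_of_comp_eq (G.equivMap g) (g : L →+* E) g.toRingHom.injective rfl

/-! ### Leaders depend only on the values at normal words -/

section Congr

variable {k : Type*} [Field k] {𝓓 : OpType → LocalOperatorSystem k} {K E : Type*} [Field K]
  [Field E] [Algebra K E] {n : ℕ} {a b : List (Idx 𝓓) → Fin n → E}

theorem fieldBelow_congr (h : ∀ ξ t, IsNormal ξ → a ξ t = b ξ t) (x : List (Idx 𝓓) × Fin n) :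
    fieldBelow K a x = fieldBelow K b x := by
  rw [fieldBelow, fieldBelow]
  congr 1
  ext c
  constructor
  · rintro ⟨y, h1, h2, rfl⟩
    exact ⟨y, h1, h2, h _ _ h1⟩
  · rintro ⟨y, h1, h2, rfl⟩
    exact ⟨y, h1, h2, (h _ _ h1).symm⟩

theorem sepLeaders_congr (h : ∀ ξ t, IsNormal ξ → a ξ t = b ξ t) (N : ℕ∞) :
    sepLeaders K a N = sepLeaders K b N := by
  ext x
  refine and_congr_right fun hx => ?_
  rw [fieldBelow_congr h, h _ _ hx]

theorem insepLeaders_congr (h : ∀ ξ t, IsNormal ξ → a ξ t = b ξ t) (N : ℕ∞) :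
    insepLeaders K a N = insepLeaders K b N := by
  ext x
  refine and_congr_right fun hx => ?_
  rw [fieldBelow_congr h, h _ _ hx]

theorem minSepLeaders_congr (h : ∀ ξ t, IsNormal ξ → a ξ t = b ξ t) (N : ℕ∞) :
    minSepLeaders K a N = minSepLeaders K b N := by
  rw [minSepLeaders, minSepLeaders, sepLeaders_congr h]

end Congr

/-! ### Relations on the whole field and determination of its leaders -/

section Setting

variable {k F K L : Type*} [Field k] [Field F] [Field K] [Field L] [Algebra k F] [Algebra k K]
  [Algebra k L] [Algebra F K] [Algebra K L] [IsScalarTower k F K] [IsScalarTower k K L]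
  {𝓓 : OpType → LocalOperatorSystem k} {Γ : LHSSystem 𝓓 F}
  {eK : ∀ u, K →ₐ[k] (𝓓 u).Alg ⊗[k] K} {n s : ℕ} {𝓛 : DKernel eK n s L}

open LocalOperatorSystem MvPolynomial

variable {E : Type*} [Field E] [Algebra k E] [Algebra K E] [Algebra L E] [IsScalarTower k K E]
  [IsScalarTower k L E] [IsScalarTower K L E]

variable {z : 𝓛.free → E} {A : List (Idx 𝓓) × Fin n → E} {e : ∀ u, E →ₐ[k] (𝓓 u).Alg ⊗[k] E}

variable (h𝓛 : 𝓛.IsDGammaKernel Γ) (hB : CoefRelations (K := K) Γ eK)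
  (htop : IntermediateField.adjoin L (Set.range z) = ⊤)
  (hA : 𝓛.IsPrincipalFamily Γ z A e)

section Generation

include h𝓛 hB htop hA

/-- The field is generated over `K` by the values of the family at normal words. -/
theorem DKernel.IsPrincipalFamily.mem_subfield (T : Subfield E)
    (hK : ∀ c, algebraMap K E c ∈ T)
    (hT : ∀ x : List (Idx 𝓓) × Fin n, IsNormal x.1 → A x ∈ T) (b : E) : b ∈ T := by
  have hL : ∀ c : L, algebraMap L E c ∈ T := by
    intro c
    have hc : c ∈ levelField K 𝓛.a (s + 1) := by rw [𝓛.generates]; trivial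
    rw [DKernel.levelField_eq h𝓛 hB le_rfl] at hc
    induction hc using IntermediateField.adjoin_induction with
    | mem c hc =>
      obtain ⟨ξ, t, h1, h2, rfl⟩ := hc
      have h3 := hT (ξ, t) h1
      rwa [hA.base (ξ, t) (Or.inl (Nat.lt_succ_iff.1 h2)),
        baseFamily_of_le (Nat.lt_succ_iff.1 h2)] at h3
    | algebraMap c => rw [← IsScalarTower.algebraMap_apply]; exact hK c
    | add _ _ _ _ h1 h2 => rw [map_add]; exact add_mem h1 h2
    | inv _ _ h => rw [map_inv₀]; exact inv_mem h
    | mul _ _ _ _ h1 h2 => rw [map_mul]; exact mul_mem h1 h2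
  have hb : b ∈ IntermediateField.adjoin L (Set.range z) := by rw [htop]; trivial
  induction hb using IntermediateField.adjoin_induction with
  | mem c hc =>
    obtain ⟨y, rfl⟩ := hc
    have h1 := hT y y.2.1
    rwa [hA.base y (Or.inr y.2.2.2), baseFamily_of_mem y.2] at h1
  | algebraMap c => exact hL c
  | add _ _ _ _ h1 h2 => exact add_mem h1 h2
  | inv _ _ h => exact inv_mem h
  | mul _ _ _ _ h1 h2 => exact mul_mem h1 h2

variable {r : ℕ} (hr : 2 * r ≤ s) (hmin : ∀ μ ∈ minSepLeaders K 𝓛.a s, μ.1.length ≤ r)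
include hr hmin

/-- Vanishing of the defects up to a given position defines a subfield; it contains `K` and all
values of the family at normal words, which generate `E`. -/
theorem DKernel.IsPrincipalFamily.gammaCommuteOn :
    GammaCommuteOn Γ (baseMap k F K E) (AlgHom.id k E) Set.univ e := by
  have he := hA.isExtension.isDRing
  refine (gammaCommuteOn_univ_iff (K := K) Γ _ (fun _ => rfl) he.crd_zero).2 ?_
  have H : ∀ (x : List (Idx 𝓓) × Fin n) (l : Idx 𝓓) (τ : List (Idx 𝓓) × Fin n), IsNormal τ.1 →
      TriLT (l :: τ.1, τ.2) x → Intertwines Γ eK e (fun ξ => A (ξ, τ.2)) l τ.1 :=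
    fun _ l τ hτ _ => intertwines h𝓛 hB hA hr hmin l hτ τ.2
  refine ⟨fun b p q => ?_, fun b p q => ?_, fun b p q => ?_⟩
  · have hδ := isDefect_lie (K := K) Γ (baseMap k F K E) (fun _ => rfl) he.crd_zero
    refine hδ.mem_defectField.1 (hA.mem_subfield h𝓛 hB htop _ (fun c => hδ.mem_defectField.2
      fun i _ j _ => hB.defectLie_algebraMap he i j c) (fun x hx => hδ.mem_defectField.2
      fun i _ j _ => ?_) b) p le_rfl q le_rfl
    exact defectLie_eq_zero_of_below (H _) hB he h𝓛 hA hx (triLT_cons_self _ _ x.2 ⟨.lie, i⟩)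
  · have hδ := isDefect_hs (K := K) Γ (baseMap k F K E) (fun _ => rfl) he.crd_zero
    refine hδ.mem_defectField.1 (hA.mem_subfield h𝓛 hB htop _ (fun c => hδ.mem_defectField.2
      fun i _ j _ => hB.defectHS_algebraMap he i j c) (fun x hx => hδ.mem_defectField.2
      fun i _ j _ => ?_) b) p le_rfl q le_rfl
    exact defectHS_eq_zero_of_below (H _) hB he hx (triLT_cons_self _ _ x.2 ⟨.hs, i⟩)
  · have hδ := isDefect_mix (𝓓 := 𝓓) (baseMap k F K E) he.crd_zero
    refine hδ.mem_defectField.1 (hA.mem_subfield h𝓛 hB htop _ (fun c => hδ.mem_defectField.2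
      fun i _ j _ => hB.defectMix_algebraMap he i j c) (fun x hx => hδ.mem_defectField.2
      fun i _ j _ => ?_) b) p le_rfl q le_rfl
    exact defectMix_eq_zero_of_below (H _) hB he hx (triLT_cons_self _ _ x.2 ⟨.lie, i⟩)

omit htop in
theorem DKernel.IsPrincipalFamily.foldr_eq (t : Fin n) {ξ : List (Idx 𝓓)} (hξ : IsNormal ξ) :
    ξ.foldr (fun i b => dd e i b) (algebraMap L E (𝓛.a [] t)) = A (ξ, t) := by
  induction ξ with
  | nil =>
    rw [hA.base ([], t) (Or.inl (Nat.zero_le _)), baseFamily_of_le (Nat.zero_le _)]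
    rfl
  | cons i ξ ih =>
    rw [List.foldr_cons, ih hξ.tail, intertwines h𝓛 hB hA hr hmin i hξ.tail t,
      wordD_of_isNormal_cons Γ eK hξ, aeval_X]

end Generation

section Leaders

include h𝓛 hB hA

/-- Where the two families differ, at long indices above a leader, one is zero and, at normal
indices, the other lies in the field generated by smaller elements. -/
theorem DKernel.IsPrincipalFamily.fieldBelow_eq (x : List (Idx 𝓓) × Fin n) :
    fieldBelow K (fun ξ t => A (ξ, t)) x = fieldBelow K (baseFamily z) x := by
  apply le_antisymm
  · refine IntermediateField.adjoin_le_iff.2 ?_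
    rintro _ ⟨y, h1, h2, rfl⟩
    exact fieldUpTo_le_fieldBelow h2 (hA.mem_fieldUpTo h𝓛 hB h1)
  · refine IntermediateField.adjoin_le_iff.2 ?_
    rintro _ ⟨y, h1, h2, rfl⟩
    rcases hA.baseFamily_eq_or y with h | h
    · rw [h]
      exact IntermediateField.subset_adjoin K _ ⟨y, h1, h2, rfl⟩
    · rw [h]
      exact zero_mem _

theorem DKernel.IsPrincipalFamily.isSeparable_iff {x : List (Idx 𝓓) × Fin n}
    (hl : x.1.length ≤ s) :
    _root_.IsSeparable (fieldBelow K (fun ξ t => A (ξ, t)) x) (A (x.1, x.2)) ↔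
      _root_.IsSeparable (fieldBelow K 𝓛.a x) (𝓛.a x.1 x.2) := by
  rw [isSeparable_iff_sepOver_coe, hA.fieldBelow_eq h𝓛 hB, hA.base _ (Or.inl hl)]
  exact isSeparable_baseFamily_iff hl

theorem DKernel.IsPrincipalFamily.isAlgebraic_iff {x : List (Idx 𝓓) × Fin n}
    (hl : x.1.length ≤ s) :
    IsAlgebraic (fieldBelow K (fun ξ t => A (ξ, t)) x) (A (x.1, x.2)) ↔
      IsAlgebraic (fieldBelow K 𝓛.a x) (𝓛.a x.1 x.2) := by
  rw [hA.fieldBelow_eq h𝓛 hB, hA.base _ (Or.inl hl), fieldBelow_baseFamily hl,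
    baseFamily_of_le hl]
  exact isAlgebraic_map_iff (IsScalarTower.toAlgHom K L E)

variable (hz : AlgebraicIndependent L z)
include hz

/-- The field below `x` is contained in the extension of `L` by the new elements other than the one
at `x`, which is transcendental over it. -/
theorem DKernel.IsPrincipalFamily.not_isAlgebraic {x : List (Idx 𝓓) × Fin n} (hx : x ∈ 𝓛.free) :
    ¬ IsAlgebraic (fieldBelow K (fun ξ t => A (ξ, t)) x) (A (x.1, x.2)) := by
  rw [hA.fieldBelow_eq h𝓛 hB, hA.base _ (Or.inr hx.2.2), baseFamily_of_mem hx]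
  intro halg
  have h1 := hz.transcendental_adjoin (s := {y | y ≠ ⟨x, hx⟩}) (i := ⟨x, hx⟩) (by simp)
  refine IntermediateField.transcendental_adjoin_iff.2 h1 (isAlgebraic_of_forall_mem ?_ halg)
  intro c hc
  rw [fieldBelow] at hc
  induction hc using IntermediateField.adjoin_induction with
  | mem c hc =>
    obtain ⟨w, h1, h2, rfl⟩ := hc
    by_cases hl : w.1.length ≤ s
    · rw [baseFamily_of_le hl]
      exact IntermediateField.algebraMap_mem _ _
    by_cases hab : 𝓛.IsAbove w
    · rw [baseFamily_of_isAbove (not_le.1 hl) hab]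
      exact zero_mem _
    · have hw : w ∈ 𝓛.free := ⟨h1, not_le.1 hl, hab⟩
      rw [baseFamily_of_mem hw]
      refine IntermediateField.subset_adjoin L _ ⟨⟨w, hw⟩, fun h => ?_, rfl⟩
      obtain rfl : w = x := congrArg Subtype.val h
      exact TriLT.irrefl _ h2
  | algebraMap c =>
    rw [IsScalarTower.algebraMap_apply K L E]
    exact IntermediateField.algebraMap_mem _ _
  | add _ _ _ _ h1 h2 => exact add_mem h1 h2
  | inv _ _ h => exact inv_mem h
  | mul _ _ _ _ h1 h2 => exact mul_mem h1 h2

theorem DKernel.IsPrincipalFamily.sepLeaders_eq :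
    sepLeaders K (fun ξ t => A (ξ, t)) ⊤ = {x | IsNormal x.1 ∧ 𝓛.IsAbove x} := by
  ext x
  refine and_congr_right fun hn => ?_
  simp only [le_top, true_and]
  rcases le_or_gt x.1.length s with hl | hl
  · rw [hA.isSeparable_iff h𝓛 hB hl]
    exact ⟨fun h => 𝓛.isAbove_of_mem_sepLeaders ⟨hn, by exact_mod_cast hl, h⟩,
      fun h => (h.mem_sepLeaders h𝓛 hB hA.isExtension hn hl).2.2⟩
  · constructor
    · intro h
      by_contra hab
      exact hA.not_isAlgebraic h𝓛 hB hz ⟨hn, hl, hab⟩ h.isIntegral.isAlgebraic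
    · intro hab
      rw [isSeparable_iff_sepOver_coe, hA.fieldBelow_eq h𝓛 hB]
      exact hA.sepOver h𝓛 hB hn hab

theorem DKernel.IsPrincipalFamily.insepLeaders_eq :
    insepLeaders K (fun ξ t => A (ξ, t)) ⊤ = insepLeaders K 𝓛.a s := by
  ext x
  refine and_congr_right fun hn => ?_
  simp only [le_top, true_and, Nat.cast_le]
  rcases le_or_gt x.1.length s with hl | hl
  · rw [hA.isSeparable_iff h𝓛 hB hl, hA.isAlgebraic_iff h𝓛 hB hl]
    simp only [hl, true_and]
  · refine iff_of_false ?_ fun h => absurd h.1 (not_le.2 hl)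
    rintro ⟨h1, h2⟩
    by_cases hab : 𝓛.IsAbove x
    · have h3 : x ∈ sepLeaders K (fun ξ t => A (ξ, t)) ⊤ := by
        rw [hA.sepLeaders_eq h𝓛 hB hz]; exact ⟨hn, hab⟩
      exact h2 h3.2.2
    · exact hA.not_isAlgebraic h𝓛 hB hz ⟨hn, hl, hab⟩ h1

theorem DKernel.IsPrincipalFamily.minSepLeaders_eq :
    minSepLeaders K (fun ξ t => A (ξ, t)) ⊤ = minSepLeaders K 𝓛.a s := by
  ext x
  rw [minSepLeaders, hA.sepLeaders_eq h𝓛 hB hz]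
  constructor
  · rintro ⟨⟨hn, μ, hμ, hμx⟩, h⟩
    rw [← h μ ⟨hμ.1.1, μ, hμ, ProdLE.refl μ⟩ hμx]
    exact hμ
  · intro hx
    refine ⟨⟨hx.1.1, x, hx, ProdLE.refl x⟩, ?_⟩
    rintro y ⟨hn, hy⟩ hyx
    exact hx.2 y (hy.mem_sepLeaders h𝓛 hB hA.isExtension hn
      (hyx.length_le.trans (mem_minSepLeaders_length hx))) hyx

end Leaders

end Setting

/-! ### The rational function field over the kernel -/

section FractionField

variable {k K L : Type*} [Field k] [Field K] [Field L] [Algebra k K] [Algebra k L] [Algebra K L]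
  [IsScalarTower k K L] (ι : Type*)

theorem algebraicIndependent_fractionRing : AlgebraicIndependent L
    (fun i => algebraMap (MvPolynomial ι L) (FractionRing (MvPolynomial ι L))
      (MvPolynomial.X i)) := by
  have h : AlgebraicIndependent L (MvPolynomial.X : ι → MvPolynomial ι L) :=
    MvPolynomial.algebraicIndependent_X ι L
  exact h.map' (f := IsScalarTower.toAlgHom L (MvPolynomial ι L) (FractionRing (MvPolynomial ι L)))
    (IsFractionRing.injective _ _)

theorem adjoin_fractionRing : IntermediateField.adjoin L (Set.range
    (fun i => algebraMap (MvPolynomial ι L) (FractionRing (MvPolynomial ι L))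
      (MvPolynomial.X i))) = ⊤ := by
  rw [eq_top_iff]
  intro b _
  set G := IntermediateField.adjoin L (Set.range
    (fun i => algebraMap (MvPolynomial ι L) (FractionRing (MvPolynomial ι L))
      (MvPolynomial.X i))) with hG
  have key : ∀ f : MvPolynomial ι L, algebraMap _ (FractionRing (MvPolynomial ι L)) f ∈ G := by
    intro f
    induction f using MvPolynomial.induction_on with
    | C a => exact G.algebraMap_mem a
    | add p q hp hq => rw [map_add]; exact add_mem hp hq
    | mul_X p i hp =>
      rw [map_mul]
      exact mul_mem hp (IntermediateField.subset_adjoin L _ ⟨i, rfl⟩)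
  obtain ⟨p, q, -, rfl⟩ := IsFractionRing.div_surjective (A := MvPolynomial ι L) b
  exact div_mem (key p) (key q)

end FractionField

/-! ### Assembly of the principal realisation -/

section Setting

variable {k F K L : Type*} [Field k] [Field F] [Field K] [Field L] [Algebra k F] [Algebra k K]
  [Algebra k L] [Algebra F K] [Algebra K L] [IsScalarTower k F K] [IsScalarTower k K L]
  {𝓓 : OpType → LocalOperatorSystem k} {Γ : LHSSystem 𝓓 F}
  {eF : ∀ u, F →ₐ[k] (𝓓 u).Alg ⊗[k] F}
  {eK : ∀ u, K →ₐ[k] (𝓓 u).Alg ⊗[k] K} {n s : ℕ} {𝓛 : DKernel eK n s L}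

open LocalOperatorSystem

theorem DKernel.exists_isPrincipal (h𝓛 : 𝓛.IsDGammaKernel Γ)
    (hB : CoefRelations (K := K) Γ eK)
    (hK : ∀ u, ((𝓓 u).map (IsScalarTower.toAlgHom k F K)).comp (eF u) =
      (eK u).comp (IsScalarTower.toAlgHom k F K)) (hsep : 𝓛.IsSeparable) {r : ℕ}
    (hr : 2 * r ≤ s) (hmin : ∀ μ ∈ minSepLeaders K 𝓛.a s, μ.1.length ≤ r) :
    ∃ ρ : RegularRealisation 𝓛 eF Γ, ρ.IsPrincipal := by
  let E := FractionRing (MvPolynomial 𝓛.free L)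
  have hz := algebraicIndependent_fractionRing (L := L) 𝓛.free
  have htop := adjoin_fractionRing (L := L) 𝓛.free
  obtain ⟨A, e, hA⟩ := DKernel.exists_isPrincipalFamily (E := E) h𝓛 hB hsep hz htop
  have he := hA.isExtension.isDRing
  have hfam : ∀ (t : Fin n) {ξ : List (Idx 𝓓)}, IsNormal ξ →
      ξ.foldr (fun i b => dd e i b) (algebraMap L E (𝓛.a [] t)) = A (ξ, t) :=
    fun t ξ hξ => hA.foldr_eq h𝓛 hB hr hmin t hξ
  let ρ : RegularRealisation 𝓛 eF Γ :=
    { E := E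
      e := e
      isDGammaField :=
        { isOperator := fun u => (isOperator_iff _).2 (he.crd_zero u)
          extends_base := fun u => by
            refine AlgHom.ext fun c => ?_
            have h1 := AlgHom.congr_fun (hK u) c
            simp only [AlgHom.comp_apply] at h1 ⊢
            refine Eq.trans ?_ (he.map_algebraMap u (algebraMap F K c)).symm
            refine Eq.trans ?_ (congrArg ((𝓓 u).map (IsScalarTower.toAlgHom k K E)) h1)
            refine (𝓓 u).crd_ext fun p => ?_
            rw [crd_map, crd_map, crd_map]
            rfl
          commute := hA.gammaCommuteOn h𝓛 hB htop hr hmin }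
      extends_K := fun u => AlgHom.ext fun c => (he.map_algebraMap u c).symm
      ι := IsScalarTower.toAlgHom K L E
      extends_kernel := fun u => AlgHom.ext fun b => (hA.isExtension.kernel u b).symm
      generates := fun M hM ht => by
        have hdd : ∀ i : Idx 𝓓, ∀ b ∈ M, dd e i b ∈ M := by
          rintro ⟨u, i⟩ b hb
          obtain ⟨y, hy⟩ := hM u b hb
          rw [← crd_succ_eq_dd, ← hy]
          change (𝓓 u).crd i.succ ((𝓓 u).map (M.val.restrictScalars k) y) ∈ M
          rw [crd_map]
          exact Subtype.prop _
        have hfold : ∀ (t : Fin n) (ξ : List (Idx 𝓓)),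
            ξ.foldr (fun i b => dd e i b) (algebraMap L E (𝓛.a [] t)) ∈ M := by
          intro t ξ
          induction ξ with
          | nil => exact ht t
          | cons i ξ ih => exact hdd i _ ih
        refine eq_top_iff.2 fun b _ => ?_
        refine hA.mem_subfield h𝓛 hB htop M.toSubfield M.algebraMap_mem (fun x hx => ?_) b
        have := hfold x.2 x.1
        rwa [hfam x.2 hx] at this }
  have hρ : ∀ ξ t, IsNormal ξ → ρ.family ξ t = A (ξ, t) := fun ξ t hξ => hfam t hξ
  refine ⟨ρ, ?_, ?_⟩
  · rw [minSepLeaders_congr (b := fun ξ t => A (ξ, t)) hρ]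
    exact hA.minSepLeaders_eq h𝓛 hB hz
  · rw [insepLeaders_congr (b := fun ξ t => A (ξ, t)) hρ]
    exact hA.insepLeaders_eq h𝓛 hB hz

end Setting

end DGamma

end

theorem mainTheorem1 {k F K L : Type*} [Field k] [Field F] [Field K] [Field L]
    [Algebra k F] [Algebra k K] [Algebra k L] [Algebra F K] [Algebra K L]
    [IsScalarTower k F K] [IsScalarTower k K L]
    (𝓓 : OpType → LocalOperatorSystem k)
    (eF : ∀ u, F →ₐ[k] TensorProduct k (𝓓 u).Alg F)
    (hF : ∀ u, (𝓓 u).IsOperator (AlgHom.id k F) (eF u))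
    (Γ : LHSSystem 𝓓 F) (hΓ : Γ.IsJacobiAssociative eF)
    (eK : ∀ u, K →ₐ[k] TensorProduct k (𝓓 u).Alg K)
    (hK : IsDGammaField Γ eF (IsScalarTower.toAlgHom k F K) eK)
    (n r : ℕ) (hr : 1 ≤ r) (𝓛 : DKernel eK n (2 * r) L)
    (hcomm : 𝓛.IsDGammaKernel Γ) (hsep : 𝓛.IsSeparable)
    (hmin : minSepLeaders K 𝓛.a (2 * r : ℕ) = minSepLeaders K 𝓛.a r) :
    ∃ ρ : RegularRealisation 𝓛 eF Γ, ρ.IsPrincipal := by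
  refine DKernel.exists_isPrincipal hcomm (coefRelations hΓ hK) hK.extends_base hsep le_rfl ?_
  intro μ hμ
  -- The equality of minimal-separable leaders enters only through the bound `r` on their lengths.
  rw [hmin] at hμ
  exact_mod_cast hμ.1.2.1
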